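/- **Conventions.** Let $k$ be a field of characteristic $0$. A *Feynman category* $\mathbb F$ is a symmetric monoidal category whose objects are words $v_1\otimes\dots\otimes v_n$ in a set of *vertices* and whose morphisms are tensor products of *generating morphisms* $A\to v$ from a word $A$ to a vertex $v$; equivalently, its generating morphisms form a symmetric operad coloured by the vertices. Isomorphic vertices are assumed equal, and the groups $Aut(v)$ finite. $\mathbb F$ is *cubical* if it carries an $\mathbb N$-valued degree function on morphisms, additive under composition and $\otimes$, such that: the morphisms of degree $0$ are exactly the isomorphisms; each vertex is the target of finitely many generating morphisms of degree $1$; if $C^n(A,B)$ is the set of sequences of $n$ composable degree $1$ morphisms from $A$ to $B$ modulo isomorphisms of the intermediate objects, then $S_n$ acts freely on $C^n(A,B)$, the orbits being the fibres of the composition map from $C^n(A,B)$ onto the morphisms $A\to B$ of degree $n$ (for $n\ge1$), compatibly with concatenation; and the isomorphism which identifies two equivalent factorizations into two degree $1$ morphisms is unique (if $g\colon A\to X$ and $f\colon X\to B$ have degree $1$ and $\tau\in Aut(X)$ satisfies $\tau g=g$ and $f\tau=f$, then $\tau=id$). Let $\phi\colon\mathbb F_1\to\mathbb F_2$ be a *cubical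 morphism*: a strict symmetric monoidal functor between cubical Feynman categories which takes vertices to vertices, preserves degrees, and has finite fibres on vertices. Assume that $\phi$ is *admissible*: (0) $\phi$ is faithful; (1) if $\phi(g)=f\circ\phi(l)$ with $l\colon A\to B$, $g\colon A\to C$ and $f\colon\phi(B)\to\phi(C)$, then $f=\phi(m)$ for some $m\colon B\to C$; (2) if $\phi(g)=f\circ h$, then $g=g_1\circ g_2$ with $h=\sigma\circ\phi(g_2)$ and $f=\phi(g_1)\circ\sigma^{-1}$ for some isomorphism $\sigma$. For a parity $\pm$, let $\mathbb F^{\pm}$-$\mathcal Ops$ be the category of differential graded operads of parity $\pm$ over $\mathbb F$: symmetric monoidal functors to cochain complexes over $k$ from the category with morphisms $\coprod_nC^n(A,B)$, which are invariant (parity $+$; all structure maps of degree $0$) or skew invariant (parity $-$; elements of $C^n$ act by maps of degree $n$) under the symmetric groups. $\mathcal P$ is *of finite type* if $\mathcal P(v_1)\otimes\dots\otimes\mathcal P(v_m)$ is finite dimensional in each degree, for all vertices $v_1,\dots,v_m$. * $L^{\pm}\colon\mathbb F_1^{\pm}\text{-}\mathcal Ops\to\mathbb F_2^{\pm}\text{-}\mathcal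 Ops$ is the left adjoint of the restriction $\mathcal Q\mapsto\mathcal Q\circ\phi$. * $L^{!\pm}\colon\mathbb F_1^{\pm}\text{-}\mathcal Ops\to\mathbb F_2^{\pm}\text{-}\mathcal Ops$ is given by $$L^!(\mathcal P)(v)=\bigoplus_{\phi(w)=v}\mathcal P(w)\otimes_{Aut(w)}k[Aut(v)],$$ where $[p\otimes\sigma\phi(\lambda)]=[\lambda p\otimes\sigma]$ for $\lambda\in Aut(w)$, with the differential and the functoriality induced from those of $\mathcal P$; a generating morphism $f$ of degree at most $1$ sends $\bigotimes_i[p_i\otimes\sigma_i]$ (with $p_i\in\mathcal P(w_i)$) to $\sum_{w_0}[\mathcal P(g)(\bigotimes_ip_i)\otimes\tau]$, where $f\circ\bigotimes_i\sigma_i=\tau\circ\phi(g)$ with $g\colon\bigotimes_iw_i\to w_0$ and $\tau\in Aut(\phi(w_0))$, $\phi(w_0)=v$; the summand of $w_0$ is $0$ if there is no such decomposition. * The *Feynman transform* $D^{\pm}$ is a contravariant functor from operads of parity $\pm$ and of finite type to operads of parity $\mp$. As a graded operad, $D(\mathcal P)$ is the free operad of parity $\mp$ on the graded linear dual $\mathcal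 P^*$ of the representation of the groupoid of vertices underlying $\mathcal P$. Its differential is that of the dual complex on generators $p\in\mathcal P(v)^*$, plus the sum over the isomorphism classes of morphisms $f\colon X\to v$ of degree $1$ of $\frac1{|Aut(f)|}$ times the image of $p\circ\mathcal P(f)$ under $\mathcal P(X)^*\cong\mathcal P^*(X)\xrightarrow{f}D(\mathcal P)(v)$, with the Koszul sign rule; here $Aut(f)=\{\tau\in Aut(X): f\tau=f\}$. **Theorem.** Let $\phi$ be an admissible cubical morphism. The functors $D^{\pm}$ (for $\mathbb F_1$ and $\mathbb F_2$), $L^{!\pm}$ and $L^{\pm}$ exist, $L^{!\pm}$ preserves finite type, and there are natural isomorphisms $$D^+L^{!+}\cong L^-D^+,\qquad D^-L^{!-}\cong L^+D^-$$ of contravariant functors from the $\mathbb F_1$-operads of finite type (of parity $+$, respectively $-$) to the differential graded $\mathbb F_2$-operads of parity $-$, respectively $+$. These are isomorphisms of differential graded operads, not only weak equivalences. -/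

import Mathlib

open CategoryTheory

universe u

/-! ## Feynman categories -/

/-- The bijection `Σ _ : Unit, α ≃ α`. -/
def unitSigmaEquiv (α : Type) : (Σ _ : Unit, α) ≃ α where
  toFun p := p.2
  invFun a := ⟨(), a⟩

/-- A (strict, skeletal) Feynman category, given by its set `V` of vertices and its generating
morphisms `Hom A v`, where the source `A` is a finite family of vertices (read as the tensor product
of its members) and `v` is a vertex.  The generating morphisms form a `V`-coloured symmetric operad:
`one` are the identities, `map` renames the index set of the source, and `comp f g` is the composite
of `f` with the tensor product of the `g j`.  Morphisms between tensor products of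
vertices are given by `FeynmanCategory.Mor` below.  The groupoid of vertices consists of the invertible
morphisms between vertices; it has only automorphisms, and its automorphism groups are finite. -/
structure FeynmanCategory where
  V : Type u
  Hom : {ι : Type} → [Finite ι] → (ι → V) → V → Type u
  one : (v : V) → Hom (fun _ : Unit => v) v
  map : {ι κ : Type} → [Finite ι] → [Finite κ] → (e : ι ≃ κ) → {A : κ → V} → {v : V} →
    Hom (fun i => A (e i)) v → Hom A v
  comp : {κ : Type} → [Finite κ] → {α : κ → Type} → [∀ j, Finite (α j)] →
    {A : (Σ j, α j) → V} → {B : κ → V} → {v : V} →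
    Hom B v → ((j : κ) → Hom (fun a : α j => A ⟨j, a⟩) (B j)) → Hom A v
  map_refl : ∀ {ι : Type} [Finite ι] {A : ι → V} {v : V} (f : Hom A v),
    map (Equiv.refl ι) (A := A) f = f
  map_map : ∀ {ι κ l : Type} [Finite ι] [Finite κ] [Finite l] (e : ι ≃ κ) (e' : κ ≃ l)
    {A : l → V} {v : V} (f : Hom (fun i => A (e' (e i))) v),
    map e' (A := A) (map e (A := fun j => A (e' j)) f) = map (e.trans e') (A := A) f
  comp_map : ∀ {κ : Type} [Finite κ] {α α' : κ → Type} [∀ j, Finite (α j)] [∀ j, Finite (α' j)]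
    (e : ∀ j, α j ≃ α' j) {A : (Σ j, α' j) → V} {B : κ → V} {v : V} (f : Hom B v)
    (g : ∀ j, Hom (fun a => A ⟨j, e j a⟩) (B j)),
    comp (A := A) f (fun j => map (e j) (A := fun a => A ⟨j, a⟩) (g j)) =
      map (Equiv.sigmaCongrRight e) (A := A)
        (comp (A := fun p => A ⟨p.1, e p.1 p.2⟩) f g)
  map_comp : ∀ {κ κ' : Type} [Finite κ] [Finite κ'] (e : κ ≃ κ') {α : κ' → Type}
    [∀ j, Finite (α j)] {A : (Σ j, α j) → V} {B : κ' → V} {v : V}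
    (f : Hom (fun j => B (e j)) v) (g : ∀ j, Hom (fun a => A ⟨j, a⟩) (B j)),
    comp (A := A) (map e (A := B) f) g =
      map (Equiv.sigmaCongrLeft (β := α) e) (A := A)
        (comp (α := fun j => α (e j)) (A := fun p => A ⟨e p.1, p.2⟩) f (fun j => g (e j)))
  assoc : ∀ {l : Type} [Finite l] {β : l → Type} [∀ i, Finite (β i)]
    {γ : (i : l) → β i → Type} [∀ i j, Finite (γ i j)]
    {A : (Σ i, Σ j : β i, γ i j) → V} {B : (Σ i, β i) → V} {C : l → V} {v : V}
    (f : Hom C v) (g : ∀ i, Hom (fun j => B ⟨i, j⟩) (C i))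
    (h : ∀ i j, Hom (fun a : γ i j => A ⟨i, ⟨j, a⟩⟩) (B ⟨i, j⟩)),
    map (Equiv.sigmaAssoc γ) (A := A)
        (comp (α := fun p : Σ i, β i => γ p.1 p.2) (A := fun x => A ⟨x.1.1, ⟨x.1.2, x.2⟩⟩)
          (comp (A := B) f g) (fun p => h p.1 p.2)) =
      comp (A := A) f (fun i => comp (A := fun x => A ⟨i, x⟩) (g i) (h i))
  one_comp : ∀ {ι : Type} [Finite ι] {A : ι → V} {v : V} (f : Hom A v),
    map (unitSigmaEquiv ι) (A := A)
      (comp (α := fun _ => ι) (A := fun p => A p.2) (one v) (fun _ => f)) = f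
  comp_one : ∀ {ι : Type} [Finite ι] {A : ι → V} {v : V} (f : Hom A v),
    map (Equiv.sigmaPUnit ι) (A := A)
      (comp (α := fun _ => Unit) (A := fun p => A p.1) f (fun i => one (A i))) = f
  /-- Isomorphic vertices are equal. -/
  skeletal : ∀ {v w : V} (f : Hom (fun _ : Unit => v) w) (g : Hom (fun _ : Unit => w) v),
    map (unitSigmaEquiv Unit) (A := fun _ => v) (comp (α := fun _ => Unit) g (fun _ => f)) = one v →
    map (unitSigmaEquiv Unit) (A := fun _ => w) (comp (α := fun _ => Unit) f (fun _ => g)) = one w →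
    v = w
  /-- Automorphism groups of vertices are finite. -/
  finite_aut : ∀ v : V, {f : Hom (fun _ : Unit => v) v | ∃ g : Hom (fun _ : Unit => v) v,
    map (unitSigmaEquiv Unit) (A := fun _ => v) (comp (α := fun _ => Unit) g (fun _ => f)) = one v ∧
    map (unitSigmaEquiv Unit) (A := fun _ => v)
      (comp (α := fun _ => Unit) f (fun _ => g)) = one v}.Finite

namespace FeynmanCategory

variable (F : FeynmanCategory.{u})

/-- Composition `f ∘ g` of a generating morphism `g` with a morphism `f` between vertices. -/
def post {ι : Type} [Finite ι] {A : ι → F.V} {v w : F.V} (f : F.Hom (fun _ : Unit => v) w)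
    (g : F.Hom A v) : F.Hom A w :=
  F.map (unitSigmaEquiv ι) (A := A)
    (F.comp (α := fun _ => ι) (A := fun p => A p.2) f (fun _ => g))

/-- Composition `f ∘ (⊗ σ i)` of a generating morphism `f` with morphisms between vertices. -/
def pre {ι : Type} [Finite ι] {A B : ι → F.V} {v : F.V} (f : F.Hom B v)
    (σ : ∀ i, F.Hom (fun _ : Unit => A i) (B i)) : F.Hom A v :=
  F.map (Equiv.sigmaPUnit ι) (A := A)
    (F.comp (α := fun _ => Unit) (A := fun p => A p.1) f σ)

/-- Isomorphisms between vertices, i.e. the morphisms of the groupoid of vertices. -/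
structure VIso (v w : F.V) where
  hom : F.Hom (fun _ : Unit => v) w
  inv : F.Hom (fun _ : Unit => w) v
  inv_hom : F.post inv hom = F.one v
  hom_inv : F.post hom inv = F.one w

/-- The order of the automorphism group of a vertex. -/
noncomputable def autCard (v : F.V) : ℕ := Nat.card (F.VIso v v)

/-- The morphisms of the Feynman category between tensor products of vertices: a map
`π` of index sets together with a generating morphism from each fibre. -/
structure Mor {ι κ : Type} [Finite ι] [Finite κ] (A : ι → F.V) (B : κ → F.V) where
  π : ι → κ
  hom : ∀ j, F.Hom (fun i : {i // π i = j} => A i) (B j)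

variable {F}

/-- The fibres of a composite map. -/
def fiberEquiv {ι κ l : Type} (π : ι → κ) (ρ : κ → l) (c : l) :
    (Σ j : {j // ρ j = c}, {i // π i = j.1}) ≃ {i // ρ (π i) = c} where
  toFun p := ⟨p.2.1, by rw [p.2.2]; exact p.1.2⟩
  invFun i := ⟨⟨π i.1, i.2⟩, ⟨i.1, rfl⟩⟩
  left_inv := by rintro ⟨⟨j, h⟩, ⟨i, hi⟩⟩; dsimp only at hi; subst hi; rfl
  right_inv := by rintro ⟨i, h⟩; rfl

/-- `g` followed by `h`. -/
def Mor.comp {ι κ l : Type} [Finite ι] [Finite κ] [Finite l] {A : ι → F.V} {B : κ → F.V}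
    {C : l → F.V} (g : F.Mor A B) (h : F.Mor B C) : F.Mor A C where
  π := fun i => h.π (g.π i)
  hom c := F.map (fiberEquiv g.π h.π c) (A := fun i => A i.1)
    (F.comp (α := fun j : {j // h.π j = c} => {i // g.π i = j.1}) (A := fun p => A p.2.1)
      (h.hom c) (fun j => g.hom j.1))

/-- `g` followed by the generating morphism `f`. -/
def Mor.into {ι κ : Type} [Finite ι] [Finite κ] {A : ι → F.V} {B : κ → F.V} {v : F.V}
    (g : F.Mor A B) (f : F.Hom B v) : F.Hom A v :=
  F.map (Equiv.sigmaFiberEquiv g.π) (A := A)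
    (F.comp (α := fun j => {i // g.π i = j}) (A := fun p => A p.2.1) f g.hom)

/-- The one point fibre of the identity. -/
def pointEquiv {ι : Type} (j : ι) : Unit ≃ {i : ι // i = j} where
  toFun _ := ⟨j, rfl⟩
  invFun _ := ()
  left_inv _ := rfl
  right_inv := by rintro ⟨i, rfl⟩; rfl

variable (F) in
/-- Identity morphisms. -/
def Mor.id {ι : Type} [Finite ι] (A : ι → F.V) : F.Mor A A where
  π := fun i => i
  hom j := F.map (pointEquiv j) (A := fun i => A i.1) (F.one (A j))

/-- Isomorphisms of the Feynman category. -/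
def Mor.IsIso {ι κ : Type} [Finite ι] [Finite κ] {A : ι → F.V} {B : κ → F.V}
    (g : F.Mor A B) : Prop :=
  ∃ h : F.Mor B A, g.comp h = Mor.id F A ∧ h.comp g = Mor.id F B

/-- Two-step factorizations `A → X → v` and `A → X' → v` are equivalent if they differ by an
isomorphism `X ≅ X'`. -/
def EquivFact {ι κ κ' : Type} [Finite ι] [Finite κ] [Finite κ'] {A : ι → F.V} {X : κ → F.V}
    {X' : κ' → F.V} {v : F.V} (g : F.Mor A X) (f : F.Hom X v) (g' : F.Mor A X')
    (f' : F.Hom X' v) : Prop :=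
  ∃ τ : F.Mor X X', τ.IsIso ∧ g.comp τ = g' ∧ τ.into f' = f

variable (F) in
/-- Objects of the Feynman category: words in the vertices. -/
abbrev Word := Σ n : ℕ, (Fin n → F.V)

/-! ## Cubical Feynman categories -/

variable (F) in
/-- A degree function on generating morphisms, additive under composition.  -/
structure Degree where
  deg : {ι : Type} → [Finite ι] → {A : ι → F.V} → {v : F.V} → F.Hom A v → ℕ
  deg_map : ∀ {ι κ : Type} [Finite ι] [Finite κ] (e : ι ≃ κ) {A : κ → F.V} {v : F.V}
    (f : F.Hom (fun i => A (e i)) v), deg (F.map e (A := A) f) = deg f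
  deg_comp : ∀ {κ : Type} [Fintype κ] {α : κ → Type} [∀ j, Finite (α j)]
    {A : (Σ j, α j) → F.V} {B : κ → F.V} {v : F.V} (f : F.Hom B v)
    (g : (j : κ) → F.Hom (fun a : α j => A ⟨j, a⟩) (B j)),
    deg (F.comp (A := A) f g) = deg f + ∑ j, deg (g j)

namespace Degree

variable (d : F.Degree)

/-- The degree of a morphism is the sum of the degrees of its tensor factors. -/
def mor {ι κ : Type} [Finite ι] [Fintype κ] {A : ι → F.V} {B : κ → F.V} (g : F.Mor A B) : ℕ :=
  ∑ j, d.deg (g.hom j)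

lemma deg_post {ι : Type} [Finite ι] {A : ι → F.V} {v w : F.V}
    (f : F.Hom (fun _ : Unit => v) w) (g : F.Hom A v) :
    d.deg (F.post f g) = d.deg f + d.deg g := by
  refine (d.deg_map _ _).trans ((d.deg_comp _ _).trans ?_)
  simp only [Finset.univ_unique, Finset.sum_singleton]
  rfl

lemma deg_pre {ι : Type} [Fintype ι] {A B : ι → F.V} {v : F.V} (f : F.Hom B v)
    (σ : ∀ i, F.Hom (fun _ : Unit => A i) (B i)) :
    d.deg (F.pre f σ) = d.deg f + ∑ i, d.deg (σ i) := by
  exact (d.deg_map _ _).trans (d.deg_comp _ _)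

lemma deg_one (v : F.V) : d.deg (F.one v) = 0 := by
  have h := d.deg_post (F.one v) (F.one v)
  have h' : F.post (F.one v) (F.one v) = F.one v := F.one_comp (F.one v)
  rw [h'] at h
  omega

lemma deg_viso {v w : F.V} (σ : F.VIso v w) : d.deg σ.hom = 0 := by
  have h := d.deg_post σ.inv σ.hom
  rw [σ.inv_hom, d.deg_one] at h
  omega

lemma mor_comp {ι κ l : Type} [Finite ι] [Fintype κ] [Fintype l] {A : ι → F.V} {B : κ → F.V}
    {C : l → F.V} (g : F.Mor A B) (h : F.Mor B C) : d.mor (g.comp h) = d.mor h + d.mor g := by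
  classical
  have key : ∀ c, d.deg ((g.comp h).hom c) =
      d.deg (h.hom c) + ∑ j : {j // h.π j = c}, d.deg (g.hom j.1) :=
    fun c => (d.deg_map _ _).trans (d.deg_comp _ _)
  simp only [mor, key, Finset.sum_add_distrib]
  rw [Fintype.sum_fiberwise h.π (fun j => d.deg (g.hom j))]

lemma deg_into {ι κ : Type} [Finite ι] [Fintype κ] {A : ι → F.V} {B : κ → F.V} {v : F.V}
    (g : F.Mor A B) (f : F.Hom B v) : d.deg (g.into f) = d.deg f + d.mor g := by
  exact (d.deg_map _ _).trans (d.deg_comp _ _)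

/-- Sequences of `n` composable morphisms of degree one. -/
inductive Chain : F.Word → F.Word → ℕ → Type u
  | nil (A : F.Word) : Chain A A 0
  | cons {A X B : F.Word} {n : ℕ} (g : F.Mor A.2 X.2) (hg : d.mor g = 1) (c : Chain X B n) :
      Chain A B (n + 1)

variable {d}

/-- The composite of a sequence. -/
def Chain.composite : {A B : F.Word} → {n : ℕ} → d.Chain A B n → F.Mor A.2 B.2
  | _, _, _, .nil A => Mor.id F A.2
  | _, _, _, .cons g _ c => g.comp c.composite

/-- Concatenation; the morphisms of the first argument come first. -/
def Chain.concat : {A B C : F.Word} → {n m : ℕ} → d.Chain A B n → d.Chain B C m →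
    d.Chain A C (m + n)
  | _, _, _, _, _, .nil _, c' => c'
  | _, _, _, _, _, .cons g hg c, c' => .cons g hg (c.concat c')

/-- `Chain.Rel τ c c'` : there is a commutative ladder of isomorphisms from `c` to `c'` which begins
with `τ` and ends with the identity. -/
inductive Chain.Rel : {A A' B : F.Word} → {n : ℕ} → F.Mor A.2 A'.2 → d.Chain A B n →
    d.Chain A' B n → Prop
  | nil (A : F.Word) : Chain.Rel (Mor.id F A.2) (.nil A) (.nil A)
  | cons {A A' X X' B : F.Word} {n : ℕ} {τ : F.Mor A.2 A'.2} {τ' : F.Mor X.2 X'.2}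
      {g : F.Mor A.2 X.2} {g' : F.Mor A'.2 X'.2} {c : d.Chain X B n} {c' : d.Chain X' B n}
      (hg : d.mor g = 1) (hg' : d.mor g' = 1) (hτ' : τ'.IsIso)
      (w : g.comp τ' = τ.comp g') (h : Chain.Rel τ' c c') :
      Chain.Rel τ (.cons g hg c) (.cons g' hg' c')

/-- Two sequences define the same element of `C^n(A, B)` if they agree up to isomorphisms of the
intermediate objects. -/
def Chain.Equiv {A B : F.Word} {n : ℕ} (c c' : d.Chain A B n) : Prop :=
  Chain.Rel (Mor.id F A.2) c c'

end Degree

/-- The inclusion `S_n × S_m → S_{m+n}` as permutations of the first `n` and of the last `m`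
letters. -/
def blockPerm {n m : ℕ} (σ : _root_.Equiv.Perm (Fin n)) (τ : _root_.Equiv.Perm (Fin m)) :
    _root_.Equiv.Perm (Fin (m + n)) :=
  (finSumFinEquiv.trans (finCongr (Nat.add_comm n m))).permCongr (Equiv.Perm.sumCongr σ τ)

variable (F) in
/-- A cubical Feynman category: a degree function whose degree `0` morphisms are
the isomorphisms, together with an action of `S_n` on the set `C^n(A, B)` of sequences of `n`
morphisms of degree one modulo isomorphisms (`perm`, written on representatives), which is
free, whose orbits are the fibres of the composition map onto the morphisms of degree `n`, and which is
compatible with concatenation. -/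
structure Cubical extends F.Degree where
  isIso_of_deg_zero : ∀ {A B : F.Word} (g : F.Mor A.2 B.2), toDegree.mor g = 0 → g.IsIso
  /-- There are finitely many morphisms of degree one with a given target. -/
  finite_deg_one : ∀ v : F.V,
    Finite (Σ A : F.Word, {f : F.Hom A.2 v // toDegree.deg f = 1})
  perm : {A B : F.Word} → {n : ℕ} → Equiv.Perm (Fin n) → toDegree.Chain A B n →
    toDegree.Chain A B n
  perm_congr : ∀ {A B : F.Word} {n : ℕ} (σ : Equiv.Perm (Fin n)) (c c' : toDegree.Chain A B n),
    c.Equiv c' → (perm σ c).Equiv (perm σ c')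
  perm_one : ∀ {A B : F.Word} {n : ℕ} (c : toDegree.Chain A B n), (perm 1 c).Equiv c
  perm_mul : ∀ {A B : F.Word} {n : ℕ} (σ τ : Equiv.Perm (Fin n)) (c : toDegree.Chain A B n),
    (perm (σ * τ) c).Equiv (perm σ (perm τ c))
  perm_free : ∀ {A B : F.Word} {n : ℕ} (σ : Equiv.Perm (Fin n)) (c : toDegree.Chain A B n),
    (perm σ c).Equiv c → σ = 1
  composite_eq_iff : ∀ {A B : F.Word} {n : ℕ} (c c' : toDegree.Chain A B n),
    c.composite = c'.composite ↔ ∃ σ, (perm σ c).Equiv c'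
  exists_chain : ∀ {A B : F.Word} {n : ℕ} (g : F.Mor A.2 B.2), 1 ≤ n → toDegree.mor g = n →
    ∃ c : toDegree.Chain A B n, c.composite = g
  perm_concat : ∀ {A B C : F.Word} {n m : ℕ} (σ : Equiv.Perm (Fin n)) (τ : Equiv.Perm (Fin m))
    (c : toDegree.Chain A B n) (c' : toDegree.Chain B C m),
    (perm (blockPerm σ τ) (c.concat c')).Equiv ((perm σ c).concat (perm τ c'))
  /-- The isomorphism which identifies two equivalent factorizations is unique. -/
  rigid : ∀ {A X B : F.Word} (g : F.Mor A.2 X.2) (f : F.Mor X.2 B.2) (τ : F.Mor X.2 X.2),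
    toDegree.mor g = 1 → toDegree.mor f = 1 → τ.IsIso → g.comp τ = g → τ.comp f = f →
    τ = Mor.id F X.2

/-- The morphisms of degree one with target `v`. -/
abbrev Cubical.DegOne (C : F.Cubical) (v : F.V) :=
  Σ A : F.Word, {f : F.Hom A.2 v // C.deg f = 1}

end FeynmanCategory

open FeynmanCategory

/-! ## Morphisms of cubical Feynman categories -/

/-- A morphism of cubical Feynman categories: a symmetric monoidal functor taking vertices to vertices
and preserving degrees, such that every object has finitely many preimages (equivalently,
every vertex is the image of finitely many vertices). -/
structure CubicalMorphism {F₁ F₂ : FeynmanCategory.{u}} (C₁ : F₁.Cubical) (C₂ : F₂.Cubical) where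
  obj : F₁.V → F₂.V
  map : {ι : Type} → [Finite ι] → {A : ι → F₁.V} → {v : F₁.V} → F₁.Hom A v →
    F₂.Hom (fun i => obj (A i)) (obj v)
  map_one : ∀ v, map (F₁.one v) = F₂.one (obj v)
  map_map : ∀ {ι κ : Type} [Finite ι] [Finite κ] (e : ι ≃ κ) {A : κ → F₁.V} {v : F₁.V}
    (f : F₁.Hom (fun i => A (e i)) v),
    map (F₁.map e (A := A) f) = F₂.map e (A := fun i => obj (A i)) (map f)
  map_comp : ∀ {κ : Type} [Finite κ] {α : κ → Type} [∀ j, Finite (α j)]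
    {A : (Σ j, α j) → F₁.V} {B : κ → F₁.V} {v : F₁.V} (f : F₁.Hom B v)
    (g : (j : κ) → F₁.Hom (fun a : α j => A ⟨j, a⟩) (B j)),
    map (F₁.comp (A := A) f g) = F₂.comp (A := fun p => obj (A p)) (map f) (fun j => map (g j))
  deg_map : ∀ {ι : Type} [Finite ι] {A : ι → F₁.V} {v : F₁.V} (f : F₁.Hom A v),
    C₂.deg (map f) = C₁.deg f
  finite_fiber : ∀ v : F₂.V, {w : F₁.V | obj w = v}.Finite

namespace CubicalMorphism

variable {F₁ F₂ : FeynmanCategory.{u}} {C₁ : F₁.Cubical} {C₂ : F₂.Cubical}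
  (φ : CubicalMorphism C₁ C₂)

/-- The action on arbitrary morphisms. -/
def mor {ι κ : Type} [Finite ι] [Finite κ] {A : ι → F₁.V} {B : κ → F₁.V} (g : F₁.Mor A B) :
    F₂.Mor (fun i => φ.obj (A i)) (fun j => φ.obj (B j)) where
  π := g.π
  hom j := φ.map (g.hom j)

/-- The action on isomorphisms of vertices. -/
def viso {v w : F₁.V} (σ : F₁.VIso v w) : F₂.VIso (φ.obj v) (φ.obj w) where
  hom := φ.map σ.hom
  inv := φ.map σ.inv
  inv_hom := by
    have h := congrArg φ.map σ.inv_hom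
    simpa only [FeynmanCategory.post, φ.map_map, φ.map_comp, φ.map_one] using h
  hom_inv := by
    have h := congrArg φ.map σ.hom_inv
    simpa only [FeynmanCategory.post, φ.map_map, φ.map_comp, φ.map_one] using h

lemma mor_comp {ι κ l : Type} [Finite ι] [Finite κ] [Finite l] {A : ι → F₁.V} {B : κ → F₁.V}
    {C : l → F₁.V} (g : F₁.Mor A B) (h : F₁.Mor B C) :
    φ.mor (g.comp h) = (φ.mor g).comp (φ.mor h) := by
  exact congrArg (Mor.mk (F := F₂) (A := fun i => φ.obj (A i)) (B := fun j => φ.obj (C j)) _)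
    (funext fun c => (φ.map_map _ _).trans (congrArg _ (φ.map_comp _ _)))

lemma map_into {ι κ : Type} [Finite ι] [Finite κ] {A : ι → F₁.V} {B : κ → F₁.V} {v : F₁.V}
    (g : F₁.Mor A B) (f : F₁.Hom B v) : φ.map (g.into f) = (φ.mor g).into (φ.map f) := by
  exact (φ.map_map _ _).trans (congrArg _ (φ.map_comp _ _))

lemma deg_mor {ι κ : Type} [Finite ι] [Fintype κ] {A : ι → F₁.V} {B : κ → F₁.V}
    (g : F₁.Mor A B) : C₂.mor (φ.mor g) = C₁.mor g := by
  exact Finset.sum_congr rfl fun j _ => φ.deg_map _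

/-- Admissible morphisms: faithful, and satisfying the two factorization axioms. -/
structure Admissible : Prop where
  faithful : ∀ {A B : F₁.Word},
    Function.Injective (φ.mor : F₁.Mor A.2 B.2 → F₂.Mor _ _)
  /-- If `φ(g) = f ∘ φ(l)` then `f` is in the image of `φ`. -/
  lift : ∀ {A B C : F₁.Word} (g : F₁.Mor A.2 C.2) (l : F₁.Mor A.2 B.2)
    (f : F₂.Mor (fun i => φ.obj (B.2 i)) (fun i => φ.obj (C.2 i))),
    φ.mor g = (φ.mor l).comp f → ∃ m : F₁.Mor B.2 C.2, φ.mor m = f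
  /-- If `φ(g) = f ∘ h` then `g = g₁ ∘ g₂` with `f = φ(g₁) σ⁻¹` and `h = σ φ(g₂)`. -/
  factor : ∀ {A C : F₁.Word} {X : F₂.Word} (g : F₁.Mor A.2 C.2)
    (h : F₂.Mor (fun i => φ.obj (A.2 i)) X.2) (f : F₂.Mor X.2 (fun i => φ.obj (C.2 i))),
    φ.mor g = h.comp f →
    ∃ (B : F₁.Word) (g₂ : F₁.Mor A.2 B.2) (g₁ : F₁.Mor B.2 C.2)
      (σ : F₂.Mor (fun i => φ.obj (B.2 i)) X.2) (σinv : F₂.Mor X.2 (fun i => φ.obj (B.2 i))),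
      σ.comp σinv = Mor.id F₂ _ ∧ σinv.comp σ = Mor.id F₂ _ ∧
      g = g₂.comp g₁ ∧ f = σinv.comp (φ.mor g₁) ∧ h = (φ.mor g₂).comp σ

variable {φ}

lemma Admissible.map_injective (hφ : φ.Admissible) {A : F₁.Word} {v : F₁.V} :
    Function.Injective (φ.map : F₁.Hom A.2 v → _) := by
  intro f f' h
  let E : {i : Fin A.1 // (0 : Fin 1) = 0} ≃ Fin A.1 := Equiv.subtypeUnivEquiv fun _ => rfl
  let B : F₁.Word := ⟨1, fun _ => v⟩
  let M : F₁.Hom A.2 v → F₁.Mor A.2 B.2 := fun f =>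
    { π := fun _ => 0
      hom := fun j => F₁.map (Equiv.subtypeUnivEquiv fun _ => Subsingleton.elim _ _).symm
        (A := fun i => A.2 i.1) f }
  let M' : F₂.Hom (fun i => φ.obj (A.2 i)) (φ.obj v) →
      F₂.Mor (fun i => φ.obj (A.2 i)) (fun j => φ.obj (B.2 j)) := fun f =>
    { π := fun _ => 0
      hom := fun j => F₂.map (Equiv.subtypeUnivEquiv fun _ => Subsingleton.elim _ _).symm
        (A := fun i => φ.obj (A.2 i.1)) f }
  have hM : ∀ f, φ.mor (M f) = M' (φ.map f) := fun f =>
    congrArg (Mor.mk (F := F₂) (A := fun i => φ.obj (A.2 i)) (B := fun j => φ.obj (B.2 j)) _)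
      (funext fun c => φ.map_map _ _)
  have h1 : M f = M f' := hφ.faithful ((hM f).trans ((congrArg M' h).trans (hM f').symm))
  have h2 : F₁.map E.symm (A := fun i => A.2 i.1) f = F₁.map E.symm (A := fun i => A.2 i.1) f' :=
    congrFun (eq_of_heq (Mor.mk.inj h1).2) 0
  have h3 : ∀ f : F₁.Hom A.2 v, F₁.map E (A := A.2) (F₁.map E.symm (A := fun i => A.2 i.1) f) = f :=
    fun f => (F₁.map_map E.symm E (A := A.2) f).trans (F₁.map_refl f)
  rw [← h3 f, ← h3 f', h2]

lemma Admissible.equivFact (hφ : φ.Admissible) {A X X' : F₁.Word} {v : F₁.V}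
    (g : F₁.Mor A.2 X.2) (f : F₁.Hom X.2 v) (g' : F₁.Mor A.2 X'.2) (f' : F₁.Hom X'.2 v)
    (hg : C₁.mor g = 1) (hg' : C₁.mor g' = 1)
    (h : EquivFact (φ.mor g) (φ.map f) (φ.mor g') (φ.map f')) : EquivFact g f g' f' := by
  obtain ⟨τ, -, h1, h2⟩ := h
  obtain ⟨m, rfl⟩ := hφ.lift g' g τ h1.symm
  rw [← φ.mor_comp] at h1
  rw [← φ.map_into] at h2
  have h1' := hφ.faithful h1
  refine ⟨m, C₁.isIso_of_deg_zero m ?_, h1', hφ.map_injective h2⟩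
  have := C₁.mor_comp g m
  rw [h1'] at this
  omega

end CubicalMorphism

/-! ## Operads of either parity -/

/-- The Koszul sign of the passage from the order of `ι` to the lexicographic order of
`Σ j, α j`, for factors of degrees `n`. -/
noncomputable def koszulSign {ι κ : Type} [LinearOrder ι] [Fintype κ] [LinearOrder κ]
    {α : κ → Type} [∀ j, Fintype (α j)] [∀ j, LinearOrder (α j)] (e : (Σ j, α j) ≃ ι)
    (n : ι → ℤ) : ℤˣ := by
  classical
  exact ∏ p : (Σ j, α j), ∏ q : (Σ j, α j),
    if Sigma.Lex (· < ·) (fun _ => (· < ·)) p q ∧ e q < e p then (n (e p) * n (e q)).negOnePow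
    else 1

/-- The Koszul sign of `(⊗ g j) (⊗ y j)`, where `g j` has degree `b j` and `y j` has degree
`m j`. -/
def passSign {κ : Type} [Fintype κ] [LinearOrder κ] (b m : κ → ℤ) : ℤˣ :=
  ∏ j, (b j * ∑ j' with j' < j, m j').negOnePow

lemma sum_block {ι κ : Type} [Fintype ι] [Fintype κ] {α : κ → Type} [∀ j, Fintype (α j)]
    (e : (Σ j, α j) ≃ ι) (n : ι → ℤ) (c : ℤ) (b : ℕ) (a : κ → ℕ) :
    ∑ i, n i + c * ((b + ∑ j, a j : ℕ) : ℤ) =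
      ∑ j, (∑ x : α j, n (e ⟨j, x⟩) + c * (a j : ℤ)) + c * (b : ℤ) := by
  rw [← e.sum_comp n, Fintype.sum_sigma, Finset.sum_add_distrib, ← Finset.mul_sum]
  push_cast
  ring

lemma sum_shift {ι : Type} [Fintype ι] [DecidableEq ι] (n : ι → ℤ) (i : ι) :
    ∑ j, (if j = i then n j + 1 else n j) = ∑ j, n j + 1 := by
  have : ∀ j, (if j = i then n j + 1 else n j) = n j + if j = i then 1 else 0 := by
    intro j; split_ifs <;> simp
  simp [this, Finset.sum_add_distrib]

section Ops

variable (k : Type u) [Field k] {F : FeynmanCategory.{u}} (C : F.Cubical)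

/-- The data of an operad over a cubical Feynman category, of parity `s` (`false` for even, `true`
for odd): graded vector spaces `obj v n` and, for each generating morphism of degree at
most one, a multilinear structure map, which has degree `0` in the even case
and the degree of the morphism in the odd case.  Inputs are indexed by finite linearly
ordered sets, the order being that of the factors of a tensor product. -/
structure PreOp (s : Bool) where
  obj : F.V → ℤ → Type u
  [addCommGroup : ∀ v n, AddCommGroup (obj v n)]
  [module : ∀ v n, Module k (obj v n)]
  act : {ι : Type} → [Fintype ι] → [LinearOrder ι] → {A : ι → F.V} → {v : F.V} →
    (f : F.Hom A v) → C.deg f ≤ 1 → (n : ι → ℤ) → (N : ℤ) →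
    N = ∑ i, n i + s.toNat * (C.deg f : ℤ) →
    MultilinearMap k (fun i => obj (A i) (n i)) (obj v N)

attribute [instance] PreOp.addCommGroup PreOp.module

variable {k C} {s : Bool}

namespace PreOp

/-- The value of `P(f) ∘ (⊗ P(g j))` on `⊗ x i`, where the inputs are first rearranged by `e`. -/
noncomputable def actComp (P : PreOp k C s) {ι κ : Type} [Fintype ι] [LinearOrder ι] [Fintype κ]
    [LinearOrder κ] {α : κ → Type} [∀ j, Fintype (α j)] [∀ j, LinearOrder (α j)]
    (e : (Σ j, α j) ≃ ι) {A : ι → F.V} {B : κ → F.V} {v : F.V}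
    (f : F.Hom B v) (hf : C.deg f ≤ 1)
    (g : ∀ j, F.Hom (fun a : α j => A (e ⟨j, a⟩)) (B j)) (hg : ∀ j, C.deg (g j) ≤ 1)
    (n : ι → ℤ) (N : ℤ)
    (hN : N = ∑ i, n i + s.toNat * ((C.deg f + ∑ j, C.deg (g j) : ℕ) : ℤ))
    (x : ∀ i, P.obj (A i) (n i)) : P.obj v N :=
  (koszulSign e n *
    passSign (fun j => s.toNat * (C.deg (g j) : ℤ)) (fun j => ∑ a, n (e ⟨j, a⟩))) •
  P.act f hf (fun j => ∑ a, n (e ⟨j, a⟩) + s.toNat * (C.deg (g j) : ℤ)) N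
    (hN.trans (sum_block e n _ _ _))
    (fun j => P.act (g j) (hg j) (fun a => n (e ⟨j, a⟩)) _ rfl (fun a => x (e ⟨j, a⟩)))

/-- The action of an isomorphism of vertices. -/
def viso (P : PreOp k C s) {v w : F.V} (σ : F.VIso v w) (n : ℤ) : P.obj v n →ₗ[k] P.obj w n :=
  (MultilinearMap.ofSubsingleton k (P.obj v n) (P.obj w n) ()).symm
    (P.act σ.hom (by rw [C.deg_viso]; exact zero_le_one) (fun _ => n) n
      (by rw [C.deg_viso]; simp))

/-- Transport along an equality of degrees. -/
def castDeg (P : PreOp k C s) {v : F.V} {n m : ℤ} (h : n = m) (x : P.obj v n) : P.obj v m :=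
  h ▸ x

/-- The family obtained from `x` by applying `d` to its `i`-th member. -/
def applyAt (P : PreOp k C s) (d : ∀ {v : F.V} {n m : ℤ}, m = n + 1 → P.obj v n → P.obj v m)
    {ι : Type} [DecidableEq ι] {A : ι → F.V} {n : ι → ℤ} (x : ∀ i, P.obj (A i) (n i)) (i : ι) :
    ∀ j, P.obj (A j) (if j = i then n j + 1 else n j) :=
  fun j => if h : j = i then d (by simp [h]) (x j) else P.castDeg (by simp [h]) (x j)

end PreOp

variable (k C)

/-- Graded operads of parity `s`: the graded symmetric monoidal functors out of the category of
sequences of degree one morphisms modulo isomorphisms which are invariant (`s = false`) or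
skew invariant (`s = true`) under the permutations of sequences.  A sequence is a
composite of morphisms of degree one and of isomorphisms, hence such a functor is given by its
structure maps in degrees at most one; they have to be functorial in total degree at most
one (`act_one`, `act_comp`), and the two inequivalent factorizations of a
generating morphism of degree two have to act by the same map up to the sign of the
transposition (`act_swap`). -/
structure GrOp (s : Bool) extends PreOp k C s where
  act_one : ∀ (v : F.V) (n : ℤ) (h : C.deg (F.one v) ≤ 1) (hn) (x : obj v n),
    act (F.one v) h (fun _ => n) n hn (fun _ => x) = x
  act_comp : ∀ {ι κ : Type} [Fintype ι] [LinearOrder ι] [Fintype κ] [LinearOrder κ]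
    {α : κ → Type} [∀ j, Fintype (α j)] [∀ j, LinearOrder (α j)]
    (e : (Σ j, α j) ≃ ι) {A : ι → F.V} {B : κ → F.V} {v : F.V}
    (f : F.Hom B v) (hf : C.deg f ≤ 1)
    (g : ∀ j, F.Hom (fun a : α j => A (e ⟨j, a⟩)) (B j)) (hg : ∀ j, C.deg (g j) ≤ 1)
    (h : C.deg (F.map e (A := A) (F.comp (A := fun p => A (e p)) f g)) ≤ 1)
    (n : ι → ℤ) (N : ℤ) (hN) (hN') (x : ∀ i, obj (A i) (n i)),
    act (F.map e (A := A) (F.comp (A := fun p => A (e p)) f g)) h n N hN x =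
      toPreOp.actComp e f hf g hg n N hN' x
  act_swap : ∀ {A X X' : F.Word} {v : F.V} (g : F.Mor A.2 X.2) (f : F.Hom X.2 v)
    (g' : F.Mor A.2 X'.2) (f' : F.Hom X'.2 v),
    C.mor g = 1 → C.deg f = 1 → C.mor g' = 1 → C.deg f' = 1 →
    g.into f = g'.into f' → ¬ EquivFact g f g' f' →
    ∀ (hf hg hf' hg') (n : Fin A.1 → ℤ) (N : ℤ) (hN hN') (x : ∀ i, obj (A.2 i) (n i)),
    toPreOp.actComp (Equiv.sigmaFiberEquiv g'.π) f' hf' g'.hom hg' n N hN' x =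
      (s.toNat : ℤ).negOnePow •
        toPreOp.actComp (Equiv.sigmaFiberEquiv g.π) f hf g.hom hg n N hN x

/-- Differential graded operads of parity `s`; the differential has degree `1`. -/
structure DGOp (s : Bool) extends GrOp k C s where
  d : {v : F.V} → {n m : ℤ} → m = n + 1 → obj v n →ₗ[k] obj v m
  d_d : ∀ {v : F.V} {n m l : ℤ} (h : m = n + 1) (h' : l = m + 1) (x : obj v n), d h' (d h x) = 0
  d_act : ∀ {ι : Type} [Fintype ι] [LinearOrder ι] {A : ι → F.V} {v : F.V}
    (f : F.Hom A v) (hf : C.deg f ≤ 1) (n : ι → ℤ) (N M : ℤ)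
    (hN : N = ∑ i, n i + s.toNat * (C.deg f : ℤ)) (hM : M = N + 1)
    (x : ∀ i, obj (A i) (n i)),
    d hM (act f hf n N hN x) =
      ∑ i, (s.toNat * (C.deg f : ℤ) + ∑ j with j < i, n j).negOnePow •
        act f hf (fun j => if j = i then n j + 1 else n j) M
          (by rw [sum_shift, hM, hN]; ring)
          (toPreOp.applyAt (fun h => d h) x i)

variable {k C}

/-- Morphisms of graded operads. -/
@[ext]
structure GrOp.Hom (P Q : GrOp k C s) where
  app : ∀ v n, P.obj v n →ₗ[k] Q.obj v n
  app_act : ∀ {ι : Type} [Fintype ι] [LinearOrder ι] {A : ι → F.V} {v : F.V}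
    (f : F.Hom A v) (hf : C.deg f ≤ 1) (n : ι → ℤ) (N : ℤ) (hN) (x : ∀ i, P.obj (A i) (n i)),
    app v N (P.act f hf n N hN x) = Q.act f hf n N hN (fun i => app (A i) (n i) (x i))

/-- Morphisms of differential graded operads. -/
@[ext]
structure DGOp.Hom (P Q : DGOp k C s) extends GrOp.Hom P.toGrOp Q.toGrOp where
  app_d : ∀ {v : F.V} {n m : ℤ} (h : m = n + 1) (x : P.obj v n),
    app v m (P.d h x) = Q.d h (app v n x)

instance : Category (DGOp k C s) where
  Hom P Q := DGOp.Hom P Q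
  id P :=
    { app := fun _ _ => LinearMap.id
      app_act := fun _ _ _ _ _ _ => rfl
      app_d := fun _ _ => rfl }
  comp a b :=
    { app := fun v n => (b.app v n).comp (a.app v n)
      app_act := fun f hf n N hN x => by
        simp only [LinearMap.comp_apply, a.app_act, b.app_act]
      app_d := fun h x => by simp only [LinearMap.comp_apply, a.app_d, b.app_d] }

/-- `P` is of finite type if `P(v₁) ⊗ ⋯ ⊗ P(vₘ)` is finite dimensional in each degree, for all
vertices `v₁, …, vₘ`. -/
def DGOp.finiteType : ObjectProperty (DGOp k C s) := fun P =>
  (∀ v n, Module.Finite k (P.obj v n)) ∧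
  ∀ (A : F.Word) (N : ℤ),
    {n : Fin A.1 → ℤ | ∑ i, n i = N ∧ ∀ i, Nontrivial (P.obj (A.2 i) (n i))}.Finite

end Ops

/-! ## The functors -/

section Functors

variable (k : Type u) [Field k] {F₁ F₂ : FeynmanCategory.{u}} {C₁ : F₁.Cubical} {C₂ : F₂.Cubical}
  {φ : CubicalMorphism C₁ C₂}

lemma PreOp.act_congr {F : FeynmanCategory.{u}} {C : F.Cubical} {s : Bool} {k : Type u} [Field k]
    (P : PreOp k C s) {ι : Type} [Fintype ι]
    [LinearOrder ι] {A : ι → F.V} {v : F.V} {f f' : F.Hom A v} (h : f = f') (hf : C.deg f ≤ 1)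
    (hf' : C.deg f' ≤ 1) (n : ι → ℤ) (N : ℤ) (hN) (hN') (x : ∀ i, P.obj (A i) (n i)) :
    P.act f hf n N hN x = P.act f' hf' n N hN' x := by
  subst h
  rfl

/-- Pull back of the data of an operad: composition with `φ`. -/
def PreOp.restrict {k : Type u} [Field k] {s : Bool} (φ : CubicalMorphism C₁ C₂)
    (Q : PreOp k C₂ s) : PreOp k C₁ s where
  obj v n := Q.obj (φ.obj v) n
  act f hf n N hN := Q.act (φ.map f) (by rwa [φ.deg_map]) n N (by rwa [φ.deg_map])

lemma PreOp.actComp_restrict {k : Type u} [Field k] {s : Bool} (φ : CubicalMorphism C₁ C₂)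
    (Q : PreOp k C₂ s) {ι κ : Type} [Fintype ι] [LinearOrder ι] [Fintype κ]
    [LinearOrder κ] {α : κ → Type} [∀ j, Fintype (α j)] [∀ j, LinearOrder (α j)]
    (e : (Σ j, α j) ≃ ι) {A : ι → F₁.V} {B : κ → F₁.V} {v : F₁.V}
    (f : F₁.Hom B v) (hf : C₁.deg f ≤ 1)
    (g : ∀ j, F₁.Hom (fun a : α j => A (e ⟨j, a⟩)) (B j)) (hg : ∀ j, C₁.deg (g j) ≤ 1)
    (n : ι → ℤ) (N : ℤ) (hN) (hf') (hg') (hN')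
    (x : ∀ i, Q.obj (φ.obj (A i)) (n i)) :
    (Q.restrict φ).actComp e f hf g hg n N hN x =
      Q.actComp e (A := fun i => φ.obj (A i)) (B := fun j => φ.obj (B j)) (φ.map f) hf'
        (fun j => φ.map (g j)) hg' n N hN' x := by
  have key : ∀ (a a' : κ → ℕ) (_ : a = a') (h1) (h1')
      (h2 : ∀ j, _ = ∑ a, n (e ⟨j, a⟩) + s.toNat * (C₂.deg (φ.map (g j)) : ℤ))
      (h2' : ∀ j, _ = ∑ a, n (e ⟨j, a⟩) + s.toNat * (C₂.deg (φ.map (g j)) : ℤ)),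
      (koszulSign e n * passSign (fun j => s.toNat * (a j : ℤ)) (fun j => ∑ a, n (e ⟨j, a⟩))) •
        Q.act (φ.map f) hf' (fun j => ∑ a, n (e ⟨j, a⟩) + s.toNat * (a j : ℤ)) N h1
          (fun j => Q.act (φ.map (g j)) (hg' j) (fun a => n (e ⟨j, a⟩)) _ (h2 j)
            (fun a => x (e ⟨j, a⟩))) =
      (koszulSign e n * passSign (fun j => s.toNat * (a' j : ℤ)) (fun j => ∑ a, n (e ⟨j, a⟩))) •
        Q.act (φ.map f) hf' (fun j => ∑ a, n (e ⟨j, a⟩) + s.toNat * (a' j : ℤ)) N h1'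
          (fun j => Q.act (φ.map (g j)) (hg' j) (fun a => n (e ⟨j, a⟩)) _ (h2' j)
            (fun a => x (e ⟨j, a⟩))) := by
    rintro a _ rfl _ _ _ _
    rfl
  exact key (fun j => C₁.deg (g j)) (fun j => C₂.deg (φ.map (g j)))
    (funext fun j => (φ.deg_map (g j)).symm) _ _ _ _

/-- Pull back of operads along an admissible morphism: composition with `φ`. -/
def restriction (hφ : φ.Admissible) (s : Bool) : DGOp k C₂ s ⥤ DGOp k C₁ s where
  obj Q :=
    { toPreOp := Q.toPreOp.restrict φ
      act_one := fun v n h hn x => by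
        refine (Q.act_congr (φ.map_one v) _ (by rw [C₂.deg_one]; exact zero_le_one) _ _ _
          (by rw [C₂.deg_one]; simp) _).trans ?_
        exact Q.act_one (φ.obj v) n _ _ x
      act_comp := by
        intro ι κ _ _ _ _ α _ _ e A B v f hf g hg h n N hN hN' x
        have h1 : φ.map (F₁.map e (A := A) (F₁.comp (A := fun p => A (e p)) f g)) =
            F₂.map e (A := fun i => φ.obj (A i))
              (F₂.comp (A := fun p => φ.obj (A (e p))) (φ.map f) (fun j => φ.map (g j))) :=
          (φ.map_map _ _).trans (congrArg _ (φ.map_comp _ _))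
        have hg' : ∀ j, C₂.deg (φ.map (g j)) ≤ 1 := fun j => by rw [φ.deg_map]; exact hg j
        have hd : C₂.deg (φ.map f) + ∑ j, C₂.deg (φ.map (g j)) = C₁.deg f + ∑ j, C₁.deg (g j) :=
          congrArg₂ _ (φ.deg_map f) (Finset.sum_congr rfl fun j _ => φ.deg_map (g j))
        have hf' : C₂.deg (φ.map f) ≤ 1 := by rwa [φ.deg_map]
        have h2 := (φ.deg_map _).symm.trans (congrArg C₂.deg h1)
        have hN₂ := by rw [h2] at hN; exact hN
        have h3 := Q.act_congr h1 (by rwa [φ.deg_map]) (h2 ▸ h) n N (by rwa [φ.deg_map]) hN₂ x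
        have hN₃ := by rw [← hd] at hN'; exact hN'
        have h4 := Q.act_comp e (A := fun i => φ.obj (A i)) (φ.map f) hf'
          (fun j => φ.map (g j)) hg' (h2 ▸ h) n N hN₂ hN₃ x
        have h5 := PreOp.actComp_restrict φ Q.toPreOp e f hf g hg n N hN' hf' hg' hN₃ x
        exact h3.trans (h4.trans h5.symm)
      act_swap := by
        intro A X X' v g f g' f' hg hf hg' hf' h hne h₁ h₂ h₁' h₂' n N hN hN' x
        have hd : ∀ {Y : F₁.Word} (g : F₁.Mor A.2 Y.2) (f : F₁.Hom Y.2 v),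
            C₂.deg (φ.map f) + ∑ j, C₂.deg (φ.map (g.hom j)) = C₁.deg f + ∑ j, C₁.deg (g.hom j) :=
          fun g f => congrArg₂ _ (φ.deg_map f) (Finset.sum_congr rfl fun j _ => φ.deg_map (g.hom j))
        have hN₃ := hN.trans (congrArg (fun t : ℕ => ∑ i, n i + s.toNat * (t : ℤ)) (hd g f).symm)
        have hN₃' := hN'.trans (congrArg (fun t : ℕ => ∑ i, n i + s.toNat * (t : ℤ)) (hd g' f').symm)
        have k₁ : C₂.deg (φ.map f) ≤ 1 := by rwa [φ.deg_map]
        have k₁' : C₂.deg (φ.map f') ≤ 1 := by rwa [φ.deg_map]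
        have k₂ : ∀ j, C₂.deg (φ.map (g.hom j)) ≤ 1 := fun j => by rw [φ.deg_map]; exact h₂ j
        have k₂' : ∀ j, C₂.deg (φ.map (g'.hom j)) ≤ 1 := fun j => by rw [φ.deg_map]; exact h₂' j
        have h3 := PreOp.actComp_restrict φ Q.toPreOp (Equiv.sigmaFiberEquiv g.π) f h₁ g.hom h₂ n N
          hN k₁ k₂ hN₃ x
        have h3' := PreOp.actComp_restrict φ Q.toPreOp (Equiv.sigmaFiberEquiv g'.π) f' h₁' g'.hom
          h₂' n N hN' k₁' k₂' hN₃' x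
        have h4 := Q.act_swap (A := ⟨A.1, fun i => φ.obj (A.2 i)⟩)
          (X := ⟨X.1, fun i => φ.obj (X.2 i)⟩)
          (X' := ⟨X'.1, fun i => φ.obj (X'.2 i)⟩) (φ.mor g) (φ.map f) (φ.mor g') (φ.map f')
          ((φ.deg_mor g).trans hg) ((φ.deg_map f).trans hf) ((φ.deg_mor g').trans hg')
          ((φ.deg_map f').trans hf')
          ((φ.map_into g f).symm.trans ((congrArg φ.map h).trans (φ.map_into g' f')))
          (fun h' => hne (hφ.equivFact g f g' f' hg hg' h')) k₁ k₂ k₁' k₂' n N hN₃ hN₃' x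
        exact h3'.trans (h4.trans (congrArg _ h3.symm))
      d := fun h => Q.d h
      d_d := fun h h' x => Q.d_d h h' x
      d_act := by
        intro ι _ _ A v f hf n N M hN hM x
        refine (Q.d_act (φ.map f) (by rwa [φ.deg_map]) n N M (by rwa [φ.deg_map]) hM x).trans ?_
        refine Finset.sum_congr rfl fun i _ => ?_
        exact congrArg (fun t : ℕ => (s.toNat * (t : ℤ) + ∑ j with j < i, n j).negOnePow •
          Q.act (φ.map f) (by rwa [φ.deg_map]) (fun j => if j = i then n j + 1 else n j) M
            (by rw [sum_shift, hM, hN, φ.deg_map]; ring)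
            (Q.toPreOp.applyAt (fun h => Q.d h) x i)) (φ.deg_map f) }
  map a :=
    { app := fun v n => a.app (φ.obj v) n
      app_act := fun f hf n N hN x => a.app_act _ _ _ _ _ _
      app_d := fun h x => a.app_d h x }

variable {k} in
/-- The vector space `⨁ P(w) ⊗_{Aut w} k[Iso(φ(w), v)]` in degree `n`, the sum being over the
vertices `w`, as the quotient of the sum of copies of `P(w)` indexed by isomorphisms `σ : φ(w) ≅ v`
by the relations `p ⊗ σ φ(l) = l p ⊗ σ` for `l` in `Aut w`.  Since isomorphic vertices are equal,
only the `w` with `φ(w) = v` contribute, and `Iso(φ(w), v) = Aut v`. -/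
def Induced (φ : CubicalMorphism C₁ C₂) {s : Bool} (P : PreOp k C₁ s) (v : F₂.V) (n : ℤ) : Type u :=
  open scoped Classical in
  (DirectSum (Σ w, F₂.VIso (φ.obj w) v) fun x => P.obj x.1 n) ⧸
    Submodule.span k {y : DirectSum (Σ w, F₂.VIso (φ.obj w) v) fun x => P.obj x.1 n |
      ∃ (w : F₁.V) (σ σ' : F₂.VIso (φ.obj w) v) (l : F₁.VIso w w) (p : P.obj w n),
        σ'.hom = F₂.post σ.hom (φ.map l.hom) ∧
        y = DirectSum.of (fun x : Σ w, F₂.VIso (φ.obj w) v => P.obj x.1 n) ⟨w, σ'⟩ p -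
          DirectSum.of (fun x : Σ w, F₂.VIso (φ.obj w) v => P.obj x.1 n) ⟨w, σ⟩ (P.viso l n p)}

namespace Induced

variable {k} {s : Bool} {P : PreOp k C₁ s} {v : F₂.V} {n : ℤ}

noncomputable instance : AddCommGroup (Induced φ P v n) :=
  inferInstanceAs (AddCommGroup (_ ⧸ Submodule.span k _))

noncomputable instance : Module k (Induced φ P v n) :=
  inferInstanceAs (Module k (_ ⧸ Submodule.span k _))

/-- The class `[p ⊗ σ]`. -/
noncomputable def mk {w : F₁.V} (σ : F₂.VIso (φ.obj w) v) : P.obj w n →ₗ[k] Induced φ P v n := by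
  classical
  exact (Submodule.mkQ _).comp
    (DirectSum.lof k _ (fun x : Σ w, F₂.VIso (φ.obj w) v => P.obj x.1 n) ⟨w, σ⟩)

end Induced

/-- A decomposition `f ∘ (⊗ σ i) = τ ∘ φ(g)` with `g` a generating morphism with target `w₀`. -/
structure CubicalMorphism.Decomposition (φ : CubicalMorphism C₁ C₂) {ι : Type} [Finite ι]
    {w : ι → F₁.V} {B : ι → F₂.V} {v : F₂.V} (f : F₂.Hom B v)
    (σ : ∀ i, F₂.VIso (φ.obj (w i)) (B i)) (w₀ : F₁.V) where
  g : F₁.Hom w w₀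
  τ : F₂.VIso (φ.obj w₀) v
  eq : F₂.pre f (fun i => (σ i).hom) = F₂.post τ.hom (φ.map g)

lemma CubicalMorphism.Decomposition.deg_g {ι : Type} [Fintype ι]
    {w : ι → F₁.V} {B : ι → F₂.V} {v : F₂.V} {f : F₂.Hom B v}
    {σ : ∀ i, F₂.VIso (φ.obj (w i)) (B i)} {w₀ : F₁.V} (x : φ.Decomposition f σ w₀) :
    C₁.deg x.g = C₂.deg f := by
  have h := congrArg C₂.deg x.eq
  rw [C₂.deg_pre, C₂.deg_post, C₂.deg_viso, φ.deg_map] at h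
  simp only [C₂.deg_viso, Finset.sum_const_zero] at h
  omega

/-- The exceptional push-forward `L^!` of operads of parity `s`.  As a graded object it is
`v ↦ ⨁ P(w) ⊗_{Aut w} k[Aut v]`, the sum being over the `w` with `φ(w) = v`.  The
differential and the functoriality in `P` come from those of `P`.  A generating morphism `f` takes
`⊗ [p i ⊗ σ i]` to the sum over all `w₀` of the elements `[P(g)(⊗ p i) ⊗ τ]`, where
`f ∘ (⊗ σ i) = τ ∘ φ(g)` with `g` of target `w₀`, the summand being zero if there is no such
decomposition. -/
structure ExceptionalPushforward (φ : CubicalMorphism C₁ C₂) (s : Bool) where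
  functor : DGOp k C₁ s ⥤ DGOp k C₂ s
  equiv : ∀ (P : DGOp k C₁ s) (v : F₂.V) (n : ℤ),
    Induced φ P.toPreOp v n ≃ₗ[k] (functor.obj P).obj v n
  map_mk : ∀ {P Q : DGOp k C₁ s} (a : P ⟶ Q) {v : F₂.V} {n : ℤ} {w : F₁.V}
    (σ : F₂.VIso (φ.obj w) v) (p : P.obj w n),
    (functor.map a).app v n (equiv P v n (Induced.mk σ p)) =
      equiv Q v n (Induced.mk σ (a.app w n p))
  d_mk : ∀ (P : DGOp k C₁ s) {v : F₂.V} {n m : ℤ} (h : m = n + 1) {w : F₁.V}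
    (σ : F₂.VIso (φ.obj w) v) (p : P.obj w n),
    (functor.obj P).d h (equiv P v n (Induced.mk σ p)) = equiv P v m (Induced.mk σ (P.d h p))
  act_mk : open scoped Classical in
    ∀ (P : DGOp k C₁ s) {ι : Type} [Fintype ι] [LinearOrder ι] {w : ι → F₁.V} {B : ι → F₂.V}
    {v : F₂.V} (f : F₂.Hom B v) (hf : C₂.deg f ≤ 1) (n : ι → ℤ) (N : ℤ)
    (hN : N = ∑ i, n i + s.toNat * (C₂.deg f : ℤ)) (σ : ∀ i, F₂.VIso (φ.obj (w i)) (B i))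
    (p : ∀ i, P.obj (w i) (n i)),
    (functor.obj P).act f hf n N hN (fun i => equiv P (B i) (n i) (Induced.mk (σ i) (p i))) =
      ∑ᶠ w₀ : F₁.V, if h : Nonempty (φ.Decomposition f σ w₀) then
        equiv P v N (Induced.mk h.some.τ
          (P.act h.some.g (by rw [h.some.deg_g]; exact hf) n N (by rw [h.some.deg_g]; exact hN) p))
        else 0

variable {F : FeynmanCategory.{u}} (C : F.Cubical) (s : Bool)

/-- The category of operads of parity `s` and of finite type. -/
abbrev FinOp := (DGOp.finiteType (k := k) (C := C) (s := s)).FullSubcategory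

instance (P : FinOp k C s) (v : F.V) (n : ℤ) : Module.Finite k (P.obj.obj v n) := P.property.1 v n

/-- The Feynman transform of operads of parity `s` and of finite type; its values have the opposite
parity.  The graded operad underlying `D(P)` is free (`exists_unique_hom`) on the dual of
the module over the vertex groupoid underlying `P`, with generators `gen P v n p` of degree `n` for
linear forms `p` on `P(v)` of degree `n`.  The
differential of a generator is the sum of its differential in the dual complex and of the terms
given by the morphisms `f` of degree one, namely the image of `p ∘ P(f)` under
`(⊗ P(X i))^* = ⊗ P(X i)^* → D(P)(v)`, the last map being `D(P)(f)`.
The sum is over the groupoid of all morphisms `f` of degree one with target `v`; an isomorphism class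
has the weight `1 / |Aut f|`, so that a single `f` has the weight
`1 / (r! * |Aut (X 1)| * ⋯ * |Aut (X r)|)`, where `X 1, …, X r` is its source. -/
structure FeynmanTransform where
  functor : (FinOp k C s)ᵒᵖ ⥤ DGOp k C (!s)
  gen : ∀ (P : FinOp k C s) (v : F.V) (n : ℤ),
    Module.Dual k (P.obj.obj v (-n)) →ₗ[k] (functor.obj (.op P)).obj v n
  viso_gen : ∀ (P : FinOp k C s) {v w : F.V} (σ : F.VIso v w) (n : ℤ) (p : Module.Dual k (P.obj.obj w (-n))),
    (functor.obj (.op P)).viso σ n (gen P v n (p.comp (P.obj.viso σ (-n)))) = gen P w n p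
  exists_unique_hom : ∀ (P : FinOp k C s) (Q : GrOp k C (!s))
    (j : ∀ (v : F.V) (n : ℤ), Module.Dual k (P.obj.obj v (-n)) →ₗ[k] Q.obj v n),
    (∀ {v w : F.V} (σ : F.VIso v w) (n : ℤ) (p : Module.Dual k (P.obj.obj w (-n))),
      Q.viso σ n (j v n (p.comp (P.obj.viso σ (-n)))) = j w n p) →
    ∃! a : GrOp.Hom (functor.obj (.op P)).toGrOp Q, ∀ v n p, a.app v n (gen P v n p) = j v n p
  map_gen : ∀ {P Q : FinOp k C s} (a : P ⟶ Q)
    {v : F.V} {n : ℤ} (p : Module.Dual k (Q.obj.obj v (-n))),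
    (functor.map a.op).app v n (gen Q v n p) = gen P v n (p.comp (a.hom.app v (-n)))
  d_gen : ∀ (P : FinOp k C s) {v : F.V} {n m : ℤ} (h : m = n + 1) (p : Module.Dual k (P.obj.obj v (-n))),
    (functor.obj (.op P)).d h (gen P v n p) =
      m.negOnePow • gen P v m (p.comp (P.obj.d (show -n = -m + 1 by omega))) +
      ∑ᶠ f : C.DegOne v,
        ((f.1.1.factorial * ∏ i, F.autCard (f.1.2 i) : ℕ) : k)⁻¹ •
        ∑ᶠ l : {l : Fin f.1.1 → ℤ // ∑ i, l i = n + s.toNat},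
          (s.toNat * n + ∑ i, ∑ j with j < i, l.1 i * l.1 j).negOnePow •
          ∑ a : ∀ i, Fin (Module.finrank k (P.obj.obj (f.1.2 i) (-l.1 i))),
            p (P.obj.act f.2.1 f.2.2.le (fun i => -l.1 i) (-n)
                (by rw [f.2.2, Finset.sum_neg_distrib, l.2]; push_cast; ring)
                (fun i => Module.finBasis k _ (a i))) •
              (functor.obj (.op P)).act f.2.1 f.2.2.le l.1 m
                (by rw [f.2.2, l.2, h]; cases s <;> simp)
                (fun i => gen P (f.1.2 i) (l.1 i) ((Module.finBasis k _).coord (a i)))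

end Functors

/-! Both composites represent the same functor of a differential graded `F₂`-operad `Q`. As `D₁ P`
is free on the dual of `P`, a morphism from `D₁ P` to the restriction of `Q` is an equivariant
family `K` of maps `P(w)^* → Q(φ w)` with `d K = dif K`, where `dif` is the formula for the
differential of a generator, its operations being evaluated in the target. In the same way a
morphism `D₂ L^! P → Q` is an equivariant family `J` of maps `(L^! P)(v)^* → Q(v)` with `d J = dif
J`. The components of `L^! P` are sums of induced representations, so Frobenius reciprocity matches
the families `K` and `J`: the passages `restrictGen` and `inducedGen` are mutually inverse by
`sum_viso_restrictGen` and `restrictGen_inducedGen`.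

The two differential equations also match, by `dif_restrictGen`, and this is the heart of the
comparison. Its essential part is `ext_restrictGen`. In the sum over morphisms `f : X → φ(w)` of
degree one the identity of each `L^! P(X i)` is resolved into the projections to the summands,
indexed by isomorphisms `x i : φ(w i) ≅ X i`. By the definition of `L^!` a term vanishes unless `f ∘
⊗ x i = φ(g)` for some `g` over `F₁`, and otherwise it is the term of `g`. The pairs `(f, x)` over a
given `g` are the families of isomorphisms out of the `φ(w i)`, and counting them turns the weight
of `f` into the weight of `g` (`weight_transport`). Consequently the morphism `unit` from `D₁ P` to
the restriction of `D₂ L^! P` induces a bijection of morphism sets for every `Q`, and its adjoint `L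
D₁ P → D₂ L^! P` is an isomorphism by Yoneda. Only the characterizing properties of `D`, `L^!` and
`L` enter, so the comparison holds for all functors that have them.

Existence of `L` and `D` comes from one construction: terms in generators and operations, identified
when they agree in all operads of a given class of models. For `L` the models of `P` are the operads
`Q` with a morphism from `P` to the restriction of `Q`. For `D` they are the dg operads with an
equivariant family satisfying `d J = dif J`. That the universal model for `D` is free as a graded
operad is shown with jets: a graded operad `Q` has a dg operad of pairs `(x, y)`, thought of as an
element and its derivative, with differential `(x, y) ↦ (y, 0)`. A family `j` with values in `Q`
lifts to `(j, dif j)`, which is a model exactly because `dif` squares to zero (`jsnd_dif_lift`).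

The square of `dif` has a part from `d² = 0` in `P`, a mixed part that cancels by the Leibniz rule
in `P` (`sum_conv_d`), and a part indexed by composable pairs of morphisms of degree one
(`sum_steps`). As `S₂` acts freely and transitively on the factorizations of a morphism of degree
two, each pair has, up to isomorphism, one partner with the same composite; since exactly one of the
source and the target operad is odd, partners contribute with opposite signs. Rigidity makes the
isomorphism between equivalent factorizations unique, so that the weights `1 / |Aut|` balance.

For `L^!` admissibility says that decompositions behave like factorizations in `F₁`. They are unique
up to isomorphism (`exists_viso`), a decomposition of a composite restricts to the inner factors
(`exists_factors`) and passes to the outer one (`exists_decomposition`). This makes the structure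
maps well defined and functorial; inequivalent factorizations lift to inequivalent ones, which gives
the law for transpositions. -/

set_option linter.unusedSectionVars false

/-! ### The category of words: composition, tensor products and renaming. -/

namespace FeynmanCategory

variable {F : FeynmanCategory.{u}}

section Calculus

/-- The source family depends on the bijection, so the morphisms are compared by `HEq`. Computations
with renamings end here, with bijections that agree pointwise by definition. -/
lemma map_congr {ι κ : Type} [Finite ι] [Finite κ] {e e' : ι ≃ κ} (he : e = e') {A : κ → F.V}
    {v : F.V} {f : F.Hom (fun i => A (e i)) v} {f' : F.Hom (fun i => A (e' i)) v} (hf : HEq f f') :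
    F.map e (A := A) f = F.map e' (A := A) f' := by
  subst he; rw [eq_of_heq hf]

lemma map_id' {ι : Type} [Finite ι] {A : ι → F.V} {v : F.V} (e : ι ≃ ι) (he : e = Equiv.refl ι)
    (f : F.Hom A v) (f' : F.Hom (fun i => A (e i)) v) (hf : HEq f' f) : F.map e (A := A) f' = f := by
  subst he; rw [eq_of_heq hf]; exact F.map_refl f

lemma map_surjective {ι κ : Type} [Finite ι] [Finite κ] (e : ι ≃ κ) {A : κ → F.V} {v : F.V} :
    Function.Surjective (F.map e (A := A) (v := v)) := by
  intro f
  have h : (fun i => A (e (e.symm i))) = A := by funext i; simp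
  refine ⟨F.map e.symm (A := fun i => A (e i)) (cast (congrArg (fun A => F.Hom A v) h.symm) f), ?_⟩
  refine (F.map_map e.symm e (A := A) _).trans (map_id' _ (by simp) _ _ (cast_heq _ _))

lemma map_injective {ι κ : Type} [Finite ι] [Finite κ] (e : ι ≃ κ) {A : κ → F.V} {v : F.V} :
    Function.Injective (F.map e (A := A) (v := v)) := by
  -- Presenting `A` as a pulled back family makes `F.map e.symm` applicable to values of `F.map e`
  -- without a cast.
  obtain ⟨A, rfl⟩ : ∃ A' : ι → F.V, A = fun j => A' (e.symm j) := ⟨fun i => A (e i), by simp⟩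
  intro f f' h
  have key : ∀ f : F.Hom (fun i => A (e.symm (e i))) v,
      HEq (F.map e.symm (A := A) (F.map e (A := fun j => A (e.symm j)) f)) f := by
    intro f
    have h : (fun i => A (e.symm (e i))) = A := by funext i; simp
    have h2 : F.map e.symm (A := A) (F.map e (A := fun j => A (e.symm j)) f) =
        cast (congrArg (fun A => F.Hom A v) h) f :=
      (F.map_map e e.symm (A := A) f).trans (map_id' _ (by simp) _ _ (cast_heq _ _).symm)
    rw [h2]; exact cast_heq _ _
  exact eq_of_heq ((key f).symm.trans ((heq_of_eq (congrArg (F.map e.symm (A := A)) h)).trans (key f')))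

namespace Mor

variable {ι κ l m : Type} [Finite ι] [Finite κ] [Finite l] [Finite m]
  {A : ι → F.V} {B : κ → F.V} {C : l → F.V} {D : m → F.V}

/-- The fibres of `g.π` and `h.π` are different types even when the maps agree pointwise, so
components are compared after a renaming of the fibres. -/
lemma ext_hom {g h : F.Mor A B} (hπ : ∀ i, g.π i = h.π i)
    (hh : ∀ j, F.map (Equiv.subtypeEquivRight (fun i => by rw [hπ i]) :
      {i // h.π i = j} ≃ {i // g.π i = j}) (A := fun i => A i.1) (h.hom j) = g.hom j) : g = h := by
  obtain ⟨π, a⟩ := g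
  obtain ⟨π', b⟩ := h
  obtain rfl : π = π' := funext hπ
  congr 1
  funext j
  exact (hh j).symm.trans (map_id' _ (Equiv.ext fun _ => rfl) _ _ HEq.rfl)

lemma hom_congr {g h : F.Mor A B} (e : g = h) (j : κ) :
    F.map (Equiv.subtypeEquivRight (fun i => by rw [e]) :
      {i // h.π i = j} ≃ {i // g.π i = j}) (A := fun i => A i.1) (h.hom j) = g.hom j := by
  subst e
  exact map_id' _ (Equiv.ext fun _ => rfl) _ _ HEq.rfl

/-- Associativity of the operad applied to the iterated fibres. `comp_map` and `map_comp` pull all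
renamings to the outside, where they compose to the same bijection. -/
lemma comp_assoc (g : F.Mor A B) (h : F.Mor B C) (k : F.Mor C D) :
    (g.comp h).comp k = g.comp (h.comp k) := by
  refine congrArg (Mor.mk _) (funext fun d => ?_)
  have h1 := F.comp_map (α := fun c : {c // k.π c = d} => Σ j : {j // h.π j = c.1}, {i // g.π i = j.1})
    (α' := fun c : {c // k.π c = d} => {i // h.π (g.π i) = c.1})
    (fun c => fiberEquiv g.π h.π c.1) (A := fun p => A p.2.1) (k.hom d)
    (fun c => F.comp (α := fun j : {j // h.π j = c.1} => {i // g.π i = j.1}) (A := fun p => A p.2.1)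
      (h.hom c.1) (fun j => g.hom j.1))
  have h2 := F.map_comp (fiberEquiv h.π k.π d)
    (α := fun j : {j // k.π (h.π j) = d} => {i // g.π i = j.1}) (A := fun p => A p.2.1)
    (B := fun j => B j.1)
    (F.comp (α := fun c : {c // k.π c = d} => {j // h.π j = c.1}) (A := fun p => B p.2.1)
      (k.hom d) (fun c => h.hom c.1)) (fun j => g.hom j.1)
  have h3 := F.assoc (β := fun c : {c // k.π c = d} => {j // h.π j = c.1})
    (γ := fun _ j => {i // g.π i = j.1}) (A := fun p => A p.2.2.1) (B := fun p => B p.2.1)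
    (k.hom d) (fun c => h.hom c.1) (fun c j => g.hom j.1)
  refine (congrArg (F.map (fiberEquiv _ _ d) (A := fun i : {i // _} => A i.1))
      (h1.trans (congrArg _ h3.symm))).trans
    (Eq.trans ?_ (congrArg (F.map (fiberEquiv _ _ d) (A := fun i : {i // _} => A i.1)) h2).symm)
  erw [F.map_map, F.map_map, F.map_map]
  exact map_congr (Equiv.ext fun _ => rfl) HEq.rfl

lemma id_comp (g : F.Mor A B) : (Mor.id F A).comp g = g := by
  refine congrArg (Mor.mk _) (funext fun d => ?_)
  have h1 := F.comp_map (α := fun _ : {j // g.π j = d} => Unit)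
    (α' := fun j : {j // g.π j = d} => {i // i = j.1})
    (fun c => pointEquiv c.1) (A := fun p => A p.2.1) (g.hom d) (fun j => F.one (A j.1))
  dsimp only [comp, id]
  rw [h1]
  erw [F.map_map]
  refine Eq.trans ?_ (F.comp_one (g.hom d))
  exact map_congr (Equiv.ext fun _ => rfl) HEq.rfl

lemma comp_id (g : F.Mor A B) : g.comp (Mor.id F B) = g := by
  refine congrArg (Mor.mk _) (funext fun d => ?_)
  have h1 := F.map_comp (pointEquiv d) (α := fun j : {j // j = d} => {i // g.π i = j.1})
    (A := fun p => A p.2.1) (B := fun j => B j.1) (F.one (B d)) (fun j => g.hom j.1)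
  dsimp only [comp, id]
  rw [h1]
  erw [F.map_map]
  refine Eq.trans ?_ (F.one_comp (g.hom d))
  exact map_congr (by ext; rfl) HEq.rfl

/-- A generating morphism as a morphism to a word with one letter. -/
def single {v : F.V} (f : F.Hom A v) : F.Mor A (fun _ : Unit => v) where
  π := fun _ => ()
  hom _ := F.map (Equiv.subtypeUnivEquiv (fun _ => rfl)).symm (A := fun i => A i.1) f

lemma single_injective {v : F.V} : Function.Injective (single : F.Hom A v → _) := by
  intro f f' h
  exact map_injective _ (congrFun (eq_of_heq (Mor.mk.inj h).2) ())

lemma single_surjective {v : F.V} : Function.Surjective (single : F.Hom A v → _) := by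
  intro g
  obtain ⟨f, hf⟩ := map_surjective (Equiv.subtypeUnivEquiv (fun i => (rfl : g.π i = ()))).symm
    (A := fun i => A i.1) (g.hom ())
  refine ⟨f, ext_hom (fun _ => rfl) ?_⟩
  rintro ⟨⟩
  rw [← hf]
  erw [F.map_map]
  exact map_congr (Equiv.ext fun _ => rfl) HEq.rfl

/-- `single` is injective and turns `into` into composition; identities between generating morphisms
are therefore proved in the category of words. -/
lemma single_into (g : F.Mor A B) {v : F.V} (f : F.Hom B v) :
    single (g.into f) = g.comp (single f) := by
  refine congrArg (Mor.mk _) (funext fun d => ?_)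
  have h1 := F.map_comp (Equiv.subtypeUnivEquiv (fun _ => rfl : ∀ i : κ, () = d)).symm
    (α := fun j : {j : κ // () = d} => {i // g.π i = j.1}) (A := fun p => A p.2.1)
    (B := fun j => B j.1) f (fun j => g.hom j.1)
  dsimp only [comp, single, into]
  rw [h1]
  erw [F.map_map, F.map_map]
  exact map_congr (Equiv.ext fun _ => rfl) HEq.rfl

/-- The block `j` of a decomposition of `ι`, as a fibre. -/
def blockEquiv {α : κ → Type} (e : (Σ j, α j) ≃ ι) (j : κ) : α j ≃ {i // (e.symm i).1 = j} where
  toFun a := ⟨e ⟨j, a⟩, by simp⟩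
  invFun i := cast (congrArg α i.2) (e.symm i.1).2
  left_inv a := by
    have h : ∀ p : Σ j, α j, p = ⟨j, a⟩ → ∀ h, cast (congrArg α h : α p.1 = α j) p.2 = a := by
      rintro _ rfl _; rfl
    exact h _ (e.symm_apply_apply _) (congrArg Sigma.fst (e.symm_apply_apply ⟨j, a⟩))
  right_inv := by
    rintro ⟨i, rfl⟩
    simp

/-- The tensor product of generating morphisms. -/
def tens {α : κ → Type} [∀ j, Finite (α j)] (e : (Σ j, α j) ≃ ι)
    (g : ∀ j, F.Hom (fun a : α j => A (e ⟨j, a⟩)) (B j)) : F.Mor A B where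
  π i := (e.symm i).1
  hom j := F.map (blockEquiv e j) (A := fun i => A i.1) (g j)

lemma tens_into {α : κ → Type} [∀ j, Finite (α j)] (e : (Σ j, α j) ≃ ι)
    (g : ∀ j, F.Hom (fun a : α j => A (e ⟨j, a⟩)) (B j)) {v : F.V} (f : F.Hom B v) :
    (tens e g).into f = F.map e (A := A) (F.comp (A := fun p => A (e p)) f g) := by
  have h1 := F.comp_map (fun j => blockEquiv e j) (A := fun p => A p.2.1) f g
  dsimp only [into, tens]
  rw [h1]
  erw [F.map_map]
  exact map_congr (Equiv.ext fun _ => rfl) HEq.rfl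

lemma tens_injective {α : κ → Type} [∀ j, Finite (α j)] (e : (Σ j, α j) ≃ ι) :
    Function.Injective (tens e : (∀ j, F.Hom (fun a : α j => A (e ⟨j, a⟩)) (B j)) → _) := by
  intro g g' h
  funext j
  exact map_injective _ (congrFun (eq_of_heq (Mor.mk.inj h).2) j)

/-- Tensor products may be indexed by arbitrary blocks. The fibres form the canonical choice,
through which statements about `tens` apply to every morphism. -/
lemma tens_fiber (g : F.Mor A B) : tens (Equiv.sigmaFiberEquiv g.π) g.hom = g := by
  refine congrArg (Mor.mk _) (funext fun d => ?_)
  exact map_id' _ (by ext; rfl) _ _ HEq.rfl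

lemma single_map_comp {α : κ → Type} [∀ j, Finite (α j)] (e : (Σ j, α j) ≃ ι)
    (g : ∀ j, F.Hom (fun a : α j => A (e ⟨j, a⟩)) (B j)) {v : F.V} (f : F.Hom B v) :
    single (F.map e (A := A) (F.comp (A := fun p => A (e p)) f g)) = (tens e g).comp (single f) := by
  rw [← tens_into, single_into]

lemma single_post {v w : F.V} (f : F.Hom (fun _ : Unit => v) w) (g : F.Hom A v) :
    single (F.post f g) = (single g).comp (single f) := by
  refine (single_map_comp (unitSigmaEquiv ι) (fun _ => g) f).trans (congrArg (fun g => Mor.comp g (single f)) ?_)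
  refine ext_hom (fun _ => rfl) ?_
  rintro ⟨⟩
  dsimp only [single, tens]
  erw [F.map_map]
  exact map_congr (Equiv.ext fun _ => rfl) HEq.rfl

lemma single_one (v : F.V) : single (F.one v) = Mor.id F (fun _ : Unit => v) := by
  refine ext_hom (fun _ => rfl) ?_
  rintro ⟨⟩
  erw [F.map_map]
  exact map_congr (Equiv.ext fun _ => rfl) HEq.rfl

lemma single_pre {B : ι → F.V} {v : F.V} (f : F.Hom B v)
    (σ : ∀ i, F.Hom (fun _ : Unit => A i) (B i)) :
    single (F.pre f σ) = (tens (Equiv.sigmaPUnit ι) σ).comp (single f) :=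
  single_map_comp (Equiv.sigmaPUnit ι) σ f

end Mor
end Calculus
end FeynmanCategory

/-! ### Isomorphisms of families of vertices and their number. -/

namespace FeynmanCategory

variable {F : FeynmanCategory.{u}}

section Isomorphisms

variable {ι κ l m : Type} [Finite ι] [Finite κ] [Finite l] [Finite m]
  {A : ι → F.V} {B : κ → F.V} {C : l → F.V} {D : m → F.V}

lemma post_assoc {u v w : F.V} (f : F.Hom (fun _ : Unit => v) w) (g : F.Hom (fun _ : Unit => u) v)
    (h : F.Hom A u) : F.post (F.post f g) h = F.post f (F.post g h) :=
  Mor.single_injective (by simp only [Mor.single_post, Mor.comp_assoc])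

@[simp] lemma post_one {v w : F.V} (f : F.Hom (fun _ : Unit => v) w) : F.post f (F.one v) = f :=
  Mor.single_injective (by rw [Mor.single_post, Mor.single_one, Mor.id_comp])

@[simp] lemma one_post {v : F.V} (f : F.Hom A v) : F.post (F.one v) f = f := F.one_comp f

lemma post_map (e : ι ≃ κ) {v w : F.V} (f : F.Hom (fun _ : Unit => v) w)
    (g : F.Hom (fun i => B (e i)) v) :
    F.post f (F.map e (A := B) g) = F.map e (A := B) (F.post f g) := by
  have h1 := F.comp_map (α := fun _ : Unit => ι) (fun _ => e) (A := fun p => B p.2) f (fun _ => g)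
  refine (congrArg (F.map (unitSigmaEquiv κ) (A := B)) h1).trans ?_
  unfold post
  erw [F.map_map, F.map_map]
  exact map_congr (Equiv.ext fun _ => rfl) HEq.rfl

namespace VIso

@[ext] lemma ext' {v w : F.V} {a b : F.VIso v w} (h : a.hom = b.hom) : a = b := by
  have : a.inv = b.inv := by
    rw [← post_one a.inv, ← b.hom_inv, ← post_assoc, ← h, a.inv_hom, one_post]
  cases a; cases b; simp_all

variable (F) in
/-- The identity. -/
@[simps] def refl (v : F.V) : F.VIso v v := ⟨F.one v, F.one v, one_post _, one_post _⟩

/-- The inverse. -/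
@[simps] def symm {v w : F.V} (a : F.VIso v w) : F.VIso w v := ⟨a.inv, a.hom, a.hom_inv, a.inv_hom⟩

/-- `a` followed by `b`. -/
@[simps] def trans {u v w : F.V} (a : F.VIso u v) (b : F.VIso v w) : F.VIso u w where
  hom := F.post b.hom a.hom
  inv := F.post a.inv b.inv
  inv_hom := by
    rw [post_assoc, ← post_assoc b.inv b.hom a.hom, b.inv_hom, one_post, a.inv_hom]
  hom_inv := by
    rw [post_assoc, ← post_assoc a.hom a.inv b.inv, a.hom_inv, one_post, b.hom_inv]

lemma eq {v w : F.V} (a : F.VIso v w) : v = w := F.skeletal a.hom a.inv a.inv_hom a.hom_inv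

@[simp] lemma symm_trans_self {v w : F.V} (a : F.VIso v w) : a.symm.trans a = refl F w :=
  ext' a.hom_inv

@[simp] lemma self_trans_symm {v w : F.V} (a : F.VIso v w) : a.trans a.symm = refl F v :=
  ext' a.inv_hom

@[simp] lemma trans_refl {v w : F.V} (a : F.VIso v w) : a.trans (refl F w) = a :=
  ext' (one_post _)

@[simp] lemma refl_trans {v w : F.V} (a : F.VIso v w) : (refl F v).trans a = a :=
  ext' (post_one _)

lemma trans_assoc {u v w x : F.V} (a : F.VIso u v) (b : F.VIso v w) (c : F.VIso w x) :
    (a.trans b).trans c = a.trans (b.trans c) :=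
  ext' (post_assoc _ _ _).symm

instance finite (v w : F.V) : Finite (F.VIso v w) := by
  rcases isEmpty_or_nonempty (F.VIso v w) with h | ⟨⟨a⟩⟩
  · infer_instance
  obtain rfl := a.eq
  have := (F.finite_aut v).to_subtype
  exact Finite.of_injective (fun a : F.VIso v v => (⟨a.hom, a.inv, a.inv_hom, a.hom_inv⟩ :
    {f : F.Hom (fun _ : Unit => v) v | ∃ g : F.Hom (fun _ : Unit => v) v,
      F.map (unitSigmaEquiv Unit) (A := fun _ => v) (F.comp (α := fun _ => Unit) g (fun _ => f)) = F.one v ∧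
      F.map (unitSigmaEquiv Unit) (A := fun _ => v)
        (F.comp (α := fun _ => Unit) f (fun _ => g)) = F.one v}))
    (fun a b h => ext' (congrArg Subtype.val h))

noncomputable instance fintype (v w : F.V) : Fintype (F.VIso v w) := Fintype.ofFinite _

end VIso

lemma autCard_pos (v : F.V) : 0 < F.autCard v := by
  have : Nonempty (F.VIso v v) := ⟨VIso.refl F v⟩
  exact Nat.card_pos

/-- By skeletality the target of an isomorphism out of `v` is `v`. Counting over free targets suits
the sums over words below. -/
lemma card_vIso_out (v : F.V) : Nat.card (Σ w, F.VIso v w) = F.autCard v :=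
  Nat.card_congr
    { toFun := fun x => cast (congrArg (F.VIso v) x.2.eq.symm) x.2
      invFun := fun a => ⟨v, a⟩
      left_inv := by rintro ⟨w, a⟩; obtain rfl := a.eq; rfl
      right_inv := fun a => rfl }

namespace Mor

/-- The fibre of a composite over a point with only one preimage. -/
def fiberPoint (π : ι → κ) (ρ : κ → l) (c : l) (E : Unit ≃ {j // ρ j = c}) :
    {i // π i = (E ()).1} ≃ {i // ρ (π i) = c} :=
  Equiv.subtypeEquivRight fun i => by
    constructor
    · intro h; rw [h]; exact (E ()).2
    · intro h
      have : (⟨π i, h⟩ : {j // ρ j = c}) = E () := by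
        rw [← E.apply_symm_apply ⟨π i, h⟩]
      exact congrArg Subtype.val this

/-- Over a one point fibre, composition in the category of words reduces to `post`. This is how
composites with isomorphisms are computed. -/
lemma comp_hom_point (g : F.Mor A B) (h : F.Mor B C) (c : l) (E : Unit ≃ {j // h.π j = c})
    (s : F.Hom (fun x => B (E x).1) (C c)) (hs : F.map E (A := fun j => B j.1) s = h.hom c) :
    (g.comp h).hom c = F.map (fiberPoint g.π h.π c E) (A := fun i => A i.1)
      (F.post s (g.hom (E ()).1)) := by
  have h1 := F.map_comp E (α := fun j => {i // g.π i = j.1}) (A := fun p => A p.2.1)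
    (B := fun j => B j.1) s (fun j => g.hom j.1)
  rw [hs] at h1
  refine (congrArg (F.map (fiberEquiv g.π h.π c) (A := fun i => A i.1)) h1).trans ?_
  unfold post
  erw [F.map_map, F.map_map]
  exact map_congr (by exact Equiv.ext fun _ => rfl) HEq.rfl

lemma IsIso.id : (Mor.id F A).IsIso := ⟨Mor.id F A, id_comp _, id_comp _⟩

lemma IsIso.comp {g : F.Mor A B} {h : F.Mor B C} (hg : g.IsIso) (hh : h.IsIso) :
    (g.comp h).IsIso := by
  obtain ⟨g', h1, h2⟩ := hg
  obtain ⟨h', h3, h4⟩ := hh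
  refine ⟨h'.comp g', ?_, ?_⟩
  · rw [comp_assoc, ← comp_assoc h, h3, id_comp, h1]
  · rw [comp_assoc, ← comp_assoc g', h2, id_comp, h4]

/-- The inverse of an isomorphism. -/
noncomputable def IsIso.inv {g : F.Mor A B} (hg : g.IsIso) : F.Mor B A := hg.choose

@[simp] lemma IsIso.comp_inv {g : F.Mor A B} (hg : g.IsIso) : g.comp hg.inv = Mor.id F A :=
  hg.choose_spec.1

@[simp] lemma IsIso.inv_comp {g : F.Mor A B} (hg : g.IsIso) : hg.inv.comp g = Mor.id F B :=
  hg.choose_spec.2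

lemma IsIso.inv_isIso {g : F.Mor A B} (hg : g.IsIso) : hg.inv.IsIso :=
  ⟨g, hg.inv_comp, hg.comp_inv⟩

@[simp] lemma IsIso.comp_inv_assoc {g : F.Mor A B} (hg : g.IsIso) (h : F.Mor A C) :
    g.comp (hg.inv.comp h) = h := by rw [← comp_assoc, hg.comp_inv, id_comp]

@[simp] lemma IsIso.inv_comp_assoc {g : F.Mor A B} (hg : g.IsIso) (h : F.Mor B C) :
    hg.inv.comp (g.comp h) = h := by rw [← comp_assoc, hg.inv_comp, id_comp]

lemma IsIso.cancel_left {g : F.Mor A B} (hg : g.IsIso) {h h' : F.Mor B C}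
    (e : g.comp h = g.comp h') : h = h' := by
  rw [← hg.inv_comp_assoc h, e, hg.inv_comp_assoc]

lemma IsIso.cancel_right {g : F.Mor B C} (hg : g.IsIso) {h h' : F.Mor A B}
    (e : h.comp g = h'.comp g) : h = h' := by
  rw [← comp_id h, ← hg.comp_inv, ← comp_assoc, e, comp_assoc, hg.comp_inv, comp_id]

end Mor

/-- Isomorphisms of families of vertices. -/
structure FIso (A : ι → F.V) (B : κ → F.V) where
  e : κ ≃ ι
  σ : ∀ j, F.VIso (A (e j)) (B j)

namespace FIso

/-- The associated morphism. -/
def mor (a : FIso A B) : F.Mor A B :=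
  Mor.tens ((Equiv.sigmaPUnit κ).trans a.e) (fun j => (a.σ j).hom)

/-- The one point fibre of a bijection. -/
def point (e : κ ≃ ι) (j : κ) : Unit ≃ {i // e.symm i = j} where
  toFun _ := ⟨e j, by simp⟩
  invFun _ := ()
  left_inv _ := rfl
  right_inv := by rintro ⟨i, rfl⟩; simp

lemma mor_hom (a : FIso A B) (j : κ) :
    F.map (point a.e j) (A := fun i => A i.1) (a.σ j).hom = a.mor.hom j :=
  map_congr (Equiv.ext fun _ => rfl) HEq.rfl

/-- The fibre of a composite with a bijection. -/
def fiber (π : ι → κ) (e : l ≃ κ) (c : l) : {i // π i = e c} ≃ {i // e.symm (π i) = c} :=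
  Equiv.subtypeEquivRight fun i => by rw [Equiv.symm_apply_eq]

lemma comp_mor_hom (g : F.Mor A B) (a : FIso B C) (c : l) :
    (g.comp a.mor).hom c = F.map (fiber g.π a.e c) (A := fun i => A i.1)
      (F.post (a.σ c).hom (g.hom (a.e c))) :=
  (Mor.comp_hom_point g a.mor c (point a.e c) _ (mor_hom a c)).trans
    (map_congr (Equiv.ext fun _ => rfl) HEq.rfl)

lemma mor_injective : Function.Injective (mor : FIso A B → F.Mor A B) := by
  rintro ⟨e, σ⟩ ⟨e', σ'⟩ h
  have h1 : e = e' := by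
    have : e.symm = e'.symm := Equiv.ext fun i => congrFun (congrArg Mor.π h) i
    rw [← e.symm_symm, this, Equiv.symm_symm]
  subst h1
  congr 1
  funext j
  exact VIso.ext' (congrFun (Mor.tens_injective _ h) j)

/-- `a` followed by `b`. -/
def trans (a : FIso A B) (b : FIso B C) : FIso A C :=
  ⟨b.e.trans a.e, fun c => (a.σ (b.e c)).trans (b.σ c)⟩

lemma mor_trans (a : FIso A B) (b : FIso B C) : (a.trans b).mor = a.mor.comp b.mor := by
  refine Mor.ext_hom (fun _ => rfl) fun c => ?_
  rw [comp_mor_hom, ← mor_hom, ← mor_hom]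
  erw [post_map, F.map_map, F.map_map]
  exact map_congr (Equiv.ext fun _ => rfl) HEq.rfl

lemma mor_isIso (a : FIso A B) : a.mor.IsIso := by
  let E : ∀ j, Unit ≃ {j' // a.e j' = a.e j} := fun j =>
    { toFun := fun _ => ⟨j, rfl⟩
      invFun := fun _ => ()
      left_inv := fun _ => rfl
      right_inv := fun x => Subtype.ext (a.e.injective x.2).symm }
  -- The inverse has components indexed by the points `a.e j`; `piCongrLeft` moves a family indexed
  -- by `j` there without explicit casts.
  let H : ∀ i, F.Hom (fun j : {j // a.e j = i} => B j.1) (A i) :=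
    Equiv.piCongrLeft (fun i => F.Hom (fun j : {j // a.e j = i} => B j.1) (A i)) a.e
      (fun j => F.map (E j) (A := fun j => B j.1) (a.σ j).inv)
  have hH : ∀ j, F.map (E j) (A := fun j => B j.1) (a.σ j).inv = H (a.e j) := fun j =>
    (Equiv.piCongrLeft_apply_apply (fun i => F.Hom (fun j : {j // a.e j = i} => B j.1) (A i)) a.e
      (fun j => F.map (E j) (A := fun j => B j.1) (a.σ j).inv) j).symm
  let h : F.Mor B A := ⟨a.e, H⟩
  refine ⟨h, Mor.ext_hom (fun i => a.e.apply_symm_apply i) fun i => ?_,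
    Mor.ext_hom (fun j => a.e.symm_apply_apply j) fun j => ?_⟩
  · obtain ⟨j, rfl⟩ := a.e.surjective i
    rw [Mor.comp_hom_point a.mor h (a.e j) (E j) _ (hH j)]
    dsimp only [Mor.id]
    erw [← mor_hom, post_map, (a.σ j).inv_hom, F.map_map, F.map_map]
    exact map_congr (Equiv.ext fun _ => rfl) HEq.rfl
  · rw [comp_mor_hom]
    dsimp only [Mor.id]
    erw [show h.hom (a.e j) = _ from (hH j).symm, post_map, (a.σ j).hom_inv, F.map_map, F.map_map]
    exact map_congr (Equiv.ext fun _ => rfl) HEq.rfl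

/-- Mutually inverse morphisms have mutually inverse index maps. All fibres are then points, and the
components are mutually inverse morphisms between vertices. -/
lemma exists_mor_eq {g : F.Mor A B} (hg : g.IsIso) : ∃ a : FIso A B, a.mor = g := by
  obtain ⟨h, h1, h2⟩ := hg
  have hgh : ∀ i, h.π (g.π i) = i := fun i => congrFun (congrArg Mor.π h1) i
  have hhg : ∀ j, g.π (h.π j) = j := fun j => congrFun (congrArg Mor.π h2) j
  let e : κ ≃ ι := ⟨h.π, g.π, hhg, hgh⟩
  let E : ∀ j, Unit ≃ {j' // h.π j' = h.π j} := fun j =>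
    { toFun := fun _ => ⟨j, rfl⟩
      invFun := fun _ => ()
      left_inv := fun _ => rfl
      right_inv := fun x => Subtype.ext (e.injective x.2).symm }
  let E' : ∀ j, Unit ≃ {i // g.π i = j} := fun j =>
    { toFun := fun _ => ⟨h.π j, hhg j⟩
      invFun := fun _ => ()
      left_inv := fun _ => rfl
      right_inv := fun x => Subtype.ext ((congrArg h.π x.2).symm.trans (hgh _)) }
  choose s hs using fun j => map_surjective (E' j) (A := fun i => A i.1) (g.hom j)
  choose t ht using fun j => map_surjective (E j) (A := fun j => B j.1) (h.hom (h.π j))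
  have e1 : ∀ j, F.post (t j) (s j) = F.one (A (h.π j)) := by
    intro j
    have := Mor.hom_congr h1 (h.π j)
    rw [Mor.comp_hom_point g h (h.π j) (E j) _ (ht j)] at this
    dsimp only [Mor.id] at this
    erw [← hs j, post_map, F.map_map, F.map_map] at this
    refine map_injective ((E' j).trans (Mor.fiberPoint g.π h.π (h.π j) (E j)))
      (A := fun i => A i.1) (this.symm.trans ?_)
    refine map_congr (Equiv.ext fun _ => rfl) HEq.rfl
  have e2 : ∀ j, F.post (s j) (t j) = F.one (B j) := by
    intro j
    have := Mor.hom_congr h2 j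
    rw [Mor.comp_hom_point h g j (E' j) _ (hs j)] at this
    dsimp only [Mor.id] at this
    erw [← ht j, post_map, F.map_map, F.map_map] at this
    refine map_injective ((E j).trans (Mor.fiberPoint h.π g.π j (E' j)))
      (A := fun i => B i.1) (this.symm.trans ?_)
    refine map_congr (Equiv.ext fun _ => rfl) HEq.rfl
  refine ⟨⟨e, fun j => ⟨s j, t j, e1 j, e2 j⟩⟩, Mor.ext_hom (fun _ => rfl) fun j => ?_⟩
  rw [← mor_hom, ← hs j]
  erw [F.map_map]
  exact map_congr (Equiv.ext fun _ => rfl) HEq.rfl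

end FIso

/-- Isomorphisms out of a family, as morphisms. -/
noncomputable def isoEquiv : {g : F.Mor A B // g.IsIso} ≃ FIso A B where
  toFun g := (FIso.exists_mor_eq g.2).choose
  invFun a := ⟨a.mor, a.mor_isIso⟩
  left_inv g := Subtype.ext (FIso.exists_mor_eq g.2).choose_spec
  right_inv a := FIso.mor_injective (FIso.exists_mor_eq a.mor_isIso).choose_spec

/-- Isomorphisms from a family to words. -/
abbrev OutIso (A : ι → F.V) := Σ B : F.Word, {g : F.Mor A B.2 // g.IsIso}

/-- Isomorphisms from words to a family. -/
abbrev InIso (A : ι → F.V) := Σ B : F.Word, {g : F.Mor B.2 A // g.IsIso}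

lemma isIso_inv_inv {g : F.Mor A B} (hg : g.IsIso) : hg.inv_isIso.inv = g :=
  hg.inv_isIso.cancel_left (by rw [hg.inv_isIso.comp_inv, hg.inv_comp])

/-- Passage to the inverse. -/
noncomputable def inOutEquiv (A : ι → F.V) : InIso A ≃ OutIso A :=
  Equiv.sigmaCongrRight fun _ =>
    { toFun := fun g => ⟨g.2.inv, g.2.inv_isIso⟩
      invFun := fun g => ⟨g.2.inv, g.2.inv_isIso⟩
      left_inv := fun g => Subtype.ext (isIso_inv_inv g.2)
      right_inv := fun g => Subtype.ext (isIso_inv_inv g.2) }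

/-- The number of isomorphisms from a family to words. -/
noncomputable def isoCard {ι : Type} [Fintype ι] (A : ι → F.V) : ℕ :=
  (Fintype.card ι).factorial * ∏ i, F.autCard (A i)

lemma isoCard_pos {ι : Type} [Fintype ι] (A : ι → F.V) : 0 < isoCard A :=
  Nat.mul_pos (Nat.factorial_pos _) (Finset.prod_pos fun _ _ => autCard_pos _)

lemma isoCard_eq {ι κ : Type} [Fintype ι] [Fintype κ] {A : ι → F.V} {B : κ → F.V}
    {g : F.Mor A B} (hg : g.IsIso) : isoCard A = isoCard B := by
  obtain ⟨a, -⟩ := FIso.exists_mor_eq hg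
  unfold isoCard
  rw [← a.e.prod_comp, Fintype.card_congr a.e]
  congr 1
  exact Finset.prod_congr rfl fun j _ => by rw [(a.σ j).eq]

/-- Isomorphisms to words in terms of enumerations. -/
noncomputable def outIsoEquiv {ι : Type} [Fintype ι] (A : ι → F.V) :
    OutIso A ≃ Σ e : Fin (Fintype.card ι) ≃ ι, ∀ j, Σ w, F.VIso (A (e j)) w :=
  calc OutIso A ≃ Σ B : F.Word, FIso A B.2 := Equiv.sigmaCongrRight fun _ => isoEquiv
    _ ≃ Σ e : Fin (Fintype.card ι) ≃ ι, ∀ j, Σ w, F.VIso (A (e j)) w :=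
      { toFun := fun x =>
          have h : x.1.1 = Fintype.card ι := by rw [← Fintype.card_congr x.2.e]; simp
          ⟨(finCongr h.symm).trans x.2.e, fun j => ⟨x.1.2 (finCongr h.symm j), x.2.σ (finCongr h.symm j)⟩⟩
        invFun := fun y => ⟨⟨_, fun j => (y.2 j).1⟩, ⟨y.1, fun j => (y.2 j).2⟩⟩
        left_inv := by
          rintro ⟨⟨n, B⟩, ⟨e, σ⟩⟩
          obtain rfl : n = Fintype.card ι := by rw [← Fintype.card_congr e]; simp
          rfl
        right_inv := fun y => rfl }

instance finite_outIso {ι : Type} [Finite ι] (A : ι → F.V) : Finite (OutIso A) := by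
  have := Fintype.ofFinite ι
  have h : ∀ v : F.V, Finite (Σ w, F.VIso v w) := fun v =>
    Nat.finite_of_card_ne_zero (by rw [card_vIso_out]; exact (autCard_pos v).ne')
  exact Finite.of_equiv _ (outIsoEquiv A).symm

/-- An isomorphism to a word is an enumeration of the index set together with an isomorphism out of
each vertex. The resulting number is the denominator of the weights in the Feynman transform. -/
lemma card_outIso {ι : Type} [Fintype ι] (A : ι → F.V) : Nat.card (OutIso A) = isoCard A := by
  classical
  have h : ∀ v : F.V, Finite (Σ w, F.VIso v w) := fun v =>
    Nat.finite_of_card_ne_zero (by rw [card_vIso_out]; exact (autCard_pos v).ne')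
  rw [Nat.card_congr (outIsoEquiv A), Nat.card_sigma]
  have : ∀ e : Fin (Fintype.card ι) ≃ ι, Nat.card (∀ j, Σ w, F.VIso (A (e j)) w) =
      ∏ i, F.autCard (A i) := by
    intro e
    rw [Nat.card_pi, ← e.prod_comp]
    simp only [card_vIso_out]
  simp only [this, Finset.sum_const, smul_eq_mul, isoCard]
  congr 1
  rw [Finset.card_univ, Fintype.card_equiv (Fintype.equivFin ι).symm, Fintype.card_fin]

lemma card_inIso {ι : Type} [Fintype ι] (A : ι → F.V) : Nat.card (InIso A) = isoCard A := by
  rw [Nat.card_congr (inOutEquiv A), card_outIso]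

end Isomorphisms
end FeynmanCategory

/-! ### Koszul signs. -/

section Signs

lemma negOnePow_sum {ι : Type*} (s : Finset ι) (f : ι → ℤ) :
    (∑ i ∈ s, f i).negOnePow = ∏ i ∈ s, (f i).negOnePow := by
  classical
  induction s using Finset.induction_on with
  | empty => simp
  | insert a s ha ih => rw [Finset.sum_insert ha, Finset.prod_insert ha, Int.negOnePow_add, ih]

lemma negOnePow_congr {a b : ℤ} (h : Even (a - b)) : a.negOnePow = b.negOnePow :=
  (Int.negOnePow_eq_iff a b).2 h

lemma units_mul_self (a : ℤˣ) : a * a = 1 := Int.units_mul_self a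

variable {ι κ : Type} [LinearOrder ι] [Fintype κ] [LinearOrder κ]
    {α : κ → Type} [∀ j, Fintype (α j)] [∀ j, LinearOrder (α j)]

/-- The lexicographic order. -/
abbrev SigmaLT (p q : Σ j, α j) : Prop := Sigma.Lex (· < ·) (fun _ => (· < ·)) p q

lemma sigmaLT_trichotomy (p q : Σ j, α j) : SigmaLT p q ∨ p = q ∨ SigmaLT q p := by
  obtain ⟨j, a⟩ := p
  obtain ⟨j', b⟩ := q
  rcases lt_trichotomy j j' with h | rfl | h
  · exact Or.inl (Sigma.Lex.left _ _ h)
  · rcases lt_trichotomy a b with h | rfl | h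
    · exact Or.inl (Sigma.Lex.right _ _ h)
    · exact Or.inr (Or.inl rfl)
    · exact Or.inr (Or.inr (Sigma.Lex.right _ _ h))
  · exact Or.inr (Or.inr (Sigma.Lex.left _ _ h))

lemma sigmaLT_asymm {p q : Σ j, α j} (h : SigmaLT p q) (h' : SigmaLT q p) : False := by
  obtain ⟨j, a⟩ := p
  obtain ⟨j', b⟩ := q
  rcases h with ⟨_, _, h⟩ | ⟨_, _, h⟩
  · rcases h' with ⟨_, _, h'⟩ | ⟨_, _, h'⟩
    · exact lt_asymm h h'
    · exact lt_irrefl _ h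
  · rcases h' with ⟨_, _, h'⟩ | ⟨_, _, h'⟩
    · exact lt_irrefl _ h'
    · exact lt_asymm h h'

lemma koszulSign_eq_one {e : (Σ j, α j) ≃ ι} (h : ∀ p q, SigmaLT p q → e p < e q) (n : ι → ℤ) :
    koszulSign e n = 1 := by
  unfold koszulSign
  refine Finset.prod_eq_one fun p _ => Finset.prod_eq_one fun q _ => if_neg ?_
  rintro ⟨h1, h2⟩
  exact lt_asymm h2 (h p q h1)

/-- The main use is for degrees and their negatives: an operad and its dual give the same Koszul
sign. -/
lemma koszulSign_congr (e : (Σ j, α j) ≃ ι) {n n' : ι → ℤ} (h : ∀ i, (n i).negOnePow = (n' i).negOnePow) :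
    koszulSign e n = koszulSign e n' := by
  unfold koszulSign
  refine Finset.prod_congr rfl fun p _ => Finset.prod_congr rfl fun q _ => ?_
  split_ifs
  · have h1 := (Int.negOnePow_eq_iff _ _).1 (h (e p))
    have h2 := (Int.negOnePow_eq_iff _ _).1 (h (e q))
    apply negOnePow_congr
    have : n (e p) * n (e q) - n' (e p) * n' (e q) =
      (n (e p) - n' (e p)) * n (e q) + n' (e p) * (n (e q) - n' (e q)) := by ring
    rw [this]
    exact (h1.mul_right _).add (h2.mul_left _)
  · rfl

/-- The sum of the degrees of the factors that come before `p` in the lexicographic order. -/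
def lexSum (e : (Σ j, α j) ≃ ι) (n : ι → ℤ) (j : κ) (a : α j) : ℤ :=
  ∑ j' with j' < j, ∑ b, n (e ⟨j', b⟩) + ∑ b with b < a, n (e ⟨j, b⟩)

open scoped Classical in
lemma lexSum_eq (e : (Σ j, α j) ≃ ι) (n : ι → ℤ) (j : κ) (a : α j) :
    lexSum e n j a = ∑ q : Σ j, α j, if SigmaLT q ⟨j, a⟩ then n (e q) else 0 := by
  rw [Fintype.sum_sigma]
  have : ∀ j', ∑ b : α j', (if SigmaLT ⟨j', b⟩ ⟨j, a⟩ then n (e ⟨j', b⟩) else 0) =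
      (if j' < j then ∑ b, n (e ⟨j', b⟩) else 0) +
      (if j' = j then ∑ b with b < a, n (e ⟨j, b⟩) else 0) := by
    intro j'
    rcases lt_trichotomy j' j with h | rfl | h
    · rw [if_pos h, if_neg h.ne, add_zero]
      exact Finset.sum_congr rfl fun b _ => if_pos (Sigma.Lex.left _ _ h)
    · rw [if_neg (lt_irrefl _), if_pos rfl, zero_add, Finset.sum_filter]
      refine Finset.sum_congr rfl fun b _ => if_congr ?_ rfl rfl
      constructor
      · rintro (⟨_, _, h⟩ | ⟨_, _, h⟩)
        · exact absurd h (lt_irrefl _)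
        · exact h
      · exact fun h => Sigma.Lex.right _ _ h
    · rw [if_neg h.not_gt, if_neg h.ne', add_zero]
      refine Finset.sum_eq_zero fun b _ => if_neg ?_
      rintro (⟨_, _, h'⟩ | ⟨_, _, h'⟩)
      · exact lt_asymm h h'
      · exact lt_irrefl _ h
  simp only [this, Finset.sum_add_distrib, lexSum, Finset.sum_ite_eq', Finset.mem_univ, if_true,
    Finset.sum_filter]

/-- When one factor becomes odd relative to its old degree, the sign changes by the degrees of the
factors that it crosses. These precede it in exactly one of the two orders; factors preceding it in
both are counted twice and drop out. -/
lemma koszulSign_shift [Fintype ι] (e : (Σ j, α j) ≃ ι) (n n' : ι → ℤ) (j : κ) (a : α j)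
    (h0 : Odd (n' (e ⟨j, a⟩) - n (e ⟨j, a⟩))) (h1 : ∀ i, i ≠ e ⟨j, a⟩ → Even (n' i - n i)) :
    koszulSign e n' =
      koszulSign e n * (∑ i with i < e ⟨j, a⟩, n i + lexSum e n j a).negOnePow := by
  classical
  set p₀ : Σ j, α j := ⟨j, a⟩
  have key : koszulSign e n * koszulSign e n' =
      (∑ i with i < e ⟨j, a⟩, n i + lexSum e n j a).negOnePow := by
    have e1 : ∑ i with i < e p₀, n i = ∑ q : Σ j, α j, if e q < e p₀ then n (e q) else 0 := by
      rw [Finset.sum_filter, ← e.sum_comp]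
    have e0 : lexSum e n j a = ∑ q : Σ j, α j, if SigmaLT q p₀ then n (e q) else 0 :=
      lexSum_eq e n j a
    rw [e0, e1, ← Finset.sum_add_distrib, negOnePow_sum]
    unfold koszulSign
    rw [← Finset.prod_mul_distrib]
    simp only [← Finset.prod_mul_distrib]
    -- Pair by pair the two signs differ only if one member is `p₀`, and the discrepancy is then the
    -- parity of the degree of the other member.
    have e2 : ∀ p q : Σ j, α j, ((if SigmaLT p q ∧ e q < e p then (n (e p) * n (e q)).negOnePow else 1) *
        (if SigmaLT p q ∧ e q < e p then (n' (e p) * n' (e q)).negOnePow else 1) : ℤˣ) =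
        (if p = p₀ then (if SigmaLT p₀ q ∧ e q < e p₀ then (n (e q)).negOnePow else 1) else 1) *
        (if q = p₀ then (if SigmaLT p p₀ ∧ e p₀ < e p then (n (e p)).negOnePow else 1) else 1) := by
      intro p q
      by_cases hpq : SigmaLT p q ∧ e q < e p
      · rw [if_pos hpq, if_pos hpq, ← Int.negOnePow_add]
        by_cases hp : p = p₀
        · subst hp
          have hq : q ≠ p₀ := by rintro rfl; exact lt_irrefl _ hpq.2
          rw [if_pos rfl, if_pos hpq, if_neg hq, mul_one]
          apply negOnePow_congr
          obtain ⟨c, hc⟩ := h0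
          obtain ⟨c', hc'⟩ := h1 (e q) (fun h => hq (e.injective h))
          rw [show n' (e p₀) = n (e p₀) + (2 * c + 1) by rw [← hc]; ring,
            show n' (e q) = n (e q) + (c' + c') by rw [← hc']; ring]
          exact ⟨n (e p₀) * n (e q) + n (e p₀) * c' + c * (n (e q) + 2 * c') + c', by ring⟩
        · rw [if_neg hp, one_mul]
          obtain ⟨c', hc'⟩ := h1 (e p) (fun h => hp (e.injective h))
          by_cases hq : q = p₀
          · subst hq
            rw [if_pos rfl, if_pos hpq]
            apply negOnePow_congr
            obtain ⟨c, hc⟩ := h0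
            rw [show n' (e p₀) = n (e p₀) + (2 * c + 1) by rw [← hc]; ring,
              show n' (e p) = n (e p) + (c' + c') by rw [← hc']; ring]
            exact ⟨n (e p) * n (e p₀) + n (e p₀) * c' + c * (n (e p) + 2 * c') + c', by ring⟩
          · rw [if_neg hq]
            obtain ⟨c, hc⟩ := h1 (e q) (fun h => hq (e.injective h))
            refine Int.negOnePow_even _ ?_
            rw [show n' (e q) = n (e q) + (c + c) by rw [← hc]; ring,
              show n' (e p) = n (e p) + (c' + c') by rw [← hc']; ring]
            exact ⟨n (e p) * n (e q) + n (e p) * c + c' * n (e q) + 2 * c' * c, by ring⟩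
      · rw [if_neg hpq, if_neg hpq]
        have h2 : p = p₀ → ¬ (SigmaLT p₀ q ∧ e q < e p₀) := by rintro rfl; exact hpq
        have h3 : q = p₀ → ¬ (SigmaLT p p₀ ∧ e p₀ < e p) := by rintro rfl; exact hpq
        split_ifs <;> simp_all
    simp only [e2, Finset.prod_mul_distrib]
    rw [Finset.prod_comm (s := Finset.univ) (t := Finset.univ)
      (f := fun p q => if p = p₀ then (if SigmaLT p₀ q ∧ e q < e p₀ then (n (e q)).negOnePow else 1)
        else 1)]
    simp only [Finset.prod_ite_eq', Finset.mem_univ, if_true]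
    rw [← Finset.prod_mul_distrib]
    refine Finset.prod_congr rfl fun q _ => ?_
    rcases sigmaLT_trichotomy q p₀ with h | rfl | h
    · have h' : ¬ SigmaLT p₀ q := fun h' => sigmaLT_asymm h h'
      rcases lt_trichotomy (e q) (e p₀) with h2 | h2 | h2
      · simp [h, h', h2, h2.not_gt, Int.negOnePow_add]
      · obtain rfl := e.injective h2; exact absurd h h'
      · simp [h, h', h2, h2.not_gt]
    · have h' : ¬ SigmaLT p₀ p₀ := fun h' => sigmaLT_asymm h' h'
      simp [h']
    · have h' : ¬ SigmaLT q p₀ := fun h' => sigmaLT_asymm h h'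
      rcases lt_trichotomy (e q) (e p₀) with h2 | h2 | h2
      · simp [h, h', h2, h2.not_gt]
      · obtain rfl := e.injective h2; exact absurd h h'
      · simp [h, h', h2, h2.not_gt]
  rw [← key, ← mul_assoc, units_mul_self, one_mul]

lemma passSign_eq_one {κ : Type} [Fintype κ] [LinearOrder κ] {b : κ → ℤ} (hb : ∀ j, b j = 0)
    (m : κ → ℤ) : passSign b m = 1 := by
  unfold passSign
  exact Finset.prod_eq_one fun j _ => by rw [hb j, zero_mul, Int.negOnePow_zero]

/-- The Koszul sign of a rearrangement. -/
noncomputable def permSign (e : κ ≃ ι) (n : ι → ℤ) : ℤˣ :=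
  koszulSign ((Equiv.sigmaPUnit κ).trans e) n

lemma permSign_eq_one {e : κ ≃ ι} (h : ∀ i j, i < j → e i < e j) (n : ι → ℤ) :
    permSign e n = 1 := by
  refine koszulSign_eq_one ?_ n
  rintro ⟨i, a⟩ ⟨j, b⟩ (⟨_, _, h'⟩ | ⟨_, _, h'⟩)
  · exact h _ _ h'
  · exact absurd h' (lt_irrefl _)

lemma permSign_congr (e : κ ≃ ι) {n n' : ι → ℤ} (h : ∀ i, (n i).negOnePow = (n' i).negOnePow) :
    permSign e n = permSign e n' := koszulSign_congr _ h

end Signs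

/-! ### Structure maps under isomorphisms and renaming of the inputs. -/

section Basic

variable {k : Type u} [Field k] {F : FeynmanCategory.{u}} {C : F.Cubical} {s : Bool}

namespace PreOp

variable (P : PreOp k C s)

lemma castDeg_heq {v : F.V} {n m : ℤ} (h : n = m) (x : P.obj v n) : HEq (P.castDeg h x) x := by
  subst h; rfl

/-- Transport along an equality of degrees, as a linear map. -/
def castL {v : F.V} {n m : ℤ} (h : n = m) : P.obj v n →ₗ[k] P.obj v m where
  toFun := P.castDeg h
  map_add' x y := by subst h; rfl
  map_smul' c x := by subst h; rfl

lemma castL_heq {v : F.V} {n m : ℤ} (h : n = m) (x : P.obj v n) : HEq (P.castL h x) x :=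
  P.castDeg_heq h x

@[simp] lemma castL_rfl {v : F.V} {n : ℤ} (h : n = n) (x : P.obj v n) : P.castL h x = x := rfl

/-- Degrees occur in the types of elements; heterogeneous equality of inputs allows the degrees to
be replaced by equal expressions. -/
lemma act_heq {ι : Type} [Fintype ι] [LinearOrder ι] {A : ι → F.V} {v : F.V} {f f' : F.Hom A v}
    (h : f = f') {hf : C.deg f ≤ 1} {hf' : C.deg f' ≤ 1} {n n' : ι → ℤ} (hn : ∀ i, n i = n' i)
    {N N' : ℤ} (hNN : N = N') {hN} {hN'} {x : ∀ i, P.obj (A i) (n i)} {x' : ∀ i, P.obj (A i) (n' i)}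
    (hx : ∀ i, HEq (x i) (x' i)) : HEq (P.act f hf n N hN x) (P.act f' hf' n' N' hN' x') := by
  subst h hNN
  obtain rfl : n = n' := funext hn
  obtain rfl : x = x' := funext fun i => eq_of_heq (hx i)
  rfl

lemma act_eq {ι : Type} [Fintype ι] [LinearOrder ι] {A : ι → F.V} {v : F.V} {f f' : F.Hom A v}
    (h : f = f') {hf : C.deg f ≤ 1} {hf' : C.deg f' ≤ 1} {n n' : ι → ℤ} (hn : ∀ i, n i = n' i)
    {N : ℤ} {hN} {hN'} {x : ∀ i, P.obj (A i) (n i)} {x' : ∀ i, P.obj (A i) (n' i)}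
    (hx : ∀ i, HEq (x i) (x' i)) : P.act f hf n N hN x = P.act f' hf' n' N hN' x' :=
  eq_of_heq (P.act_heq h hn rfl hx)

lemma viso_apply {v w : F.V} (σ : F.VIso v w) (n : ℤ) (x : P.obj v n) :
    P.viso σ n x = P.act σ.hom (by rw [C.deg_viso]; exact zero_le_one) (fun _ => n) n
      (by rw [C.deg_viso]; simp) (fun _ => x) := rfl

end PreOp

namespace GrOp

variable (P : GrOp k C s)

/-- Renaming inputs along isomorphisms is composition with a tensor product of operations of degree
zero, so `act_comp` applies and only the Koszul sign of the permutation remains. -/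
lemma act_reindex {ι κ : Type} [Fintype ι] [LinearOrder ι] [Fintype κ] [LinearOrder κ] (e : κ ≃ ι)
    {A : ι → F.V} {B : κ → F.V} {v : F.V} (f : F.Hom B v) (σ : ∀ j, F.VIso (A (e j)) (B j))
    (f' : F.Hom A v) (hf' : f' = F.map ((Equiv.sigmaPUnit κ).trans e) (A := A)
      (F.comp (α := fun _ => Unit) (A := fun p => A (e p.1)) f (fun j => (σ j).hom)))
    (h : C.deg f ≤ 1) (h' : C.deg f' ≤ 1) (n : ι → ℤ) (N : ℤ) (hN) (hN')
    (x : ∀ i, P.obj (A i) (n i)) :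
    P.act f' h' n N hN' x =
      permSign e n • P.act f h (fun j => n (e j)) N hN (fun j => P.viso (σ j) _ (x (e j))) := by
  subst hf'
  obtain ⟨g, hg⟩ : ∃ g : ∀ j, F.Hom (fun a : Unit => A (((Equiv.sigmaPUnit κ).trans e) ⟨j, a⟩)) (B j),
    g = fun j => (σ j).hom := ⟨_, rfl⟩
  have hd : ∀ j, C.deg (g j) = 0 := by rw [hg]; exact fun j => C.deg_viso (σ j)
  have key := P.act_comp ((Equiv.sigmaPUnit κ).trans e) f h g
    (fun j => (hd j).le.trans zero_le_one) (by rw [hg]; exact h') n N (by rw [hg]; exact hN') (by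
      rw [hN, e.sum_comp n, Finset.sum_eq_zero fun j _ => hd j, add_zero]) x
  have hn : ∀ j, ∑ a, n (((Equiv.sigmaPUnit κ).trans e) ⟨j, a⟩) + s.toNat * (C.deg (g j) : ℤ) =
      n (e j) := by
    intro j
    rw [hd j]
    simp
  unfold PreOp.actComp at key
  rw [passSign_eq_one (by intro j; rw [hd j]; simp), mul_one] at key
  refine (P.act_eq (by rw [hg]; rfl) (fun _ => rfl) fun _ => HEq.rfl).trans (key.trans ?_)
  congr 1
  refine P.act_eq rfl hn fun j => ?_
  exact P.act_heq (congrFun hg j) (fun _ => rfl) (hn j) fun _ => HEq.rfl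

@[simp] lemma viso_refl (v : F.V) (n : ℤ) (x : P.obj v n) : P.viso (VIso.refl F v) n x = x :=
  P.act_one v n _ _ x

lemma act_map {ι κ : Type} [Fintype ι] [LinearOrder ι] [Fintype κ] [LinearOrder κ] (e : κ ≃ ι)
    {A : ι → F.V} {v : F.V} (f : F.Hom (fun j => A (e j)) v)
    (h : C.deg f ≤ 1) (h' : C.deg (F.map e (A := A) f) ≤ 1) (n : ι → ℤ) (N : ℤ) (hN) (hN')
    (x : ∀ i, P.obj (A i) (n i)) :
    P.act (F.map e (A := A) f) h' n N hN' x =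
      permSign e n • P.act f h (fun j => n (e j)) N hN (fun j => x (e j)) := by
  have h1 : F.map e (A := A) f = F.map ((Equiv.sigmaPUnit κ).trans e) (A := A)
      (F.comp (α := fun _ => Unit) (A := fun p => A (e p.1)) f (fun j => F.one (A (e j)))) := by
    exact (congrArg (F.map e (A := A)) (F.comp_one f).symm).trans
      (F.map_map (Equiv.sigmaPUnit κ) e (A := A) _)
  refine (P.act_reindex e f (fun j => VIso.refl F (A (e j))) _ h1 h h' n N hN hN' x).trans ?_
  simp only [viso_refl]

lemma act_map_mono {ι κ : Type} [Fintype ι] [LinearOrder ι] [Fintype κ] [LinearOrder κ] (e : κ ≃ ι)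
    (he : ∀ i j, i < j → e i < e j)
    {A : ι → F.V} {v : F.V} (f : F.Hom (fun j => A (e j)) v)
    (h : C.deg f ≤ 1) (h' : C.deg (F.map e (A := A) f) ≤ 1) (n : ι → ℤ) (N : ℤ) (hN) (hN')
    (x : ∀ i, P.obj (A i) (n i)) :
    P.act (F.map e (A := A) f) h' n N hN' x =
      P.act f h (fun j => n (e j)) N hN (fun j => x (e j)) := by
  rw [P.act_map e f h h' n N hN hN' x, permSign_eq_one he, one_smul]

lemma act_pre {ι : Type} [Fintype ι] [LinearOrder ι] {A B : ι → F.V} {v : F.V} (f : F.Hom B v)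
    (σ : ∀ i, F.VIso (A i) (B i)) (h : C.deg f ≤ 1)
    (h' : C.deg (F.pre f (fun i => (σ i).hom)) ≤ 1) (n : ι → ℤ) (N : ℤ) (hN) (hN')
    (x : ∀ i, P.obj (A i) (n i)) :
    P.act (F.pre f (fun i => (σ i).hom)) h' n N hN' x =
      P.act f h n N hN (fun i => P.viso (σ i) _ (x i)) := by
  refine (P.act_reindex (Equiv.refl ι) f σ _ rfl h h' n N hN hN' x).trans ?_
  rw [permSign_eq_one (fun _ _ h => h), one_smul]
  rfl

lemma act_post {ι : Type} [Fintype ι] [LinearOrder ι] {A : ι → F.V} {v w : F.V} (τ : F.VIso v w)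
    (f : F.Hom A v) (h : C.deg f ≤ 1) (h' : C.deg (F.post τ.hom f) ≤ 1) (n : ι → ℤ) (N : ℤ) (hN) (hN')
    (x : ∀ i, P.obj (A i) (n i)) :
    P.act (F.post τ.hom f) h' n N hN' x = P.viso τ N (P.act f h n N hN x) := by
  refine (P.act_comp (unitSigmaEquiv ι) τ.hom (by rw [C.deg_viso]; exact zero_le_one) (fun _ => f)
    (fun _ => h) h' n N hN' (by rw [hN, C.deg_viso, zero_add]; simp; exact Or.inl rfl) x).trans ?_
  unfold PreOp.actComp
  have h1 : koszulSign (α := fun _ : Unit => ι) (unitSigmaEquiv ι) n = 1 := by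
    refine koszulSign_eq_one ?_ n
    rintro ⟨i, a⟩ ⟨j, b⟩ (⟨_, _, h'⟩ | ⟨_, _, h'⟩)
    · exact absurd h' (lt_irrefl _)
    · exact h'
  have h2 : ∀ b m : Unit → ℤ, passSign b m = 1 := by
    intro b m
    simp [passSign]
  rw [h1, h2, one_mul, one_smul, PreOp.viso_apply]
  refine P.act_eq rfl (fun j => hN.symm) fun j => ?_
  exact P.act_heq rfl (fun _ => rfl) hN.symm fun _ => HEq.rfl

@[simp] lemma viso_trans {u v w : F.V} (σ : F.VIso u v) (τ : F.VIso v w) (n : ℤ) (x : P.obj u n) :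
    P.viso (σ.trans τ) n x = P.viso τ n (P.viso σ n x) := by
  rw [PreOp.viso_apply, PreOp.viso_apply _ σ]
  exact P.act_post τ σ.hom _ _ _ _ _ _ _

end GrOp

namespace GrOp.Hom

variable {P Q R : GrOp k C s}

lemma app_viso (a : GrOp.Hom P Q) {v w : F.V} (σ : F.VIso v w) (n : ℤ) (x : P.obj v n) :
    a.app w n (P.viso σ n x) = Q.viso σ n (a.app v n x) := by
  rw [PreOp.viso_apply, a.app_act]
  rfl

/-- Composition. -/
@[simps] protected def comp (a : GrOp.Hom P Q) (b : GrOp.Hom Q R) : GrOp.Hom P R where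
  app v n := (b.app v n).comp (a.app v n)
  app_act f hf n N hN x := by simp only [LinearMap.comp_apply, a.app_act, b.app_act]

lemma app_castL (a : GrOp.Hom P Q) {v : F.V} {n m : ℤ} (h : n = m) (x : P.obj v n) :
    a.app v m (P.castL h x) = Q.castL h (a.app v n x) := by
  subst h; rfl

end GrOp.Hom

end Basic

/-! ### Universal operads: terms modulo equality in all models. -/

section Presentation

variable {k : Type u} [Field k] {F : FeynmanCategory.{u}} {C : F.Cubical} {s : Bool}

variable (k C s) in
/-- Terms in the operations of differential graded operads. -/
inductive OpTerm (G : F.V → ℤ → Type u) : F.V → ℤ → Type u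
  | gen {v : F.V} {n : ℤ} (x : G v n) : OpTerm G v n
  | zero (v : F.V) (n : ℤ) : OpTerm G v n
  | add {v : F.V} {n : ℤ} (x y : OpTerm G v n) : OpTerm G v n
  | smul {v : F.V} {n : ℤ} (c : k) (x : OpTerm G v n) : OpTerm G v n
  | act {r : ℕ} {A : Fin r → F.V} {v : F.V} (f : F.Hom A v) (hf : C.deg f ≤ 1) (n : Fin r → ℤ)
      (N : ℤ) (hN : N = ∑ i, n i + s.toNat * (C.deg f : ℤ)) (x : ∀ i, OpTerm G (A i) (n i)) :
      OpTerm G v N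
  | d {v : F.V} {n m : ℤ} (h : m = n + 1) (x : OpTerm G v n) : OpTerm G v m

/-- The value of a term. -/
def OpTerm.eval {G : F.V → ℤ → Type u} (Q : DGOp k C s) (j : ∀ v n, G v n → Q.obj v n) :
    {v : F.V} → {n : ℤ} → OpTerm k C s G v n → Q.obj v n
  | _, _, .gen x => j _ _ x
  | _, _, .zero _ _ => 0
  | _, _, .add x y => x.eval Q j + y.eval Q j
  | _, _, .smul c x => c • x.eval Q j
  | _, _, .act f hf n N hN x => Q.act f hf n N hN (fun i => (x i).eval Q j)
  | _, _, .d h x => Q.d h (x.eval Q j)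

/-- A class of operads with a map from a family of generators. -/
abbrev ModelClass (k : Type u) [Field k] (C : F.Cubical) (s : Bool) (G : F.V → ℤ → Type u) :=
  (Q : DGOp k C s) → (∀ v n, G v n → Q.obj v n) → Prop

variable {G : F.V → ℤ → Type u} (K : ModelClass k C s G)

/-- Terms are identified if they have the same value in all models. -/
def ModelClass.setoid (v : F.V) (n : ℤ) : Setoid (OpTerm k C s G v n) where
  r x y := ∀ Q j, K Q j → x.eval Q j = y.eval Q j
  iseqv := ⟨fun _ _ _ _ => rfl, fun h Q j hK => (h Q j hK).symm,
    fun h h' Q j hK => (h Q j hK).trans (h' Q j hK)⟩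

/-- The components of the universal operad. -/
def ModelClass.Obj (v : F.V) (n : ℤ) : Type u := Quotient (K.setoid v n)

namespace ModelClass

/-- The models of a class. -/
structure Model where
  op : DGOp k C s
  val : ∀ v n, G v n → op.obj v n
  prop : K op val

/-- Evaluation in a model. -/
def ev (M : K.Model) {v : F.V} {n : ℤ} (x : K.Obj v n) : M.op.obj v n :=
  Quotient.lift (fun t : OpTerm k C s G v n => t.eval M.op M.val)
    (fun x y h => (show ∀ Q j, K Q j → x.eval Q j = y.eval Q j from h) M.op M.val M.prop) x

variable {K}

/-- The class of a term. -/
def mk {v : F.V} {n : ℤ} (x : OpTerm k C s G v n) : K.Obj v n := Quotient.mk _ x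

lemma exists_mk {v : F.V} {n : ℤ} (x : K.Obj v n) : ∃ t, mk t = x := Quotient.exists_rep x

lemma ev_mk (M : K.Model) {v : F.V} {n : ℤ} (t : OpTerm k C s G v n) :
    K.ev M (mk t) = t.eval M.op M.val := rfl

/-- Equality in the universal operad is joint equality in the models. Every law of operads is
inherited through this lemma, without a normal form for terms. -/
lemma ext_ev {v : F.V} {n : ℤ} {x y : K.Obj v n} (h : ∀ M : K.Model, K.ev M x = K.ev M y) :
    x = y := by
  obtain ⟨x, rfl⟩ := exists_mk x
  obtain ⟨y, rfl⟩ := exists_mk y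
  exact Quotient.sound fun Q j hK => h ⟨Q, j, hK⟩

lemma ev_injective {v : F.V} {n : ℤ} :
    Function.Injective (fun (x : K.Obj v n) (M : K.Model) => K.ev M x) :=
  fun _ _ h => ext_ev fun M => congrFun h M

/-- A term representing an element. -/
noncomputable def rep {v : F.V} {n : ℤ} (x : K.Obj v n) : OpTerm k C s G v n := (exists_mk x).choose

lemma eval_rep (M : K.Model) {v : F.V} {n : ℤ} (x : K.Obj v n) :
    (rep x).eval M.op M.val = K.ev M x := by
  conv_rhs => rw [← (exists_mk x).choose_spec]
  rfl

variable {v : F.V} {n : ℤ}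

noncomputable instance : Zero (K.Obj v n) := ⟨mk (.zero v n)⟩
noncomputable instance : Add (K.Obj v n) := ⟨fun x y => mk (.add (rep x) (rep y))⟩
noncomputable instance : SMul k (K.Obj v n) := ⟨fun c x => mk (.smul c (rep x))⟩
noncomputable instance : Neg (K.Obj v n) := ⟨fun x => (-1 : k) • x⟩
noncomputable instance : Sub (K.Obj v n) := ⟨fun x y => x + -y⟩
noncomputable instance : SMul ℕ (K.Obj v n) := ⟨fun c x => (c : k) • x⟩
noncomputable instance : SMul ℤ (K.Obj v n) := ⟨fun c x => (c : k) • x⟩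

lemma ev_zero (M : K.Model) : K.ev M (0 : K.Obj v n) = 0 := rfl

lemma ev_add (M : K.Model) (x y : K.Obj v n) : K.ev M (x + y) = K.ev M x + K.ev M y := by
  rw [← eval_rep M x, ← eval_rep M y]; rfl

lemma ev_smul (M : K.Model) (c : k) (x : K.Obj v n) : K.ev M (c • x) = c • K.ev M x := by
  rw [← eval_rep M x]; rfl

lemma ev_neg (M : K.Model) (x : K.Obj v n) : K.ev M (-x) = -K.ev M x := by
  refine (ev_smul M (-1) x).trans ?_; simp

lemma ev_sub (M : K.Model) (x y : K.Obj v n) : K.ev M (x - y) = K.ev M x - K.ev M y := by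
  refine (ev_add M x (-y)).trans ?_; rw [ev_neg, sub_eq_add_neg]

lemma ev_nsmul (M : K.Model) (c : ℕ) (x : K.Obj v n) : K.ev M (c • x) = c • K.ev M x :=
  (ev_smul M (c : k) x).trans (Nat.cast_smul_eq_nsmul k c _)

lemma ev_zsmul (M : K.Model) (c : ℤ) (x : K.Obj v n) : K.ev M (c • x) = c • K.ev M x :=
  (ev_smul M (c : k) x).trans (Int.cast_smul_eq_zsmul k c _)

noncomputable instance : AddCommGroup (K.Obj v n) :=
  ev_injective.addCommGroup (fun (x : K.Obj v n) (M : K.Model) => K.ev M x) rfl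
    (fun x y => funext fun M => ev_add M x y) (fun x => funext fun M => ev_neg M x)
    (fun x y => funext fun M => ev_sub M x y) (fun x c => funext fun M => ev_nsmul M c x)
    (fun x c => funext fun M => ev_zsmul M c x)

noncomputable instance : Module k (K.Obj v n) where
  one_smul x := ext_ev fun M => by rw [ev_smul, one_smul]
  mul_smul a b x := ext_ev fun M => by simp only [ev_smul, mul_smul]
  smul_zero a := ext_ev fun M => by rw [ev_smul, ev_zero, smul_zero]
  smul_add a x y := ext_ev fun M => by simp only [ev_smul, ev_add, smul_add]
  add_smul a b x := ext_ev fun M => by simp only [ev_smul, ev_add, add_smul]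
  zero_smul x := ext_ev fun M => by rw [ev_smul, ev_zero, zero_smul]

/-- Evaluation as a linear map. -/
def evL (M : K.Model) (v : F.V) (n : ℤ) : K.Obj v n →ₗ[k] M.op.obj v n where
  toFun := K.ev M
  map_add' := ev_add M
  map_smul' := ev_smul M

/-- The enumeration of a finite linear order. -/
noncomputable def enum (ι : Type) [Fintype ι] [LinearOrder ι] : Fin (Fintype.card ι) ≃ ι :=
  (Fintype.orderIsoFinOfCardEq ι rfl).toEquiv

lemma enum_lt (ι : Type) [Fintype ι] [LinearOrder ι] (i j : Fin (Fintype.card ι)) (h : i < j) :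
    enum ι i < enum ι j :=
  (Fintype.orderIsoFinOfCardEq ι rfl).lt_iff_lt.2 h

/-- A generating morphism with its source enumerated. -/
noncomputable def enumHom {ι : Type} [Fintype ι] [LinearOrder ι] {A : ι → F.V} {v : F.V}
    (f : F.Hom A v) : F.Hom (fun i => A (enum ι i)) v :=
  (map_surjective (enum ι) (A := A) f).choose

lemma map_enumHom {ι : Type} [Fintype ι] [LinearOrder ι] {A : ι → F.V} {v : F.V} (f : F.Hom A v) :
    F.map (enum ι) (A := A) (enumHom f) = f :=
  (map_surjective (enum ι) (A := A) f).choose_spec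

lemma deg_enumHom {ι : Type} [Fintype ι] [LinearOrder ι] {A : ι → F.V} {v : F.V} (f : F.Hom A v) :
    C.deg (enumHom f) = C.deg f := by
  rw [← C.deg_map (enum ι), map_enumHom]

/-- The structure maps of the universal operad, as functions. -/
noncomputable def actFun {ι : Type} [Fintype ι] [LinearOrder ι] {A : ι → F.V} {v : F.V}
    (f : F.Hom A v) (hf : C.deg f ≤ 1) (n : ι → ℤ) (N : ℤ)
    (hN : N = ∑ i, n i + s.toNat * (C.deg f : ℤ)) (x : ∀ i, K.Obj (A i) (n i)) : K.Obj v N :=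
  -- Terms use only the index sets `Fin r`, which keeps them in `Type u`. A general source is
  -- enumerated in increasing order, so no sign arises.
  mk (.act (enumHom f) (by rwa [deg_enumHom]) (fun i => n (enum ι i)) N
    (by rw [deg_enumHom, hN, (enum ι).sum_comp n]) (fun i => rep (x (enum ι i))))

lemma ev_actFun (M : K.Model) {ι : Type} [Fintype ι] [LinearOrder ι] {A : ι → F.V} {v : F.V}
    (f : F.Hom A v) (hf : C.deg f ≤ 1) (n : ι → ℤ) (N : ℤ)
    (hN : N = ∑ i, n i + s.toNat * (C.deg f : ℤ)) (x : ∀ i, K.Obj (A i) (n i)) :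
    K.ev M (actFun f hf n N hN x) = M.op.act f hf n N hN (fun i => K.ev M (x i)) := by
  have h1 : M.op.act f hf n N hN (fun i => K.ev M (x i)) =
      M.op.act (F.map (enum ι) (A := A) (enumHom f)) (by rwa [map_enumHom]) n N
        (by rwa [map_enumHom]) (fun i => K.ev M (x i)) :=
    M.op.act_eq (map_enumHom f).symm (fun _ => rfl) fun _ => HEq.rfl
  rw [h1, GrOp.act_map_mono M.op.toGrOp (enum ι) (enum_lt ι) (enumHom f) (by rwa [deg_enumHom]) _ n N
    (by rw [deg_enumHom, hN, (enum ι).sum_comp n])]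
  refine (ev_mk M _).trans ?_
  simp only [OpTerm.eval, eval_rep]

variable (K) in
/-- The universal operad, without its laws. -/
noncomputable def preOp : PreOp k C s where
  obj := K.Obj
  act f hf n N hN :=
    { toFun := actFun f hf n N hN
      map_update_add' := fun x i a b => ext_ev fun M => by
        have h : ∀ y : K.Obj _ _, (fun j => K.ev M (Function.update x i y j)) =
            Function.update (fun j => K.ev M (x j)) i (K.ev M y) := by
          intro y; funext j
          exact Function.apply_update (fun j => K.ev M (v := _) (n := _)) x i y j
        simp only [ev_add, ev_actFun, h, MultilinearMap.map_update_add]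
      map_update_smul' := fun x i c a => ext_ev fun M => by
        have h : ∀ y : K.Obj _ _, (fun j => K.ev M (Function.update x i y j)) =
            Function.update (fun j => K.ev M (x j)) i (K.ev M y) := by
          intro y; funext j
          exact Function.apply_update (fun j => K.ev M (v := _) (n := _)) x i y j
        simp only [ev_smul, ev_actFun, h, MultilinearMap.map_update_smul] }

/-- Evaluation in terms of `preOp`. -/
noncomputable def evP (M : K.Model) {v : F.V} {n : ℤ} : K.preOp.obj v n →ₗ[k] M.op.obj v n := evL M v n

lemma ext_evP {v : F.V} {n : ℤ} {x y : K.preOp.obj v n} (h : ∀ M : K.Model, evP M x = evP M y) :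
    x = y := ext_ev h

lemma evP_act (M : K.Model) {ι : Type} [Fintype ι] [LinearOrder ι] {A : ι → F.V} {v : F.V}
    (f : F.Hom A v) (hf : C.deg f ≤ 1) (n : ι → ℤ) (N : ℤ) (hN) (x : ∀ i, K.preOp.obj (A i) (n i)) :
    evP M (K.preOp.act f hf n N hN x) = M.op.act f hf n N hN (fun i => evP M (x i)) :=
  ev_actFun M f hf n N hN x

lemma evP_units_smul (M : K.Model) {v : F.V} {n : ℤ} (c : ℤˣ) (x : K.preOp.obj v n) :
    evP M (c • x) = c • evP M x := by
  rw [Units.smul_def, Units.smul_def, map_zsmul]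

lemma evP_actComp (M : K.Model) {ι κ : Type} [Fintype ι] [LinearOrder ι] [Fintype κ]
    [LinearOrder κ] {α : κ → Type} [∀ j, Fintype (α j)] [∀ j, LinearOrder (α j)]
    (e : (Σ j, α j) ≃ ι) {A : ι → F.V} {B : κ → F.V} {v : F.V}
    (f : F.Hom B v) (hf : C.deg f ≤ 1)
    (g : ∀ j, F.Hom (fun a : α j => A (e ⟨j, a⟩)) (B j)) (hg : ∀ j, C.deg (g j) ≤ 1)
    (n : ι → ℤ) (N : ℤ) (hN) (x : ∀ i, K.preOp.obj (A i) (n i)) :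
    evP M (K.preOp.actComp e f hf g hg n N hN x) =
      M.op.actComp e f hf g hg n N hN (fun i => evP M (x i)) := by
  unfold PreOp.actComp
  rw [evP_units_smul, evP_act]
  simp only [evP_act]

/-- The differential of the universal operad. -/
noncomputable def dL {v : F.V} {n m : ℤ} (h : m = n + 1) : K.Obj v n →ₗ[k] K.Obj v m where
  toFun x := mk (.d h (rep x))
  map_add' x y := ext_ev fun M => by
    simp only [ev_add, ev_mk, OpTerm.eval, eval_rep, map_add]
  map_smul' c x := ext_ev fun M => by
    simp only [ev_smul, ev_mk, OpTerm.eval, eval_rep, map_smul, RingHom.id_apply]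

lemma ev_d (M : K.Model) {v : F.V} {n m : ℤ} (h : m = n + 1) (x : K.Obj v n) :
    K.ev M (dL h x) = M.op.d h (K.ev M x) := by
  rw [← eval_rep M x]; rfl

/-- The differential of the universal operad in terms of `preOp`. -/
noncomputable def dP {v : F.V} {n m : ℤ} (h : m = n + 1) : K.preOp.obj v n →ₗ[k] K.preOp.obj v m := dL h

lemma evP_d (M : K.Model) {v : F.V} {n m : ℤ} (h : m = n + 1) (x : K.preOp.obj v n) :
    evP M (dP h x) = M.op.d h (evP M x) := ev_d M h x

lemma evP_castDeg (M : K.Model) {v : F.V} {n m : ℤ} (h : n = m) (x : K.preOp.obj v n) :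
    evP M (K.preOp.castDeg h x) = M.op.castDeg h (evP M x) := by
  subst h; rfl

lemma evP_applyAt (M : K.Model) {ι : Type} [DecidableEq ι] {A : ι → F.V} {n : ι → ℤ}
    (x : ∀ i, K.preOp.obj (A i) (n i)) (i j : ι) :
    evP M (K.preOp.applyAt (fun h => dP h) x i j) =
      M.op.applyAt (fun h => M.op.d h) (fun i => evP M (x i)) i j := by
  unfold PreOp.applyAt
  by_cases h : j = i
  · rw [dif_pos h, dif_pos h]; exact evP_d M _ _
  · rw [dif_neg h, dif_neg h]; exact evP_castDeg M _ _

variable (K) in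
/-- The universal operad of a class of models. -/
noncomputable def op : DGOp k C s where
  toPreOp := K.preOp
  act_one v n h hn x := ext_evP fun M => by
    rw [evP_act]; exact M.op.act_one v n h hn _
  act_comp e A B v f hf g hg h n N hN hN' x := ext_evP fun M => by
    rw [evP_act, evP_actComp]; exact M.op.act_comp e f hf g hg h n N hN hN' _
  act_swap g f g' f' hg hf hg' hf' h hne h1 h2 h1' h2' n N hN hN' x := ext_evP fun M => by
    rw [evP_units_smul]
    exact (evP_actComp M (Equiv.sigmaFiberEquiv g'.π) f' h1' g'.hom h2' n N hN' x).trans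
      ((M.op.act_swap g f g' f' hg hf hg' hf' h hne h1 h2 h1' h2' n N hN hN' _).trans
      (congrArg _ (evP_actComp M (Equiv.sigmaFiberEquiv g.π) f h1 g.hom h2 n N hN x).symm))
  d h := dP h
  d_d h h' x := ext_evP fun M => by
    rw [evP_d, evP_d, M.op.d_d, map_zero]
  d_act f hf n N M' hN hM x := ext_evP fun M => by
    rw [evP_d, evP_act, M.op.d_act f hf n N M' hN hM, map_sum]
    refine Finset.sum_congr rfl fun i _ => ?_
    rw [evP_units_smul, evP_act]
    congr 2
    funext j
    exact (evP_applyAt M x i j).symm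

variable (K) in
/-- The generators of the universal operad. -/
def gen {v : F.V} {n : ℤ} (x : G v n) : K.op.obj v n := mk (.gen x)

/-- The morphism to a model. -/
noncomputable def lift (Q : DGOp k C s) (j : ∀ v n, G v n → Q.obj v n) (h : K Q j) : K.op ⟶ Q :=
  { app := fun v n => evP ⟨Q, j, h⟩
    app_act := fun f hf n N hN x => evP_act ⟨Q, j, h⟩ f hf n N hN x
    app_d := fun h' x => evP_d ⟨Q, j, h⟩ h' x }

lemma lift_gen (Q : DGOp k C s) (j : ∀ v n, G v n → Q.obj v n) (h : K Q j) {v : F.V} {n : ℤ}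
    (x : G v n) : (lift Q j h).app v n (K.gen x) = j v n x := rfl

lemma ext_lift {v : F.V} {n : ℤ} {x y : K.op.obj v n}
    (h : ∀ Q j (hK : K Q j), (lift Q j hK).app v n x = (lift Q j hK).app v n y) : x = y :=
  ext_ev fun M => h M.op M.val M.prop

lemma induction {p : ∀ v n, K.op.obj v n → Prop} (hgen : ∀ {v n} (x : G v n), p v n (K.gen x))
    (hzero : ∀ v n, p v n 0) (hadd : ∀ {v n} (x y), p v n x → p v n y → p v n (x + y))
    (hsmul : ∀ {v n} (c : k) (x), p v n x → p v n (c • x))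
    (hact : ∀ {r : ℕ} {A : Fin r → F.V} {v : F.V} (f : F.Hom A v) (hf : C.deg f ≤ 1) (n : Fin r → ℤ)
      (N : ℤ) (hN) (x : ∀ i, K.op.obj (A i) (n i)), (∀ i, p _ _ (x i)) → p v N (K.op.act f hf n N hN x))
    (hd : ∀ {v n m} (h : m = n + 1) (x), p v n x → p v m (K.op.d h x)) {v : F.V} {n : ℤ}
    (x : K.op.obj v n) : p v n x := by
  obtain ⟨t, rfl⟩ := exists_mk x
  induction t with
  | gen x => exact hgen x
  | zero v n => exact hzero v n
  | add x y hx hy =>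
    have : mk (x.add y) = (mk x + mk y : K.op.obj _ _) := ext_ev fun M => by
      refine Eq.trans ?_ (ev_add M _ _).symm; rfl
    rw [this]; exact hadd _ _ hx hy
  | smul c x hx =>
    have : mk (x.smul c) = (c • mk x : K.op.obj _ _) := ext_ev fun M => by
      refine Eq.trans ?_ (ev_smul M _ _).symm; rfl
    rw [this]; exact hsmul _ _ hx
  | act f hf n N hN x hx =>
    have : mk (.act f hf n N hN x) = K.op.act f hf n N hN (fun i => mk (x i)) := ext_ev fun M => by
      exact (evP_act M f hf n N hN (fun i => mk (x i))).symm
    rw [this]; exact hact _ _ _ _ _ _ hx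
  | d h x hx =>
    have : mk (.d h x) = K.op.d h (mk x) := ext_ev fun M => by
      refine Eq.trans ?_ (ev_d M _ _).symm; rfl
    rw [this]; exact hd _ _ hx

lemma hom_ext {Q : DGOp k C s} {a b : K.op ⟶ Q}
    (h : ∀ v n (x : G v n), a.app v n (K.gen x) = b.app v n (K.gen x)) : a = b := by
  refine DGOp.Hom.ext (funext fun v => funext fun n => LinearMap.ext fun x => ?_)
  induction x using induction with
  | hgen x => exact h _ _ x
  | hzero v n => rw [map_zero, map_zero]
  | hadd x y hx hy => rw [map_add, map_add, hx, hy]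
  | hsmul c x hx => rw [map_smul, map_smul, hx]
  | hact f hf n N hN x hx => rw [a.app_act, b.app_act, funext hx]
  | hd h x hx => rw [a.app_d, b.app_d, hx]

end ModelClass

end Presentation

/-! ### The push-forward, left adjoint to restriction. -/

section LeftAdjoint

variable {k : Type u} [Field k] {F₁ F₂ : FeynmanCategory.{u}} {C₁ : F₁.Cubical} {C₂ : F₂.Cubical}
  {φ : CubicalMorphism C₁ C₂} {s : Bool}

/-- The elements of an operad as generators of its push-forward. -/
inductive PushGen (φ : CubicalMorphism C₁ C₂) (P : DGOp k C₁ s) : F₂.V → ℤ → Type u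
  | mk {w : F₁.V} {n : ℤ} (p : P.obj w n) : PushGen φ P (φ.obj w) n

/-- The operads under a push-forward. -/
def pushClass (hφ : φ.Admissible) (P : DGOp k C₁ s) : ModelClass k C₂ s (PushGen φ P) := fun Q j =>
  ∃ a : P ⟶ (restriction k hφ s).obj Q, ∀ w n (p : P.obj w n), j _ _ (.mk p) = a.app w n p

/-- The universal morphism to the push-forward. -/
noncomputable def pushUnit (hφ : φ.Admissible) (P : DGOp k C₁ s) :
    P ⟶ (restriction k hφ s).obj (pushClass hφ P).op :=
  { app := fun w n =>
      { toFun := fun p => (pushClass hφ P).gen (.mk p)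
        map_add' := fun x y => ModelClass.ext_lift fun Q j ⟨a, ha⟩ => by
          refine Eq.trans ?_ (map_add ((ModelClass.lift Q j ⟨a, ha⟩).app (φ.obj w) n) _ _).symm
          exact (ha w n (x + y)).trans ((map_add (a.app w n) x y).trans
            (congrArg₂ (· + ·) (ha w n x).symm (ha w n y).symm))
        map_smul' := fun c x => ModelClass.ext_lift fun Q j ⟨a, ha⟩ => by
          refine Eq.trans ?_ (map_smul ((ModelClass.lift Q j ⟨a, ha⟩).app (φ.obj w) n) _ _).symm
          exact (ha w n (c • x)).trans ((map_smul (a.app w n) c x).trans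
            (congrArg (c • ·) (ha w n x).symm)) }
    app_act := fun f hf n N hN x => ModelClass.ext_lift fun Q j ⟨a, ha⟩ => by
      refine (ModelClass.lift_gen Q j ⟨a, ha⟩ _).trans ((ha _ _ _).trans
        ((a.app_act f hf n N hN x).trans ?_))
      refine Eq.trans ?_ ((ModelClass.lift Q j ⟨a, ha⟩).app_act (φ.map f) _ n N _ _).symm
      refine congrArg _ (funext fun i => ?_)
      exact (ha _ _ _).symm
    app_d := fun h x => ModelClass.ext_lift fun Q j ⟨a, ha⟩ => by
      refine (ModelClass.lift_gen Q j ⟨a, ha⟩ _).trans ((ha _ _ _).trans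
        ((a.app_d h x).trans ?_))
      refine Eq.trans ?_ ((ModelClass.lift Q j ⟨a, ha⟩).app_d h _).symm
      exact congrArg _ (ha _ _ _).symm }

/-- The universal property of the push-forward. -/
noncomputable def pushEquiv (hφ : φ.Admissible) (P : DGOp k C₁ s) (Q : DGOp k C₂ s) :
    ((pushClass hφ P).op ⟶ Q) ≃ (P ⟶ (restriction k hφ s).obj Q) where
  toFun b := pushUnit hφ P ≫ (restriction k hφ s).map b
  invFun a := ModelClass.lift Q (fun v n x => match v, n, x with | _, _, .mk p => a.app _ _ p)
    ⟨a, fun _ _ _ => rfl⟩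
  left_inv b := ModelClass.hom_ext fun v n x => by
    obtain ⟨p⟩ := x
    rfl
  right_inv a := rfl

/-- The universal operad under `P` is itself a model, by `pushUnit`, and so corepresents the
morphisms from `P` to restrictions. -/
theorem restriction_isRightAdjoint (hφ : φ.Admissible) : (restriction k hφ s).IsRightAdjoint :=
  (Adjunction.adjunctionOfEquivLeft (pushEquiv hφ) (fun _ _ _ _ _ => rfl)).isRightAdjoint

end LeftAdjoint

/-! ### Jets: a differential graded operad attached to a graded operad. -/

section Jets

/-- Exactly the operations with a later index than `j` have to pass the factor whose degree has gone
up by one. -/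
lemma passSign_shift {κ : Type} [Fintype κ] [LinearOrder κ] (b m m' : κ → ℤ) (j : κ)
    (h0 : m' j = m j + 1) (h1 : ∀ j', j' ≠ j → m' j' = m j') :
    passSign b m' = passSign b m * (∑ j' with j < j', b j').negOnePow := by
  unfold passSign
  rw [negOnePow_sum, Finset.prod_filter, ← Finset.prod_mul_distrib]
  refine Finset.prod_congr rfl fun i _ => ?_
  have : ∑ j' with j' < i, m' j' = ∑ j' with j' < i, m j' + if j < i then 1 else 0 := by
    have : ∀ j', m' j' = m j' + if j' = j then 1 else 0 := by
      intro j'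
      split_ifs with h
      · rw [h, h0]
      · rw [h1 j' h, add_zero]
    simp only [this, Finset.sum_add_distrib, Finset.sum_ite_eq', Finset.mem_filter, Finset.mem_univ,
      true_and]
  rw [this]
  split_ifs
  · rw [mul_add, mul_one, Int.negOnePow_add]
  · rw [add_zero, mul_one]

variable {k : Type u} [Field k] {F : FeynmanCategory.{u}} {C : F.Cubical} {s : Bool}

/-- The degrees `n`, with that of `i` increased by one. -/
abbrev shiftAt {ι : Type} [DecidableEq ι] (i : ι) (n : ι → ℤ) : ι → ℤ :=
  fun j => if j = i then n j + 1 else n j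

namespace GrOp

variable (Q : GrOp k C s)

/-- The linear maps which take the second component in the place `i` and the first one elsewhere. -/
def mixL {ι : Type} [DecidableEq ι] {A : ι → F.V} (n : ι → ℤ) (i j : ι) :
    (Q.obj (A j) (n j) × Q.obj (A j) (n j + 1)) →ₗ[k] Q.obj (A j) (shiftAt i n j) :=
  if h : j = i then (Q.castL (by simp [h])).comp (LinearMap.snd k _ _)
  else (Q.castL (by simp [h])).comp (LinearMap.fst k _ _)

/-- The operad of jets: pairs of an element and of its differential, with the structure maps of the
Leibniz rule. -/
noncomputable def jetPre : PreOp k C s where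
  obj v n := Q.obj v n × Q.obj v (n + 1)
  act {ι} _ _ A v f hf n N hN :=
    ((Q.act f hf n N hN).compLinearMap (fun _ => LinearMap.fst k _ _)).prod
      (∑ i, (((s.toNat * (C.deg f : ℤ) + ∑ j with j < i, n j).negOnePow : ℤˣ) : ℤ) •
        (Q.act f hf (shiftAt i n) (N + 1) (by rw [sum_shift, hN]; ring)).compLinearMap
          (fun j => Q.mixL n i j))

/-- The element underlying a jet. -/
noncomputable def jfst {v : F.V} {n : ℤ} : Q.jetPre.obj v n →ₗ[k] Q.obj v n := LinearMap.fst k _ _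

/-- The derivative of a jet. -/
noncomputable def jsnd {v : F.V} {n : ℤ} : Q.jetPre.obj v n →ₗ[k] Q.obj v (n + 1) := LinearMap.snd k _ _

/-- The jet with given components. -/
def jmk {v : F.V} {n : ℤ} (x : Q.obj v n) (y : Q.obj v (n + 1)) : Q.jetPre.obj v n := (x, y)

@[simp] lemma jfst_jmk {v : F.V} {n : ℤ} (x : Q.obj v n) (y : Q.obj v (n + 1)) :
    Q.jfst (Q.jmk x y) = x := rfl

variable {Q} in
lemma jext {v : F.V} {n : ℤ} {x y : Q.jetPre.obj v n} (h1 : Q.jfst x = Q.jfst y)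
    (h2 : Q.jsnd x = Q.jsnd y) : x = y := Prod.ext h1 h2

/-- The derivative in the place `i`. -/
noncomputable def mix {ι : Type} [DecidableEq ι] {A : ι → F.V} {n : ι → ℤ}
    (z : ∀ i, Q.jetPre.obj (A i) (n i)) (i j : ι) : Q.obj (A j) (shiftAt i n j) :=
  Q.mixL n i j (z j)

lemma mix_self {ι : Type} [DecidableEq ι] {A : ι → F.V} {n : ι → ℤ}
    (z : ∀ i, Q.jetPre.obj (A i) (n i)) (i : ι) :
    Q.mix z i i = Q.castL (by simp) (Q.jsnd (z i)) := by
  unfold mix mixL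
  rw [dif_pos rfl]
  rfl

lemma mix_of_ne {ι : Type} [DecidableEq ι] {A : ι → F.V} {n : ι → ℤ}
    (z : ∀ i, Q.jetPre.obj (A i) (n i)) {i j : ι} (h : j ≠ i) :
    Q.mix z i j = Q.castL (by simp [h]) (Q.jfst (z j)) := by
  unfold mix mixL
  rw [dif_neg h]
  rfl

lemma mix_self_heq {ι : Type} [DecidableEq ι] {A : ι → F.V} {n : ι → ℤ}
    (z : ∀ i, Q.jetPre.obj (A i) (n i)) {i j : ι} (h : j = i) : HEq (Q.mix z i j) (Q.jsnd (z j)) := by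
  subst h
  rw [mix_self]
  exact Q.castL_heq _ _

lemma mix_ne_heq {ι : Type} [DecidableEq ι] {A : ι → F.V} {n : ι → ℤ}
    (z : ∀ i, Q.jetPre.obj (A i) (n i)) {i j : ι} (h : j ≠ i) : HEq (Q.mix z i j) (Q.jfst (z j)) := by
  rw [mix_of_ne _ _ h]
  exact Q.castL_heq _ _

variable {ι : Type} [Fintype ι] [LinearOrder ι] {A : ι → F.V} {v : F.V}

lemma jfst_act (f : F.Hom A v) (hf : C.deg f ≤ 1) (n : ι → ℤ) (N : ℤ) (hN)
    (z : ∀ i, Q.jetPre.obj (A i) (n i)) :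
    Q.jfst (Q.jetPre.act f hf n N hN z) = Q.act f hf n N hN (fun i => Q.jfst (z i)) := rfl

lemma jsnd_act (f : F.Hom A v) (hf : C.deg f ≤ 1) (n : ι → ℤ) (N : ℤ) (hN)
    (z : ∀ i, Q.jetPre.obj (A i) (n i)) :
    Q.jsnd (Q.jetPre.act f hf n N hN z) =
      ∑ i, (s.toNat * (C.deg f : ℤ) + ∑ j with j < i, n j).negOnePow •
        Q.act f hf (shiftAt i n) (N + 1) (by rw [sum_shift, hN]; ring) (Q.mix z i) := by
  have h := sum_apply Finset.univ (fun i => (((s.toNat * (C.deg f : ℤ) + ∑ j with j < i, n j).negOnePow : ℤˣ) : ℤ) •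
        (Q.act f hf (shiftAt i n) (N + 1) (by rw [sum_shift, hN]; ring)).compLinearMap
          (fun j => Q.mixL n i j)) z
  refine Eq.trans (show _ = _ from h) ?_
  refine Finset.sum_congr rfl fun i _ => ?_
  rw [Units.smul_def]
  rfl

lemma jfst_units_smul {v : F.V} {n : ℤ} (c : ℤˣ) (x : Q.jetPre.obj v n) :
    Q.jfst (c • x) = c • Q.jfst x := by
  rw [Units.smul_def, Units.smul_def, map_zsmul]

lemma jsnd_units_smul {v : F.V} {n : ℤ} (c : ℤˣ) (x : Q.jetPre.obj v n) :
    Q.jsnd (c • x) = c • Q.jsnd x := by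
  rw [Units.smul_def, Units.smul_def, map_zsmul]

section ActComp

variable {κ : Type} [Fintype κ] [LinearOrder κ] {α : κ → Type} [∀ j, Fintype (α j)]
  [∀ j, LinearOrder (α j)] (e : (Σ j, α j) ≃ ι) {B : κ → F.V} (f : F.Hom B v)
  (hf : C.deg f ≤ 1) (g : ∀ j, F.Hom (fun a : α j => A (e ⟨j, a⟩)) (B j)) (hg : ∀ j, C.deg (g j) ≤ 1)
  (n : ι → ℤ) (N : ℤ) (hN : N = ∑ i, n i + s.toNat * ((C.deg f + ∑ j, C.deg (g j) : ℕ) : ℤ))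
  (z : ∀ i, Q.jetPre.obj (A i) (n i))

lemma jfst_actComp : Q.jfst (Q.jetPre.actComp e f hf g hg n N hN z) =
    Q.actComp e f hf g hg n N hN (fun i => Q.jfst (z i)) := by
  unfold PreOp.actComp
  rw [jfst_units_smul, jfst_act]
  simp only [jfst_act]

/-- On the left a derivation reaches the input `(j, a)` through the two operations, crossing `f`,
the blocks before `j`, the operation `g j`, and the inputs of block `j` before `a`. On the right it
crosses all operations and the inputs that precede in the order of `ι`. The changes of the Koszul
sign and of the pass sign under the shift account for the difference. -/
lemma leibniz_sign (j : κ) (a : α j) :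
    (koszulSign e n * passSign (fun j => s.toNat * (C.deg (g j) : ℤ)) (fun j => ∑ a, n (e ⟨j, a⟩))) *
      (s.toNat * (C.deg f : ℤ) +
        ∑ j' with j' < j, (∑ a, n (e ⟨j', a⟩) + s.toNat * (C.deg (g j') : ℤ))).negOnePow *
      (s.toNat * (C.deg (g j) : ℤ) + ∑ a' with a' < a, n (e ⟨j, a'⟩)).negOnePow =
    (s.toNat * ((C.deg f + ∑ j, C.deg (g j) : ℕ) : ℤ) + ∑ i with i < e ⟨j, a⟩, n i).negOnePow *
      (koszulSign e (shiftAt (e ⟨j, a⟩) n) * passSign (fun j => s.toNat * (C.deg (g j) : ℤ))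
        (fun j' => ∑ a', shiftAt (e ⟨j, a⟩) n (e ⟨j', a'⟩))) := by
  rw [koszulSign_shift e n (shiftAt (e ⟨j, a⟩) n) j a (by simp [shiftAt])
      (by intro i hi; simp [shiftAt, hi]),
    passSign_shift _ (fun j => ∑ a, n (e ⟨j, a⟩))
      (fun j' => ∑ a', shiftAt (e ⟨j, a⟩) n (e ⟨j', a'⟩)) j
      (by simpa [shiftAt] using sum_shift (fun b => n (e ⟨j, b⟩)) a)
      (by intro j' hj'; exact Finset.sum_congr rfl fun b _ => by simp [shiftAt, hj'])]
  have h1 : ∀ x y p q r t w : ℤˣ, p * q = r * t * w → x * y * p * q = r * (x * t * (y * w)) := by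
    intro x y p q r t w h
    calc x * y * p * q = x * y * (p * q) := mul_assoc _ _ _
      _ = _ := by rw [h]; simp only [mul_comm, mul_left_comm]
  apply h1
  rw [← Int.negOnePow_add, ← Int.negOnePow_add, ← Int.negOnePow_add]
  apply negOnePow_congr
  have h2 : (∑ j, (C.deg (g j) : ℤ)) = ∑ j' with j' < j, (C.deg (g j') : ℤ) + C.deg (g j) +
      ∑ j' with j < j', (C.deg (g j') : ℤ) := by
    have h3 : (C.deg (g j) : ℤ) = ∑ j', if j' = j then (C.deg (g j') : ℤ) else 0 := by simp
    rw [h3]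
    simp only [Finset.sum_filter]
    rw [← Finset.sum_add_distrib, ← Finset.sum_add_distrib]
    refine Finset.sum_congr rfl fun j' _ => ?_
    rcases lt_trichotomy j' j with h | rfl | h
    · simp [h, h.ne, h.not_gt]
    · simp
    · simp [h, h.ne', h.not_gt]
  push_cast
  rw [h2, lexSum, Finset.sum_add_distrib, ← Finset.mul_sum, ← Finset.mul_sum]
  refine ⟨-(∑ i with i < e ⟨j, a⟩, n i) - s.toNat * ∑ j' with j < j', (C.deg (g j') : ℤ), ?_⟩
  ring

lemma act_mix (j : κ) (a : α j) (z' : ∀ j, Q.jetPre.obj (B j) (∑ a, n (e ⟨j, a⟩) + s.toNat * (C.deg (g j) : ℤ)))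
    (hz' : ∀ j, z' j = Q.jetPre.act (g j) (hg j) (fun a => n (e ⟨j, a⟩)) _ rfl (fun a => z (e ⟨j, a⟩)))
    (h1) (h2) (h3) (h4) :
    Q.act f hf (shiftAt j (fun j => ∑ a, n (e ⟨j, a⟩) + s.toNat * (C.deg (g j) : ℤ))) (N + 1) h1
      (Function.update (Q.mix z' j) j (Q.castL h2
        (Q.act (g j) (hg j) (shiftAt a (fun a => n (e ⟨j, a⟩)))
          (∑ a, n (e ⟨j, a⟩) + s.toNat * (C.deg (g j) : ℤ) + 1) h3
          (Q.mix (fun a => z (e ⟨j, a⟩)) a)))) =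
    Q.act f hf (fun j' => ∑ a', shiftAt (e ⟨j, a⟩) n (e ⟨j', a'⟩) + s.toNat * (C.deg (g j') : ℤ)) (N + 1)
      h4
      (fun j' => Q.act (g j') (hg j') (fun a' => shiftAt (e ⟨j, a⟩) n (e ⟨j', a'⟩)) _ rfl
        (fun a' => Q.mix z (e ⟨j, a⟩) (e ⟨j', a'⟩))) := by
  have hs : ∑ a', shiftAt (e ⟨j, a⟩) n (e ⟨j, a'⟩) = ∑ a', n (e ⟨j, a'⟩) + 1 := by
    simpa [shiftAt] using sum_shift (fun b => n (e ⟨j, b⟩)) a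
  have hs' : ∀ j', j' ≠ j → ∑ a', shiftAt (e ⟨j, a⟩) n (e ⟨j', a'⟩) = ∑ a', n (e ⟨j', a'⟩) := by
    intro j' hj'; exact Finset.sum_congr rfl fun b _ => by simp [shiftAt, hj']
  refine Q.act_eq rfl (fun j' => ?_) fun j' => ?_
  · by_cases h : j' = j
    · subst h
      rw [hs, shiftAt, if_pos rfl]; ring
    · rw [hs' j' h, shiftAt, if_neg h]
  · by_cases h : j' = j
    · subst h
      rw [Function.update_self]
      refine (Q.castL_heq _ _).trans (Q.act_heq rfl (fun a' => ?_) ?_ fun a' => ?_)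
      · by_cases ha : a' = a
        · subst ha; simp [shiftAt]
        · simp [shiftAt, ha]
      · rw [hs]; ring
      · by_cases ha : a' = a
        · exact (Q.mix_self_heq _ ha).trans (Q.mix_self_heq z (by rw [ha])).symm
        · exact (Q.mix_ne_heq _ ha).trans (Q.mix_ne_heq z (by simpa using ha)).symm
    · rw [Function.update_of_ne h]
      refine (Q.mix_ne_heq z' h).trans ?_
      rw [hz' j', jfst_act]
      refine Q.act_heq rfl (fun a' => by simp [shiftAt, h]) (by rw [hs' j' h]) fun a' => ?_
      exact (Q.mix_ne_heq z (by simp [h])).symm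

/-- The Leibniz rule applied twice has the form of the Leibniz rule for a single operation. This is
what makes jets functorial. -/
lemma jsnd_actComp : Q.jsnd (Q.jetPre.actComp e f hf g hg n N hN z) =
    ∑ i, (s.toNat * ((C.deg f + ∑ j, C.deg (g j) : ℕ) : ℤ) + ∑ i' with i' < i, n i').negOnePow •
      Q.actComp e f hf g hg (shiftAt i n) (N + 1) (by rw [sum_shift, hN]; ring) (Q.mix z i) := by
  rw [← e.sum_comp, Fintype.sum_sigma]
  unfold PreOp.actComp
  rw [jsnd_units_smul, jsnd_act, Finset.smul_sum]
  refine Finset.sum_congr rfl fun j _ => ?_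
  set z' : ∀ j, Q.jetPre.obj (B j) (∑ a, n (e ⟨j, a⟩) + s.toNat * (C.deg (g j) : ℤ)) :=
    fun j => Q.jetPre.act (g j) (hg j) (fun a => n (e ⟨j, a⟩)) _ rfl (fun a => z (e ⟨j, a⟩)) with hz'
  have h2 : ∑ a, n (e ⟨j, a⟩) + s.toNat * (C.deg (g j) : ℤ) + 1 =
      shiftAt j (fun j => ∑ a, n (e ⟨j, a⟩) + s.toNat * (C.deg (g j) : ℤ)) j := by simp [shiftAt]
  -- The derivative in the place `j` is itself a sum over the inputs of `g j`. Written as an update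
  -- of one argument it can be expanded by multilinearity.
  have key : Q.mix z' j = Function.update (Q.mix z' j) j
      (∑ a, (((s.toNat * (C.deg (g j) : ℤ) + ∑ a' with a' < a, n (e ⟨j, a'⟩)).negOnePow : ℤˣ) : ℤ) •
        Q.castL h2 (Q.act (g j) (hg j) (shiftAt a (fun a => n (e ⟨j, a⟩)))
          (∑ a, n (e ⟨j, a⟩) + s.toNat * (C.deg (g j) : ℤ) + 1) (by rw [sum_shift]; ring)
          (Q.mix (fun a => z (e ⟨j, a⟩)) a))) := by
    rw [eq_comm, Function.update_eq_self_iff, mix_self, hz']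
    dsimp only
    rw [jsnd_act, map_sum]
    refine Finset.sum_congr rfl fun a _ => ?_
    rw [Units.smul_def, map_zsmul]
  rw [key, MultilinearMap.map_update_sum, Finset.smul_sum, Finset.smul_sum]
  refine Finset.sum_congr rfl fun a _ => ?_
  have hz : ∀ (c : ℤ) (x), Q.act f hf (shiftAt j (fun j => ∑ a, n (e ⟨j, a⟩) + s.toNat * (C.deg (g j) : ℤ)))
      (N + 1) (by rw [sum_shift, hN, sum_block e]; ring) (Function.update (Q.mix z' j) j (c • x)) =
      c • Q.act f hf (shiftAt j (fun j => ∑ a, n (e ⟨j, a⟩) + s.toNat * (C.deg (g j) : ℤ)))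
      (N + 1) (by rw [sum_shift, hN, sum_block e]; ring) (Function.update (Q.mix z' j) j x) := by
    intro c x
    rw [← Int.cast_smul_eq_zsmul k c x, MultilinearMap.map_update_smul, Int.cast_smul_eq_zsmul]
  rw [hz, Q.act_mix e f hf g hg n N z j a z' (fun _ => rfl) _ _ _
    (by rw [← sum_block e (shiftAt (e ⟨j, a⟩) n), sum_shift, hN]; ring), ← Units.smul_def, smul_smul, smul_smul, smul_smul, leibniz_sign]

end ActComp

/-- The jets as a graded operad. -/
noncomputable def jetGr : GrOp k C s where
  toPreOp := Q.jetPre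
  act_one v n h hn x := jext (by rw [jfst_act]; exact Q.act_one v n h hn _) (by
    rw [jsnd_act]
    have hd := C.deg_one v
    rw [Fintype.sum_unique]
    have : (Finset.univ.filter fun j : Unit => j < default) = ∅ := by ext; simp
    have hs : (s.toNat * (C.deg (F.one v) : ℤ) + ∑ j : Unit with j < default, n).negOnePow = 1 := by
      rw [hd, this]; simp
    rw [hs, one_smul]
    refine Eq.trans ?_ (Q.act_one v (n + 1) h (by rw [hd]; simp) (Q.jsnd x))
    refine Q.act_eq rfl (fun j => by simp) fun j => ?_
    exact Q.mix_self_heq _ rfl)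
  act_comp e A B v f hf g hg h n N hN hN' x := by
    have hdeg : C.deg (F.map e (A := A) (F.comp (A := fun p => A (e p)) f g)) =
        C.deg f + ∑ j, C.deg (g j) := (C.deg_map _ _).trans (C.deg_comp _ _)
    refine jext ?_ ?_
    · rw [jfst_act, jfst_actComp]; exact Q.act_comp e f hf g hg h n N hN hN' _
    · rw [jsnd_act, jsnd_actComp]
      refine Finset.sum_congr rfl fun i _ => ?_
      refine congrArg₂ (· • ·) ?_ (Q.act_comp e f hf g hg h _ _ _ _ _)
      exact congrArg (fun t : ℕ => (s.toNat * (t : ℤ) + ∑ i' with i' < i, n i').negOnePow) hdeg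
  act_swap g f g' f' hg hf hg' hf' h hne h1 h2 h1' h2' n N hN hN' x := by
    have e1 : C.deg f + ∑ j, C.deg (g.hom j) = 2 := by rw [hf]; exact congrArg (1 + ·) hg
    have e2 : C.deg f' + ∑ j, C.deg (g'.hom j) = 2 := by rw [hf']; exact congrArg (1 + ·) hg'
    refine jext ?_ ?_
    · rw [jfst_units_smul]
      refine (Q.jfst_actComp (Equiv.sigmaFiberEquiv g'.π) f' h1' g'.hom h2' n N hN' x).trans ?_
      refine Eq.trans ?_ (congrArg _
        (Q.jfst_actComp (Equiv.sigmaFiberEquiv g.π) f h1 g.hom h2 n N hN x)).symm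
      exact Q.act_swap g f g' f' hg hf hg' hf' h hne h1 h2 h1' h2' n N hN hN' _
    · rw [jsnd_units_smul]
      refine (Q.jsnd_actComp (Equiv.sigmaFiberEquiv g'.π) f' h1' g'.hom h2' n N hN' x).trans ?_
      refine Eq.trans ?_ (congrArg _
        (Q.jsnd_actComp (Equiv.sigmaFiberEquiv g.π) f h1 g.hom h2 n N hN x)).symm
      rw [Finset.smul_sum]
      refine Finset.sum_congr rfl fun i _ => ?_
      rw [smul_comm]
      refine congrArg₂ (· • ·) ?_ ?_
      · exact congrArg (fun t : ℕ => (s.toNat * (t : ℤ) + ∑ i' with i' < i, n i').negOnePow)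
          (e2.trans e1.symm)
      · exact Q.act_swap g f g' f' hg hf hg' hf' h hne h1 h2 h1' h2' _ _ _ _ _

lemma shiftAt_comm {ι : Type} [DecidableEq ι] (i i' : ι) (n : ι → ℤ) :
    shiftAt i' (shiftAt i n) = shiftAt i (shiftAt i' n) := by
  funext j
  simp only [shiftAt]
  split_ifs <;> rfl

/-- The differential of jets. -/
noncomputable def jd {v : F.V} {n m : ℤ} (h : m = n + 1) : Q.jetPre.obj v n →ₗ[k] Q.jetPre.obj v m :=
  (LinearMap.inl k _ _).comp ((Q.castL h.symm).comp Q.jsnd)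

lemma jfst_jd {v : F.V} {n m : ℤ} (h : m = n + 1) (z : Q.jetPre.obj v n) :
    Q.jfst (Q.jd h z) = Q.castL h.symm (Q.jsnd z) := rfl

lemma jsnd_jd {v : F.V} {n m : ℤ} (h : m = n + 1) (z : Q.jetPre.obj v n) : Q.jsnd (Q.jd h z) = 0 := rfl

lemma jfst_castDeg {v : F.V} {n m : ℤ} (h : n = m) (z : Q.jetPre.obj v n) :
    HEq (Q.jfst (Q.jetPre.castDeg h z)) (Q.jfst z) := by subst h; rfl

lemma jsnd_castDeg {v : F.V} {n m : ℤ} (h : n = m) (z : Q.jetPre.obj v n) :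
    HEq (Q.jsnd (Q.jetPre.castDeg h z)) (Q.jsnd z) := by subst h; rfl

section

variable {n : ι → ℤ} (z : ∀ i, Q.jetPre.obj (A i) (n i))

lemma applyAt_jd_self (i : ι) : Q.jetPre.applyAt (fun h => Q.jd h) z i i = Q.jd (by simp) (z i) :=
  dif_pos rfl

lemma applyAt_jd_of_ne {i j : ι} (h : j ≠ i) :
    Q.jetPre.applyAt (fun h => Q.jd h) z i j = Q.jetPre.castDeg (by simp [h]) (z j) :=
  dif_neg h

lemma jfst_applyAt (i j : ι) :
    HEq (Q.jfst (Q.jetPre.applyAt (fun h => Q.jd h) z i j)) (Q.mix z i j) := by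
  by_cases h : j = i
  · subst h
    rw [applyAt_jd_self, jfst_jd]
    exact (Q.castL_heq _ _).trans (Q.mix_self_heq z rfl).symm
  · rw [applyAt_jd_of_ne _ _ h]
    exact (Q.jfst_castDeg _ _).trans (Q.mix_ne_heq z h).symm

lemma mix_applyAt_self (i : ι) : Q.mix (Q.jetPre.applyAt (fun h => Q.jd h) z i) i i = 0 := by
  rw [mix_self, applyAt_jd_self, jsnd_jd, map_zero]

lemma mix_applyAt_comm {i i' : ι} (h : i' ≠ i) (j : ι) :
    HEq (Q.mix (Q.jetPre.applyAt (fun h => Q.jd h) z i) i' j)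
      (Q.mix (Q.jetPre.applyAt (fun h => Q.jd h) z i') i j) := by
  have key : ∀ {i i' : ι}, i' ≠ i →
      HEq (Q.mix (Q.jetPre.applyAt (fun h => Q.jd h) z i) i' i')
        (Q.mix (Q.jetPre.applyAt (fun h => Q.jd h) z i') i i') := by
    intro i i' h
    refine (Q.mix_self_heq _ rfl).trans (HEq.trans ?_ (Q.mix_ne_heq _ h).symm)
    rw [applyAt_jd_of_ne _ _ h, applyAt_jd_self, jfst_jd]
    exact (Q.jsnd_castDeg _ _).trans (Q.castL_heq _ _).symm
  by_cases h1 : j = i'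
  · subst h1; exact key h
  by_cases h2 : j = i
  · subst h2; exact (key h.symm).symm
  refine (Q.mix_ne_heq _ h1).trans (HEq.trans ?_ (Q.mix_ne_heq _ h2).symm)
  rw [applyAt_jd_of_ne _ _ h1, applyAt_jd_of_ne _ _ h2]
  exact (Q.jfst_castDeg _ _).trans (Q.jfst_castDeg _ _).symm

end

lemma sum_lt_shiftAt (n : ι → ℤ) (i i' : ι) :
    ∑ j with j < i', shiftAt i n j = ∑ j with j < i', n j + if i < i' then 1 else 0 := by
  have : ∀ j, shiftAt i n j = n j + if j = i then 1 else 0 := by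
    intro j; simp only [shiftAt]; split_ifs <;> simp
  simp only [this, Finset.sum_add_distrib, Finset.sum_ite_eq', Finset.mem_filter, Finset.mem_univ,
    true_and]

lemma jd_jd {v : F.V} {n m l : ℤ} (h : m = n + 1) (h' : l = m + 1) (x : Q.jetPre.obj v n) :
    Q.jd h' (Q.jd h x) = 0 := by
  refine jext ?_ ?_
  · rw [jfst_jd, jsnd_jd, map_zero, map_zero]
  · rw [jsnd_jd, map_zero]

/-- The first components are the Leibniz rule built into the structure maps. On the second
components the content is that the twofold Leibniz rule gives zero. -/
lemma jd_act (f : F.Hom A v) (hf : C.deg f ≤ 1) (n : ι → ℤ) (N M : ℤ)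
    (hN : N = ∑ i, n i + s.toNat * (C.deg f : ℤ)) (hM : M = N + 1)
    (x : ∀ i, Q.jetPre.obj (A i) (n i)) :
    Q.jd hM (Q.jetPre.act f hf n N hN x) =
      ∑ i, (s.toNat * (C.deg f : ℤ) + ∑ j with j < i, n j).negOnePow •
        Q.jetPre.act f hf (fun j => if j = i then n j + 1 else n j) M
          (by rw [sum_shift, hM, hN]; ring) (Q.jetPre.applyAt (fun h => Q.jd h) x i) := by
  subst hM
  refine jext ?_ ?_
  · refine (Q.jfst_jd _ _).trans ?_
    rw [Q.jsnd_act f hf n N hN x, map_sum, map_sum]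
    refine Finset.sum_congr rfl fun i _ => ?_
    refine Eq.trans ?_ (Q.jfst_units_smul _ _).symm
    rw [PreOp.castL_rfl]
    refine congrArg _ ?_
    refine Eq.trans ?_ (Q.jfst_act _ _ _ _ _ _).symm
    exact Q.act_eq rfl (fun _ => rfl) fun j => (Q.jfst_applyAt x i j).symm
  · refine (Q.jsnd_jd _ _).trans ?_
    rw [map_sum]
    refine Eq.trans ?_ (Finset.sum_congr rfl fun i _ => (Q.jsnd_units_smul _ _).symm)
    refine Eq.trans ?_ (Finset.sum_congr rfl fun i _ => congrArg _ (Q.jsnd_act _ _ _ _ _ _).symm)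
    simp only [Finset.smul_sum, smul_smul]
    rw [← Finset.sum_product', eq_comm]
    have hz : ∀ i : ι, ∀ h, Q.act f hf (shiftAt i (shiftAt i n)) (N + 1 + 1) h
        (Q.mix (Q.jetPre.applyAt (fun h => Q.jd h) x i) i) = 0 := fun i h =>
      MultilinearMap.map_coord_zero _ i (Q.mix_applyAt_self x i)
    -- Derivatives in two different places, taken in the two orders, have opposite signs: in one of
    -- the orders the later derivation passes a factor whose degree was already raised. The diagonal
    -- terms contain the derivative of a derivative, which is zero.
    refine Finset.sum_involution (fun p _ => (p.2, p.1)) ?_ ?_ (fun _ _ => by simp) (fun _ _ => rfl)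
    · rintro ⟨i, i'⟩ -
      dsimp only
      by_cases h : i' = i
      · subst h
        rw [show _ = _ from hz i' _]
        simp
      · have h1 : ∀ h h', Q.act f hf (shiftAt i' (shiftAt i n)) (N + 1 + 1) h
            (Q.mix (Q.jetPre.applyAt (fun h => Q.jd h) x i) i') =
            Q.act f hf (shiftAt i (shiftAt i' n)) (N + 1 + 1) h'
            (Q.mix (Q.jetPre.applyAt (fun h => Q.jd h) x i') i) := fun _ _ =>
          Q.act_eq rfl (fun j => congrFun (shiftAt_comm i i' n) j) fun j =>
            Q.mix_applyAt_comm x h j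
        rw [show _ = _ from h1 _ (by rw [sum_shift, sum_shift, hN]; ring)]
        have h2 : ((s.toNat * (C.deg f : ℤ) + ∑ j with j < i, n j).negOnePow *
            (s.toNat * (C.deg f : ℤ) + ∑ j with j < i', shiftAt i n j).negOnePow) =
            -((s.toNat * (C.deg f : ℤ) + ∑ j with j < i', n j).negOnePow *
            (s.toNat * (C.deg f : ℤ) + ∑ j with j < i, shiftAt i' n j).negOnePow) := by
          rw [sum_lt_shiftAt, sum_lt_shiftAt, ← Int.negOnePow_add, ← Int.negOnePow_add,
            ← Int.negOnePow_succ]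
          apply negOnePow_congr
          rcases lt_or_gt_of_ne h with h | h
          · simp only [h, h.not_gt, if_true, if_false]
            exact ⟨-1, by ring⟩
          · simp only [h, h.not_gt, if_true, if_false]
            exact ⟨0, by ring⟩
        rw [show _ = _ from h2, Units.neg_smul]
        exact neg_add_cancel _
    · rintro ⟨i, i'⟩ - hne h
      obtain rfl : i' = i := (Prod.ext_iff.1 h).1
      refine hne ?_
      dsimp only
      rw [show _ = _ from hz i' _]
      exact smul_zero _

/-- The jets of a graded operad, a differential graded operad. -/
noncomputable def jet : DGOp k C s where
  toGrOp := Q.jetGr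
  d h := Q.jd h
  d_d h h' x := Q.jd_jd h h' x
  d_act f hf n N M hN hM x := Q.jd_act f hf n N M hN hM x

end GrOp
end Jets

/-! ### Contraction of forms on tensor products with maps on tensor products of duals. -/

section Contraction

variable {k : Type u} [Field k] {ι : Type} [Fintype ι] {V : ι → Type u} [∀ i, AddCommGroup (V i)]
  [∀ i, Module k (V i)] [∀ i, Module.Finite k (V i)] {M : Type u} [AddCommGroup M] [Module k M]

open scoped Classical in
/-- The contraction of a form on a tensor product with a map on the tensor product of the duals. -/
noncomputable def contr (β : (∀ i, V i) → k) (c : (∀ i, Module.Dual k (V i)) → M) : M :=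
  ∑ a : ∀ i, Fin (Module.finrank k (V i)), β (fun i => Module.finBasis k (V i) (a i)) •
    c (fun i => (Module.finBasis k (V i)).coord (a i))

lemma contr_def [DecidableEq ι] (β : (∀ i, V i) → k) (c : (∀ i, Module.Dual k (V i)) → M) :
    contr β c = ∑ a : ∀ i, Fin (Module.finrank k (V i)), β (fun i => Module.finBasis k (V i) (a i)) •
      c (fun i => (Module.finBasis k (V i)).coord (a i)) := by
  unfold contr
  exact Finset.sum_congr (by ext; simp) fun _ _ => rfl

lemma contr_eq_zero (β : (∀ i, V i) → k) (c : (∀ i, Module.Dual k (V i)) → M) (i : ι)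
    (h : ¬ Nontrivial (V i)) : contr β c = 0 := by
  rw [not_nontrivial_iff_subsingleton] at h
  have : Module.finrank k (V i) = 0 := Module.finrank_zero_of_subsingleton
  refine Finset.sum_eq_zero fun a _ => ?_
  have := a i
  rw [‹Module.finrank k (V i) = 0›] at this
  exact this.elim0

lemma contr_add_left (β β' : (∀ i, V i) → k) (c : (∀ i, Module.Dual k (V i)) → M) :
    contr (fun x => β x + β' x) c = contr β c + contr β' c := by
  simp only [contr, add_smul, Finset.sum_add_distrib]

lemma contr_smul_left (r : k) (β : (∀ i, V i) → k) (c : (∀ i, Module.Dual k (V i)) → M) :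
    contr (fun x => r * β x) c = r • contr β c := by
  simp only [contr, mul_smul, Finset.smul_sum]

lemma contr_zsmul_left (r : ℤˣ) (β : (∀ i, V i) → k) (c : (∀ i, Module.Dual k (V i)) → M) :
    contr (fun x => r • β x) c = r • contr β c := by
  simp only [contr, smul_assoc, Finset.smul_sum]

lemma contr_sum_left {σ : Type*} (S : Finset σ) (β : σ → (∀ i, V i) → k)
    (c : (∀ i, Module.Dual k (V i)) → M) :
    contr (fun x => ∑ y ∈ S, β y x) c = ∑ y ∈ S, contr (β y) c := by
  simp only [contr, Finset.sum_smul]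
  exact Finset.sum_comm

lemma contr_add_right (β : (∀ i, V i) → k) (c c' : (∀ i, Module.Dual k (V i)) → M) :
    contr β (fun x => c x + c' x) = contr β c + contr β c' := by
  simp only [contr, smul_add, Finset.sum_add_distrib]

lemma contr_zsmul_right (r : ℤˣ) (β : (∀ i, V i) → k) (c : (∀ i, Module.Dual k (V i)) → M) :
    contr β (fun x => r • c x) = r • contr β c := by
  simp only [contr, Finset.smul_sum]
  exact Finset.sum_congr rfl fun a _ => smul_comm _ _ _

lemma contr_smul_right (r : k) (β : (∀ i, V i) → k) (c : (∀ i, Module.Dual k (V i)) → M) :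
    contr β (fun x => r • c x) = r • contr β c := by
  simp only [contr, Finset.smul_sum]
  exact Finset.sum_congr rfl fun a _ => smul_comm _ _ _

lemma contr_sum_right {σ : Type*} (S : Finset σ) (β : (∀ i, V i) → k)
    (c : σ → (∀ i, Module.Dual k (V i)) → M) :
    contr β (fun x => ∑ y ∈ S, c y x) = ∑ y ∈ S, contr β (c y) := by
  simp only [contr, Finset.smul_sum]
  exact Finset.sum_comm

lemma map_contr {M' : Type u} [AddCommGroup M'] [Module k M'] (T : M →ₗ[k] M') (β : (∀ i, V i) → k)
    (c : (∀ i, Module.Dual k (V i)) → M) : T (contr β c) = contr β (fun x => T (c x)) := by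
  simp only [contr, map_sum, map_smul]

lemma multilinear_expand {κ : Type} [Fintype κ] [DecidableEq κ] {W : κ → Type u} [∀ i, AddCommGroup (W i)]
    [∀ i, Module k (W i)] [∀ i, Module.Finite k (W i)] (β : MultilinearMap k W k) (w : ∀ j, W j) :
    ∑ b : ∀ j, Fin (Module.finrank k (W j)), β (fun j => Module.finBasis k (W j) (b j)) *
      ∏ j, (Module.finBasis k (W j)).coord (b j) (w j) = β w := by
  have h : w = fun j => ∑ b, (Module.finBasis k (W j)).coord b (w j) • Module.finBasis k (W j) b := by
    funext j
    exact ((Module.finBasis k (W j)).sum_repr (w j)).symm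
  conv_rhs => rw [h]
  rw [β.map_sum]
  refine Finset.sum_congr rfl fun b _ => ?_
  rw [β.map_smul_univ, smul_eq_mul, mul_comm]

/-- Contractions may be performed block by block: evaluating `g j` on basis elements of a block and
expanding the result in the basis of `W j` distributes the sum over the blocks. This is how iterated
structure maps are contracted. -/
lemma contr_sigma {κ : Type} [Fintype κ] {α : κ → Type} [∀ j, Fintype (α j)] (e : (Σ j, α j) ≃ ι)
    {W U : κ → Type u} [∀ i, AddCommGroup (W i)] [∀ i, Module k (W i)] [∀ i, Module.Finite k (W i)]
    [∀ i, AddCommGroup (U i)] [∀ i, Module k (U i)] (β : MultilinearMap k W k)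
    (g : ∀ j, (∀ a : α j, V (e ⟨j, a⟩)) → W j) (c : MultilinearMap k U M)
    (h : ∀ j, (∀ a : α j, Module.Dual k (V (e ⟨j, a⟩))) → U j) :
    contr (fun x : ∀ i, V i => β (fun j => g j (fun a => x (e ⟨j, a⟩))))
      (fun ξ => c (fun j => h j (fun a => ξ (e ⟨j, a⟩)))) =
    contr β (fun ω => c (fun j => contr (fun y => ω j (g j y)) (h j))) := by
  classical
  simp only [contr]
  simp only [c.map_sum, c.map_smul_univ, Finset.smul_sum]
  rw [Finset.sum_comm]
  refine Fintype.sum_equiv ((Equiv.piCongrLeft (fun i => Fin (Module.finrank k (V i))) e).symm.trans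
    (Equiv.piCurry (γ := fun j a => Fin (Module.finrank k (V (e ⟨j, a⟩)))))) _ _ fun a => ?_
  rw [← multilinear_expand β, Finset.sum_smul]
  simp only [mul_smul]
  rfl

/-- For one factor the contraction is the dual basis expansion of `ω`, hence does not depend on the
basis. -/
lemma contr_unit {V U : Type u} [AddCommGroup V] [Module k V] [Module.Finite k V] [AddCommGroup U]
    [Module k U] (ω : Module.Dual k V) (S : Module.Dual k V →ₗ[k] U) :
    contr (ι := Unit) (V := fun _ => V) (fun y => ω (y ())) (fun η => S (η ())) = S ω := by
  classical
  rw [contr_def]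
  refine (Fintype.sum_equiv (Equiv.funUnique Unit (Fin (Module.finrank k V))) _
    (fun a => ω (Module.finBasis k V a) • S ((Module.finBasis k V).coord a)) (fun a => rfl)).trans ?_
  simp only [← map_smul, ← map_sum]
  congr 1
  exact (Module.finBasis k V).sum_dual_apply_smul_coord ω

/-- Linear maps can be moved from the arguments of the form to their transposes on the dual side.
With isomorphisms for `T` this shows the independence of the bases as well. -/
lemma contr_linear {κ : Type} [Fintype κ] (e : κ ≃ ι)
    {W U : κ → Type u} [∀ i, AddCommGroup (W i)] [∀ i, Module k (W i)] [∀ i, Module.Finite k (W i)]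
    [∀ i, AddCommGroup (U i)] [∀ i, Module k (U i)] (β : MultilinearMap k W k)
    (T : ∀ j, V (e j) →ₗ[k] W j) (c : MultilinearMap k U M)
    (S : ∀ j, Module.Dual k (V (e j)) →ₗ[k] U j) (R : ∀ j, Module.Dual k (W j) → U j)
    (hR : ∀ j ω, S j (ω.comp (T j)) = R j ω) :
    contr (fun x : ∀ i, V i => β (fun j => T j (x (e j)))) (fun ξ => c (fun j => S j (ξ (e j)))) =
    contr β (fun ω => c (fun j => R j (ω j))) := by
  refine (contr_sigma ((Equiv.sigmaPUnit κ).trans e) (V := V) β (fun j y => T j (y ())) c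
    (fun j η => S j (η ()))).trans ?_
  refine congrArg (contr β) (funext fun ω => congrArg c (funext fun j => ?_))
  rw [← hR]
  exact contr_unit (V := V (e j)) ((ω j).comp (T j)) (S j)

end Contraction

/-! ### Contracting structure maps of `P` with those of `Q`. -/

section Convolution

variable {k : Type u} [Field k] {F : FeynmanCategory.{u}} {C : F.Cubical} {s : Bool}

namespace FinOp

variable (P : FinOp k C s) {t : Bool} (Q : GrOp k C t)
  {ι : Type} [Fintype ι] [LinearOrder ι] {A : ι → F.V} {v : F.V}

/-- The contraction of the form `ω ∘ P(f)` with the map `Q(f)`, after the application of maps `D` from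
the duals of the values of `P` to the values of `Q`. -/
noncomputable def convAt (f : F.Hom A v) (hf : C.deg f ≤ 1) (m n : ι → ℤ) (M N : ℤ)
    (hM : M = ∑ i, m i + s.toNat * (C.deg f : ℤ)) (hN : N = ∑ i, n i + t.toNat * (C.deg f : ℤ))
    (D : ∀ i, Module.Dual k (P.obj.obj (A i) (m i)) → Q.obj (A i) (n i)) :
    Module.Dual k (P.obj.obj v M) →ₗ[k] Q.obj v N where
  toFun ω := contr (fun x => ω (P.obj.act f hf m M hM x)) (fun ξ => Q.act f hf n N hN (fun i => D i (ξ i)))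
  map_add' _ _ := contr_add_left _ _ _
  map_smul' r _ := contr_smul_left r _ _

lemma convAt_apply (f : F.Hom A v) (hf : C.deg f ≤ 1) (m n : ι → ℤ) (M N : ℤ)
    (hM : M = ∑ i, m i + s.toNat * (C.deg f : ℤ)) (hN : N = ∑ i, n i + t.toNat * (C.deg f : ℤ))
    (D : ∀ i, Module.Dual k (P.obj.obj (A i) (m i)) → Q.obj (A i) (n i)) (ω) :
    P.convAt Q f hf m n M N hM hN D ω =
      contr (fun x => ω (P.obj.act f hf m M hM x)) (fun ξ => Q.act f hf n N hN (fun i => D i (ξ i))) := rfl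

lemma convAt_eq_zero (f : F.Hom A v) (hf : C.deg f ≤ 1) (m n : ι → ℤ) (M N : ℤ) (hM) (hN)
    (D : ∀ i, Module.Dual k (P.obj.obj (A i) (m i)) → Q.obj (A i) (n i)) (ω) (i : ι)
    (h : ¬ Nontrivial (P.obj.obj (A i) (m i))) : P.convAt Q f hf m n M N hM hN D ω = 0 := by
  rw [convAt_apply]
  exact contr_eq_zero (V := fun i => P.obj.obj (A i) (m i)) _ _ i h

/-- A map from the generators of the Feynman transform to an operad. -/
abbrev DualMap := ∀ (v : F.V) (n : ℤ), Module.Dual k (P.obj.obj v (-n)) →ₗ[k] Q.obj v n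

variable {P Q}

/-- Equivariance under the isomorphisms of vertices. -/
def DualMap.Equivariant (j : P.DualMap Q) : Prop :=
  ∀ {v w : F.V} (σ : F.VIso v w) (n : ℤ) (p : Module.Dual k (P.obj.obj w (-n))),
      Q.viso σ n (j v n (p.comp (P.obj.viso σ (-n)))) = j w n p

/-- The contraction of `ω ∘ P(f)` with `Q(f)`. -/
noncomputable abbrev DualMap.conv (j : P.DualMap Q) (f : F.Hom A v) (hf : C.deg f ≤ 1) (l : ι → ℤ) (M N : ℤ)
    (hM : M = ∑ i, -l i + s.toNat * (C.deg f : ℤ)) (hN : N = ∑ i, l i + t.toNat * (C.deg f : ℤ)) :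
    Module.Dual k (P.obj.obj v M) →ₗ[k] Q.obj v N :=
  P.convAt Q f hf (fun i => -l i) l M N hM hN (fun i => j (A i) (l i))

namespace DualMap

variable {j : P.DualMap Q} (hj : j.Equivariant)

include hj in
-- The permutation produces a Koszul sign in `P` and one in `Q`. Their degrees are negatives of each
-- other, so the signs are equal and cancel, and the convolution is invariant.
lemma conv_reindex {κ : Type} [Fintype κ] [LinearOrder κ] (e : κ ≃ ι) {B : κ → F.V} (f : F.Hom B v)
    (σ : ∀ j, F.VIso (A (e j)) (B j))
    (f' : F.Hom A v) (hf' : f' = F.map ((Equiv.sigmaPUnit κ).trans e) (A := A)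
      (F.comp (α := fun _ => Unit) (A := fun p => A (e p.1)) f (fun j => (σ j).hom)))
    (h : C.deg f ≤ 1) (h' : C.deg f' ≤ 1) (l : ι → ℤ) (M N : ℤ) (hM hN hM' hN') :
    j.conv f' h' l M N hM' hN' = j.conv f h (fun i => l (e i)) M N hM hN := by
  ext ω
  rw [convAt_apply, convAt_apply]
  have h1 : ∀ x, ω (P.obj.act f' h' (fun i => -l i) M hM' x) = permSign e l •
      ω (P.obj.act f h (fun i => -l (e i)) M hM (fun i => P.obj.viso (σ i) _ (x (e i)))) := by
    intro x
    rw [P.obj.act_reindex e f σ f' hf' h h' _ M hM hM' x, Units.smul_def, Units.smul_def, map_zsmul,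
      permSign_congr e (n' := l) (fun i => by rw [Int.negOnePow_neg])]
  simp only [h1, Q.act_reindex e f σ f' hf' h h' l N hN hN']
  rw [contr_zsmul_left, contr_zsmul_right, smul_smul, units_mul_self, one_smul]
  exact contr_linear e (V := fun i => P.obj.obj (A i) (-l i)) (W := fun i => P.obj.obj (B i) (-l (e i))) (U := fun i => Q.obj (B i) (l (e i)))
    (ω.compMultilinearMap (P.obj.act f h (fun i => -l (e i)) M hM)) (fun i => P.obj.viso (σ i) (-l (e i)))
    (Q.act f h (fun i => l (e i)) N hN) (fun i => (Q.viso (σ i) (l (e i))).comp (j (A (e i)) (l (e i))))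
    (fun i => j _ _) (fun i ω => hj (σ i) _ ω)

lemma conv_post {w : F.V} (τ : F.VIso v w) (f : F.Hom A v) (h : C.deg f ≤ 1)
    (h' : C.deg (F.post τ.hom f) ≤ 1) (l : ι → ℤ) (M N : ℤ) (hM hN hM' hN') (ω) :
    j.conv (F.post τ.hom f) h' l M N hM' hN' ω =
      Q.viso τ N (j.conv f h l M N hM hN (ω.comp (P.obj.viso τ M))) := by
  rw [convAt_apply, convAt_apply, map_contr]
  refine congrArg₂ contr (funext fun x => ?_) (funext fun x => ?_)
  · rw [P.obj.act_post τ f h h' _ M hM hM' x]; rfl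
  · rw [Q.act_post τ f h h' _ N hN hN']

lemma conv_one (v : F.V) (n : ℤ) (h) (hM) (hN) (ω) :
    j.conv (F.one v) h (fun _ => n) (-n) n hM hN ω = j v n ω := by
  rw [convAt_apply]
  refine Eq.trans ?_ (contr_unit ω (j v n))
  refine congrArg₂ contr (funext fun x => ?_) (funext fun x => ?_)
  · exact congrArg ω (P.obj.act_one v _ _ _ (x ()))
  · exact Q.act_one v _ _ _ (j v n (x ()))

end DualMap
end FinOp
end Convolution

/-! ### Families of generating morphisms and weighted counts of isomorphisms. -/

namespace FeynmanCategory

variable {F : FeynmanCategory.{u}} {C : F.Cubical}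

section Into

variable {ι κ l : Type} [Finite ι] [Finite κ] [Finite l]
  {A : ι → F.V} {B : κ → F.V} {X : l → F.V} {v : F.V}

lemma Mor.comp_into (g : F.Mor A B) (h : F.Mor B X) (f : F.Hom X v) :
    (g.comp h).into f = g.into (h.into f) :=
  Mor.single_injective (by simp only [Mor.single_into, Mor.comp_assoc])

lemma Mor.id_into (f : F.Hom A v) : (Mor.id F A).into f = f :=
  Mor.single_injective (by simp only [Mor.single_into, Mor.id_comp])

lemma Mor.into_eq_iff (g : F.Mor A B) (f : F.Hom B v) (g' : F.Mor A X) (f' : F.Hom X v) :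
    g.into f = g'.into f' ↔ g.comp (.single f) = g'.comp (.single f') := by
  rw [← Mor.single_into, ← Mor.single_into, Mor.single_injective.eq_iff]

lemma EquivFact.symm {g : F.Mor A B} {f : F.Hom B v} {g' : F.Mor A X} {f' : F.Hom X v}
    (h : EquivFact g f g' f') : EquivFact g' f' g f := by
  obtain ⟨τ, hτ, rfl, rfl⟩ := h
  refine ⟨hτ.inv, hτ.inv_isIso, ?_, ?_⟩
  · rw [Mor.comp_assoc, hτ.comp_inv, Mor.comp_id]
  · rw [← Mor.comp_into, hτ.inv_comp, Mor.id_into]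

lemma FIso.ext_heq {a b : FIso A B} (he : ∀ j, a.e j = b.e j) (hσ : ∀ j, HEq (a.σ j) (b.σ j)) :
    a = b := by
  obtain ⟨e, σ⟩ := a
  obtain ⟨e', σ'⟩ := b
  obtain rfl : e = e' := Equiv.ext he
  obtain rfl : σ = σ' := funext fun j => eq_of_heq (hσ j)
  rfl

lemma FIso.mor_into (a : FIso A B) (f : F.Hom B v) :
    a.mor.into f = F.map ((Equiv.sigmaPUnit κ).trans a.e) (A := A)
      (F.comp (α := fun _ => Unit) (A := fun p => A (a.e p.1)) f (fun j => (a.σ j).hom)) :=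
  Mor.tens_into _ _ _

lemma FIso.mor_into' (a : FIso A B) (f : F.Hom B v) :
    a.mor.into f = F.map a.e (A := A) (F.pre f (fun j => (a.σ j).hom)) :=
  (a.mor_into f).trans (F.map_map (Equiv.sigmaPUnit κ) a.e (A := A) _).symm

instance FIso.finite : Finite (FIso A B) :=
  have : Finite (κ ≃ ι) := inferInstance
  Finite.of_injective (fun a : FIso A B => (⟨a.e, a.σ⟩ : Σ e : κ ≃ ι, ∀ j, F.VIso (A (e j)) (B j)))
    (fun a b h => by cases a; cases b; cases h; rfl)

lemma Mor.comp_tens_hom_aux {α : κ → Type} [∀ j, Finite (α j)] {D : (Σ j, α j) → F.V}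
    (ρ : FIso A D) (g : ∀ j, F.Hom (fun a : α j => D ⟨j, a⟩) (B j)) :
    ρ.mor.comp (Mor.tens (Equiv.refl _) g) =
      Mor.tens (A := A) ρ.e (fun j => F.pre (g j) (fun a => (ρ.σ ⟨j, a⟩).hom)) := by
  refine Mor.ext_hom (fun _ => rfl) fun j => ?_
  dsimp only [Mor.comp, Mor.tens]
  have h1 := F.map_comp (Mor.blockEquiv (Equiv.refl (Σ j, α j)) j)
    (α := fun p : {p : Σ j, α j // (((Equiv.refl (Σ j, α j)).symm p).1 = j)} =>
      {i // ρ.mor.π i = p.1}) (A := fun p => A p.2.1)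
    (B := fun p => D p.1) (g j) (fun p => ρ.mor.hom p.1)
  have h2 := F.comp_map (α := fun _ : α j => Unit)
    (α' := fun a : α j => {i // ρ.mor.π i = (⟨j, a⟩ : Σ j, α j)})
    (fun a => FIso.point ρ.e ⟨j, a⟩) (A := fun p => A p.2.1) (g j) (fun a => (ρ.σ ⟨j, a⟩).hom)
  have h3 : (fun a : α j => ρ.mor.hom ⟨j, a⟩) = fun a => F.map (FIso.point ρ.e ⟨j, a⟩)
      (A := fun i => A i.1) (ρ.σ ⟨j, a⟩).hom := funext fun a => (FIso.mor_hom ρ ⟨j, a⟩).symm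
  have h4 := (congrArg (F.comp (α := fun a : α j => {i // ρ.mor.π i = (⟨j, a⟩ : Σ j, α j)})
    (A := fun p => A p.2.1) (g j)) h3).trans h2
  have h5 := h1.trans (congrArg (F.map (Equiv.sigmaCongrLeft
    (β := fun p : {p : Σ j, α j // (((Equiv.refl (Σ j, α j)).symm p).1 = j)} => {i // ρ.mor.π i = p.1})
    (Mor.blockEquiv (Equiv.refl (Σ j, α j)) j)) (A := fun p => A p.2.1)) h4)
  refine Eq.trans ?_ (congrArg (F.map (fiberEquiv ρ.mor.π
    (fun p => ((Equiv.refl (Σ j, α j)).symm p).1) j) (A := fun i => A i.1)) h5).symm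
  unfold pre
  erw [F.map_map, F.map_map, F.map_map, F.map_map]
  exact map_congr (Equiv.ext fun _ => rfl) HEq.rfl

lemma Mor.tens_congrRight {α β : κ → Type} [∀ j, Finite (α j)] [∀ j, Finite (β j)]
    (ε : ∀ j, α j ≃ β j) (e : (Σ j, β j) ≃ ι) (g : ∀ j, F.Hom (fun a : α j => A (e ⟨j, ε j a⟩)) (B j)) :
    Mor.tens (A := A) ((Equiv.sigmaCongrRight ε).trans e) g =
      Mor.tens e (fun j => F.map (ε j) (A := fun b => A (e ⟨j, b⟩)) (g j)) := by
  refine Mor.ext_hom (fun _ => rfl) fun j => ?_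
  dsimp only [Mor.tens]
  erw [F.map_map, F.map_map]
  exact map_congr (by exact Equiv.ext fun _ => rfl) HEq.rfl

end Into

section Families

variable {ι κ : Type} [Finite ι] [Finite κ] {A : ι → F.V} {X : κ → F.V}

/-- Families of generating morphisms with given targets. -/
abbrev Fam (X : κ → F.V) := ∀ j, Σ Y : F.Word, F.Hom Y.2 (X j)

/-- The index set of the source of the tensor product of a family. -/
abbrev Fam.Idx (y : Fam X) := Σ j, Fin (y j).1.1

/-- The source of the tensor product of a family. -/
def Fam.src (y : Fam X) : y.Idx → F.V := fun p => (y p.1).1.2 p.2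

/-- The tensor product of a family. -/
def Fam.mor (y : Fam X) : F.Mor y.src X := Mor.tens (A := y.src) (Equiv.refl _) (fun j => (y j).2)

lemma Fam.comp_mor (y : Fam X) (ρ : FIso A y.src) :
    ρ.mor.comp y.mor = Mor.tens (A := A) ρ.e (fun j => F.pre (A := fun a => A (ρ.e ⟨j, a⟩)) (y j).2
      (fun a => (ρ.σ ⟨j, a⟩).hom)) :=
  Mor.comp_tens_hom_aux ρ _

/-- Isomorphisms of the fibres of a morphism with the members of a family, compatible with the
morphisms. -/
abbrev Fam.FiberIso (y : Fam X) (G : F.Mor A X) (j : κ) :=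
  {a : FIso (fun i : {i // G.π i = j} => A i.1) (y j).1.2 // a.mor.into (y j).2 = G.hom j}

/-- Isomorphisms over the target, assembled from isomorphisms of the fibres. -/
def Fam.glue (y : Fam X) {G : F.Mor A X} (a : ∀ j, y.FiberIso G j) :
    {ρ : FIso A y.src // ρ.mor.comp y.mor = G} :=
  ⟨⟨(Equiv.sigmaCongrRight fun j => (a j).1.e).trans (Equiv.sigmaFiberEquiv G.π),
    fun p => (a p.1).1.σ p.2⟩, by
    rw [Fam.comp_mor]
    refine (Mor.tens_congrRight (fun j => (a j).1.e) (Equiv.sigmaFiberEquiv G.π) _).trans ?_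
    refine Eq.trans ?_ (Mor.tens_fiber G)
    refine congrArg _ (funext fun j => ?_)
    exact ((a j).1.mor_into' _).symm.trans (a j).2⟩

/-- An isomorphism compatible with the morphisms to `X` respects the fibres over the index set of
`X`; it therefore splits into its restrictions to the fibres. -/
lemma Fam.glue_bijective (y : Fam X) (G : F.Mor A X) :
    Function.Bijective (y.glue (G := G)) := by
  constructor
  · intro a b h
    have h1 : (y.glue a).1 = (y.glue b).1 := congrArg Subtype.val h
    have h2 : ∀ {a b : FIso A y.src} (_ : a = b) (p), a.e p = b.e p ∧ HEq (a.σ p) (b.σ p) := by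
      rintro a _ rfl p; exact ⟨rfl, HEq.rfl⟩
    funext j
    refine Subtype.ext (FIso.ext_heq (fun x => Subtype.ext (h2 h1 ⟨j, x⟩).1) fun x => (h2 h1 ⟨j, x⟩).2)
  · rintro ⟨ρ, rfl⟩
    refine ⟨fun j => ⟨⟨Mor.blockEquiv ρ.e j, fun x => ρ.σ ⟨j, x⟩⟩, ?_⟩, ?_⟩
    · rw [FIso.mor_into']
      refine Eq.trans ?_ (Mor.hom_congr (y.comp_mor ρ) j)
      exact (map_id' _ (Equiv.ext fun _ => rfl) _ _ HEq.rfl).symm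
    · exact Subtype.ext (FIso.ext_heq (fun _ => rfl) fun _ => HEq.rfl)

lemma Fam.card_glue {κ : Type} [Fintype κ] {X : κ → F.V} (y : Fam X) (G : F.Mor A X) :
    Nat.card {ρ : FIso A y.src // ρ.mor.comp y.mor = G} = ∏ j, Nat.card (y.FiberIso G j) := by
  rw [← Nat.card_pi, Nat.card_congr (Equiv.ofBijective _ (y.glue_bijective G))]

end Families

section Counting

/-- A count of groupoid cardinality: wherever something is counted the weight is `1 / N`, and there
are `N` things in all. -/
lemma weighted_count {k : Type u} [Field k] [CharZero k] {S : Type*} [Fintype S] (E : S → Type*)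
    [∀ x, Finite (E x)] (w : S → k) {N : ℕ} (hN : N ≠ 0) (hw : ∀ x, E x → w x = (N : k)⁻¹)
    (hc : Nat.card (Σ x, E x) = N) : ∑ x, w x * Nat.card (E x) = 1 := by
  have h1 : ∀ x, w x * Nat.card (E x) = (N : k)⁻¹ * Nat.card (E x) := by
    intro x
    rcases isEmpty_or_nonempty (E x) with h | ⟨⟨y⟩⟩
    · simp
    · rw [hw x y]
  simp only [h1]
  rw [← Finset.mul_sum, ← Nat.cast_sum, ← Nat.card_sigma, hc,
    inv_mul_cancel₀ (Nat.cast_ne_zero.2 hN)]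

instance (C : F.Cubical) (v : F.V) : Finite (C.DegOne v) := C.finite_deg_one v
noncomputable instance (C : F.Cubical) (v : F.V) : Fintype (C.DegOne v) := Fintype.ofFinite _

/-- The weight of a family. -/
noncomputable def wt (k : Type u) [Field k] {ι : Type} [Fintype ι] (A : ι → F.V) : k :=
  (isoCard A : k)⁻¹

lemma wt_eq {k : Type u} [Field k] {ι κ : Type} [Fintype ι] [Fintype κ] {A : ι → F.V} {B : κ → F.V}
    (a : FIso A B) : wt k A = wt k B := by
  unfold wt; rw [isoCard_eq a.mor_isIso]

variable {ι : Type} {A : ι → F.V} {v : F.V}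

lemma Cubical.mor_of_isIso {κ : Type} [Fintype ι] [Fintype κ] {A : ι → F.V} {B : κ → F.V} {g : F.Mor A B}
    (hg : g.IsIso) : C.mor g = 0 := by
  have h := C.mor_comp g hg.inv
  rw [hg.comp_inv] at h
  have h' := C.mor_comp (Mor.id F A) (Mor.id F A)
  rw [Mor.id_comp] at h'
  omega

lemma Cubical.deg_single [Finite ι] (f : F.Hom A v) : C.mor (Mor.single f) = C.deg f := by
  unfold Degree.mor
  rw [Fintype.sum_unique]
  exact C.deg_map _ _

lemma Cubical.deg_mor_into {κ : Type} [Fintype ι] [Fintype κ] {A : ι → F.V} {B : κ → F.V} {g : F.Mor A B}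
    (hg : g.IsIso) (f : F.Hom B v) : C.deg (g.into f) = C.deg f := by
  rw [C.deg_into, C.mor_of_isIso hg, add_zero]

/-- The enumeration of a family. -/
lemma exists_inIso [Finite ι] (A : ι → F.V) : Nonempty (InIso A) := by
  have := Fintype.ofFinite ι
  have h : 0 < Nat.card (InIso A) := by rw [card_inIso]; exact isoCard_pos A
  exact (Nat.card_pos_iff.1 h).1

lemma Cubical.isIso_of_mor_eq_zero {κ : Type} [Fintype ι] [Fintype κ] {A : ι → F.V} {B : κ → F.V} (g : F.Mor A B)
    (hg : C.mor g = 0) : g.IsIso := by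
  obtain ⟨W, a, ha⟩ := exists_inIso A
  obtain ⟨W', b, hb⟩ := exists_inIso B
  have h1 := C.isIso_of_deg_zero (A := W) (B := W') ((a.comp g).comp hb.inv) (by
    rw [C.mor_comp, C.mor_comp, hg, C.mor_of_isIso ha, C.mor_of_isIso hb.inv_isIso])
  have h2 : g = ha.inv.comp (((a.comp g).comp hb.inv).comp b) := by
    rw [Mor.comp_assoc, hb.inv_comp, Mor.comp_id, ha.inv_comp_assoc]
  rw [h2]
  exact ha.inv_isIso.comp (h1.comp hb)

/-- The identity of a vertex, as a morphism from a word. -/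
def idHom (v : F.V) : F.Hom (fun _ : Fin 1 => v) v :=
  F.map (Equiv.ofUnique Unit (Fin 1)) (A := fun _ : Fin 1 => v) (F.one v)

lemma deg_idHom (v : F.V) : C.deg (idHom v) = 0 := by
  refine (C.deg_map _ _).trans (C.deg_one v)

lemma single_idHom_isIso (C : F.Cubical) (v : F.V) : (Mor.single (idHom v)).IsIso :=
  C.isIso_of_mor_eq_zero _ (by rw [C.deg_single, deg_idHom])

/-- Composition with the identity of `v` loses nothing, so the isomorphism is `h` itself, provided
that `h` has degree zero and is thereby invertible. -/
lemma card_fiberIso_idHom [Fintype ι] (h : F.Hom A v) :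
    Nat.card {a : FIso A (fun _ : Fin 1 => v) // a.mor.into (idHom v) = h} =
      if C.deg h = 0 then 1 else 0 := by
  split_ifs with h0
  · have h1 : (Mor.single h).IsIso := C.isIso_of_mor_eq_zero _ (by rw [C.deg_single, h0])
    have h2 := single_idHom_isIso C v
    obtain ⟨a, ha⟩ := FIso.exists_mor_eq (h1.comp h2.inv_isIso)
    refine Nat.card_eq_one_iff_unique.2 ⟨⟨fun b b' => Subtype.ext (FIso.mor_injective ?_)⟩, ⟨a, ?_⟩⟩
    · exact h2.cancel_right ((Mor.into_eq_iff _ _ _ _).1 (b.2.trans b'.2.symm))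
    · refine Mor.single_injective ?_
      rw [Mor.single_into, ha, Mor.comp_assoc, h2.inv_comp, Mor.comp_id]
  · rw [Nat.card_eq_zero]
    refine Or.inl ⟨fun a => h0 ?_⟩
    rw [← a.2, C.deg_mor_into a.1.mor_isIso, deg_idHom]

/-- An isomorphism `a : A ≅ Y` determines `g = h ∘ a⁻¹`. Pairs `(g, a)` are thus the same as
isomorphisms from `A` to words, and all of them have the weight `1 / isoCard A`. -/
lemma sum_card_fiberIso (k : Type u) [Field k] [CharZero k] [Fintype ι] (h : F.Hom A v) :
    ∑ g : C.DegOne v, wt k g.1.2 * Nat.card {a : FIso A g.1.2 // a.mor.into g.2.1 = h} =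
      if C.deg h = 1 then 1 else 0 := by
  split_ifs with h1
  · refine weighted_count _ _ (isoCard_pos A).ne' (fun g a => ?_) ?_
    · rw [← wt_eq a.1]; rfl
    · rw [← card_outIso]
      refine Nat.card_congr
        { toFun := fun x => ⟨x.1.1, x.2.1.mor, x.2.1.mor_isIso⟩
          invFun := fun x => ⟨⟨x.1, x.2.2.inv.into h, by rw [C.deg_mor_into x.2.2.inv_isIso, h1]⟩,
            ⟨isoEquiv x.2, by
              have : (isoEquiv x.2).mor = x.2.1 := congrArg Subtype.val (isoEquiv.symm_apply_apply x.2)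
              rw [this, ← Mor.comp_into, x.2.2.comp_inv, Mor.id_into]⟩⟩
          left_inv := ?_
          right_inv := fun x => ?_ }
      · rintro ⟨⟨Y, g, hg⟩, a, rfl⟩
        have e1 : a.mor_isIso.inv.into (a.mor.into g) = g := by
          rw [← Mor.comp_into, a.mor_isIso.inv_comp, Mor.id_into]
        have key : ∀ g' (hg') (a' : FIso A Y.2) (ha'), g' = g → a' = a →
            (⟨⟨Y, g', hg'⟩, a', ha'⟩ : Σ g' : C.DegOne v, {a' : FIso A g'.1.2 // a'.mor.into g'.2.1 = a.mor.into g}) =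
              ⟨⟨Y, g, hg⟩, a, rfl⟩ := by
          rintro _ _ _ _ rfl rfl; rfl
        exact key _ _ _ _ e1 (isoEquiv.apply_symm_apply a)
      · exact Sigma.ext rfl (heq_of_eq (isoEquiv.symm_apply_apply x.2))
  · refine Finset.sum_eq_zero fun g _ => ?_
    have : IsEmpty {a : FIso A g.1.2 // a.mor.into g.2.1 = h} :=
      ⟨fun a => h1 (by rw [← a.2, C.deg_mor_into a.1.mor_isIso, g.2.2])⟩
    simp

end Counting
end FeynmanCategory

/-! ### Factorizations of morphisms of degree two and their enumeration. -/

namespace FeynmanCategory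

variable {F : FeynmanCategory.{u}} {C : F.Cubical}

section Pad

variable {ι κ : Type} [Fintype ι] [Fintype κ] [DecidableEq κ] {A : ι → F.V} {X : κ → F.V} {v : F.V}

/-- The family with the given member in the place `i` and identities elsewhere. -/
def pad (i : κ) (y : Σ Y : F.Word, F.Hom Y.2 (X i)) : Fam X :=
  Function.update (fun j => ⟨⟨1, fun _ => X j⟩, idHom (X j)⟩) i y

lemma pad_self (i : κ) (y : Σ Y : F.Word, F.Hom Y.2 (X i)) : pad i y i = y := Function.update_self _ _ _

lemma pad_of_ne {i j : κ} (h : j ≠ i) (y : Σ Y : F.Word, F.Hom Y.2 (X i)) :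
    pad i y j = ⟨⟨1, fun _ => X j⟩, idHom (X j)⟩ := Function.update_of_ne h _ _

lemma deg_pad (i j : κ) (y : Σ Y : F.Word, F.Hom Y.2 (X i)) :
    C.deg (pad i y j).2 = if j = i then C.deg y.2 else 0 := by
  split_ifs with h
  · subst h; rw [pad_self]
  · rw [pad_of_ne h]; exact deg_idHom _

lemma mor_pad (i : κ) (y : Σ Y : F.Word, F.Hom Y.2 (X i)) : C.mor (pad i y).mor = C.deg y.2 := by
  unfold Degree.mor Fam.mor
  have h : ∀ j, C.deg ((Mor.tens (A := (pad i y).src) (Equiv.refl _) (fun j => (pad i y j).2)).hom j) =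
      C.deg (pad i y j).2 := fun j => C.deg_map (Mor.blockEquiv (Equiv.refl (pad i y).Idx) j) _
  simp only [h, deg_pad, Finset.sum_ite_eq', Finset.mem_univ, if_true]

/-- A morphism of degree one has a single component of degree one, all others being isomorphisms.
The place `i` has to be that of this component, where `sum_card_fiberIso` applies. -/
lemma sum_card_pad (k : Type u) [Field k] [CharZero k] (G : F.Mor A X) (hG : C.mor G = 1) :
    ∑ i, ∑ g : C.DegOne (X i), wt k g.1.2 *
      Nat.card {ρ : FIso A (pad i ⟨g.1, g.2.1⟩ : Fam X).src // ρ.mor.comp (pad i ⟨g.1, g.2.1⟩ : Fam X).mor = G} = 1 := by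
  have h1 : ∀ i, ∑ g : C.DegOne (X i), wt k g.1.2 *
      (Nat.card {ρ : FIso A (pad i ⟨g.1, g.2.1⟩ : Fam X).src //
        ρ.mor.comp (pad i ⟨g.1, g.2.1⟩ : Fam X).mor = G} : k) =
      if C.deg (G.hom i) = 1 then 1 else 0 := by
    intro i
    -- If the component at `i` has degree one, all others have degree zero and each contributes a
    -- factor `1`. In the remaining case the other factors are irrelevant, because the sum over `g`
    -- of the first one vanishes.
    have h2 : ∀ g : C.DegOne (X i), Nat.card {ρ : FIso A (pad i ⟨g.1, g.2.1⟩ : Fam X).src //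
        ρ.mor.comp (pad i ⟨g.1, g.2.1⟩ : Fam X).mor = G} =
        Nat.card {a : FIso (fun i' : {i' // G.π i' = i} => A i'.1) g.1.2 // a.mor.into g.2.1 = G.hom i} *
          if C.deg (G.hom i) = 1 then 1 else
            ∏ j ∈ Finset.univ.erase i, if C.deg (G.hom j) = 0 then 1 else 0 := by
      intro g
      rw [Fam.card_glue, ← Finset.mul_prod_erase Finset.univ _ (Finset.mem_univ i)]
      have e1 : ∀ y : (Σ Y : F.Word, F.Hom Y.2 (X i)), y = ⟨g.1, g.2.1⟩ →
          Nat.card {a : FIso (fun i' : {i' // G.π i' = i} => A i'.1) y.1.2 // a.mor.into y.2 = G.hom i} =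
          Nat.card {a : FIso (fun i' : {i' // G.π i' = i} => A i'.1) g.1.2 // a.mor.into g.2.1 = G.hom i} := by
        rintro _ rfl; rfl
      have e2 : ∀ j, j ≠ i → Nat.card ((pad i ⟨g.1, g.2.1⟩ : Fam X).FiberIso G j) =
          if C.deg (G.hom j) = 0 then 1 else 0 := by
        intro j hj
        rw [← card_fiberIso_idHom]
        have : ∀ y : (Σ Y : F.Word, F.Hom Y.2 (X j)), y = ⟨⟨1, fun _ => X j⟩, idHom (X j)⟩ →
          Nat.card {a : FIso (fun i' : {i' // G.π i' = j} => A i'.1) y.1.2 // a.mor.into y.2 = G.hom j} =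
          Nat.card {a : FIso (fun i' : {i' // G.π i' = j} => A i'.1) (fun _ : Fin 1 => X j) //
            a.mor.into (idHom (X j)) = G.hom j} := by
          rintro _ rfl; rfl
        exact this _ (pad_of_ne hj _)
      rw [Finset.prod_congr rfl fun j hj => e2 j (Finset.ne_of_mem_erase hj)]
      refine congrArg₂ (· * ·) (e1 _ (pad_self i _)) ?_
      split_ifs with h
      · refine Finset.prod_eq_one fun j hj => if_pos ?_
        have := Finset.add_sum_erase Finset.univ (fun j => C.deg (G.hom j)) (Finset.mem_univ i)
        have h' : ∑ j, C.deg (G.hom j) = 1 := hG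
        rw [h', h] at this
        exact (Finset.sum_eq_zero_iff.1 (Nat.add_left_cancel (this.trans (add_zero 1).symm))) j hj
      · rfl
    simp only [h2, Nat.cast_mul, ← mul_assoc]
    rw [← Finset.sum_mul, sum_card_fiberIso]
    split_ifs <;> simp
  simp only [h1]
  have hG' : ∑ j, C.deg (G.hom j) = 1 := hG
  have hle : ∀ j, C.deg (G.hom j) ≤ 1 := fun j =>
    hG' ▸ Finset.single_le_sum (f := fun j => C.deg (G.hom j)) (fun _ _ => Nat.zero_le _) (Finset.mem_univ j)
  have h3 : ∀ j, (if C.deg (G.hom j) = 1 then (1 : k) else 0) = (C.deg (G.hom j) : k) := by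
    intro j
    have := hle j
    interval_cases h : C.deg (G.hom j) <;> simp
  simp only [h3]
  rw [← Nat.cast_sum, hG', Nat.cast_one]

end Pad

section Square

variable {ι : Type} [Fintype ι] {A : ι → F.V} {v : F.V}

/-- A generating morphism, as a morphism to a word. -/
noncomputable def mor1 (C : F.Cubical) {X : ι → F.V} (f : F.Hom X v) : F.Mor X (⟨1, fun _ => v⟩ : F.Word).2 :=
  (Mor.single f).comp (single_idHom_isIso C v).inv

lemma mor1_surjective {X : ι → F.V} (g : F.Mor X (⟨1, fun _ => v⟩ : F.Word).2) :
    ∃ f : F.Hom X v, mor1 C f = g := by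
  obtain ⟨f, hf⟩ := Mor.single_surjective (g.comp (Mor.single (idHom v)))
  refine ⟨f, ?_⟩
  unfold mor1
  rw [hf, Mor.comp_assoc, (single_idHom_isIso C v).comp_inv, Mor.comp_id]

lemma deg_mor1 {X : ι → F.V} (f : F.Hom X v) : C.mor (mor1 C f) = C.deg f := by
  unfold mor1
  rw [C.mor_comp, C.deg_single, C.mor_of_isIso (single_idHom_isIso C v).inv_isIso, zero_add]

lemma comp_mor1 {κ : Type} [Fintype κ] {X : κ → F.V} (g : F.Mor A X) (f : F.Hom X v) :
    g.comp (mor1 C f) = mor1 C (g.into f) := by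
  unfold mor1
  rw [Mor.single_into, Mor.comp_assoc]

lemma mor1_injective {X : ι → F.V} : Function.Injective (mor1 C : F.Hom X v → _) := fun _ _ h =>
  Mor.single_injective ((single_idHom_isIso C v).inv_isIso.cancel_right h)

/-- A factorization as a sequence. -/
noncomputable def chain2 {A X : F.Word} (g : F.Mor A.2 X.2) (f : F.Hom X.2 v) (hg : C.mor g = 1)
    (hf : C.deg f = 1) : C.Chain A ⟨1, fun _ => v⟩ 2 :=
  .cons g hg (.cons (mor1 C f) ((deg_mor1 f).trans hf) (.nil _))

lemma composite_chain2 {A X : F.Word} (g : F.Mor A.2 X.2) (f : F.Hom X.2 v) (hg : C.mor g = 1)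
    (hf : C.deg f = 1) : (chain2 g f hg hf).composite = mor1 C (g.into f) := by
  refine Eq.trans ?_ (comp_mor1 g f)
  exact congrArg g.comp (Mor.comp_id _)

lemma chain2_surjective {A : F.Word} (c : C.Chain A ⟨1, fun _ => v⟩ 2) :
    ∃ (X : F.Word) (g : F.Mor A.2 X.2) (f : F.Hom X.2 v) (hg : C.mor g = 1) (hf : C.deg f = 1),
      chain2 g f hg hf = c := by
  obtain _ | @⟨_, X, _, _, g, hg, c⟩ := c
  obtain _ | @⟨_, Y, _, _, f', hf', c⟩ := c
  cases c
  obtain ⟨f, rfl⟩ := mor1_surjective (C := C) f'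
  exact ⟨X, g, f, hg, (deg_mor1 f).symm.trans hf', rfl⟩

/-- Translates the axioms on sequences of length two into statements about factorizations; the word
`v` with one letter replaces the vertex. -/
lemma chain2_equiv_iff {A X X' : F.Word} (g : F.Mor A.2 X.2) (f : F.Hom X.2 v) (hg : C.mor g = 1)
    (hf : C.deg f = 1) (g' : F.Mor A.2 X'.2) (f' : F.Hom X'.2 v) (hg' : C.mor g' = 1)
    (hf' : C.deg f' = 1) :
    (chain2 g f hg hf).Equiv (chain2 g' f' hg' hf') ↔ EquivFact g f g' f' := by
  constructor
  · rintro (_ | @⟨_, _, _, _, _, _, _, τ, _, _, _, _, _, _, hτ, w, h⟩)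
    rcases h with _ | @⟨_, _, _, _, _, _, _, τ', _, _, _, _, _, _, hτ', w', h⟩
    cases h
    refine ⟨τ, hτ, by rw [w, Mor.id_comp], mor1_injective (C := C) ?_⟩
    rw [Mor.comp_id] at w'
    rw [w', comp_mor1]
  · rintro ⟨τ, hτ, h1, h2⟩
    refine .cons hg hg' hτ (by rw [h1, Mor.id_comp]) ?_
    refine .cons _ _ Mor.IsIso.id ?_ (.nil _)
    rw [Mor.comp_id, comp_mor1, h2]

lemma perm_two (σ : Equiv.Perm (Fin 2)) : σ = 1 ∨ σ = Equiv.swap 0 1 := by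
  revert σ; decide

lemma chainEquiv_symm {A : F.Word} {c c' : C.Chain A ⟨1, fun _ => v⟩ 2} (h : c.Equiv c') : c'.Equiv c := by
  obtain ⟨X, g, f, hg, hf, rfl⟩ := chain2_surjective c
  obtain ⟨X', g', f', hg', hf', rfl⟩ := chain2_surjective c'
  exact (chain2_equiv_iff _ _ _ _ _ _ _ _).2 ((chain2_equiv_iff _ _ _ _ _ _ _ _).1 h).symm

lemma EquivFact.comp_left {κ l l' : Type} [Fintype κ] [Finite l] [Finite l'] {B : κ → F.V} {X : l → F.V}
    {X' : l' → F.V} {g : F.Mor A X} {f : F.Hom X v} {g' : F.Mor A X'} {f' : F.Hom X' v}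
    (h : EquivFact g f g' f') (a : F.Mor B A) : EquivFact (a.comp g) f (a.comp g') f' := by
  obtain ⟨τ, hτ, rfl, rfl⟩ := h
  exact ⟨τ, hτ, Mor.comp_assoc _ _ _, rfl⟩

lemma EquivFact.of_comp_left {κ l l' : Type} [Fintype κ] [Finite l] [Finite l'] {B : κ → F.V} {X : l → F.V}
    {X' : l' → F.V} {g : F.Mor A X} {f : F.Hom X v} {g' : F.Mor A X'} {f' : F.Hom X' v}
    {a : F.Mor B A} (ha : a.IsIso) (h : EquivFact (a.comp g) f (a.comp g') f') :
    EquivFact g f g' f' := by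
  have := h.comp_left ha.inv
  rwa [ha.inv_comp_assoc, ha.inv_comp_assoc] at this

/-- Besides the class of a given factorization there is exactly one further class of factorizations. -/
lemma exists_other_word (C : F.Cubical) {A X : F.Word} (g : F.Mor A.2 X.2) (f : F.Hom X.2 v) (hg : C.mor g = 1)
    (hf : C.deg f = 1) :
    ∃ (X₀ : F.Word) (g₀ : F.Mor A.2 X₀.2) (f₀ : F.Hom X₀.2 v), C.mor g₀ = 1 ∧ C.deg f₀ = 1 ∧
      g₀.into f₀ = g.into f ∧ ¬ EquivFact g f g₀ f₀ ∧
      ∀ (X' : F.Word) (g' : F.Mor A.2 X'.2) (f' : F.Hom X'.2 v), C.mor g' = 1 → C.deg f' = 1 →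
        g'.into f' = g.into f → EquivFact g f g' f' ∨ EquivFact g₀ f₀ g' f' := by
  -- The second class is the image of the given one under the transposition. Freeness of the action
  -- separates the two, and transitivity on the fibres of composition leaves no third.
  obtain ⟨X₀, g₀, f₀, hg₀, hf₀, h⟩ := chain2_surjective (C.perm (Equiv.swap 0 1) (chain2 g f hg hf))
  refine ⟨X₀, g₀, f₀, hg₀, hf₀, ?_, fun h' => ?_, fun X' g' f' hg' hf' h' => ?_⟩
  · refine mor1_injective (C := C) ?_
    rw [← composite_chain2 g₀ f₀ hg₀ hf₀, ← composite_chain2 g f hg hf, eq_comm, C.composite_eq_iff, h]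
    refine ⟨Equiv.swap 0 1, ?_⟩
    obtain ⟨Y, a, b, ha, hb, e⟩ := chain2_surjective (C.perm (Equiv.swap 0 1) (chain2 g f hg hf))
    rw [← e]
    exact (chain2_equiv_iff _ _ _ _ _ _ _ _).2 ⟨Mor.id F _, Mor.IsIso.id, Mor.comp_id _, Mor.id_into _⟩
  · have h1 := (chain2_equiv_iff g f hg hf g₀ f₀ hg₀ hf₀).2 h'
    rw [h] at h1
    have := C.perm_free _ _ (chainEquiv_symm h1)
    exact absurd this (by decide)
  · have h1 : (chain2 g f hg hf).composite = (chain2 g' f' hg' hf').composite := by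
      rw [composite_chain2, composite_chain2, h']
    obtain ⟨σ, hσ⟩ := (C.composite_eq_iff _ _).1 h1
    rcases perm_two σ with rfl | rfl
    · left
      obtain ⟨Y, a, b, ha, hb, e⟩ := chain2_surjective (C.perm 1 (chain2 g f hg hf))
      have h2 := C.perm_one (chain2 g f hg hf)
      rw [← e] at h2 hσ
      obtain ⟨τ, hτ, rfl, rfl⟩ := ((chain2_equiv_iff _ _ _ _ _ _ _ _).1 h2).symm
      obtain ⟨τ', hτ', rfl, e'⟩ := (chain2_equiv_iff _ _ _ _ _ _ _ _).1 hσ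
      exact ⟨τ.comp τ', hτ.comp hτ', (Mor.comp_assoc _ _ _).symm, by rw [Mor.comp_into, e']⟩
    · right
      rw [← h] at hσ
      exact (chain2_equiv_iff _ _ _ _ _ _ _ _).1 hσ

lemma exists_other (C : F.Cubical) {X : F.Word} (g : F.Mor A X.2) (f : F.Hom X.2 v) (hg : C.mor g = 1)
    (hf : C.deg f = 1) :
    ∃ (X₀ : F.Word) (g₀ : F.Mor A X₀.2) (f₀ : F.Hom X₀.2 v), C.mor g₀ = 1 ∧ C.deg f₀ = 1 ∧
      g₀.into f₀ = g.into f ∧ ¬ EquivFact g f g₀ f₀ ∧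
      ∀ (X' : F.Word) (g' : F.Mor A X'.2) (f' : F.Hom X'.2 v), C.mor g' = 1 → C.deg f' = 1 →
        g'.into f' = g.into f → EquivFact g f g' f' ∨ EquivFact g₀ f₀ g' f' := by
  obtain ⟨W, a, ha⟩ := exists_inIso A
  have hd : ∀ {X : F.Word} (g : F.Mor A X.2), C.mor (a.comp g) = C.mor g := fun g => by
    rw [C.mor_comp, C.mor_of_isIso ha, add_zero]
  obtain ⟨X₀, g₀, f₀, hg₀, hf₀, h1, h2, h3⟩ := exists_other_word C (a.comp g) f ((hd g).trans hg) hf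
  have e0 : g₀ = a.comp (ha.inv.comp g₀) := (ha.comp_inv_assoc _).symm
  refine ⟨X₀, ha.inv.comp g₀, f₀, by rw [← hd, ← e0, hg₀], hf₀, ?_, fun h => h2 ?_,
    fun X' g' f' hg' hf' h' => ?_⟩
  · rw [Mor.comp_into, h1, Mor.comp_into, ← Mor.comp_into, ha.inv_comp, Mor.id_into]
  · have := h.comp_left a
    rwa [← e0] at this
  · rcases h3 X' (a.comp g') f' ((hd g').trans hg') hf' (by rw [Mor.comp_into, h', Mor.comp_into]) with h | h
    · exact Or.inl (h.of_comp_left ha)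
    · rw [e0] at h
      exact Or.inr (h.of_comp_left ha)

lemma rigid_into (C : F.Cubical) {X : F.Word} (g : F.Mor A X.2) (f : F.Hom X.2 v) (hg : C.mor g = 1) (hf : C.deg f = 1)
    (τ : F.Mor X.2 X.2) (hτ : τ.IsIso) (h1 : g.comp τ = g) (h2 : τ.into f = f) : τ = Mor.id F X.2 := by
  obtain ⟨W, a, ha⟩ := exists_inIso A
  refine C.rigid (A := W) (B := ⟨1, fun _ => v⟩) (a.comp g) (mor1 C f) τ ?_ ((deg_mor1 f).trans hf) hτ ?_ ?_
  · rw [C.mor_comp, C.mor_of_isIso ha, add_zero, hg]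
  · rw [Mor.comp_assoc, h1]
  · rw [comp_mor1, h2]

/-- The factorizations with the given composite which are not equivalent to the given one. -/
abbrev Other (C : F.Cubical) {X : F.Word} (g : F.Mor A X.2) (f : F.Hom X.2 v) (x : C.DegOne v) :=
  {g' : F.Mor A x.1.2 // C.mor g' = 1 ∧ g'.into x.2.1 = g.into f ∧ ¬ EquivFact g f g' x.2.1}

/-- All these factorizations arise from one of them, through `X₀`, by an isomorphism out of `X₀`.
Rigidity says that this isomorphism is unique, so they are in bijection with the isomorphisms from
`X₀` to words. -/
lemma exists_other_equiv (C : F.Cubical) {X : F.Word} (g : F.Mor A X.2) (f : F.Hom X.2 v) (hg : C.mor g = 1)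
    (hf : C.deg f = 1) :
    ∃ X₀ : F.Word, (∀ x, Other C g f x → isoCard x.1.2 = isoCard X₀.2) ∧
      Nonempty (OutIso X₀.2 ≃ Σ x, Other C g f x) := by
  obtain ⟨X₀, g₀, f₀, hg₀, hf₀, h1, h2, h3⟩ := exists_other C g f hg hf
  have key : ∀ x, ∀ y : Other C g f x, EquivFact g₀ f₀ y.1 x.2.1 := fun x y =>
    (h3 x.1 y.1 x.2.1 y.2.1 x.2.2 y.2.2.1).resolve_left y.2.2.2
  refine ⟨X₀, fun x y => ?_, ⟨Equiv.ofBijective (fun z => ⟨⟨z.1, z.2.2.inv.into f₀, ?_⟩,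
    g₀.comp z.2.1, ?_, ?_, ?_⟩) ⟨?_, ?_⟩⟩⟩
  · obtain ⟨τ, hτ, -⟩ := key x y
    exact (isoCard_eq hτ).symm
  · rw [C.deg_mor_into z.2.2.inv_isIso, hf₀]
  · rw [C.mor_comp, C.mor_of_isIso z.2.2, zero_add, hg₀]
  · dsimp only
    rw [Mor.comp_into, ← Mor.comp_into z.2.1, z.2.2.comp_inv, Mor.id_into, h1]
  · rintro ⟨τ, hτ, e1, e2⟩
    refine h2 ⟨τ.comp z.2.2.inv, hτ.comp z.2.2.inv_isIso, ?_, ?_⟩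
    · rw [← Mor.comp_assoc, e1, Mor.comp_assoc, z.2.2.comp_inv, Mor.comp_id]
    · rw [Mor.comp_into]; exact e2
  · rintro ⟨Y, τ, hτ⟩ ⟨Y', τ', hτ'⟩ h
    have hY : Y = Y' := congrArg (fun z => z.1.1) h
    subst hY
    have e1 : hτ.inv.into f₀ = hτ'.inv.into f₀ := by
      have := congrArg Sigma.fst h
      exact congrArg Subtype.val (eq_of_heq (Sigma.mk.inj this).2)
    have e2 : g₀.comp τ = g₀.comp τ' := by
      have : ∀ {x x' : C.DegOne v} (hx : x = x') (y : Other C g f x) (y' : Other C g f x'), HEq y y' →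
          HEq y.1 y'.1 := by
        rintro x _ rfl y _ ⟨⟩; exact HEq.rfl
      exact eq_of_heq (this (congrArg Sigma.fst h) _ _ (Sigma.mk.inj h).2)
    have e3 : τ.comp hτ'.inv = Mor.id F X₀.2 := by
      refine rigid_into C g₀ f₀ hg₀ hf₀ _ (hτ.comp hτ'.inv_isIso) ?_ ?_
      · rw [← Mor.comp_assoc, e2, Mor.comp_assoc, hτ'.comp_inv, Mor.comp_id]
      · rw [Mor.comp_into, ← e1, ← Mor.comp_into, hτ.comp_inv, Mor.id_into]
    have e4 : τ = τ' := hτ'.inv_isIso.cancel_right (by rw [e3, hτ'.comp_inv])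
    subst e4
    rfl
  · rintro ⟨⟨Y, f', hf'⟩, ⟨g', hg', h4, h5⟩⟩
    obtain ⟨τ, hτ, rfl, e2⟩ := key ⟨Y, f', hf'⟩ ⟨g', hg', h4, h5⟩
    refine ⟨⟨Y, τ, hτ⟩, ?_⟩
    dsimp only at e2
    have e3 : hτ.inv.into f₀ = f' := by rw [← e2, ← Mor.comp_into, hτ.inv_comp, Mor.id_into]
    have : ∀ f'' (h : C.deg f'' = 1) (hh), f'' = f' →
        (⟨⟨Y, f'', h⟩, ⟨g₀.comp τ, hh⟩⟩ : Σ x, Other C g f x) = ⟨⟨Y, f', hf'⟩, ⟨g₀.comp τ, hg', h4, h5⟩⟩ := by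
      rintro _ _ _ rfl; rfl
    exact this _ _ _ e3

lemma finite_other {X : F.Word} (g : F.Mor A X.2) (f : F.Hom X.2 v) (hg : C.mor g = 1)
    (hf : C.deg f = 1) (x) : Finite (Other C g f x) := by
  obtain ⟨X₀, h1, ⟨h2⟩⟩ := exists_other_equiv C g f hg hf
  have : Finite (Σ x, Other C g f x) := Finite.of_equiv _ h2
  exact Finite.of_injective (fun y => (⟨x, y⟩ : Σ x, Other C g f x)) sigma_mk_injective

lemma sum_card_other (k : Type u) [Field k] [CharZero k] {X : F.Word} (g : F.Mor A X.2) (f : F.Hom X.2 v)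
    (hg : C.mor g = 1) (hf : C.deg f = 1) :
    ∑ x, wt k x.1.2 * Nat.card (Other C g f x) = 1 := by
  obtain ⟨X₀, h1, ⟨h2⟩⟩ := exists_other_equiv C g f hg hf
  have := finite_other g f hg hf
  refine weighted_count _ _ (isoCard_pos X₀.2).ne' (fun x y => ?_) ?_
  · unfold wt; rw [h1 x y]
  · rw [← card_outIso, Nat.card_congr h2]

end Square

section Pairs

/-- Composable pairs of generating morphisms of degree one. -/
abbrev Cubical.Pair (C : F.Cubical) (v : F.V) := Σ x : C.DegOne v, Σ i : Fin x.1.1, C.DegOne (x.1.2 i)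

namespace Cubical.Pair

variable {v : F.V}

/-- The family of a pair. -/
def fam (t : C.Pair v) : Fam t.1.1.2 := pad t.2.1 ⟨t.2.2.1, t.2.2.2.1⟩

lemma mor_fam (t : C.Pair v) : C.mor t.fam.mor = 1 := (mor_pad _ _).trans t.2.2.2.2

/-- Isomorphisms of the sources under which the composites agree, but the factorizations are
inequivalent. -/
abbrev Swap {ι : Type} [Fintype ι] {A : ι → F.V} {X : F.Word} (g : F.Mor A X.2) (f : F.Hom X.2 v) (t : C.Pair v) :=
  {ρ : FIso A t.fam.src // (ρ.mor.comp t.fam.mor).into t.1.2.1 = g.into f ∧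
    ¬ EquivFact g f (ρ.mor.comp t.fam.mor) t.1.2.1}

/-- For a fixed outer morphism and a fixed other factorization the sum over the inner morphisms is
`1` by `sum_card_pad`. What remains is the count `sum_card_other`. -/
lemma sum_card_swap (k : Type u) [Field k] [CharZero k] {ι : Type} [Fintype ι] {A : ι → F.V}
    {X : F.Word} (g : F.Mor A X.2) (f : F.Hom X.2 v) (hg : C.mor g = 1) (hf : C.deg f = 1) :
    ∑ t : C.Pair v, wt k t.1.1.2 * wt k t.2.2.1.2 * Nat.card (Swap g f t) = 1 := by
  rw [← sum_card_other k g f hg hf, Fintype.sum_sigma]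
  refine Finset.sum_congr rfl fun x _ => ?_
  rw [Fintype.sum_sigma]
  have := finite_other g f hg hf
  have := Fintype.ofFinite (Other C g f x)
  have h1 : ∀ i (y : C.DegOne (x.1.2 i)), Nat.card (Swap g f ⟨x, i, y⟩) =
      ∑ g' : Other C g f x, Nat.card {ρ : FIso A (pad i ⟨y.1, y.2.1⟩ : Fam x.1.2).src //
        ρ.mor.comp (pad i ⟨y.1, y.2.1⟩ : Fam x.1.2).mor = g'.1} := by
    intro i y
    rw [← Nat.card_sigma]
    refine Nat.card_congr
      { toFun := fun ρ => ⟨⟨ρ.1.mor.comp _, ?_, ρ.2⟩, ⟨ρ.1, rfl⟩⟩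
        invFun := fun z => ⟨z.2.1, ?_⟩
        left_inv := fun ρ => rfl
        right_inv := ?_ }
    · rw [C.mor_comp, C.mor_of_isIso ρ.1.mor_isIso, add_zero]; exact mor_fam ⟨x, i, y⟩
    · have := z.1.2.2
      rw [← z.2.2] at this
      exact this
    · rintro ⟨⟨g', h⟩, ⟨ρ, hρ⟩⟩
      have : ∀ g'' (h'') (hρ''), g'' = g' → (⟨⟨g'', h''⟩, ⟨ρ, hρ''⟩⟩ : Σ g' : Other C g f x,
        {ρ : FIso A (pad i ⟨y.1, y.2.1⟩ : Fam x.1.2).src //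
          ρ.mor.comp (pad i ⟨y.1, y.2.1⟩ : Fam x.1.2).mor = g'.1}) = ⟨⟨g', h⟩, ⟨ρ, hρ⟩⟩ := by
        rintro _ _ _ rfl; rfl
      exact this _ _ _ hρ
  simp only [h1, Nat.cast_sum, mul_assoc]
  refine Eq.trans (b := wt k x.1.2 * ∑ i, ∑ y : C.DegOne (x.1.2 i), ∑ g' : Other C g f x, wt k y.1.2 *
      (Nat.card {ρ : FIso A (pad i ⟨y.1, y.2.1⟩ : Fam x.1.2).src //
        ρ.mor.comp (pad i ⟨y.1, y.2.1⟩ : Fam x.1.2).mor = g'.1} : k)) ?_ ?_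
  · rw [Finset.mul_sum]
    refine Finset.sum_congr rfl fun i _ => ?_
    rw [Finset.mul_sum]
    refine Finset.sum_congr rfl fun y _ => ?_
    rw [Finset.mul_sum]
  congr 1
  have h2 : ∀ i, ∑ y : C.DegOne (x.1.2 i), ∑ g' : Other C g f x, wt k y.1.2 *
      (Nat.card {ρ : FIso A (pad i ⟨y.1, y.2.1⟩ : Fam x.1.2).src //
        ρ.mor.comp (pad i ⟨y.1, y.2.1⟩ : Fam x.1.2).mor = g'.1} : k) =
      ∑ g' : Other C g f x, ∑ y : C.DegOne (x.1.2 i), wt k y.1.2 *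
      (Nat.card {ρ : FIso A (pad i ⟨y.1, y.2.1⟩ : Fam x.1.2).src //
        ρ.mor.comp (pad i ⟨y.1, y.2.1⟩ : Fam x.1.2).mor = g'.1} : k) := fun i => Finset.sum_comm
  rw [Finset.sum_congr rfl fun i _ => h2 i, Finset.sum_comm,
    Finset.sum_congr rfl fun g' _ => sum_card_pad k g'.1 g'.2.1]
  simp

/-- Passing to inverse isomorphisms exchanges the roles of the two pairs. -/
lemma card_swap_comm (t t' : C.Pair v) :
    Nat.card (Swap t.fam.mor t.1.2.1 t') = Nat.card (Swap t'.fam.mor t'.1.2.1 t) := by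
  have key : ∀ t t' : C.Pair v, ∀ ρ : FIso t.fam.src t'.fam.src,
      ((ρ.mor.comp t'.fam.mor).into t'.1.2.1 = t.fam.mor.into t.1.2.1 ∧
        ¬ EquivFact t.fam.mor t.1.2.1 (ρ.mor.comp t'.fam.mor) t'.1.2.1) →
      ((ρ.mor_isIso.inv.comp t.fam.mor).into t.1.2.1 = t'.fam.mor.into t'.1.2.1 ∧
        ¬ EquivFact t'.fam.mor t'.1.2.1 (ρ.mor_isIso.inv.comp t.fam.mor) t.1.2.1) := by
    rintro t t' ρ ⟨h1, h2⟩
    refine ⟨?_, fun h => h2 ?_⟩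
    · rw [Mor.comp_into, ← h1, ← Mor.comp_into, ρ.mor_isIso.inv_comp_assoc]
    · have := h.symm.comp_left ρ.mor
      rwa [ρ.mor_isIso.comp_inv_assoc] at this
  have h0 : ∀ {A B : Type} [Finite A] [Finite B] {A' : A → F.V} {B' : B → F.V} (ρ : {g : F.Mor A' B' // g.IsIso}),
      (isoEquiv ρ).mor = ρ.1 := fun ρ => congrArg Subtype.val (isoEquiv.symm_apply_apply ρ)
  refine Nat.card_congr
    { toFun := fun ρ => ⟨isoEquiv ⟨ρ.1.mor_isIso.inv, ρ.1.mor_isIso.inv_isIso⟩, by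
        rw [h0]; exact key t t' ρ.1 ρ.2⟩
      invFun := fun ρ => ⟨isoEquiv ⟨ρ.1.mor_isIso.inv, ρ.1.mor_isIso.inv_isIso⟩, by
        rw [h0]; exact key t' t ρ.1 ρ.2⟩
      left_inv := ?_
      right_inv := ?_ }
  all_goals
    intro ρ
    refine Subtype.ext (FIso.mor_injective ((h0 _).trans ?_))
    have h1 := h0 ⟨ρ.1.mor_isIso.inv, ρ.1.mor_isIso.inv_isIso⟩
    refine (FIso.mor_isIso (isoEquiv ⟨ρ.1.mor_isIso.inv, ρ.1.mor_isIso.inv_isIso⟩)).cancel_left ?_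
    refine (Mor.IsIso.comp_inv _).trans ?_
    rw [h1]
    exact ρ.1.mor_isIso.inv_comp.symm

end Cubical.Pair
end Pairs
end FeynmanCategory

/-! ### Sums over degrees, and insertion of an element in one place. -/

section Eps

variable {ι κ : Type} [Fintype ι] [LinearOrder ι] [Fintype κ] [LinearOrder κ]

/-- The sum of the products of pairs of degrees. -/
def eps (l : ι → ℤ) : ℤ := ∑ i, ∑ j with j < i, l i * l j

/-- Expresses the reordering exponent by the sum and the sum of squares, both easy to follow through
a composition. Sign identities become linear arithmetic. -/
lemma two_mul_eps (l : ι → ℤ) : 2 * eps l = (∑ i, l i) ^ 2 - ∑ i, l i ^ 2 := by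
  have h1 : (∑ i, l i) ^ 2 = ∑ i, ∑ j, l i * l j := by rw [sq, Finset.sum_mul_sum]
  have h2 : ∀ i j, l i * l j = (if j < i then l i * l j else 0) + (if i < j then l i * l j else 0) +
      if j = i then l i ^ 2 else 0 := by
    intro i j
    rcases lt_trichotomy i j with h | rfl | h
    · simp [h, h.not_gt, h.ne']
    · simp [sq]
    · simp [h, h.not_gt, h.ne]
  have h3 : ∑ i, ∑ j, (if j < i then l i * l j else 0) = eps l := by
    simp only [eps, Finset.sum_filter]
  have h4 : ∑ i, ∑ j, (if i < j then l i * l j else 0) = eps l := by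
    rw [Finset.sum_comm, ← h3]
    refine Finset.sum_congr rfl fun i _ => Finset.sum_congr rfl fun j _ => ?_
    rw [mul_comm]
  rw [h1]
  conv_rhs => arg 1; arg 2; ext i; arg 2; ext j; rw [h2 i j]
  simp only [Finset.sum_add_distrib, h3, h4, Finset.sum_ite_eq', Finset.mem_univ, if_true]
  ring

end Eps

section Degs

variable {k : Type u} [Field k] {F : FeynmanCategory.{u}} {C : F.Cubical} {s : Bool}

namespace FinOp

variable (P : FinOp k C s)

lemma finite_degs (A : F.Word) (N : ℤ) :
    {l : {l : Fin A.1 → ℤ // ∑ i, l i = N} | ∀ i, Nontrivial (P.obj.obj (A.2 i) (-l.1 i))}.Finite := by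
  refine Set.Finite.of_finite_image ((P.property.2 A (-N)).subset ?_) (f := fun l i => -l.1 i) ?_
  · rintro _ ⟨l, hl, rfl⟩
    exact ⟨by rw [Finset.sum_neg_distrib, l.2], hl⟩
  · intro l _ l' _ h
    exact Subtype.ext (funext fun i => neg_injective (congrFun h i))

/-- The families of degrees of the elements of a tensor product. -/
noncomputable def degs (A : F.Word) (N : ℤ) : Finset {l : Fin A.1 → ℤ // ∑ i, l i = N} :=
  (P.finite_degs A N).toFinset

lemma support_subset_degs {A : F.Word} {N : ℤ} {M : Type*} [AddCommMonoid M]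
    (f : {l : Fin A.1 → ℤ // ∑ i, l i = N} → M)
    (hf : ∀ l i, ¬ Nontrivial (P.obj.obj (A.2 i) (-l.1 i)) → f l = 0) :
    Function.support f ⊆ P.degs A N := by
  intro l hl
  rw [degs, Set.Finite.coe_toFinset]
  intro i
  by_contra h
  exact hl (hf l i h)

/-- Degrees for which some tensor factor vanishes contribute nothing, and finite type leaves
finitely many others. A common finite index set replaces the formally infinite sum. -/
lemma finsum_degs {A : F.Word} {N : ℤ} {M : Type*} [AddCommMonoid M]
    (f : {l : Fin A.1 → ℤ // ∑ i, l i = N} → M)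
    (hf : ∀ l i, ¬ Nontrivial (P.obj.obj (A.2 i) (-l.1 i)) → f l = 0) :
    ∑ᶠ l, f l = ∑ l ∈ P.degs A N, f l :=
  finsum_eq_sum_of_support_subset f (P.support_subset_degs f hf)

end FinOp

end Degs

section Basics

variable {k : Type u} [Field k] {F : FeynmanCategory.{u}} {C : F.Cubical} {s : Bool}

lemma DGOp.d_viso (P : DGOp k C s) {v w : F.V} (σ : F.VIso v w) {n m : ℤ} (h : m = n + 1) (x : P.obj v n) :
    P.d h (P.viso σ n x) = P.viso σ m (P.d h x) := by
  rw [PreOp.viso_apply, P.d_act σ.hom _ _ _ _ _ h, Fintype.sum_unique, PreOp.viso_apply]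
  have : (Finset.univ.filter fun j : Unit => j < default) = ∅ := by ext; simp
  have hs : (s.toNat * (C.deg σ.hom : ℤ) + ∑ j : Unit with j < default, n).negOnePow = 1 := by
    rw [C.deg_viso, this]; simp
  rw [hs, one_smul]
  refine P.act_eq rfl (fun _ => by simp [h]) fun _ => ?_
  subst h
  rfl

namespace GrOp

variable (Q : GrOp k C s) {ι : Type} [Fintype ι] [LinearOrder ι] {A : ι → F.V} {v : F.V}

lemma jsnd_viso {v w : F.V} (σ : F.VIso v w) (n : ℤ) (z : Q.jetPre.obj v n) :
    Q.jsnd (Q.jetPre.viso σ n z) = Q.viso σ (n + 1) (Q.jsnd z) := by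
  rw [PreOp.viso_apply, jsnd_act, Fintype.sum_unique, PreOp.viso_apply]
  have : (Finset.univ.filter fun j : Unit => j < default) = ∅ := by ext; simp
  have hs : (s.toNat * (C.deg σ.hom : ℤ) + ∑ j : Unit with j < default, n).negOnePow = 1 := by
    rw [C.deg_viso, this]; simp
  rw [hs, one_smul]
  exact Q.act_eq rfl (fun _ => by simp [shiftAt]) fun _ => Q.mix_self_heq _ rfl

/-- The projection of jets. -/
noncomputable def jfstHom : GrOp.Hom Q.jetGr Q where
  app _ _ := Q.jfst
  app_act f hf n N hN x := Q.jfst_act f hf n N hN x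

/-- The structure map applied to a family with the element in the place `i` replaced by an element of
degree one more. -/
noncomputable def actPut (f : F.Hom A v) (hf : C.deg f ≤ 1) (l : ι → ℤ) (N : ℤ)
    (hN : N = ∑ i, l i + s.toNat * (C.deg f : ℤ)) (x : ∀ i, Q.obj (A i) (l i)) (i : ι) :
    Q.obj (A i) (l i + 1) →ₗ[k] Q.obj v (N + 1) :=
  ((Q.act f hf (shiftAt i l) (N + 1) (by rw [sum_shift, hN]; ring)).toLinearMap
    (Q.mix (fun j => Q.jmk (x j) 0) i) i).comp (Q.castL (by simp [shiftAt]))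

lemma act_mix_eq_actPut (f : F.Hom A v) (hf : C.deg f ≤ 1) (l : ι → ℤ) (N : ℤ)
    (hN : N = ∑ i, l i + s.toNat * (C.deg f : ℤ)) (z : ∀ i, Q.jetPre.obj (A i) (l i)) (i : ι) (h) :
    Q.act f hf (shiftAt i l) (N + 1) h (Q.mix z i) =
      Q.actPut f hf l N hN (fun j => Q.jfst (z j)) i (Q.jsnd (z i)) := by
  refine congrArg (Q.act f hf (shiftAt i l) (N + 1) h) (funext fun j => ?_)
  by_cases hj : j = i
  · subst hj
    rw [Function.update_self, mix_self]
  · rw [Function.update_of_ne hj, mix_of_ne _ _ hj, mix_of_ne _ _ hj, jfst_jmk]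

lemma actPut_eq (f : F.Hom A v) (hf : C.deg f ≤ 1) (l : ι → ℤ) (N : ℤ)
    (hN : N = ∑ i, l i + s.toNat * (C.deg f : ℤ)) (x : ∀ i, Q.obj (A i) (l i)) (i : ι)
    (y : Q.obj (A i) (l i + 1)) (n' : ι → ℤ) (N' : ℤ) (hN' : N' = N + 1) (h) (x' : ∀ i, Q.obj (A i) (n' i))
    (hn : ∀ j, n' j = shiftAt i l j) (h1 : ∀ j, j ≠ i → HEq (x' j) (x j)) (h2 : HEq (x' i) y) :
    Q.castL hN'.symm (Q.actPut f hf l N hN x i y) = Q.act f hf n' N' h x' := by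
  subst hN'
  rw [PreOp.castL_rfl]
  refine (Q.act_eq rfl hn fun j => ?_).symm
  by_cases hj : j = i
  · subst hj
    rw [Function.update_self]
    exact h2.trans (Q.castL_heq _ _).symm
  · rw [Function.update_of_ne hj]
    exact (h1 j hj).trans (Q.mix_ne_heq (fun j => Q.jmk (x j) 0) hj).symm

end GrOp

end Basics

/-! ### The differential of the Feynman transform, for an arbitrary family of generators. -/

section Differential

variable {k : Type u} [Field k] {F : FeynmanCategory.{u}} {C : F.Cubical} {s : Bool}

namespace FinOp.DualMap

variable {P : FinOp k C s}

lemma deg_source {A : F.Word} {v : F.V} {f : F.Hom A.2 v} (hf : C.deg f = 1) {n : ℤ} {l : Fin A.1 → ℤ}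
    (hl : ∑ i, l i = n + s.toNat) : -n = ∑ i, -l i + s.toNat * (C.deg f : ℤ) := by
  rw [hf, Finset.sum_neg_distrib, hl]; push_cast; ring

lemma deg_target {A : F.Word} {v : F.V} {f : F.Hom A.2 v} (hf : C.deg f = 1) {n m : ℤ} (h : m = n + 1)
    {l : Fin A.1 → ℤ} (hl : ∑ i, l i = n + s.toNat) :
    m = ∑ i, l i + (!s).toNat * (C.deg f : ℤ) := by
  rw [hf, hl, h]; cases s <;> simp

variable {Q : GrOp k C (!s)} (j : P.DualMap Q)

/-- The part of the differential of the Feynman transform which is given by the morphisms of degree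
one. -/
noncomputable def ext {v : F.V} {n m : ℤ} (h : m = n + 1) :
    Module.Dual k (P.obj.obj v (-n)) →ₗ[k] Q.obj v m :=
  ∑ f : C.DegOne v, wt k f.1.2 • ∑ l ∈ P.degs f.1 (n + s.toNat),
    (((s.toNat * n + eps l.1).negOnePow : ℤˣ) : ℤ) •
      j.conv f.2.1 f.2.2.le l.1 (-n) m (deg_source f.2.2 l.2) (deg_target f.2.2 h l.2)

lemma ext_apply {v : F.V} {n m : ℤ} (h : m = n + 1) (ω : Module.Dual k (P.obj.obj v (-n))) :
    j.ext h ω = ∑ f : C.DegOne v, wt k f.1.2 • ∑ l ∈ P.degs f.1 (n + s.toNat),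
      (s.toNat * n + eps l.1).negOnePow •
        j.conv f.2.1 f.2.2.le l.1 (-n) m (deg_source f.2.2 l.2) (deg_target f.2.2 h l.2) ω := by
  simp only [ext, LinearMap.sum_apply, LinearMap.smul_apply, Units.smul_def]

/-- The differential of the Feynman transform on generators. -/
noncomputable def dif {v : F.V} {n m : ℤ} (h : m = n + 1) :
    Module.Dual k (P.obj.obj v (-n)) →ₗ[k] Q.obj v m :=
  ((m.negOnePow : ℤˣ) : ℤ) • (j v m).comp (P.obj.d (show -n = -m + 1 by omega)).dualMap + j.ext h

lemma dif_apply {v : F.V} {n m : ℤ} (h : m = n + 1) (ω : Module.Dual k (P.obj.obj v (-n))) :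
    j.dif h ω = m.negOnePow • j v m (ω.comp (P.obj.d (show -n = -m + 1 by omega))) + j.ext h ω := rfl

/-- Identifies `dif` with the right hand side of `FeynmanTransform.d_gen`. -/
lemma dif_eq_finsum {v : F.V} {n m : ℤ} (h : m = n + 1) (p : Module.Dual k (P.obj.obj v (-n))) :
    j.dif h p = m.negOnePow • j v m (p.comp (P.obj.d (show -n = -m + 1 by omega))) +
      ∑ᶠ f : C.DegOne v,
        ((f.1.1.factorial * ∏ i, F.autCard (f.1.2 i) : ℕ) : k)⁻¹ •
        ∑ᶠ l : {l : Fin f.1.1 → ℤ // ∑ i, l i = n + s.toNat},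
          (s.toNat * n + ∑ i, ∑ j with j < i, l.1 i * l.1 j).negOnePow •
          ∑ a : ∀ i, Fin (Module.finrank k (P.obj.obj (f.1.2 i) (-l.1 i))),
            p (P.obj.act f.2.1 f.2.2.le (fun i => -l.1 i) (-n)
                (by rw [f.2.2, Finset.sum_neg_distrib, l.2]; push_cast; ring)
                (fun i => Module.finBasis k _ (a i))) •
              Q.act f.2.1 f.2.2.le l.1 m
                (by rw [f.2.2, l.2, h]; cases s <;> simp)
                (fun i => j (f.1.2 i) (l.1 i) ((Module.finBasis k _).coord (a i))) := by
  rw [dif_apply, ext_apply, finsum_eq_sum_of_fintype]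
  congr 1
  refine Finset.sum_congr rfl fun f _ => ?_
  refine congrArg₂ (· • ·) ?_ ?_
  · unfold wt isoCard; rw [Fintype.card_fin]
  · rw [← P.finsum_degs]
    · refine finsum_congr fun l => ?_
      rw [convAt_apply, contr_def]
      rfl
    · intro l i hi
      rw [convAt_eq_zero _ _ _ _ _ _ _ _ _ _ _ _ i hi, smul_zero]

/-- Composition with a morphism of operads. -/
def map {Q' : GrOp k C (!s)} (a : GrOp.Hom Q Q') : P.DualMap Q' := fun v n => (a.app v n).comp (j v n)

variable {j}

lemma Equivariant.map (hj : j.Equivariant) {Q' : GrOp k C (!s)} (a : GrOp.Hom Q Q') :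
    (j.map a).Equivariant := by
  intro v w σ n p
  exact (a.app_viso σ n _).symm.trans (congrArg (a.app w n) (hj σ n p))

lemma map_dif {Q' : GrOp k C (!s)} (a : GrOp.Hom Q Q') {v : F.V} {n m : ℤ} (h : m = n + 1)
    (ω : Module.Dual k (P.obj.obj v (-n))) : a.app v m (j.dif h ω) = (j.map a).dif h ω := by
  rw [dif_apply, dif_apply, map_add, Units.smul_def, Units.smul_def, map_zsmul, ext_apply, ext_apply]
  refine congrArg₂ (· + ·) rfl ?_
  rw [map_sum]
  refine Finset.sum_congr rfl fun f _ => ?_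
  rw [map_smul, map_sum]
  refine congrArg _ (Finset.sum_congr rfl fun l _ => ?_)
  rw [Units.smul_def, map_zsmul, ← Units.smul_def]
  refine congrArg _ ?_
  rw [convAt_apply, convAt_apply, map_contr]
  simp only [a.app_act]
  rfl

/-- Composition with an isomorphism, on morphisms of degree one. -/
def postEquiv (C : F.Cubical) {v w : F.V} (σ : F.VIso v w) : C.DegOne v ≃ C.DegOne w where
  toFun f := ⟨f.1, F.post σ.hom f.2.1, by rw [C.deg_post, C.deg_viso, zero_add, f.2.2]⟩
  invFun f := ⟨f.1, F.post σ.inv f.2.1, by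
    rw [C.deg_post, show C.deg σ.inv = 0 from C.deg_viso σ.symm, zero_add, f.2.2]⟩
  left_inv f := by
    obtain ⟨A, f, hf⟩ := f
    simp only [← post_assoc, σ.inv_hom, one_post]
  right_inv f := by
    obtain ⟨A, f, hf⟩ := f
    simp only [← post_assoc, σ.hom_inv, one_post]

/-- Composition with `σ` permutes the morphisms of degree one without changing their sources, hence
without changing their weights. -/
lemma Equivariant.dif (hj : j.Equivariant) {v w : F.V} (σ : F.VIso v w) {n m : ℤ} (h : m = n + 1)
    (p : Module.Dual k (P.obj.obj w (-n))) :
    Q.viso σ m (j.dif h (p.comp (P.obj.viso σ (-n)))) = j.dif h p := by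
  rw [dif_apply, dif_apply, map_add, Units.smul_def, Units.smul_def, map_zsmul, ext_apply, ext_apply]
  refine congrArg₂ (· + ·) (congrArg _ ?_) ?_
  · rw [← hj σ m]
    refine congrArg (fun z => Q.viso σ m (j v m z)) (LinearMap.ext fun x => ?_)
    exact congrArg p (P.obj.d_viso σ _ x).symm
  · rw [map_sum]
    refine Fintype.sum_equiv (postEquiv C σ) _ _ fun f => ?_
    rw [map_smul, map_sum]
    refine congrArg _ (Finset.sum_congr rfl fun l _ => ?_)
    rw [Units.smul_def, map_zsmul, ← Units.smul_def]
    refine congrArg _ ?_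
    exact (conv_post σ f.2.1 _ _ _ _ _ _ _ _ _ p).symm

variable (j) in
/-- The lift to jets. -/
noncomputable def lift : P.DualMap Q.jetGr := fun v n => LinearMap.prod (j v n) (j.dif rfl)

lemma Equivariant.lift (hj : j.Equivariant) : j.lift.Equivariant := by
  intro v w σ n p
  refine GrOp.jext (hj σ n p) ?_
  exact (Q.jsnd_viso σ n _).trans (hj.dif σ rfl p)

lemma conv_map (hj : j.Equivariant) {ι κ : Type} [Fintype ι] [LinearOrder ι] [Fintype κ] [LinearOrder κ]
    (e : κ ≃ ι) {A : ι → F.V} {v : F.V} (f : F.Hom (fun i => A (e i)) v)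
    (h : C.deg f ≤ 1) (h' : C.deg (F.map e (A := A) f) ≤ 1) (l : ι → ℤ) (M N : ℤ) (hM hN hM' hN') :
    j.conv (F.map e (A := A) f) h' l M N hM' hN' = j.conv f h (fun i => l (e i)) M N hM hN := by
  have h1 : F.map e (A := A) f = F.map ((Equiv.sigmaPUnit κ).trans e) (A := A)
      (F.comp (α := fun _ => Unit) (A := fun p => A (e p.1)) f (fun j => F.one (A (e j)))) := by
    exact (congrArg (F.map e (A := A)) (F.comp_one f).symm).trans
      (F.map_map (Equiv.sigmaPUnit κ) e (A := A) _)
  exact conv_reindex hj e f (fun j => VIso.refl F (A (e j))) _ h1 h h' l M N hM hN hM' hN'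

lemma conv_eq_of_id (hj : j.Equivariant) {v : F.V} (y : Σ Y : F.Word, F.Hom Y.2 v)
    (hy : y = ⟨⟨1, fun _ => v⟩, idHom v⟩) (h) (l : Fin y.1.1 → ℤ) (c : ℤ) (hl : ∀ a, l a = c) (hM) (hN)
    (ω) : j.conv y.2 h l (-c) c hM hN ω = j v c ω := by
  subst hy
  obtain rfl : l = fun _ => c := funext hl
  have h1 : C.deg (F.one v) ≤ 1 := by rw [C.deg_one]; exact zero_le_one
  refine (congrFun (congrArg _ (conv_map hj (Equiv.ofUnique Unit (Fin 1)) (A := fun _ => v) (F.one v) h1 h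
    (fun _ => c) (-c) c ?_ ?_ hM hN)) ω).trans (conv_one v c h1 _ _ ω)
  · rw [C.deg_one]; simp
  · rw [C.deg_one]; simp

end FinOp.DualMap
end Differential

/-! ### Contractions along composites of two steps. -/

section Square

lemma contr_units_smul {k : Type u} [Field k] {ι : Type} [Fintype ι] {V : ι → Type u} [∀ i, AddCommGroup (V i)]
    [∀ i, Module k (V i)] [∀ i, Module.Finite k (V i)] {M : Type u} [AddCommGroup M] [Module k M]
    {β β' : (∀ i, V i) → k} {c c' : (∀ i, Module.Dual k (V i)) → M} (a b : ℤˣ)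
    (h : ∀ x, β x = a • β' x) (h' : ∀ x, c x = b • c' x) : contr β c = (a * b) • contr β' c' := by
  obtain rfl : β = fun x => a • β' x := funext h
  obtain rfl : c = fun x => b • c' x := funext h'
  rw [contr_zsmul_left, contr_zsmul_right, smul_smul]

variable {k : Type u} [Field k] {F : FeynmanCategory.{u}} {C : F.Cubical} {s : Bool}

lemma PreOp.actComp_eq (P : PreOp k C s) {ι κ : Type} [Fintype ι] [LinearOrder ι] [Fintype κ]
    [LinearOrder κ] {α : κ → Type} [∀ j, Fintype (α j)] [∀ j, LinearOrder (α j)]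
    (e : (Σ j, α j) ≃ ι) {A : ι → F.V} {B : κ → F.V} {v : F.V}
    (f : F.Hom B v) (hf : C.deg f ≤ 1)
    (g : ∀ j, F.Hom (fun a : α j => A (e ⟨j, a⟩)) (B j)) (hg : ∀ j, C.deg (g j) ≤ 1)
    (n : ι → ℤ) (N : ℤ) (hN) (m : κ → ℤ) (hm : ∀ j, m j = ∑ a, n (e ⟨j, a⟩) + s.toNat * (C.deg (g j) : ℤ))
    (h) (x : ∀ i, P.obj (A i) (n i)) :
    P.actComp e f hf g hg n N hN x = (koszulSign e n *
        passSign (fun j => s.toNat * (C.deg (g j) : ℤ)) (fun j => ∑ a, n (e ⟨j, a⟩))) •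
      P.act f hf m N h (fun j => P.act (g j) (hg j) (fun a => n (e ⟨j, a⟩)) (m j) (hm j)
        (fun a => x (e ⟨j, a⟩))) := by
  obtain rfl : m = fun j => ∑ a, n (e ⟨j, a⟩) + s.toNat * (C.deg (g j) : ℤ) := funext hm
  rfl

/-- Exactly one of the parities `s` and `!s` is odd. The product is therefore the sign of the odd
case, whichever of the two operads it comes from. -/
lemma passSign_mul_passSign {κ : Type} [Fintype κ] [LinearOrder κ] (s : Bool) (b : κ → ℕ) (m m' : κ → ℤ)
    (h : ∀ j, m' j = -m j) :
    passSign (fun j => s.toNat * (b j : ℤ)) m' * passSign (fun j => (!s).toNat * (b j : ℤ)) m =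
      passSign (fun j => (b j : ℤ)) m := by
  unfold passSign
  rw [← Finset.prod_mul_distrib]
  refine Finset.prod_congr rfl fun j _ => ?_
  rw [← Int.negOnePow_add]
  simp only [h, Finset.sum_neg_distrib]
  cases s
  · simp
  · simp [Int.negOnePow_neg]

namespace FinOp.DualMap

variable {P : FinOp k C s} {Q : GrOp k C (!s)} (j : P.DualMap Q)

/-- The contraction of `ω ∘ P(f) ∘ P(G)` with `Q(f) ∘ Q(G)`. -/
noncomputable def sq {W X : F.Word} {v : F.V} (G : F.Mor W.2 X.2) (f : F.Hom X.2 v) (hf : C.deg f ≤ 1)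
    (hG : ∀ i, C.deg (G.hom i) ≤ 1) (K : Fin W.1 → ℤ) (M N : ℤ)
    (hM : M = ∑ i, -K i + s.toNat * ((C.deg f + ∑ i, C.deg (G.hom i) : ℕ) : ℤ))
    (hN : N = ∑ i, K i + (!s).toNat * ((C.deg f + ∑ i, C.deg (G.hom i) : ℕ) : ℤ))
    (ω : Module.Dual k (P.obj.obj v M)) : Q.obj v N :=
  contr (V := fun i => P.obj.obj (W.2 i) (-K i))
    (fun x => ω (P.obj.actComp (Equiv.sigmaFiberEquiv G.π) f hf G.hom hG (fun i => -K i) M hM x))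
    (fun ξ => Q.actComp (Equiv.sigmaFiberEquiv G.π) f hf G.hom hG K N hN (fun i => j _ _ (ξ i)))

/-- The transposition acts on `P` and on `Q`, and exactly one of these operads is odd: a single
minus sign survives. This is the origin of `d² = 0`. -/
lemma sq_swap {W X X' : F.Word} {v : F.V} (G : F.Mor W.2 X.2) (f : F.Hom X.2 v)
    (G' : F.Mor W.2 X'.2) (f' : F.Hom X'.2 v) (h1 : C.mor G = 1) (h2 : C.deg f = 1) (h3 : C.mor G' = 1)
    (h4 : C.deg f' = 1) (h5 : G.into f = G'.into f') (h6 : ¬ EquivFact G f G' f') (hf hG hf' hG')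
    (K : Fin W.1 → ℤ) (M N : ℤ) (hM hN hM' hN') (ω : Module.Dual k (P.obj.obj v M)) :
    j.sq G' f' hf' hG' K M N hM' hN' ω = - j.sq G f hf hG K M N hM hN ω := by
  unfold sq
  have e1 := fun x => P.obj.act_swap G f G' f' h1 h2 h3 h4 h5 h6 hf hG hf' hG' (fun i => -K i) M hM hM' x
  have e2 := fun x => Q.act_swap G f G' f' h1 h2 h3 h4 h5 h6 hf hG hf' hG' K N hN hN' x
  refine (contr_units_smul (β' := fun x => ω (P.obj.actComp (Equiv.sigmaFiberEquiv G.π) f hf G.hom hG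
    (fun i => -K i) M hM x)) (s.toNat : ℤ).negOnePow ((!s).toNat : ℤ).negOnePow (fun x => ?_)
    (fun x => e2 _)).trans ?_
  · refine (congrArg ω (e1 x)).trans ?_
    rw [Units.smul_def, map_zsmul, ← Units.smul_def]
  · rw [← Int.negOnePow_add]
    cases s <;> simp

/-- The Koszul signs in `P` and `Q` cancel and the pass signs combine. By `contr_sigma` the
contraction along the composite is an outer contraction with inner convolutions inserted. -/
lemma sq_eq {W X : F.Word} {v : F.V} (G : F.Mor W.2 X.2) (f : F.Hom X.2 v) (hf : C.deg f ≤ 1)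
    (hG : ∀ i, C.deg (G.hom i) ≤ 1) (K : Fin W.1 → ℤ) (M N : ℤ) (hM) (hN) (m n : Fin X.1 → ℤ)
    (hm : ∀ i, m i = ∑ a : {a // G.π a = i}, -K a.1 + s.toNat * (C.deg (G.hom i) : ℤ))
    (hn : ∀ i, n i = ∑ a : {a // G.π a = i}, K a.1 + (!s).toNat * (C.deg (G.hom i) : ℤ)) (hM' hN')
    (ω : Module.Dual k (P.obj.obj v M)) :
    j.sq G f hf hG K M N hM hN ω =
      passSign (fun i => (C.deg (G.hom i) : ℤ)) (fun i => ∑ a : {a // G.π a = i}, K a.1) •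
      contr (V := fun i => P.obj.obj (X.2 i) (m i)) (fun y => ω (P.obj.act f hf m M hM' y))
        (fun η => Q.act f hf n N hN' (fun i => j.conv (G.hom i) (hG i) (fun a => K a.1) (m i) (n i)
          (hm i) (hn i) (η i))) := by
  unfold sq
  refine (contr_units_smul (β' := fun x => ω (P.obj.act f hf m M hM' (fun j => P.obj.act (G.hom j) (hG j)
        (fun a => -K a.1) (m j) (hm j) (fun a => x a.1))))
      (koszulSign (Equiv.sigmaFiberEquiv G.π) (fun i => -K i) *
        passSign (fun j => s.toNat * (C.deg (G.hom j) : ℤ))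
          (fun j => ∑ a : {a // G.π a = j}, -K a.1))
      (koszulSign (Equiv.sigmaFiberEquiv G.π) K *
        passSign (fun j => (!s).toNat * (C.deg (G.hom j) : ℤ))
          (fun j => ∑ a : {a // G.π a = j}, K a.1))
      (fun x => (congrArg ω (P.obj.actComp_eq (Equiv.sigmaFiberEquiv G.π) f hf G.hom hG
        (fun i => -K i) M hM m hm hM' x)).trans ?_)
      (fun ξ => Q.actComp_eq (Equiv.sigmaFiberEquiv G.π) f hf G.hom hG K N hN n hn hN' _)).trans ?_
  · rw [Units.smul_def, map_zsmul, ← Units.smul_def]; rfl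
  · rw [mul_mul_mul_comm,
      koszulSign_congr (Equiv.sigmaFiberEquiv G.π) (n := fun i => -K i) (n' := K)
        (fun i => by rw [Int.negOnePow_neg]), units_mul_self, one_mul,
      passSign_mul_passSign s _ _ _ (fun i => by rw [Finset.sum_neg_distrib])]
    refine congrArg _ ?_
    exact contr_sigma (Equiv.sigmaFiberEquiv G.π) (V := fun i => P.obj.obj (W.2 i) (-K i))
      (W := fun i => P.obj.obj (X.2 i) (m i)) (U := fun i => Q.obj (X.2 i) (n i))
      (ω.compMultilinearMap (P.obj.act f hf m M hM'))
      (fun i y => P.obj.act (G.hom i) (hG i) (fun a => -K a.1) (m i) (hm i) y)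
      (Q.act f hf n N hN')
      (fun i η => Q.act (G.hom i) (hG i) (fun a => K a.1) (n i) (hn i) (fun a => j _ _ (η a)))

end FinOp.DualMap

end Square

/-! ### Two steps in which the inner morphism has one nontrivial component. -/

section SquareFamily

variable {k : Type u} [Field k] {F : FeynmanCategory.{u}} {C : F.Cubical} {s : Bool}

lemma FeynmanCategory.Fam.exists_fiberIso {ι κ : Type} [Finite ι] [Finite κ] {A : ι → F.V} {X : κ → F.V} (y : Fam X)
    (ρ : FIso A y.src) (i : κ) :
    ∃ a : FIso (fun x : {x // (ρ.mor.comp y.mor).π x = i} => A x.1) (y i).1.2,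
      a.mor.into (y i).2 = (ρ.mor.comp y.mor).hom i ∧ ∀ x, (a.e x).1 = ρ.e ⟨i, x⟩ := by
  obtain ⟨a, ha⟩ := (y.glue_bijective (ρ.mor.comp y.mor)).2 ⟨ρ, rfl⟩
  refine ⟨(a i).1, (a i).2, fun x => ?_⟩
  have h := congrArg (fun z => z.1.e ⟨i, x⟩) ha
  exact h

lemma FeynmanCategory.Fam.deg_comp_mor {ι κ : Type} [Fintype ι] [Finite κ] {A : ι → F.V} {X : κ → F.V} (y : Fam X)
    (ρ : FIso A y.src) (i : κ) : C.deg ((ρ.mor.comp y.mor).hom i) = C.deg (y i).2 := by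
  classical
  obtain ⟨a, ha, -⟩ := y.exists_fiberIso ρ i
  rw [← ha, C.deg_mor_into a.mor_isIso]

lemma FeynmanCategory.Fam.sum_comp_mor {κ : Type} [Finite κ] {W : F.Word} [DecidableEq κ] {X : κ → F.V} (y : Fam X)
    (ρ : FIso W.2 y.src) (i : κ) {M : Type} [AddCommMonoid M] (K : Fin W.1 → M) :
    ∑ x : {x // (ρ.mor.comp y.mor).π x = i}, K x.1 = ∑ x, K (ρ.e ⟨i, x⟩) := by
  obtain ⟨a, -, ha⟩ := y.exists_fiberIso ρ i
  exact (Fintype.sum_equiv a.e _ _ fun x => by rw [ha]).symm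

namespace FinOp.DualMap

variable {P : FinOp k C s} {Q : GrOp k C (!s)} {j : P.DualMap Q}

lemma conv_into (hj : j.Equivariant) {ι κ : Type} [Fintype ι] [LinearOrder ι] [Fintype κ] [LinearOrder κ]
    {A : ι → F.V} {B : κ → F.V} {v : F.V} (a : FIso A B) (f : F.Hom B v) (f' : F.Hom A v)
    (hf' : a.mor.into f = f') (h : C.deg f ≤ 1) (h' : C.deg f' ≤ 1) (l : ι → ℤ) (M N : ℤ)
    (hM hN hM' hN') :
    j.conv f' h' l M N hM' hN' = j.conv f h (fun i => l (a.e i)) M N hM hN := by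
  refine conv_reindex hj a.e f a.σ f' ?_ h h' l M N hM hN hM' hN'
  rw [← hf', FIso.mor_into']
  exact F.map_map (Equiv.sigmaPUnit κ) a.e (A := A) _

lemma conv_comp_mor (hj : j.Equivariant) {W X : F.Word} (y : Fam X.2) (ρ : FIso W.2 y.src) (i : Fin X.1)
    (h : C.deg ((ρ.mor.comp y.mor).hom i) ≤ 1) (h' : C.deg (y i).2 ≤ 1) (K : Fin W.1 → ℤ) (M N : ℤ)
    (hM hN hM' hN') :
    j.conv ((ρ.mor.comp y.mor).hom i) h (fun a => K a.1) M N hM hN =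
      j.conv (y i).2 h' (fun a => K (ρ.e ⟨i, a⟩)) M N hM' hN' := by
  obtain ⟨a, ha, hx⟩ := y.exists_fiberIso ρ i
  have h1 : (fun x => K (a.e x).1) = fun x => K (ρ.e ⟨i, x⟩) := funext fun x => by rw [hx]
  have key : ∀ (l : Fin (y i).1.1 → ℤ) (hM hN), l = (fun x => K (ρ.e ⟨i, x⟩)) →
      j.conv (y i).2 h' l M N hM hN = j.conv (y i).2 h' (fun a => K (ρ.e ⟨i, a⟩)) M N hM' hN' := by
    rintro _ _ _ rfl; rfl
  refine (conv_into hj a (y i).2 _ ha h' h (fun a => K a.1) M N ?_ ?_ hM hN).trans (key _ _ _ h1)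
  · simp only [hx]; exact hM'
  · simp only [hx]; exact hN'

/-- Away from `i₀` the inner convolutions are those of identities and reduce to `j`. The one
operation at `i₀` passes the inputs before it, which is the sign on the right. -/
lemma sq_comp_mor (hj : j.Equivariant) {W X : F.Word} {v : F.V} (y : Fam X.2) (ρ : FIso W.2 y.src)
    (f : F.Hom X.2 v) (hf : C.deg f ≤ 1) (i₀ : Fin X.1) (hy : ∀ i, i ≠ i₀ → y i = ⟨⟨1, fun _ => X.2 i⟩, idHom (X.2 i)⟩)
    (hy₀ : C.deg (y i₀).2 = 1) (hG) (K : Fin W.1 → ℤ) (M N : ℤ) (hM hN) (l : Fin X.1 → ℤ)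
    (hl : ∀ i, l i = ∑ a, K (ρ.e ⟨i, a⟩) - s.toNat * (C.deg (y i).2 : ℤ)) (hM' hN') (h1) (h2) (h3)
    (ω : Module.Dual k (P.obj.obj v M)) :
    j.sq (ρ.mor.comp y.mor) f hf hG K M (N + 1) hM hN ω = (∑ i with i < i₀, l i).negOnePow •
      contr (V := fun i => P.obj.obj (X.2 i) (-l i)) (fun x => ω (P.obj.act f hf (fun i => -l i) M hM' x))
        (fun η => Q.actPut f hf l N hN' (fun i => j _ _ (η i)) i₀
          (j.conv (y i₀).2 h1 (fun a => K (ρ.e ⟨i₀, a⟩)) (-l i₀) (l i₀ + 1) h2 h3 (η i₀))) := by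
  have hd : ∀ i, C.deg ((ρ.mor.comp y.mor).hom i) = if i = i₀ then 1 else 0 := by
    intro i
    rw [y.deg_comp_mor]
    split_ifs with h
    · rw [h, hy₀]
    · rw [hy i h]; exact deg_idHom _
  have hd' : ∀ i, C.deg (y i).2 = if i = i₀ then 1 else 0 := fun i => (y.deg_comp_mor ρ i).symm.trans (hd i)
  have hs : ∀ i, ∑ a : {a // (ρ.mor.comp y.mor).π a = i}, K a.1 = l i + s.toNat * (C.deg (y i).2 : ℤ) := by
    intro i
    rw [y.sum_comp_mor, hl]; ring
  have hN'' : N + 1 = ∑ i, shiftAt i₀ l i + (!s).toNat * (C.deg f : ℤ) := by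
    rw [sum_shift, hN']; ring
  have hn : ∀ i, shiftAt i₀ l i = ∑ a : {a // (ρ.mor.comp y.mor).π a = i}, K a.1 +
      (!s).toNat * (C.deg ((ρ.mor.comp y.mor).hom i) : ℤ) := by
    intro i
    rw [hs, hd, hd']
    simp only [shiftAt]
    split_ifs <;> cases s <;> simp
  rw [j.sq_eq (ρ.mor.comp y.mor) f hf hG K M (N + 1) hM hN (fun i => -l i) (shiftAt i₀ l) (fun i => by
      rw [Finset.sum_neg_distrib, hs, y.deg_comp_mor]; ring) hn hM' hN'']
  congr 1
  · unfold passSign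
    rw [Finset.prod_eq_single i₀]
    · beta_reduce
      rw [hd, if_pos rfl, Nat.cast_one, one_mul]
      congr 1
      refine Finset.sum_congr rfl fun i hi => ?_
      rw [hs, hd', if_neg (Finset.mem_filter.1 hi).2.ne]
      simp
    · intro i _ hi
      beta_reduce
      rw [hd, if_neg hi]; simp
    · simp
  · refine congrArg (contr _) (funext fun η => ?_)
    refine ((Q.actPut_eq f hf l N hN' (fun i => j _ _ (η i)) i₀ _ (shiftAt i₀ l) (N + 1) rfl hN'' _
      (fun _ => rfl) ?_ ?_)).symm
    · intro i hi
      have hy1 : C.deg (y i).2 ≤ 1 := by rw [hd']; split_ifs <;> simp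
      have hsi : shiftAt i₀ l i = l i := if_neg hi
      have hKi : ∀ a, K (ρ.e ⟨i, a⟩) = l i := by
        intro a
        rw [hl, hd', if_neg hi]
        have : Subsingleton (Fin (y i).1.1) := by rw [hy i hi]; infer_instance
        rw [Fintype.sum_subsingleton _ a]
        simp
      have key : ∀ (c : ℤ) (hc : c = l i) (hM) (hN), HEq (j.conv ((ρ.mor.comp y.mor).hom i) (hG i) (fun a => K a.1)
          (-l i) c hM hN (η i)) (j _ _ (η i)) := by
        rintro _ rfl hM hN
        refine heq_of_eq ?_
        refine (congrArg (fun T : _ →ₗ[k] _ => T (η i)) (conv_comp_mor hj y ρ i (hG i) hy1 K (-l i) (l i) hM hN ?_ ?_)).trans ?_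
        · rw [Finset.sum_neg_distrib, hl]; ring
        · rw [← y.sum_comp_mor, ← y.deg_comp_mor ρ i]; exact hN
        exact conv_eq_of_id hj (y i) (hy i hi) hy1 _ (l i) hKi _ _ (η i)
      exact key _ hsi _ _
    · have hsi : shiftAt i₀ l i₀ = l i₀ + 1 := if_pos rfl
      have key : ∀ (c : ℤ) (hc : c = l i₀ + 1) (hM) (hN), HEq (j.conv ((ρ.mor.comp y.mor).hom i₀) (hG i₀) (fun a => K a.1)
          (-l i₀) c hM hN (η i₀)) (j.conv (y i₀).2 h1 (fun a => K (ρ.e ⟨i₀, a⟩)) (-l i₀) (l i₀ + 1) h2 h3 (η i₀)) := by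
        rintro _ rfl hM hN
        exact heq_of_eq (congrArg (fun T : _ →ₗ[k] _ => T (η i₀)) (conv_comp_mor hj y ρ i₀ (hG i₀) h1 K _ _ hM hN h2 h3))
      exact key _ hsi _ _

end FinOp.DualMap

end SquareFamily

/-! ### Degrees in two successive steps. -/

section Degrees

variable {F : FeynmanCategory.{u}} {C : F.Cubical}

lemma FeynmanCategory.Fam.deg_eq {X : F.Word} {y : Fam X.2} {i₀ : Fin X.1}
    (hy : ∀ i, i ≠ i₀ → y i = ⟨⟨1, fun _ => X.2 i⟩, idHom (X.2 i)⟩) (hy₀ : C.deg (y i₀).2 = 1) (i : Fin X.1) :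
    C.deg (y i).2 = if i = i₀ then 1 else 0 := by
  split_ifs with h
  · rw [h, hy₀]
  · rw [hy i h]; exact deg_idHom _

lemma FeynmanCategory.Fam.sum_of_ne {X : F.Word} {y : Fam X.2} {i₀ : Fin X.1}
    (hy : ∀ i, i ≠ i₀ → y i = ⟨⟨1, fun _ => X.2 i⟩, idHom (X.2 i)⟩) {i : Fin X.1} (hi : i ≠ i₀)
    (K : Fin (y i).1.1 → ℤ) (a) : ∑ b, K b = K a := by
  have : Subsingleton (Fin (y i).1.1) := by rw [hy i hi]; infer_instance
  rw [Fintype.sum_subsingleton _ a]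

/-- The degrees in the two steps of a composition, in terms of the degrees of its source. -/
def FeynmanCategory.Fam.stepDegs (C : F.Cubical) (s n : ℤ) {W X : F.Word} {y : Fam X.2} (ρ : FIso W.2 y.src)
    {i₀ : Fin X.1} (hy : ∀ i, i ≠ i₀ → y i = ⟨⟨1, fun _ => X.2 i⟩, idHom (X.2 i)⟩) (hy₀ : C.deg (y i₀).2 = 1)
    (K : {K : Fin W.1 → ℤ // ∑ i, K i = n + 2 * s}) :
    Σ l : {l : Fin X.1 → ℤ // ∑ i, l i = n + s}, {l' : Fin (y i₀).1.1 → ℤ // ∑ i, l' i = l.1 i₀ + s} :=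
  ⟨⟨fun i => ∑ a, K.1 (ρ.e ⟨i, a⟩) - s * (C.deg (y i).2 : ℤ), by
      have h1 : ∑ i, ∑ a, K.1 (ρ.e ⟨i, a⟩) = n + 2 * s := by
        refine Eq.trans ?_ K.2
        rw [← ρ.e.sum_comp, Fintype.sum_sigma]
      rw [Finset.sum_sub_distrib, h1, ← Finset.mul_sum]
      simp only [Fam.deg_eq hy hy₀]
      simp; ring⟩,
    ⟨fun a => K.1 (ρ.e ⟨i₀, a⟩), by dsimp only; rw [hy₀]; push_cast; ring⟩⟩

lemma FeynmanCategory.Fam.stepDegs_of_ne {s n : ℤ} {W X : F.Word} {y : Fam X.2} (ρ : FIso W.2 y.src)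
    {i₀ : Fin X.1} (hy : ∀ i, i ≠ i₀ → y i = ⟨⟨1, fun _ => X.2 i⟩, idHom (X.2 i)⟩) (hy₀ : C.deg (y i₀).2 = 1)
    (K : {K : Fin W.1 → ℤ // ∑ i, K i = n + 2 * s}) {i : Fin X.1} (hi : i ≠ i₀) (a) :
    (Fam.stepDegs C s n ρ hy hy₀ K).1.1 i = K.1 (ρ.e ⟨i, a⟩) := by
  change ∑ a, K.1 (ρ.e ⟨i, a⟩) - s * (C.deg (y i).2 : ℤ) = _
  rw [Fam.deg_eq hy hy₀, if_neg hi, Fam.sum_of_ne hy hi _ a]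
  simp

/-- An identity has one input, of the same degree as its output, so the outer degrees away from `i₀`
and the inner degrees at `i₀` determine all degrees of the source; the outer degree at `i₀` follows
from the sum of the inner ones. -/
lemma FeynmanCategory.Fam.stepDegs_bijective (s n : ℤ) {W X : F.Word} {y : Fam X.2} (ρ : FIso W.2 y.src)
    {i₀ : Fin X.1} (hy : ∀ i, i ≠ i₀ → y i = ⟨⟨1, fun _ => X.2 i⟩, idHom (X.2 i)⟩) (hy₀ : C.deg (y i₀).2 = 1) :
    Function.Bijective (Fam.stepDegs C s n ρ hy hy₀) := by
  have hext : ∀ z z' : Σ l : {l : Fin X.1 → ℤ // ∑ i, l i = n + s},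
      {l' : Fin (y i₀).1.1 → ℤ // ∑ i, l' i = l.1 i₀ + s}, z.1.1 = z'.1.1 → z.2.1 = z'.2.1 → z = z' := by
    rintro ⟨⟨l, h⟩, ⟨l', h'⟩⟩ ⟨⟨m, _⟩, ⟨m', _⟩⟩ h1 h2
    dsimp only at h1 h2
    subst h1 h2
    rfl
  constructor
  · intro K K' h
    refine Subtype.ext (funext fun x => ?_)
    obtain ⟨⟨i, a⟩, rfl⟩ := ρ.e.surjective x
    by_cases hi : i = i₀
    · subst hi
      exact congrArg (fun z => z.2.1 a) h
    · rw [← Fam.stepDegs_of_ne ρ hy hy₀ K hi a, ← Fam.stepDegs_of_ne ρ hy hy₀ K' hi a, h]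
  · rintro ⟨⟨l, hl⟩, ⟨l', hl'⟩⟩
    dsimp only at hl'
    -- The inverse: inner degrees in the block of `i₀`, outer degrees in the blocks of the
    -- identities.
    let L : y.Idx → ℤ := fun p => if h : p.1 = i₀ then l' (Fin.cast (congrArg (fun i => (y i).1.1) h) p.2) else l p.1
    have hL0 : ∀ a, L ⟨i₀, a⟩ = l' a := fun a => dif_pos rfl
    have hL1 : ∀ i a, i ≠ i₀ → L ⟨i, a⟩ = l i := fun i a h => dif_neg h
    have hpos : ∀ i, i ≠ i₀ → Nonempty (Fin (y i).1.1) := by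
      intro i hi
      rw [hy i hi]; exact ⟨(0 : Fin 1)⟩
    have hs : ∀ i, ∑ a, L ⟨i, a⟩ = l i + s * (C.deg (y i).2 : ℤ) := by
      intro i
      rw [Fam.deg_eq hy hy₀]
      split_ifs with h
      · subst h
        simp only [hL0, hl']; simp
      · obtain ⟨a⟩ := hpos i h
        rw [Fam.sum_of_ne hy h _ a, hL1 i a h]; simp
    refine ⟨⟨fun x => L (ρ.e.symm x), ?_⟩, hext _ _ (funext fun i => ?_) (funext fun a => ?_)⟩
    · rw [ρ.e.symm.sum_comp, Fintype.sum_sigma]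
      simp only [hs, Finset.sum_add_distrib, hl, ← Finset.mul_sum, Fam.deg_eq hy hy₀]
      simp; ring
    · change ∑ a, L (ρ.e.symm (ρ.e ⟨i, a⟩)) - s * (C.deg (y i).2 : ℤ) = l i
      simp only [Equiv.symm_apply_apply, hs]; ring
    · change L (ρ.e.symm (ρ.e ⟨i₀, a⟩)) = l' a
      rw [Equiv.symm_apply_apply, hL0]

/-- By `two_mul_eps` only sums and sums of squares matter, and the squares away from `i₀` agree on
both sides. -/
lemma FeynmanCategory.Fam.eps_stepDegs {s n : ℤ} {W X : F.Word} {y : Fam X.2} (ρ : FIso W.2 y.src)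
    {i₀ : Fin X.1} (hy : ∀ i, i ≠ i₀ → y i = ⟨⟨1, fun _ => X.2 i⟩, idHom (X.2 i)⟩) (hy₀ : C.deg (y i₀).2 = 1)
    (K : {K : Fin W.1 → ℤ // ∑ i, K i = n + 2 * s}) :
    eps K.1 = eps (Fam.stepDegs C s n ρ hy hy₀ K).1.1 + eps (Fam.stepDegs C s n ρ hy hy₀ K).2.1 +
      n * s + s ^ 2 - s * (Fam.stepDegs C s n ρ hy hy₀ K).1.1 i₀ := by
  have h1 := two_mul_eps K.1
  have h2 := two_mul_eps (Fam.stepDegs C s n ρ hy hy₀ K).1.1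
  have h3 := two_mul_eps (Fam.stepDegs C s n ρ hy hy₀ K).2.1
  rw [(Fam.stepDegs C s n ρ hy hy₀ K).1.2] at h2
  rw [(Fam.stepDegs C s n ρ hy hy₀ K).2.2] at h3
  rw [K.2, ← ρ.e.sum_comp, Fintype.sum_sigma, ← Finset.add_sum_erase _ _ (Finset.mem_univ i₀)] at h1
  rw [← Finset.add_sum_erase _ _ (Finset.mem_univ i₀)] at h2
  have h4 : ∑ i ∈ Finset.univ.erase i₀, ∑ a, K.1 (ρ.e ⟨i, a⟩) ^ 2 =
      ∑ i ∈ Finset.univ.erase i₀, (Fam.stepDegs C s n ρ hy hy₀ K).1.1 i ^ 2 := by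
    refine Finset.sum_congr rfl fun i hi => ?_
    have hi' := Finset.ne_of_mem_erase hi
    have : Nonempty (Fin (y i).1.1) := by rw [hy i hi']; exact ⟨(0 : Fin 1)⟩
    obtain ⟨a⟩ := this
    rw [Fam.sum_of_ne hy hi' _ a, Fam.stepDegs_of_ne ρ hy hy₀ K hi' a]
  have h5 : ∑ a, K.1 (ρ.e ⟨i₀, a⟩) ^ 2 = ∑ a, (Fam.stepDegs C s n ρ hy hy₀ K).2.1 a ^ 2 := rfl
  rw [h4, h5] at h1
  linarith [h1, h2, h3]

end Degrees

/-! ### Cancellation of the composable pairs of morphisms of degree one. -/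

section Steps

variable {k : Type u} [Field k] {F : FeynmanCategory.{u}} {C : F.Cubical} {s : Bool}

lemma FinOp.mem_degs {P : FinOp k C s} {A : F.Word} {N : ℤ} (l : {l : Fin A.1 → ℤ // ∑ i, l i = N}) :
    l ∈ P.degs A N ↔ ∀ i, Nontrivial (P.obj.obj (A.2 i) (-l.1 i)) := by
  rw [degs, Set.Finite.mem_toFinset]; rfl

namespace FinOp.DualMap

variable {P : FinOp k C s} {Q : GrOp k C (!s)} (j : P.DualMap Q)

/-- The contribution of given degrees to the composite of two steps of the differential. -/
noncomputable def step {X : F.Word} {v : F.V} (f : F.Hom X.2 v) (hf : C.deg f = 1) (i₀ : Fin X.1)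
    (z : Σ Y : F.Word, F.Hom Y.2 (X.2 i₀)) (hz : C.deg z.2 = 1) {n : ℤ} (ω : Module.Dual k (P.obj.obj v (-n)))
    (l : {l : Fin X.1 → ℤ // ∑ i, l i = n + s.toNat})
    (l' : {l' : Fin z.1.1 → ℤ // ∑ i, l' i = l.1 i₀ + s.toNat}) : Q.obj v (n + 1 + 1) :=
  contr (V := fun i => P.obj.obj (X.2 i) (-l.1 i))
    (fun x => ω (P.obj.act f hf.le (fun i => -l.1 i) (-n) (deg_source hf l.2) x))
    (fun η => Q.actPut f hf.le l.1 (n + 1) (deg_target hf rfl l.2) (fun i => j _ _ (η i)) i₀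
      (j.conv z.2 hz.le l'.1 (-l.1 i₀) (l.1 i₀ + 1) (deg_source hz l'.2) (deg_target hz rfl l'.2) (η i₀)))

/-- The contribution of a pair of morphisms of degree one to the square of the differential. -/
noncomputable def steps {X : F.Word} {v : F.V} (f : F.Hom X.2 v) (hf : C.deg f = 1) (i₀ : Fin X.1)
    (z : Σ Y : F.Word, F.Hom Y.2 (X.2 i₀)) (hz : C.deg z.2 = 1) {n : ℤ} (ω : Module.Dual k (P.obj.obj v (-n))) :
    Q.obj v (n + 1 + 1) :=
  ∑ l ∈ P.degs X (n + s.toNat), ∑ l' ∈ P.degs z.1 (l.1 i₀ + s.toNat),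
    ((s.toNat * n + eps l.1) + ((!s).toNat + ∑ i with i < i₀, l.1 i) + (s.toNat * l.1 i₀ + eps l'.1)).negOnePow •
      j.step f hf i₀ z hz ω l l'

variable {j}

lemma deg_source_two {W X : F.Word} {v : F.V} {f : F.Hom X.2 v} {G : F.Mor W.2 X.2} (hf : C.deg f = 1)
    (hG : C.mor G = 1) {n : ℤ} {K : Fin W.1 → ℤ} (hK : ∑ i, K i = n + 2 * s.toNat) :
    -n = ∑ i, -K i + s.toNat * ((C.deg f + ∑ i, C.deg (G.hom i) : ℕ) : ℤ) := by
  have hG' : ∑ i, C.deg (G.hom i) = 1 := hG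
  rw [hf, hG', Finset.sum_neg_distrib, hK]; push_cast; ring

lemma deg_target_two {W X : F.Word} {v : F.V} {f : F.Hom X.2 v} {G : F.Mor W.2 X.2} (hf : C.deg f = 1)
    (hG : C.mor G = 1) {n : ℤ} {K : Fin W.1 → ℤ} (hK : ∑ i, K i = n + 2 * s.toNat) :
    n + 1 + 1 = ∑ i, K i + (!s).toNat * ((C.deg f + ∑ i, C.deg (G.hom i) : ℕ) : ℤ) := by
  have hG' : ∑ i, C.deg (G.hom i) = 1 := hG
  rw [hf, hG', hK]; cases s <;> simp <;> ring

lemma deg_hom_le {W X : F.Word} {G : F.Mor W.2 X.2} (hG : C.mor G = 1) (i) : C.deg (G.hom i) ≤ 1 :=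
  hG ▸ Finset.single_le_sum (f := fun j => C.deg (G.hom j)) (fun _ _ => Nat.zero_le _) (Finset.mem_univ i)

/-- In terms of the degrees `K` of a common source `W` the sign depends on `K` alone, and the pair
enters only through the factorization `(G, f)`. Pairs with the same composite thereby become
comparable. -/
lemma steps_eq (hj : j.Equivariant) {W X : F.Word} {v : F.V} (f : F.Hom X.2 v) (hf : C.deg f = 1) (y : Fam X.2)
    (ρ : FIso W.2 y.src) (i₀ : Fin X.1) (hy : ∀ i, i ≠ i₀ → y i = ⟨⟨1, fun _ => X.2 i⟩, idHom (X.2 i)⟩)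
    (hy₀ : C.deg (y i₀).2 = 1) {n : ℤ} (ω : Module.Dual k (P.obj.obj v (-n))) (G : F.Mor W.2 X.2)
    (hρ : ρ.mor.comp y.mor = G) (hG : C.mor G = 1) :
    j.steps f hf i₀ (y i₀) hy₀ ω = ∑ᶠ K : {K : Fin W.1 → ℤ // ∑ i, K i = n + 2 * s.toNat},
      (eps K.1 + 1).negOnePow • j.sq G f hf.le (deg_hom_le hG) K.1 (-n) (n + 1 + 1)
        (deg_source_two hf hG K.2) (deg_target_two hf hG K.2) ω := by
  subst hρ
  unfold steps
  rw [Finset.sum_sigma', ← finsum_eq_sum_of_support_subset (fun x : Σ l : {l : Fin X.1 → ℤ // ∑ i, l i = n + s.toNat},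
    {l' : Fin (y i₀).1.1 → ℤ // ∑ i, l' i = l.1 i₀ + s.toNat} => 
      ((s.toNat * n + eps x.1.1) + ((!s).toNat + ∑ i with i < i₀, x.1.1 i) +
        (s.toNat * x.1.1 i₀ + eps x.2.1)).negOnePow • j.step f hf i₀ (y i₀) hy₀ ω x.1 x.2),
    ← finsum_comp_equiv (Equiv.ofBijective _ (Fam.stepDegs_bijective (C := C) (s.toNat : ℤ) n ρ hy hy₀))]
  · refine finsum_congr fun K => ?_
    rw [Equiv.ofBijective_apply]
    have h0 := Fam.eps_stepDegs ρ hy hy₀ K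
    have h1 := sq_comp_mor hj y ρ f hf.le i₀ hy hy₀ (deg_hom_le hG) K.1 (-n) (n + 1)
      (deg_source_two hf hG K.2) (deg_target_two hf hG K.2) (Fam.stepDegs C (s.toNat : ℤ) n ρ hy hy₀ K).1.1
      (fun i => rfl) (deg_source hf (Fam.stepDegs C (s.toNat : ℤ) n ρ hy hy₀ K).1.2)
      (deg_target hf rfl (Fam.stepDegs C (s.toNat : ℤ) n ρ hy hy₀ K).1.2) hy₀.le
      (deg_source hy₀ (Fam.stepDegs C (s.toNat : ℤ) n ρ hy hy₀ K).2.2)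
      (deg_target hy₀ rfl (Fam.stepDegs C (s.toNat : ℤ) n ρ hy hy₀ K).2.2) ω
    refine Eq.trans ?_ (congrArg ((eps K.1 + 1).negOnePow • ·) h1.symm)
    rw [smul_smul, ← Int.negOnePow_add]
    refine congrArg₂ (· • ·) (negOnePow_congr ?_) rfl
    rw [h0]
    cases s
    · exact ⟨0, by simp; ring⟩
    · refine ⟨(Fam.stepDegs C (true.toNat : ℤ) n ρ hy hy₀ K).1.1 i₀ - 1, ?_⟩
      simp
      ring
  · rintro ⟨l, l'⟩ hx
    rw [Finset.mem_coe, Finset.mem_sigma]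
    have hz : j.step f hf i₀ (y i₀) hy₀ ω l l' ≠ 0 := fun h => hx (by dsimp only; rw [h, smul_zero])
    constructor
    · rw [mem_degs]
      intro i
      by_contra h
      exact hz (contr_eq_zero (V := fun i => P.obj.obj (X.2 i) (-l.1 i)) _ _ i h)
    · rw [mem_degs]
      intro i
      by_contra h
      refine hz ?_
      unfold step
      refine (congrArg (contr _) (funext fun η => ?_)).trans ((contr_smul_right (0 : k) _ fun _ => 0).trans
        (zero_smul _ _))
      rw [convAt_eq_zero _ _ _ _ _ _ _ _ _ _ _ _ i h, map_zero, zero_smul]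

/-- Pairs related by a swap have opposite contributions, but the relation is not a fixed point free
involution of the index set. The numbers of swaps, which are symmetric and have weighted row sums
one, distribute each contribution over its partners. -/
lemma sum_steps [CharZero k] (hj : j.Equivariant) {v : F.V} {n : ℤ} (ω : Module.Dual k (P.obj.obj v (-n))) :
    ∑ t : C.Pair v, (wt k t.1.1.2 * wt k t.2.2.1.2) •
      j.steps t.1.2.1 t.1.2.2 t.2.1 ⟨t.2.2.1, t.2.2.2.1⟩ t.2.2.2.2 ω = 0 := by
  set T : C.Pair v → Q.obj v (n + 1 + 1) := fun t => j.steps t.1.2.1 t.1.2.2 t.2.1 ⟨t.2.2.1, t.2.2.2.1⟩ t.2.2.2.2 ω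
    with hT
  have hTG : ∀ (t : C.Pair v) {W : F.Word} (ρ : FIso W.2 t.fam.src) (G : F.Mor W.2 t.1.1.2)
      (hρ : ρ.mor.comp t.fam.mor = G) (hG : C.mor G = 1),
      T t = ∑ᶠ K : {K : Fin W.1 → ℤ // ∑ i, K i = n + 2 * s.toNat},
      (eps K.1 + 1).negOnePow • j.sq G t.1.2.1 t.1.2.2.le (deg_hom_le hG) K.1 (-n) (n + 1 + 1)
        (deg_source_two t.1.2.2 hG K.2) (deg_target_two t.1.2.2 hG K.2) ω := by
    intro t W ρ G hρ hG
    have h1 : t.fam t.2.1 = ⟨t.2.2.1, t.2.2.2.1⟩ := pad_self _ _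
    have h2 : C.deg (t.fam t.2.1).2 = 1 := by rw [h1]; exact t.2.2.2.2
    rw [← steps_eq hj t.1.2.1 t.1.2.2 t.fam ρ t.2.1 (fun i hi => pad_of_ne hi _) h2 ω G hρ hG]
    have key : ∀ (z : Σ Y : F.Word, F.Hom Y.2 (t.1.1.2 t.2.1)) (hz), z = t.fam t.2.1 →
        j.steps t.1.2.1 t.1.2.2 t.2.1 z hz ω = j.steps t.1.2.1 t.1.2.2 t.2.1 (t.fam t.2.1) h2 ω := by
      rintro _ _ rfl; rfl
    exact key _ _ h1.symm
  -- Both contributions are written over the same word `W`, by enumerating the source of `t` and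
  -- transporting along the swap.
  have hanti : ∀ t t' : C.Pair v, Nonempty (Cubical.Pair.Swap t.fam.mor t.1.2.1 t') → T t' = - T t := by
    rintro t t' ⟨ρ₀, h1, h2⟩
    obtain ⟨W, a, ha⟩ := exists_inIso t.fam.src
    obtain ⟨ρ, rfl⟩ := FIso.exists_mor_eq ha
    have hG : C.mor (ρ.mor.comp t.fam.mor) = 1 := by
      rw [C.mor_comp, C.mor_of_isIso ha, add_zero, t.mor_fam]
    have hG' : C.mor ((ρ.trans ρ₀).mor.comp t'.fam.mor) = 1 := by
      rw [C.mor_comp, C.mor_of_isIso (ρ.trans ρ₀).mor_isIso, add_zero, t'.mor_fam]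
    rw [hTG t ρ _ rfl hG, hTG t' (ρ.trans ρ₀) _ rfl hG', ← finsum_neg_distrib]
    refine finsum_congr fun K => ?_
    rw [← smul_neg]
    refine congrArg _ (sq_swap j _ _ _ _ hG t.1.2.2 hG' t'.1.2.2 ?_ ?_ _ _ _ _ _ _ _ _ _ _ _ ω)
    · rw [FIso.mor_trans, Mor.comp_assoc, Mor.comp_into, Mor.comp_into, h1]
    · rw [FIso.mor_trans, Mor.comp_assoc]
      exact fun h => h2 (h.of_comp_left ha)
  set N : C.Pair v → C.Pair v → k := fun t t' => (Nat.card (Cubical.Pair.Swap t.fam.mor t.1.2.1 t') : k) with hN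
  have hNN : ∀ t t', N t t' = N t' t := fun t t' => congrArg _ (Cubical.Pair.card_swap_comm t t')
  set w : C.Pair v → k := fun t => wt k t.1.1.2 * wt k t.2.2.1.2 with hw
  have hsum : ∀ t, ∑ t', w t' * N t t' = 1 := fun t =>
    Cubical.Pair.sum_card_swap k t.fam.mor t.1.2.1 t.mor_fam t.1.2.2
  have hNT : ∀ t t', N t t' • T t' = - (N t t' • T t) := by
    intro t t'
    rcases isEmpty_or_nonempty (Cubical.Pair.Swap t.fam.mor t.1.2.1 t') with h | h
    · simp [hN]
    · rw [hanti t t' h, smul_neg]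
  have h1 : ∑ t, w t • T t = ∑ t, ∑ t', (w t * w t' * N t t') • T t := by
    refine Finset.sum_congr rfl fun t _ => ?_
    rw [← Finset.sum_smul]
    simp only [mul_assoc]
    rw [← Finset.mul_sum, hsum, mul_one]
  -- The weighted matrix of swaps is symmetric, so exchanging the summation indices replaces `T t`
  -- by `T t'`, that is by `- T t`, wherever the entry is nonzero.
  have h2 : ∑ t, ∑ t', (w t * w t' * N t t') • T t = - ∑ t, ∑ t', (w t * w t' * N t t') • T t := by
    conv_lhs => rw [Finset.sum_comm]
    rw [← Finset.sum_neg_distrib]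
    refine Finset.sum_congr rfl fun t _ => ?_
    rw [← Finset.sum_neg_distrib]
    refine Finset.sum_congr rfl fun t' _ => ?_
    rw [hNN t' t, mul_comm (w t') (w t), mul_smul, hNT, smul_neg, ← mul_smul]
  rw [h1]
  -- The sum equals its own negative, and `2` is invertible in characteristic zero.
  have h3 : (2 : k) • ∑ t, ∑ t', (w t * w t' * N t t') • T t = 0 := by
    rw [two_smul]
    nth_rw 1 [h2]
    exact neg_add_cancel _
  exact (smul_eq_zero.1 h3).resolve_left two_ne_zero

end FinOp.DualMap
end Steps

/-! ### The differential of the Feynman transform squares to zero. -/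

section SquareZero

variable {k : Type u} [Field k] {F : FeynmanCategory.{u}} {C : F.Cubical} {s : Bool}

/-- The shift of the degree in one place, on families with a given sum. -/
def shiftEquiv {ι : Type} [Fintype ι] [DecidableEq ι] (i : ι) {N N' : ℤ} (h : N' = N + 1) :
    {l : ι → ℤ // ∑ i, l i = N} ≃ {l : ι → ℤ // ∑ i, l i = N'} where
  toFun l := ⟨shiftAt i l.1, by rw [sum_shift, l.2, h]⟩
  invFun l := ⟨fun a => if a = i then l.1 a - 1 else l.1 a, by
    have : ∀ a, (if a = i then l.1 a - 1 else l.1 a) = l.1 a - if a = i then 1 else 0 := by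
      intro a; split_ifs <;> simp
    simp only [this, Finset.sum_sub_distrib, l.2, h, Finset.sum_ite_eq', Finset.mem_univ, if_true]
    ring⟩
  left_inv l := Subtype.ext (funext fun a => by
    dsimp only [shiftAt]; split_ifs <;> ring)
  right_inv l := Subtype.ext (funext fun a => by
    dsimp only [shiftAt]; split_ifs <;> ring)

lemma eps_shiftAt {ι : Type} [Fintype ι] [LinearOrder ι] (i : ι) (l : ι → ℤ) :
    eps (shiftAt i l) = eps l + ∑ a, l a - l i := by
  have h1 := two_mul_eps (shiftAt i l)
  have h2 := two_mul_eps l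
  rw [sum_shift] at h1
  have h3 : ∑ a, shiftAt i l a ^ 2 = ∑ a, l a ^ 2 + 2 * l i + 1 := by
    have : ∀ a, shiftAt i l a ^ 2 = l a ^ 2 + if a = i then 2 * l i + 1 else 0 := by
      intro a; dsimp only [shiftAt]; split_ifs with h
      · subst h; ring
      · ring
    simp only [this, Finset.sum_add_distrib, Finset.sum_ite_eq', Finset.mem_univ, if_true]
    ring
  rw [h3] at h1
  linarith [h1, h2]

lemma negOnePow_smul_eq_neg {M : Type*} [AddCommGroup M] {a b : ℤ} (h : Odd (a - b)) (x : M) :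
    a.negOnePow • x = -(b.negOnePow • x) := by
  have : a.negOnePow = -b.negOnePow := by
    rw [← sub_add_cancel a b, Int.negOnePow_add, Int.negOnePow_odd _ h, neg_one_mul]
  rw [this, Units.smul_def, Units.smul_def, Units.val_neg, neg_smul]

namespace FinOp.DualMap

variable {P : FinOp k C s} {Q : GrOp k C (!s)} (j : P.DualMap Q)

/-- The derivative of the convolution of the lift follows from the Leibniz rule of jets: `dif` is
inserted in one place after another. -/
lemma jsnd_conv {ι : Type} [Fintype ι] [LinearOrder ι] {A : ι → F.V} {v : F.V} (f : F.Hom A v) (hf : C.deg f ≤ 1)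
    (l : ι → ℤ) (M N : ℤ) (hM) (hN) (ω : Module.Dual k (P.obj.obj v M)) :
    Q.jsnd (j.lift.conv f hf l M N hM hN ω) =
      ∑ i, ((!s).toNat * (C.deg f : ℤ) + ∑ i' with i' < i, l i').negOnePow •
        contr (V := fun i => P.obj.obj (A i) (-l i)) (fun x => ω (P.obj.act f hf (fun i => -l i) M hM x))
          (fun ξ => Q.actPut f hf l N hN (fun i => j _ _ (ξ i)) i (j.dif rfl (ξ i))) := by
  rw [convAt_apply]
  refine (map_contr (V := fun i => P.obj.obj (A i) (-l i)) Q.jsnd _ _).trans ?_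
  refine (congrArg (contr _) (funext fun ξ => Q.jsnd_act f hf l N hN _)).trans ?_
  rw [contr_sum_right]
  refine Finset.sum_congr rfl fun i _ => ?_
  rw [contr_zsmul_right]
  refine congrArg _ (congrArg (contr _) (funext fun ξ => ?_))
  exact Q.act_mix_eq_actPut f hf l N hN _ i _

/-- The contribution of the differential of the dual complex in the place `i`. -/
noncomputable def intStep {X : F.Word} {v : F.V} (f : F.Hom X.2 v) (hf : C.deg f = 1) {n : ℤ}
    (ω : Module.Dual k (P.obj.obj v (-n))) (i : Fin X.1) (l : {l : Fin X.1 → ℤ // ∑ i, l i = n + s.toNat}) :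
    Q.obj v (n + 1 + 1) :=
  contr (V := fun i => P.obj.obj (X.2 i) (-l.1 i))
    (fun x => ω (P.obj.act f hf.le (fun i => -l.1 i) (-n) (deg_source hf l.2) x))
    (fun ξ => Q.actPut f hf.le l.1 (n + 1) (deg_target hf rfl l.2) (fun i => j _ _ (ξ i)) i
      (j _ _ ((ξ i).comp (P.obj.d (show -l.1 i = -(l.1 i + 1) + 1 by ring)))))

/-- Splits the inserted `dif` into the dual differential, collected in `intStep`, and a second
morphism of degree one, collected in `step`. -/
lemma contr_dif {X : F.Word} {v : F.V} (f : F.Hom X.2 v) (hf : C.deg f = 1) {n : ℤ}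
    (ω : Module.Dual k (P.obj.obj v (-n))) (i : Fin X.1) (l : {l : Fin X.1 → ℤ // ∑ i, l i = n + s.toNat}) :
    contr (V := fun i => P.obj.obj (X.2 i) (-l.1 i))
      (fun x => ω (P.obj.act f hf.le (fun i => -l.1 i) (-n) (deg_source hf l.2) x))
      (fun ξ => Q.actPut f hf.le l.1 (n + 1) (deg_target hf rfl l.2) (fun i => j _ _ (ξ i)) i (j.dif rfl (ξ i))) =
    (l.1 i + 1).negOnePow • j.intStep f hf ω i l + ∑ g : C.DegOne (X.2 i), wt k g.1.2 •
      ∑ l' ∈ P.degs g.1 (l.1 i + s.toNat), (s.toNat * l.1 i + eps l'.1).negOnePow •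
        j.step f hf i ⟨g.1, g.2.1⟩ g.2.2 ω l l' := by
  have h : ∀ ξ : ∀ i, Module.Dual k (P.obj.obj (X.2 i) (-l.1 i)),
      Q.actPut f hf.le l.1 (n + 1) (deg_target hf rfl l.2) (fun i => j _ _ (ξ i)) i (j.dif rfl (ξ i)) =
      (l.1 i + 1).negOnePow • Q.actPut f hf.le l.1 (n + 1) (deg_target hf rfl l.2) (fun i => j _ _ (ξ i)) i
        (j _ _ ((ξ i).comp (P.obj.d (show -l.1 i = -(l.1 i + 1) + 1 by ring)))) +
      ∑ g : C.DegOne (X.2 i), wt k g.1.2 • ∑ l' ∈ P.degs g.1 (l.1 i + s.toNat),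
        (s.toNat * l.1 i + eps l'.1).negOnePow •
        Q.actPut f hf.le l.1 (n + 1) (deg_target hf rfl l.2) (fun i => j _ _ (ξ i)) i
          (j.conv g.2.1 g.2.2.le l'.1 (-l.1 i) (l.1 i + 1) (deg_source g.2.2 l'.2) (deg_target g.2.2 rfl l'.2) (ξ i)) := by
    intro ξ
    rw [dif_apply, ext_apply, map_add, Units.smul_def, map_zsmul, ← Units.smul_def, map_sum]
    congr 1
    refine Finset.sum_congr rfl fun g _ => ?_
    rw [map_smul, map_sum]
    congr 1
    refine Finset.sum_congr rfl fun l' _ => ?_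
    rw [Units.smul_def, map_zsmul, ← Units.smul_def]
  refine (congrArg (contr _) (funext h)).trans ?_
  rw [contr_add_right, contr_zsmul_right, contr_sum_right]
  refine congrArg₂ (· + ·) rfl (Finset.sum_congr rfl fun g _ => ?_)
  rw [contr_smul_right, contr_sum_right]
  refine congrArg _ (Finset.sum_congr rfl fun l' _ => ?_)
  rw [contr_zsmul_right]
  rfl

/-- By `contr_linear` the differential of `P` in the place `i` of the form becomes its transpose on
the dual factor `i`. -/
lemma contr_applyAt {X : F.Word} {v : F.V} (f : F.Hom X.2 v) (hf : C.deg f = 1) {n : ℤ}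
    (ω : Module.Dual k (P.obj.obj v (-n))) (i : Fin X.1) (l : {l : Fin X.1 → ℤ // ∑ i, l i = n + s.toNat})
    (l' : Fin X.1 → ℤ) (hl' : l' = shiftAt i l.1) (h1) (h2) :
    contr (V := fun i => P.obj.obj (X.2 i) (-l' i))
      (fun x => ω (P.obj.act f hf.le (fun a => if a = i then -l' a + 1 else -l' a) (-n) h1
        (P.obj.applyAt (fun h => P.obj.d h) x i)))
      (fun ξ => Q.act f hf.le l' (n + 1 + 1) h2 (fun i => j _ _ (ξ i))) = j.intStep f hf ω i l := by
  have hi : ∀ a, a = i → -l.1 a = -l' a + 1 := by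
    rintro a rfl; rw [hl']; simp [shiftAt]
  have hi' : ∀ a, a ≠ i → -l' a = -l.1 a := by
    intro a ha; rw [hl']; simp [shiftAt, ha]
  let T : ∀ a, P.obj.obj (X.2 a) (-l' a) →ₗ[k] P.obj.obj (X.2 a) (-l.1 a) := fun a =>
    if h : a = i then P.obj.d (hi a h) else P.obj.castL (hi' a h)
  have hT : ∀ a (h : a = i), T a = P.obj.d (hi a h) := fun a h => dif_pos h
  have hT' : ∀ a (h : a ≠ i), T a = P.obj.castL (hi' a h) := fun a h => dif_neg h
  refine Eq.trans ?_ ((contr_linear (Equiv.refl (Fin X.1)) (V := fun i => P.obj.obj (X.2 i) (-l' i))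
    (W := fun a => P.obj.obj (X.2 a) (-l.1 a)) (U := fun a => Q.obj (X.2 a) (l' a))
    (ω.compMultilinearMap (P.obj.act f hf.le (fun i => -l.1 i) (-n) (deg_source hf l.2))) T
    (Q.act f hf.le l' (n + 1 + 1) h2) (fun a => j _ _) (fun a ξ => j _ _ (ξ.comp (T a))) (fun a ξ => rfl)).trans ?_)
  · refine congrArg₂ contr (funext fun x => congrArg ω ?_) rfl
    refine P.obj.act_eq rfl (fun a => ?_) fun a => ?_
    · split_ifs with h
      · exact (hi a h).symm
      · exact hi' a h
    · by_cases h : a = i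
      · unfold PreOp.applyAt
        change HEq _ (T a (x a))
        rw [dif_pos h, hT a h]
        have key : ∀ (c c' : ℤ) (_ : c = c') (h1 : c = -l' a + 1) (h2 : c' = -l' a + 1) (x),
            HEq (P.obj.d (v := X.2 a) h1 x) (P.obj.d h2 x) := by
          rintro c _ rfl _ _ _; rfl
        exact key _ _ (by rw [if_pos h, hi a h]) _ _ _
      · unfold PreOp.applyAt
        change HEq _ (T a (x a))
        rw [dif_neg h, hT' a h]
        exact (P.obj.castDeg_heq _ _).trans (P.obj.castL_heq _ _).symm
  · unfold intStep
    refine congrArg (contr _) (funext fun ξ => ?_)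
    refine (Q.actPut_eq f hf.le l.1 (n + 1) (deg_target hf rfl l.2) _ i _ l' (n + 1 + 1) rfl h2 _ (fun a => congrFun hl' a) ?_ ?_).symm
    · intro a ha
      rw [hT' a ha]
      have key : ∀ (c : ℤ) (_ : c = l.1 a) (h : -c = -l.1 a), HEq (j (X.2 a) c ((ξ a).comp (P.obj.castL h)))
          (j (X.2 a) (l.1 a) (ξ a)) := by
        rintro _ rfl _; rfl
      exact key _ (by have := hi' a ha; omega) _
    · rw [hT i rfl]
      have key : ∀ (c : ℤ) (_ : c = l.1 i + 1) (h : -l.1 i = -c + 1), HEq (j (X.2 i) c ((ξ i).comp (P.obj.d h)))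
          (j (X.2 i) (l.1 i + 1) ((ξ i).comp (P.obj.d (show -l.1 i = -(l.1 i + 1) + 1 by ring)))) := by
        rintro _ rfl _; rfl
      exact key _ (by have := hi i rfl; omega) _

/-- The dual differential anticommutes with the part of `dif` given by `f`, since `P(f)` satisfies
the Leibniz rule. Both terms are expressed by the same contractions `intStep`, with opposite signs.
-/
lemma sum_conv_d {X : F.Word} {v : F.V} (f : F.Hom X.2 v) (hf : C.deg f = 1) {n : ℤ}
    (ω : Module.Dual k (P.obj.obj v (-n))) :
    (n + 1).negOnePow • ∑ l ∈ P.degs X (n + 1 + s.toNat), (s.toNat * (n + 1) + eps l.1).negOnePow •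
        j.conv f hf.le l.1 (-(n + 1)) (n + 1 + 1) (deg_source hf l.2) (deg_target hf rfl l.2)
          (ω.comp (P.obj.d (show -n = -(n + 1) + 1 by ring))) +
      ∑ l ∈ P.degs X (n + s.toNat), (s.toNat * n + eps l.1).negOnePow •
        ∑ i, ((!s).toNat * (C.deg f : ℤ) + ∑ i' with i' < i, l.1 i').negOnePow •
          (l.1 i + 1).negOnePow • j.intStep f hf ω i l = 0 := by
  have h2 : ∀ (i : Fin X.1) (l : {l : Fin X.1 → ℤ // ∑ i, l i = n + 1 + s.toNat}),
      -n = ∑ a, (if a = i then -l.1 a + 1 else -l.1 a) + s.toNat * (C.deg f : ℤ) := by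
    intro i l
    rw [sum_shift, Finset.sum_neg_distrib, l.2, hf]; push_cast; ring
  let Z : ∀ (i : Fin X.1) (l : {l : Fin X.1 → ℤ // ∑ i, l i = n + 1 + s.toNat}), Q.obj v (n + 1 + 1) := fun i l =>
    contr (V := fun i => P.obj.obj (X.2 i) (-l.1 i))
      (fun x => ω (P.obj.act f hf.le (fun a => if a = i then -l.1 a + 1 else -l.1 a) (-n) (h2 i l)
        (P.obj.applyAt (fun h => P.obj.d h) x i)))
      (fun ξ => Q.act f hf.le l.1 (n + 1 + 1) (deg_target hf rfl l.2) (fun i => j _ _ (ξ i)))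
  have h3 : ∀ l : {l : Fin X.1 → ℤ // ∑ i, l i = n + 1 + s.toNat},
      j.conv f hf.le l.1 (-(n + 1)) (n + 1 + 1) (deg_source hf l.2) (deg_target hf rfl l.2)
          (ω.comp (P.obj.d (show -n = -(n + 1) + 1 by ring))) =
      ∑ i, (s.toNat * (C.deg f : ℤ) + ∑ a with a < i, -l.1 a).negOnePow • Z i l := by
    intro l
    rw [convAt_apply]
    refine (congrArg₂ contr (funext fun x => (congrArg ω (P.obj.d_act f hf.le (fun i => -l.1 i) (-(n + 1)) (-n)
      (deg_source hf l.2) (by ring) x)).trans (map_sum _ _ _)) rfl).trans ?_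
    rw [contr_sum_left]
    refine Finset.sum_congr rfl fun i _ => ?_
    refine Eq.trans ?_ (contr_zsmul_left _ _ _)
    refine congrArg₂ contr (funext fun x => ?_) rfl
    rw [Units.smul_def, map_zsmul, ← Units.smul_def]
  have h4 : ∀ i, ∑ l ∈ P.degs X (n + 1 + s.toNat), ((n + 1) + (s.toNat * (n + 1) + eps l.1) +
      (s.toNat * (C.deg f : ℤ) + ∑ a with a < i, -l.1 a)).negOnePow • Z i l =
      - ∑ l ∈ P.degs X (n + s.toNat), ((s.toNat * n + eps l.1) + ((!s).toNat * (C.deg f : ℤ) +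
        ∑ i' with i' < i, l.1 i') + (l.1 i + 1)).negOnePow • j.intStep f hf ω i l := by
    intro i
    -- The left sum is indexed by degrees after the differential in the place `i`, the right one by
    -- degrees before it; `shiftEquiv` identifies the two index sets.
    rw [← P.finsum_degs (A := X) (N := n + 1 + s.toNat), ← P.finsum_degs (A := X) (N := n + s.toNat), ← finsum_neg_distrib,
      ← finsum_comp_equiv (shiftEquiv i (show n + 1 + (s.toNat : ℤ) = n + s.toNat + 1 by ring))]
    · refine finsum_congr fun l => ?_
      have e1 : Z i (shiftEquiv i (show n + 1 + (s.toNat : ℤ) = n + s.toNat + 1 by ring) l) = j.intStep f hf ω i l :=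
        j.contr_applyAt f hf ω i l _ rfl _ _
      rw [e1]
      refine negOnePow_smul_eq_neg ?_ _
      have e2 := eps_shiftAt i l.1
      have e3 := GrOp.sum_lt_shiftAt l.1 i i
      rw [l.2] at e2
      rw [if_neg (lt_irrefl i), add_zero] at e3
      have e4 : (shiftEquiv i (show n + 1 + (s.toNat : ℤ) = n + s.toNat + 1 by ring) l).1 = shiftAt i l.1 := rfl
      rw [e4, e2, Finset.sum_neg_distrib, e3, hf]
      cases s
      · refine ⟨n - l.1 i - 1 - ∑ x with x < i, l.1 x, ?_⟩
        simp; ring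
      · refine ⟨n - l.1 i + 1 - ∑ x with x < i, l.1 x, ?_⟩
        simp; ring
    · intro l i' h
      refine (congrArg _ (contr_eq_zero (V := fun i => P.obj.obj (X.2 i) (-l.1 i)) _ _ i' h)).trans (smul_zero _)
    · intro l i' h
      refine (congrArg _ (contr_eq_zero (V := fun i => P.obj.obj (X.2 i) (-l.1 i)) _ _ i' h)).trans (smul_zero _)
  simp only [h3, Finset.smul_sum, smul_smul, ← Int.negOnePow_add]
  rw [Finset.sum_comm, Finset.sum_comm (s := P.degs X (n + s.toNat)), ← Finset.sum_add_distrib]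
  refine Finset.sum_eq_zero fun i _ => ?_
  have := h4 i
  simp only [← add_assoc] at this ⊢
  rw [this]
  exact neg_add_cancel _

variable {j}

/-- The statement `dif² = 0`, phrased with jets. Two applications of the dual differential cancel by
`P.d_d`, the mixed terms by `sum_conv_d`, and two morphisms of degree one by `sum_steps`. -/
lemma jsnd_dif_lift [CharZero k] (hj : j.Equivariant) {v : F.V} {n : ℤ} (ω : Module.Dual k (P.obj.obj v (-n))) :
    Q.jsnd (j.lift.dif (rfl : n + 1 = n + 1) ω) = 0 := by
  have h0 : Q.jsnd (j.lift.dif (rfl : n + 1 = n + 1) ω) =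
      (n + 1).negOnePow • j.dif rfl (ω.comp (P.obj.d (show -n = -(n + 1) + 1 by ring))) +
      ∑ f : C.DegOne v, wt k f.1.2 • ∑ l ∈ P.degs f.1 (n + s.toNat), (s.toNat * n + eps l.1).negOnePow •
        Q.jsnd (j.lift.conv f.2.1 f.2.2.le l.1 (-n) (n + 1) (deg_source f.2.2 l.2) (deg_target f.2.2 rfl l.2) ω) := by
    rw [dif_apply, ext_apply]
    refine (map_add Q.jsnd _ _).trans (congrArg₂ (· + ·) (Q.jsnd_units_smul _ _) ?_)
    refine (map_sum Q.jsnd _ _).trans (Finset.sum_congr rfl fun f _ => ?_)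
    refine (map_smul Q.jsnd _ _).trans (congrArg _ ?_)
    refine (map_sum Q.jsnd _ _).trans (Finset.sum_congr rfl fun l _ => ?_)
    exact Q.jsnd_units_smul _ _
  have h1 : j.dif rfl (ω.comp (P.obj.d (show -n = -(n + 1) + 1 by ring))) =
      j.ext rfl (ω.comp (P.obj.d (show -n = -(n + 1) + 1 by ring))) := by
    rw [dif_apply]
    have : (ω.comp (P.obj.d (show -n = -(n + 1) + 1 by ring))).comp
        (P.obj.d (show -(n + 1) = -(n + 1 + 1) + 1 by ring)) = (0 : Module.Dual k (P.obj.obj v _)) := by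
      refine LinearMap.ext fun x => ?_
      exact (congrArg ω (P.obj.d_d _ _ x)).trans (map_zero ω)
    rw [this, map_zero, smul_zero, zero_add]
  rw [h0, h1, ext_apply, Finset.smul_sum, ← Finset.sum_add_distrib, ← sum_steps hj ω, Fintype.sum_sigma]
  refine Finset.sum_congr rfl fun f _ => ?_
  rw [smul_comm, ← smul_add, Fintype.sum_sigma]
  have h2 := j.sum_conv_d f.2.1 f.2.2 ω
  have h3 : ∑ l ∈ P.degs f.1 (n + s.toNat), (s.toNat * n + eps l.1).negOnePow •
        Q.jsnd (j.lift.conv f.2.1 f.2.2.le l.1 (-n) (n + 1) (deg_source f.2.2 l.2) (deg_target f.2.2 rfl l.2) ω) =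
      ∑ l ∈ P.degs f.1 (n + s.toNat), (s.toNat * n + eps l.1).negOnePow •
        ∑ i, ((!s).toNat * (C.deg f.2.1 : ℤ) + ∑ i' with i' < i, l.1 i').negOnePow •
          (l.1 i + 1).negOnePow • j.intStep f.2.1 f.2.2 ω i l +
      ∑ i, ∑ g : C.DegOne (f.1.2 i), wt k g.1.2 • j.steps f.2.1 f.2.2 i ⟨g.1, g.2.1⟩ g.2.2 ω := by
    have h4 : ∀ l : {l : Fin f.1.1 → ℤ // ∑ i, l i = n + s.toNat},
        (s.toNat * n + eps l.1).negOnePow • Q.jsnd (j.lift.conv f.2.1 f.2.2.le l.1 (-n) (n + 1)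
          (deg_source f.2.2 l.2) (deg_target f.2.2 rfl l.2) ω) =
        (s.toNat * n + eps l.1).negOnePow •
          ∑ i, ((!s).toNat * (C.deg f.2.1 : ℤ) + ∑ i' with i' < i, l.1 i').negOnePow •
            (l.1 i + 1).negOnePow • j.intStep f.2.1 f.2.2 ω i l +
        ∑ i, ∑ g : C.DegOne (f.1.2 i), wt k g.1.2 • ∑ l' ∈ P.degs g.1 (l.1 i + s.toNat),
          ((s.toNat * n + eps l.1) + ((!s).toNat + ∑ i' with i' < i, l.1 i') +
            (s.toNat * l.1 i + eps l'.1)).negOnePow • j.step f.2.1 f.2.2 i ⟨g.1, g.2.1⟩ g.2.2 ω l l' := by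
      intro l
      rw [jsnd_conv, Finset.smul_sum, Finset.smul_sum, ← Finset.sum_add_distrib]
      refine Finset.sum_congr rfl fun i _ => ?_
      have h5 := j.contr_dif f.2.1 f.2.2 ω i l
      refine (congrArg (fun z => (s.toNat * n + eps l.1).negOnePow •
        ((!s).toNat * (C.deg f.2.1 : ℤ) + ∑ i' with i' < i, l.1 i').negOnePow • z) h5).trans ?_
      rw [smul_add, smul_add]
      congr 1
      simp only [Finset.smul_sum]
      refine Finset.sum_congr rfl fun g _ => Finset.sum_congr rfl fun l' _ => ?_
      rw [smul_comm _ (wt k g.1.2), smul_comm _ (wt k g.1.2), smul_smul, smul_smul, ← Int.negOnePow_add,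
        ← Int.negOnePow_add, f.2.2, Nat.cast_one, mul_one]
    rw [Finset.sum_congr rfl fun l _ => h4 l, Finset.sum_add_distrib]
    congr 1
    rw [Finset.sum_comm]
    refine Finset.sum_congr rfl fun i _ => ?_
    rw [Finset.sum_comm]
    refine Finset.sum_congr rfl fun g _ => ?_
    rw [← Finset.smul_sum]
    rfl
  rw [h3, ← add_assoc, h2, zero_add, Finset.smul_sum]
  refine Finset.sum_congr rfl fun i _ => ?_
  rw [Finset.smul_sum]
  refine Finset.sum_congr rfl fun g _ => ?_
  rw [mul_smul]

/-- The lift of a map of generators to jets is compatible with the differentials. -/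
lemma jd_lift [CharZero k] (hj : j.Equivariant) {v : F.V} {n m : ℤ} (h : m = n + 1)
    (ω : Module.Dual k (P.obj.obj v (-n))) : Q.jd h (j.lift v n ω) = j.lift.dif h ω := by
  subst h
  refine GrOp.jext ?_ ((jsnd_dif_lift hj ω).symm)
  exact (map_dif Q.jfstHom (j := j.lift) rfl ω).symm

end FinOp.DualMap
end SquareZero

/-! ### Construction of the Feynman transform. -/

section Transform

variable {k : Type u} [Field k] {F : FeynmanCategory.{u}} {C : F.Cubical} {s : Bool}

namespace FinOp

/-- Composition of a map of generators with a morphism of operads. -/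
def DualMap.precomp {P P' : FinOp k C s} {Q : GrOp k C (!s)} (j : P.DualMap Q) (a : P ⟶ P') : P'.DualMap Q :=
  fun v n => (j v n).comp (a.hom.app v (-n)).dualMap

namespace DualMap

variable {P P' : FinOp k C s} {Q : GrOp k C (!s)} {j : P.DualMap Q}

lemma precomp_apply (a : P ⟶ P') (v : F.V) (n : ℤ) (p) : j.precomp a v n p = j v n (p.comp (a.hom.app v (-n))) := rfl

lemma Equivariant.precomp (hj : j.Equivariant) (a : P ⟶ P') : (j.precomp a).Equivariant := by
  intro v w σ n p
  rw [precomp_apply, precomp_apply, ← hj σ n]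
  refine congrArg (fun z => Q.viso σ n (j v n z)) (LinearMap.ext fun x => congrArg p ?_)
  exact (a.hom.app_viso σ (-n) x).symm

lemma conv_precomp (a : P ⟶ P') {ι : Type} [Fintype ι] [LinearOrder ι] {A : ι → F.V} {v : F.V} (f : F.Hom A v)
    (hf : C.deg f ≤ 1) (l : ι → ℤ) (M N : ℤ) (hM) (hN) (ω : Module.Dual k (P'.obj.obj v M)) :
    (j.precomp a).conv f hf l M N hM hN ω = j.conv f hf l M N hM hN (ω.comp (a.hom.app v M)) := by
  rw [convAt_apply, convAt_apply]
  refine ((congrArg₂ contr (funext fun x => congrArg ω (a.hom.app_act f hf _ M hM x)) rfl).trans ?_).symm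
  exact contr_linear (Equiv.refl ι) (V := fun i => P.obj.obj (A i) (-l i)) (W := fun i => P'.obj.obj (A i) (-l i))
    (U := fun i => Q.obj (A i) (l i)) (ω.compMultilinearMap (P'.obj.act f hf (fun i => -l i) M hM))
    (fun i => a.hom.app (A i) (-l i)) (Q.act f hf l N hN) (fun i => j _ _) (fun i => j.precomp a _ _)
    (fun i ω => rfl)

lemma ext_eq_finsum {v : F.V} {n m : ℤ} (h : m = n + 1) (ω : Module.Dual k (P.obj.obj v (-n))) :
    j.ext h ω = ∑ f : C.DegOne v, wt k f.1.2 • ∑ᶠ l : {l : Fin f.1.1 → ℤ // ∑ i, l i = n + s.toNat},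
      (s.toNat * n + eps l.1).negOnePow •
        j.conv f.2.1 f.2.2.le l.1 (-n) m (deg_source f.2.2 l.2) (deg_target f.2.2 h l.2) ω := by
  rw [ext_apply]
  refine Finset.sum_congr rfl fun f _ => congrArg _ ?_
  rw [P.finsum_degs]
  intro l i hi
  rw [convAt_eq_zero _ _ _ _ _ _ _ _ _ _ _ _ i hi, smul_zero]

/-- Naturality of the differential in `P`, from which the contravariant functoriality follows. The
`finsum` form is needed because the finite sets of degrees of `P` and `P'` differ. -/
lemma dif_precomp (a : P ⟶ P') {v : F.V} {n m : ℤ} (h : m = n + 1) (ω : Module.Dual k (P'.obj.obj v (-n))) :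
    (j.precomp a).dif h ω = j.dif h (ω.comp (a.hom.app v (-n))) := by
  rw [dif_apply, dif_apply, ext_eq_finsum, ext_eq_finsum]
  refine congrArg₂ (· + ·) (congrArg _ ?_) ?_
  · rw [precomp_apply]
    refine congrArg (j v m) (LinearMap.ext fun x => congrArg ω ?_)
    exact (a.hom.app_d _ x).symm
  · simp only [conv_precomp]

end DualMap

/-- The models of the Feynman transform. -/
def transformClass (P : FinOp k C s) : ModelClass k C (!s) (fun v n => Module.Dual k (P.obj.obj v (-n))) :=
  fun Q j => ∃ J : P.DualMap Q.toGrOp, J.Equivariant ∧ (∀ v n p, j v n p = J v n p) ∧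
    ∀ {v : F.V} {n m : ℤ} (h : m = n + 1) (p), Q.d h (J v n p) = J.dif h p

variable (P : FinOp k C s)

/-- The generators of the Feynman transform. -/
noncomputable def transformGen : P.DualMap P.transformClass.op.toGrOp := fun v n =>
  { toFun := fun p => P.transformClass.gen p
    map_add' := fun x y => ModelClass.ext_lift fun Q j hK => by
      refine Eq.trans ?_ (map_add ((ModelClass.lift Q j hK).app v n) _ _).symm
      obtain ⟨J, -, hJ, -⟩ := id hK
      exact (hJ v n (x + y)).trans ((map_add (J v n) x y).trans
            (congrArg₂ (· + ·) (hJ v n x).symm (hJ v n y).symm))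
    map_smul' := fun c x => ModelClass.ext_lift fun Q j hK => by
      refine Eq.trans ?_ (map_smul ((ModelClass.lift Q j hK).app v n) _ _).symm
      obtain ⟨J, -, hJ, -⟩ := id hK
      exact (hJ v n (c • x)).trans ((map_smul (J v n) c x).trans (congrArg (c • ·) (hJ v n x).symm)) }

lemma map_transformGen (Q : DGOp k C (!s)) (j) (hK : P.transformClass Q j) (J : P.DualMap Q.toGrOp)
    (hJ : ∀ v n p, j v n p = J v n p) : P.transformGen.map (ModelClass.lift Q j hK).toHom = J :=
  funext fun v => funext fun n => LinearMap.ext fun p => hJ v n p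

lemma transformGen_equivariant : P.transformGen.Equivariant := by
  intro v w σ n p
  refine ModelClass.ext_lift fun Q j hK => ?_
  obtain ⟨J, hJ, hj, -⟩ := id hK
  refine ((ModelClass.lift Q j hK).toHom.app_viso σ n _).trans ?_
  exact (congrArg _ (hj v n _)).trans ((hJ σ n p).trans (hj w n p).symm)

/-- The equation `d J = dif J` holds in every model and is preserved by morphisms of operads, hence
it holds in the universal model. -/
lemma d_transformGen {v : F.V} {n m : ℤ} (h : m = n + 1) (p : Module.Dual k (P.obj.obj v (-n))) :
    P.transformClass.op.d h (P.transformGen v n p) = P.transformGen.dif h p := by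
  refine ModelClass.ext_lift fun Q j hK => ?_
  obtain ⟨J, -, hj, hd⟩ := id hK
  refine ((ModelClass.lift Q j hK).app_d h _).trans ?_
  refine (congrArg _ (hj v n _)).trans ((hd h p).trans ?_)
  rw [← P.map_transformGen Q j hK J hj]
  exact (DualMap.map_dif (ModelClass.lift Q j hK).toHom h p).symm

/-- The contravariant functoriality of the Feynman transform. -/
noncomputable def transformMap {P P' : FinOp k C s} (a : P ⟶ P') : P'.transformClass.op ⟶ P.transformClass.op :=
  ModelClass.lift P.transformClass.op (fun v n p => P.transformGen.precomp a v n p)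
    ⟨P.transformGen.precomp a, DualMap.Equivariant.precomp P.transformGen_equivariant a, fun _ _ _ => rfl, fun h p => by
      rw [DualMap.dif_precomp, DualMap.precomp_apply, d_transformGen]⟩

/-- The universal model is generated by operations and `d`, while `a` and `b` are not assumed to
commute with `d`. On generators `d` is given by operations, so agreement is proved simultaneously
for an element and its differential. -/
lemma transform_hom_unique {Q : GrOp k C (!s)} (a b : GrOp.Hom P.transformClass.op.toGrOp Q)
    (h : ∀ v n p, a.app v n (P.transformGen v n p) = b.app v n (P.transformGen v n p)) : a = b := by
  have hab : P.transformGen.map a = P.transformGen.map b :=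
    funext fun v => funext fun n => LinearMap.ext fun p => h v n p
  have key : ∀ {v : F.V} {n : ℤ} (x : P.transformClass.op.obj v n), a.app v n x = b.app v n x ∧
      ∀ m (h : m = n + 1), a.app v m (P.transformClass.op.d h x) = b.app v m (P.transformClass.op.d h x) := by
    intro v n x
    induction x using ModelClass.induction with
    | @hgen v n x =>
      refine ⟨h _ _ x, fun m h' => ?_⟩
      have h1 := P.d_transformGen h' x
      refine (congrArg (a.app v m) h1).trans (Eq.trans ?_ (congrArg (b.app v m) h1).symm)
      rw [DualMap.map_dif, DualMap.map_dif, hab]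
    | hzero v n => exact ⟨by rw [map_zero, map_zero], fun m h => by rw [map_zero, map_zero, map_zero]⟩
    | hadd x y hx hy =>
      exact ⟨by rw [map_add, map_add, hx.1, hy.1], fun m h => by
        rw [map_add, map_add, map_add, hx.2 m h, hy.2 m h]⟩
    | hsmul c x hx =>
      exact ⟨by rw [map_smul, map_smul, hx.1], fun m h => by rw [map_smul, map_smul, map_smul, hx.2 m h]⟩
    | @hact r A v f hf n N hN x hx =>
      refine ⟨?_, fun m h => ?_⟩
      · rw [a.app_act, b.app_act]
        exact congrArg _ (funext fun i => (hx i).1)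
      · rw [P.transformClass.op.d_act f hf n N m hN h x, map_sum, map_sum]
        refine Finset.sum_congr rfl fun i _ => ?_
        rw [Units.smul_def, map_zsmul, map_zsmul, a.app_act, b.app_act]
        refine congrArg _ (congrArg _ (funext fun i' => ?_))
        unfold PreOp.applyAt
        by_cases hi : i' = i
        · rw [dif_pos hi]; exact (hx i').2 _ _
        · rw [dif_neg hi]
          have : ∀ {m : ℤ} (h : n i' = m), a.app _ _ (P.transformClass.op.castDeg h (x i')) =
            b.app _ _ (P.transformClass.op.castDeg h (x i')) := by
            rintro _ rfl; exact (hx i').1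
          exact this _
    | @hd v n m h x hx =>
      exact ⟨hx.2 m h, fun m' h' => by rw [P.transformClass.op.d_d, map_zero, map_zero]⟩
  exact GrOp.Hom.ext (funext fun v => funext fun n => LinearMap.ext fun x => (key x).1)

end FinOp

variable (k C s) in
/-- The Feynman transform. -/
noncomputable def feynmanTransform [CharZero k] : FeynmanTransform k C s where
  functor :=
    { obj := fun P => P.unop.transformClass.op
      map := fun a => FinOp.transformMap a.unop
      map_id := fun P => ModelClass.hom_ext fun v n x => rfl
      map_comp := fun a b => ModelClass.hom_ext fun v n x => rfl }
  gen P := P.transformGen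
  viso_gen P _ _ σ n p := P.transformGen_equivariant σ n p
  exists_unique_hom P Q j hj := by
    have hj' : FinOp.DualMap.Equivariant (P := P) (Q := Q) j := hj
    -- A graded operad is no model, but its jets with the lift of `j` are one. Projection to the
    -- first component of jets then yields the morphism of graded operads.
    have hK : P.transformClass Q.jet (fun v n p => FinOp.DualMap.lift (P := P) (Q := Q) j v n p) :=
      ⟨FinOp.DualMap.lift (P := P) (Q := Q) j, hj'.lift, fun _ _ _ => rfl, fun h p => FinOp.DualMap.jd_lift hj' h p⟩
    refine ⟨(ModelClass.lift Q.jet _ hK).toHom.comp Q.jfstHom, fun v n p => rfl, fun b hb => ?_⟩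
    exact P.transform_hom_unique _ _ fun v n p => hb v n p
  map_gen a _ _ p := rfl
  d_gen P _ _ _ h p := (P.d_transformGen h p).trans (FinOp.DualMap.dif_eq_finsum P.transformGen h p)

end Transform

/-! ### Consequences of admissibility: existence and uniqueness of decompositions. -/

section Admissible

namespace FeynmanCategory

variable {F : FeynmanCategory.{u}} {ι κ : Type} [Finite ι] [Finite κ]

lemma pre_one {A : ι → F.V} {v : F.V} (f : F.Hom A v) : F.pre f (fun i => F.one (A i)) = f :=
  F.comp_one f

/-- A family of isomorphisms of vertices as an isomorphism of families. -/
def FIso.diag {A B : ι → F.V} (σ : ∀ i, F.VIso (A i) (B i)) : FIso A B := ⟨Equiv.refl ι, σ⟩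

lemma FIso.diag_comp_single {A B : ι → F.V} (σ : ∀ i, F.VIso (A i) (B i)) {v : F.V} (f : F.Hom B v) :
    (FIso.diag σ).mor.comp (Mor.single f) = Mor.single (F.pre f (fun i => (σ i).hom)) :=
  (Mor.single_pre f (fun i => (σ i).hom)).symm

lemma FIso.diag_comp_tens {A A' : ι → F.V} {B : κ → F.V} (σ : ∀ i, F.VIso (A i) (A' i)) {α : κ → Type}
    [∀ j, Finite (α j)] (e : (Σ j, α j) ≃ ι) (g : ∀ j, F.Hom (fun a : α j => A' (e ⟨j, a⟩)) (B j)) :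
    (FIso.diag σ).mor.comp (Mor.tens e g) =
      Mor.tens e (fun j => F.pre (g j) (fun a => (σ (e ⟨j, a⟩)).hom)) := by
  let ρ : FIso A' (fun p => A' (e p)) := ⟨e, fun p => VIso.refl F _⟩
  have h1 : ρ.mor.comp (Mor.tens (Equiv.refl _) g) = Mor.tens e g :=
    (Mor.comp_tens_hom_aux ρ g).trans (congrArg (Mor.tens e) (funext fun j => pre_one (g j)))
  rw [← h1, ← Mor.comp_assoc, ← FIso.mor_trans]
  refine (Mor.comp_tens_hom_aux ((FIso.diag σ).trans ρ) g).trans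
    (congrArg (Mor.tens e) (funext fun j => congrArg (F.pre (g j)) (funext fun a => ?_)))
  exact one_post _

lemma FIso.tens_comp_diag {A : ι → F.V} {B B' : κ → F.V} {α : κ → Type}
    [∀ j, Finite (α j)] (e : (Σ j, α j) ≃ ι) (g : ∀ j, F.Hom (fun a : α j => A (e ⟨j, a⟩)) (B j))
    (ρ : ∀ j, F.VIso (B j) (B' j)) :
    (Mor.tens e g).comp (FIso.diag ρ).mor = Mor.tens e (fun j => F.post (ρ j).hom (g j)) := by
  refine Mor.ext_hom (fun _ => rfl) fun j => ?_
  rw [FIso.comp_mor_hom]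
  dsimp only [Mor.tens]
  erw [post_map, F.map_map, F.map_map]

lemma Mor.exists_tens {A : ι → F.V} {B : κ → F.V} {α : κ → Type} [∀ j, Finite (α j)]
    (e : (Σ j, α j) ≃ ι) (g : F.Mor A B) (h : ∀ i, g.π i = (e.symm i).1) :
    ∃ d : ∀ j, F.Hom (fun a : α j => A (e ⟨j, a⟩)) (B j), Mor.tens e d = g := by
  obtain ⟨π, g⟩ := g
  obtain rfl : π = fun i => (e.symm i).1 := funext h
  choose d hd using fun j => map_surjective (Mor.blockEquiv e j) (A := fun i => A i.1) (g j)
  exact ⟨d, congrArg (Mor.mk _) (funext hd)⟩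

end FeynmanCategory

namespace CubicalMorphism

variable {F₁ F₂ : FeynmanCategory.{u}} {C₁ : F₁.Cubical} {C₂ : F₂.Cubical}
  (φ : CubicalMorphism C₁ C₂) {ι κ l : Type} [Finite ι] [Finite κ] [Finite l]

lemma mor_id (A : ι → F₁.V) : φ.mor (Mor.id F₁ A) = Mor.id F₂ (fun i => φ.obj (A i)) :=
  congrArg (Mor.mk (F := F₂) (A := fun i => φ.obj (A i)) (B := fun i => φ.obj (A i)) _)
    (funext fun _ => (φ.map_map _ _).trans (congrArg _ (φ.map_one _)))

lemma mor_single {A : ι → F₁.V} {v : F₁.V} (f : F₁.Hom A v) :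
    φ.mor (Mor.single f) = Mor.single (φ.map f) :=
  congrArg (Mor.mk (F := F₂) (A := fun i => φ.obj (A i)) (B := fun _ => φ.obj v) _)
    (funext fun _ => φ.map_map _ _)

lemma mor_tens {A : ι → F₁.V} {B : κ → F₁.V} {α : κ → Type} [∀ j, Finite (α j)]
    (e : (Σ j, α j) ≃ ι) (g : ∀ j, F₁.Hom (fun a : α j => A (e ⟨j, a⟩)) (B j)) :
    φ.mor (Mor.tens e g) = Mor.tens (A := fun i => φ.obj (A i)) (B := fun j => φ.obj (B j)) e
      (fun j => φ.map (g j)) :=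
  congrArg (Mor.mk (F := F₂) (A := fun i => φ.obj (A i)) (B := fun j => φ.obj (B j)) _)
    (funext fun _ => φ.map_map _ _)

lemma mor_isIso {A : ι → F₁.V} {B : κ → F₁.V} {g : F₁.Mor A B} (hg : g.IsIso) : (φ.mor g).IsIso :=
  ⟨φ.mor hg.inv, by rw [← φ.mor_comp, hg.comp_inv, φ.mor_id],
    by rw [← φ.mor_comp, hg.inv_comp, φ.mor_id]⟩

lemma map_post {A : ι → F₁.V} {v w : F₁.V} (f : F₁.Hom (fun _ : Unit => v) w) (g : F₁.Hom A v) :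
    φ.map (F₁.post f g) = F₂.post (φ.map f) (φ.map g) :=
  (φ.map_map _ _).trans (congrArg _ (φ.map_comp _ _))

@[simp] lemma viso_refl (v : F₁.V) : φ.viso (VIso.refl F₁ v) = VIso.refl F₂ (φ.obj v) :=
  VIso.ext' (φ.map_one v)

lemma viso_trans {u v w : F₁.V} (a : F₁.VIso u v) (b : F₁.VIso v w) :
    φ.viso (a.trans b) = (φ.viso a).trans (φ.viso b) :=
  VIso.ext' (φ.map_post _ _)

lemma viso_symm {v w : F₁.V} (a : F₁.VIso v w) : φ.viso a.symm = (φ.viso a).symm := rfl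

namespace Admissible

variable {φ} (hφ : φ.Admissible)
include hφ

/-- The axioms of admissibility concern words. Here and below they are extended to families by
enumerating the index sets. -/
lemma mor_injective {A : ι → F₁.V} {B : κ → F₁.V} :
    Function.Injective (φ.mor : F₁.Mor A B → F₂.Mor _ _) := by
  intro g g' h
  obtain ⟨W, a, ha⟩ := exists_inIso A
  obtain ⟨W', b, hb⟩ := exists_inIso B
  have h1 : (a.comp g).comp hb.inv = (a.comp g').comp hb.inv :=
    hφ.faithful (A := W) (B := W') (by simp only [φ.mor_comp, h])
  exact ha.cancel_left (hb.inv_isIso.cancel_right h1)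

lemma hom_injective {A : ι → F₁.V} {v : F₁.V} :
    Function.Injective (φ.map : F₁.Hom A v → _) := fun f f' h =>
  Mor.single_injective (hφ.mor_injective (by rw [φ.mor_single, φ.mor_single, h]))

lemma viso_injective {v w : F₁.V} : Function.Injective (φ.viso : F₁.VIso v w → _) := fun _ _ h =>
  VIso.ext' (hφ.hom_injective (congrArg VIso.hom h))

lemma lift_mor {A : ι → F₁.V} {B : κ → F₁.V} {D : l → F₁.V} (g : F₁.Mor A D) (h : F₁.Mor A B)
    (f : F₂.Mor (fun i => φ.obj (B i)) (fun i => φ.obj (D i))) (e : φ.mor g = (φ.mor h).comp f) :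
    ∃ m : F₁.Mor B D, φ.mor m = f := by
  obtain ⟨W, a, ha⟩ := exists_inIso A
  obtain ⟨W', b, hb⟩ := exists_inIso B
  obtain ⟨W'', c, hc⟩ := exists_inIso D
  obtain ⟨m, hm⟩ := hφ.lift (A := W) (B := W') (C := W'') ((a.comp g).comp hc.inv) ((a.comp h).comp hb.inv)
    (((φ.mor b).comp f).comp (φ.mor hc.inv)) (by
      simp only [φ.mor_comp, e, Mor.comp_assoc]
      rw [← Mor.comp_assoc (φ.mor hb.inv), ← φ.mor_comp, hb.inv_comp, φ.mor_id, Mor.id_comp])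
  refine ⟨(hb.inv.comp m).comp c, ?_⟩
  rw [φ.mor_comp, φ.mor_comp, hm]
  simp only [Mor.comp_assoc]
  rw [← φ.mor_comp hc.inv c, hc.inv_comp, φ.mor_id, Mor.comp_id, ← Mor.comp_assoc, ← φ.mor_comp,
    hb.inv_comp, φ.mor_id, Mor.id_comp]

lemma exists_hom {A : ι → F₁.V} {B : κ → F₁.V} {v : F₁.V} (g : F₁.Hom A v) (h : F₁.Mor A B)
    (f : F₂.Hom (fun i => φ.obj (B i)) (φ.obj v)) (e : φ.map g = (φ.mor h).into f) :
    ∃ m : F₁.Hom B v, φ.map m = f := by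
  obtain ⟨m, hm⟩ := hφ.lift_mor (Mor.single g) h (Mor.single f) (by
    rw [φ.mor_single, e, Mor.single_into])
  obtain ⟨m, rfl⟩ := Mor.single_surjective m
  exact ⟨m, Mor.single_injective ((φ.mor_single m).symm.trans hm)⟩

/-- The second factorization axiom, with `B` indexed like `X` and the isomorphism diagonal: the
bijection of index sets in `σ` is absorbed into `B`. -/
lemma factor_mor {A : ι → F₁.V} {D : l → F₁.V} {X : κ → F₂.V} (g : F₁.Mor A D)
    (h : F₂.Mor (fun i => φ.obj (A i)) X) (f : F₂.Mor X (fun i => φ.obj (D i)))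
    (e : φ.mor g = h.comp f) :
    ∃ (B : κ → F₁.V) (g₂ : F₁.Mor A B) (ρ : ∀ j, F₂.VIso (φ.obj (B j)) (X j)),
      h = (φ.mor g₂).comp (FIso.diag ρ).mor := by
  obtain ⟨W, a, ha⟩ := exists_inIso A
  obtain ⟨W', b, hb⟩ := exists_inIso X
  obtain ⟨W'', c, hc⟩ := exists_inIso D
  obtain ⟨B, g₂, g₁, σ, σinv, h1, h2, -, -, h5⟩ := hφ.factor (A := W) (C := W'') (X := W')
    ((a.comp g).comp hc.inv) (((φ.mor a).comp h).comp hb.inv) ((b.comp f).comp (φ.mor hc.inv)) (by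
      simp only [φ.mor_comp, e, Mor.comp_assoc, hb.inv_comp_assoc])
  obtain ⟨r, hr⟩ := FIso.exists_mor_eq (Mor.IsIso.comp ⟨σinv, h1, h2⟩ hb)
  -- Only permutes the letters of `B`; with its help `r` becomes a diagonal family of isomorphisms.
  let q : FIso B.2 (fun j => B.2 (r.e j)) := ⟨r.e, fun j => VIso.refl F₁ _⟩
  refine ⟨fun j => B.2 (r.e j), (ha.inv.comp g₂).comp q.mor, r.σ, ?_⟩
  have hq : φ.mor q.mor = FIso.mor (A := fun i => φ.obj (B.2 i)) (B := fun j => φ.obj (B.2 (r.e j)))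
      ⟨r.e, fun j => VIso.refl F₂ _⟩ :=
    (φ.mor_tens _ _).trans (congrArg (Mor.tens _) (funext fun j => φ.map_one _))
  have h6 : h = (φ.mor ha.inv).comp ((((φ.mor a).comp h).comp hb.inv).comp b) := by
    simp only [Mor.comp_assoc, hb.inv_comp, Mor.comp_id]
    rw [← Mor.comp_assoc, ← φ.mor_comp, ha.inv_comp, φ.mor_id, Mor.id_comp]
  rw [h6, h5, φ.mor_comp, φ.mor_comp, hq, Mor.comp_assoc, Mor.comp_assoc, Mor.comp_assoc,
    ← FIso.mor_trans, ← hr]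
  refine congrArg (fun z => (φ.mor ha.inv).comp ((φ.mor g₂).comp (FIso.mor z))) ?_
  obtain ⟨e, σ⟩ := r
  exact congrArg (FIso.mk e) (funext fun j => (VIso.refl_trans _).symm)

/-- Two decompositions with the same composite differ by an isomorphism. -/
lemma exists_viso {A : ι → F₁.V} {w w' : F₁.V} {v : F₂.V} (g : F₁.Hom A w) (g' : F₁.Hom A w')
    (τ : F₂.VIso (φ.obj w) v) (τ' : F₂.VIso (φ.obj w') v)
    (h : F₂.post τ.hom (φ.map g) = F₂.post τ'.hom (φ.map g')) :
    ∃ m : F₁.VIso w w', g' = F₁.post m.hom g ∧ τ = (φ.viso m).trans τ' := by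
  have key : ∀ {w w' : F₁.V} (g : F₁.Hom A w) (g' : F₁.Hom A w')
    (τ : F₂.VIso (φ.obj w) v) (τ' : F₂.VIso (φ.obj w') v)
    (h : F₂.post τ.hom (φ.map g) = F₂.post τ'.hom (φ.map g')), ∃ m : F₁.Hom (fun _ : Unit => w) w',
      φ.map m = F₂.post τ'.inv τ.hom := by
    intro w w' g g' τ τ' h
    refine hφ.exists_hom g' (Mor.single g) _ (Mor.single_injective ?_)
    rw [Mor.single_into, φ.mor_single, ← Mor.single_post, post_assoc, h, ← post_assoc, τ'.inv_hom,
      one_post]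
  -- The lifting axiom gives morphisms in both directions, mapped by `φ` to `τ'⁻¹ τ` and to its
  -- inverse. Faithfulness makes them inverse to each other.
  obtain ⟨m, hm⟩ := key g g' τ τ' h
  obtain ⟨m', hm'⟩ := key g' g τ' τ h.symm
  refine ⟨⟨m, m', hφ.hom_injective ?_, hφ.hom_injective ?_⟩, hφ.hom_injective ?_, VIso.ext' ?_⟩
  · rw [φ.map_post, hm, hm', φ.map_one, post_assoc, ← post_assoc τ'.hom, τ'.hom_inv, one_post, τ.inv_hom]
  · rw [φ.map_post, hm, hm', φ.map_one, post_assoc, ← post_assoc τ.hom, τ.hom_inv, one_post, τ'.inv_hom]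
  · rw [φ.map_post, hm, post_assoc, h, ← post_assoc, τ'.inv_hom, one_post]
  · change _ = F₂.post τ'.hom (φ.map m)
    rw [hm, ← post_assoc, τ'.hom_inv, one_post]

end Admissible

section Decompositions

variable {φ} {A : ι → F₂.V} {w : ι → F₁.V} {B : κ → F₂.V} {v : F₂.V} {α : κ → Type} [∀ j, Finite (α j)]
  {e : (Σ j, α j) ≃ ι} {f : F₂.Hom B v} {g : ∀ j, F₂.Hom (fun a : α j => A (e ⟨j, a⟩)) (B j)}
  {σ : ∀ i, F₂.VIso (φ.obj (w i)) (A i)} {w' : κ → F₁.V} {ρ : ∀ j, F₂.VIso (φ.obj (w' j)) (B j)}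
  {d : ∀ j, F₁.Hom (fun a : α j => w (e ⟨j, a⟩)) (w' j)}

lemma diag_comp_tens_eq
    (hd : ∀ j, F₂.pre (g j) (fun a => (σ (e ⟨j, a⟩)).hom) = F₂.post (ρ j).hom (φ.map (d j))) :
    (FIso.diag σ).mor.comp (Mor.tens e g) = (φ.mor (Mor.tens e d)).comp (FIso.diag ρ).mor := by
  rw [FIso.diag_comp_tens, φ.mor_tens]
  exact (congrArg (Mor.tens e) (funext hd)).trans
    (FIso.tens_comp_diag (A := fun i => φ.obj (w i)) e (fun j => φ.map (d j)) ρ).symm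

lemma single_pre_comp
    (hd : ∀ j, F₂.pre (g j) (fun a => (σ (e ⟨j, a⟩)).hom) = F₂.post (ρ j).hom (φ.map (d j))) :
    Mor.single (F₂.pre (F₂.map e (A := A) (F₂.comp (A := fun p => A (e p)) f g)) (fun i => (σ i).hom)) =
      (φ.mor (Mor.tens e d)).comp (Mor.single (F₂.pre f (fun j => (ρ j).hom))) := by
  rw [← FIso.diag_comp_single, Mor.single_map_comp, ← Mor.comp_assoc, diag_comp_tens_eq hd,
    Mor.comp_assoc, FIso.diag_comp_single]

lemma decomposition_comp
    (hd : ∀ j, F₂.pre (g j) (fun a => (σ (e ⟨j, a⟩)).hom) = F₂.post (ρ j).hom (φ.map (d j)))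
    {w₀ : F₁.V} {h : F₁.Hom w' w₀} {τ : F₂.VIso (φ.obj w₀) v}
    (hf : F₂.pre f (fun j => (ρ j).hom) = F₂.post τ.hom (φ.map h)) :
    F₂.pre (F₂.map e (A := A) (F₂.comp (A := fun p => A (e p)) f g)) (fun i => (σ i).hom) =
      F₂.post τ.hom (φ.map (F₁.map e (A := w) (F₁.comp (A := fun p => w (e p)) h d))) := by
  refine Mor.single_injective ((single_pre_comp hd).trans ?_)
  rw [hf, Mor.single_post, Mor.single_post, ← Mor.comp_assoc, ← φ.mor_single, ← φ.mor_comp,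
    ← φ.mor_single, Mor.single_map_comp]

namespace Admissible

variable (hφ : φ.Admissible)
include hφ

/-- The lifting axiom at work: given decompositions of the inner factors, one of the composite
descends to the outer factor. -/
lemma exists_decomposition
    (hd : ∀ j, F₂.pre (g j) (fun a => (σ (e ⟨j, a⟩)).hom) = F₂.post (ρ j).hom (φ.map (d j)))
    {w₀ : F₁.V} {h : F₁.Hom w w₀} {τ : F₂.VIso (φ.obj w₀) v}
    (hf : F₂.pre (F₂.map e (A := A) (F₂.comp (A := fun p => A (e p)) f g)) (fun i => (σ i).hom) =
      F₂.post τ.hom (φ.map h)) :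
    ∃ h' : F₁.Hom w' w₀, F₂.pre f (fun j => (ρ j).hom) = F₂.post τ.hom (φ.map h') ∧
      h = F₁.map e (A := w) (F₁.comp (A := fun p => w (e p)) h' d) := by
  obtain ⟨m, hm⟩ := hφ.exists_hom h (Mor.tens e d) (F₂.post τ.inv (F₂.pre f (fun j => (ρ j).hom))) (by
    refine Mor.single_injective ?_
    rw [Mor.single_into, Mor.single_post, ← Mor.comp_assoc, ← single_pre_comp hd, ← Mor.single_post, hf,
      ← post_assoc, τ.inv_hom, one_post])
  have h1 : F₂.pre f (fun j => (ρ j).hom) = F₂.post τ.hom (φ.map m) := by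
    rw [hm, ← post_assoc, τ.hom_inv, one_post]
  refine ⟨m, h1, hφ.hom_injective ?_⟩
  have h2 := congrArg (F₂.post τ.inv) (hf.symm.trans (decomposition_comp hd h1))
  rwa [← post_assoc, ← post_assoc, τ.inv_hom, one_post, one_post] at h2

/-- The factorization axiom at work: if the composite decomposes then so does every inner factor.
Together with `exists_decomposition` this ensures that a composite acts by zero in `L^!` exactly
when the decompositions of its factors do not exist. -/
lemma exists_factors {w₀ : F₁.V} {h : F₁.Hom w w₀} {τ : F₂.VIso (φ.obj w₀) v}
    (hf : F₂.pre (F₂.map e (A := A) (F₂.comp (A := fun p => A (e p)) f g)) (fun i => (σ i).hom) =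
      F₂.post τ.hom (φ.map h)) :
    ∃ (w' : κ → F₁.V) (ρ : ∀ j, F₂.VIso (φ.obj (w' j)) (B j))
      (d : ∀ j, F₁.Hom (fun a : α j => w (e ⟨j, a⟩)) (w' j)),
      ∀ j, F₂.pre (g j) (fun a => (σ (e ⟨j, a⟩)).hom) = F₂.post (ρ j).hom (φ.map (d j)) := by
  obtain ⟨w', g₂, ρ, h1⟩ := hφ.factor_mor (Mor.single h) ((FIso.diag σ).mor.comp (Mor.tens e g))
    ((Mor.single f).comp (Mor.single τ.inv)) (by
      rw [← Mor.comp_assoc, Mor.comp_assoc (FIso.diag σ).mor, ← Mor.single_map_comp, FIso.diag_comp_single, hf,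
        ← Mor.single_post, ← post_assoc, τ.inv_hom, one_post, φ.mor_single])
  obtain ⟨d, rfl⟩ := Mor.exists_tens e g₂ (fun i => (congrFun (congrArg Mor.π h1) i).symm)
  refine ⟨w', ρ, d, ?_⟩
  rw [FIso.diag_comp_tens, φ.mor_tens] at h1
  exact congrFun (Mor.tens_injective e (h1.trans
    (FIso.tens_comp_diag (A := fun i => φ.obj (w i)) e (fun j => φ.map (d j)) ρ)))

end Admissible

end Decompositions

end CubicalMorphism

end Admissible

/-! ### Induced modules, their coefficients and multilinear maps on them. -/

section InducedModules

variable {k : Type u} [Field k] {F₁ F₂ : FeynmanCategory.{u}} {C₁ : F₁.Cubical} {C₂ : F₂.Cubical}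
  {φ : CubicalMorphism C₁ C₂} {s : Bool}

namespace CubicalMorphism

variable (φ) in
/-- The isomorphisms from images of vertices to a given vertex. -/
abbrev Over (v : F₂.V) := Σ w, F₂.VIso (φ.obj w) v

instance (v : F₂.V) : Finite (φ.Over v) := by
  have : Finite {w : F₁.V // φ.obj w = v} := φ.finite_fiber v
  refine Finite.of_injective
    (β := Σ w : {w : F₁.V // φ.obj w = v}, F₂.VIso (φ.obj w.1) v) (fun x => ⟨⟨x.1, x.2.eq⟩, x.2⟩) ?_
  rintro ⟨w, σ⟩ ⟨w', σ'⟩ h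
  simp only [Sigma.mk.injEq, Subtype.mk.injEq] at h
  obtain ⟨rfl, h⟩ := h
  rw [eq_of_heq h]

noncomputable instance (v : F₂.V) : Fintype (φ.Over v) := Fintype.ofFinite _

end CubicalMorphism

namespace Induced

section

variable {P : PreOp k C₁ s} {v : F₂.V} {n : ℤ}

/-- The defining relation involves automorphisms only; skeletality reduces an isomorphism `l` to
that case. -/
lemma mk_viso {w w' : F₁.V} (σ : F₂.VIso (φ.obj w) v) (l : F₁.VIso w' w) (p : P.obj w' n) :
    (mk ((φ.viso l).trans σ) p : Induced φ P v n) = mk σ (P.viso l n p) := by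
  classical
  obtain rfl := l.eq
  refine (Submodule.Quotient.eq _).2 (Submodule.subset_span ⟨w', σ, (φ.viso l).trans σ, l, p, rfl, ?_⟩)
  congr!

/-- A linear map on an induced module is given by compatible linear maps. -/
noncomputable def lift {M : Type*} [AddCommGroup M] [Module k M] (T : ∀ x : φ.Over v, P.obj x.1 n →ₗ[k] M)
    (hT : ∀ (w : F₁.V) (σ : F₂.VIso (φ.obj w) v) (l : F₁.VIso w w) (p : P.obj w n),
      T ⟨w, (φ.viso l).trans σ⟩ p = T ⟨w, σ⟩ (P.viso l n p)) : Induced φ P v n →ₗ[k] M := by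
  classical
  refine Submodule.liftQ _ (DirectSum.toModule k (φ.Over v) M T) (Submodule.span_le.2 ?_)
  rintro _ ⟨w, σ, σ', l, p, h, rfl⟩
  obtain rfl : σ' = (φ.viso l).trans σ := VIso.ext' h
  refine LinearMap.mem_ker.2 ((map_sub _ _ _).trans (sub_eq_zero.2 ?_))
  have h1 : ∀ (x : φ.Over v) (p : P.obj x.1 n), DirectSum.toModule k (φ.Over v) M T
      (DirectSum.of (fun x : Σ w, F₂.VIso (φ.obj w) v => P.obj x.1 n) x p) = T x p := fun x p =>
    DirectSum.toModule_lof k (M := fun x : φ.Over v => P.obj x.1 n) x p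
  exact (h1 ⟨w, (φ.viso l).trans σ⟩ p).trans ((hT w σ l p).trans (h1 ⟨w, σ⟩ (P.viso l n p)).symm)

@[simp] lemma lift_mk {M : Type*} [AddCommGroup M] [Module k M] (T : ∀ x : φ.Over v, P.obj x.1 n →ₗ[k] M)
    (hT) {w : F₁.V} (σ : F₂.VIso (φ.obj w) v) (p : P.obj w n) :
    lift T hT (mk σ p) = T ⟨w, σ⟩ p := by
  classical
  exact DirectSum.toModule_lof k (M := fun x : φ.Over v => P.obj x.1 n) ⟨w, σ⟩ p

lemma hom_ext {M : Type*} [AddCommGroup M] [Module k M] {a b : Induced φ P v n →ₗ[k] M}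
    (h : ∀ (x : φ.Over v) (p : P.obj x.1 n), a (mk x.2 p) = b (mk x.2 p)) : a = b := by
  classical
  refine Submodule.linearMap_qext _ (DirectSum.linearMap_ext k fun x => LinearMap.ext fun p => ?_)
  exact h x p

end

section Coefficients

variable {P : GrOp k C₁ s} {v : F₂.V} {n : ℤ} (hφ : φ.Admissible)

open scoped Classical in
/-- The coefficient of an element of an induced module at an isomorphism. -/
noncomputable def coef (x : φ.Over v) : Induced φ P.toPreOp v n →ₗ[k] P.obj x.1 n :=
  lift (fun y => if h : ∃ l : F₁.VIso y.1 x.1, y.2 = (φ.viso l).trans x.2 then P.viso h.choose n else 0) (by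
    intro w σ l p
    by_cases h : ∃ l : F₁.VIso w x.1, σ = (φ.viso l).trans x.2
    · obtain ⟨m, rfl⟩ := h
      have h1 : ∃ l' : F₁.VIso w x.1, (φ.viso l).trans ((φ.viso m).trans x.2) = (φ.viso l').trans x.2 :=
        ⟨l.trans m, by rw [φ.viso_trans, VIso.trans_assoc]⟩
      have h2 : ∃ l' : F₁.VIso w x.1, (φ.viso m).trans x.2 = (φ.viso l').trans x.2 := ⟨m, rfl⟩
      rw [dif_pos h1, dif_pos h2, ← GrOp.viso_trans]
      -- The isomorphism that relates two representatives is unique because `φ` is faithful; hence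
      -- the arbitrary choices are compatible.
      have h3 : h1.choose = l.trans h2.choose := by
        refine hφ.viso_injective ?_
        have h4 := (congrArg (VIso.trans (φ.viso l)) h2.choose_spec.symm).trans h1.choose_spec
        rw [← VIso.trans_assoc, ← φ.viso_trans] at h4
        have h5 := congrArg (fun t => VIso.trans t x.2.symm) h4
        simpa only [VIso.trans_assoc, VIso.self_trans_symm, VIso.trans_refl] using h5.symm
      rw [h3]
    · have h1 : ¬ ∃ l' : F₁.VIso w x.1, (φ.viso l).trans σ = (φ.viso l').trans x.2 := by
        rintro ⟨m, hm⟩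
        refine h ⟨l.symm.trans m, ?_⟩
        rw [φ.viso_trans, VIso.trans_assoc, ← hm, ← VIso.trans_assoc, φ.viso_symm, VIso.symm_trans_self,
          VIso.refl_trans]
      rw [dif_neg h, dif_neg h1]
      rfl)

lemma coef_mk (x : φ.Over v) {w : F₁.V} (l : F₁.VIso w x.1) (p : P.obj w n) :
    coef hφ x (mk ((φ.viso l).trans x.2) p) = P.viso l n p := by
  have h : ∃ l' : F₁.VIso w x.1, (φ.viso l).trans x.2 = (φ.viso l').trans x.2 := ⟨l, rfl⟩
  refine (lift_mk _ _ _ _).trans ?_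
  rw [dif_pos h]
  have h3 : h.choose = l := by
    refine hφ.viso_injective ?_
    have h5 := congrArg (fun t => VIso.trans t x.2.symm) h.choose_spec
    simpa only [VIso.trans_assoc, VIso.self_trans_symm, VIso.trans_refl] using h5.symm
  rw [h3]

lemma coef_mk_self (x : φ.Over v) (p : P.obj x.1 n) : coef hφ x (mk x.2 p) = p := by
  have h := coef_mk hφ x (VIso.refl F₁ x.1) p
  rwa [φ.viso_refl, VIso.refl_trans, GrOp.viso_refl] at h

lemma coef_mk_eq_zero (x : φ.Over v) {w : F₁.V} (σ : F₂.VIso (φ.obj w) v) (p : P.obj w n)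
    (h : ¬ ∃ l : F₁.VIso w x.1, σ = (φ.viso l).trans x.2) : coef hφ x (mk σ p) = 0 := by
  refine (lift_mk _ _ _ _).trans ?_
  rw [dif_neg h]
  rfl

/-- The isomorphisms which differ from `x` by an isomorphism from `x.1`. -/
def translate (x : φ.Over v) (y : Σ w, F₁.VIso x.1 w) : φ.Over v :=
  ⟨y.1, (φ.viso y.2.symm).trans x.2⟩

lemma viso_translate (x : φ.Over v) (y : Σ w, F₁.VIso x.1 w) :
    (φ.viso y.2).trans (translate x y).2 = x.2 := by
  unfold translate
  rw [← VIso.trans_assoc, φ.viso_symm, VIso.self_trans_symm, VIso.refl_trans]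

include hφ in
lemma translate_injective (x : φ.Over v) : Function.Injective (translate x) := by
  rintro ⟨w, l⟩ ⟨w', l'⟩ h
  obtain ⟨rfl, h⟩ := Sigma.mk.inj h
  have h1 : l.symm = l'.symm := by
    refine hφ.viso_injective ?_
    have h5 := congrArg (fun t => VIso.trans t x.2.symm) (eq_of_heq h)
    simpa only [VIso.trans_assoc, VIso.self_trans_symm, VIso.trans_refl] using h5
  rw [show l = l' from congrArg VIso.symm h1]

lemma coef_translate (x : φ.Over v) (y : Σ w, F₁.VIso x.1 w) (p : P.obj x.1 n) :
    coef hφ (translate x y) (mk x.2 p) = P.viso y.2 n p :=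
  (congrArg (fun t => coef hφ (translate x y) (mk t p)) (viso_translate x y)).symm.trans
    (coef_mk hφ (translate x y) y.2 p)

lemma mk_translate (x : φ.Over v) (y : Σ w, F₁.VIso x.1 w) (p : P.obj x.1 n) :
    (mk (translate x y).2 (P.viso y.2 n p) : Induced φ P.toPreOp v n) = mk x.2 p :=
  (mk_viso _ _ _).symm.trans (congrArg (fun t => mk t p) (viso_translate x y))

lemma coef_eq_zero_of_notMem (x z : φ.Over v) (h : z ∉ Set.range (translate x)) (p : P.obj x.1 n) :
    coef hφ z (mk x.2 p) = 0 := by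
  refine coef_mk_eq_zero hφ z x.2 p ?_
  rintro ⟨l, hl⟩
  refine h ⟨⟨z.1, l⟩, ?_⟩
  unfold translate
  dsimp only
  rw [hl, ← VIso.trans_assoc, φ.viso_symm, VIso.symm_trans_self, VIso.refl_trans]

noncomputable instance (w : F₁.V) : Fintype (Σ w', F₁.VIso w w') :=
  @Fintype.ofFinite _ (Nat.finite_of_card_ne_zero (by rw [card_vIso_out]; exact (autCard_pos w).ne'))

variable {ι : Type} [Fintype ι] {B : ι → F₂.V} {m : ι → ℤ}
  {M : Type*} [AddCommGroup M] [Module k M]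

open scoped Classical in
/-- The multilinear map on induced modules given by compatible multilinear maps. -/
noncomputable def desc (T : ∀ x : ∀ i, φ.Over (B i), MultilinearMap k (fun i => P.obj (x i).1 (m i)) M) :
    MultilinearMap k (fun i => Induced φ P.toPreOp (B i) (m i)) M :=
  ∑ x : ∀ i, φ.Over (B i), (∏ i, (F₁.autCard (x i).1 : k))⁻¹ •
    (T x).compLinearMap (fun i => coef hφ (x i))

/-- Compatibility of multilinear maps with isomorphisms of vertices. -/
def Compatible (T : ∀ x : ∀ i, φ.Over (B i), MultilinearMap k (fun i => P.obj (x i).1 (m i)) M) : Prop :=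
  ∀ (x x' : ∀ i, φ.Over (B i)) (l : ∀ i, F₁.VIso (x i).1 (x' i).1)
    (_ : ∀ i, (x i).2 = (φ.viso (l i)).trans (x' i).2) (p : ∀ i, P.obj (x i).1 (m i)),
    T x p = T x' (fun i => P.viso (l i) (m i) (p i))

variable [CharZero k]

omit [Fintype ι] in
lemma autCard_ne_zero (w : F₁.V) : (F₁.autCard w : k) ≠ 0 :=
  Nat.cast_ne_zero.2 (autCard_pos w).ne'

/-- `desc` averages over all representatives. On a class only the translates of the given
representative have nonzero coefficients, there are `∏ |Aut|` of them, and compatibility gives each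
the value `T x p`. -/
lemma desc_mk {T : ∀ x : ∀ i, φ.Over (B i), MultilinearMap k (fun i => P.obj (x i).1 (m i)) M}
    (hT : Compatible T) (x : ∀ i, φ.Over (B i)) (p : ∀ i, P.obj (x i).1 (m i)) :
    desc hφ T (fun i => mk (x i).2 (p i)) = T x p := by
  classical
  have h1 : desc hφ T (fun i => mk (x i).2 (p i)) = ∑ x' : ∀ i, φ.Over (B i),
      (∏ i, (F₁.autCard (x' i).1 : k))⁻¹ • T x' (fun i => coef hφ (x' i) (mk (x i).2 (p i))) := by
    unfold desc
    rw [sum_apply]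
    rfl
  rw [h1]
  refine (Fintype.sum_of_injective (fun (y : ∀ i, Σ w, F₁.VIso (x i).1 w) i => translate (x i) (y i))
    (fun y y' h => funext fun i => translate_injective hφ (x i) (congrFun h i))
    (fun _ => (∏ i, (F₁.autCard (x i).1 : k))⁻¹ • T x p) _ ?_ ?_).symm.trans ?_
  · intro z hz
    obtain ⟨i, hi⟩ : ∃ i, z i ∉ Set.range (translate (x i)) := by
      by_contra hcon
      push Not at hcon
      choose y hy using hcon
      exact hz ⟨y, funext hy⟩
    rw [MultilinearMap.map_coord_zero _ i (coef_eq_zero_of_notMem hφ (x i) (z i) hi (p i)), smul_zero]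
  · intro y
    refine congrArg₂ (· • ·) ?_ ?_
    · refine congrArg _ (Finset.prod_congr rfl fun i _ => ?_)
      rw [(y i).2.eq]; rfl
    · refine (hT x (fun i => translate (x i) (y i)) (fun i => (y i).2)
        (fun i => (viso_translate (x i) (y i)).symm) p).trans (congrArg _ (funext fun i => ?_))
      exact (coef_translate hφ (x i) (y i) (p i)).symm
  · rw [Finset.sum_const, Finset.card_univ, Fintype.card_pi, ← Nat.cast_smul_eq_nsmul k, smul_smul]
    have h2 : ((∏ i, Fintype.card (Σ w, F₁.VIso (x i).1 w) : ℕ) : k) = ∏ i, (F₁.autCard (x i).1 : k) := by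
      rw [Nat.cast_prod]
      exact Finset.prod_congr rfl fun i _ => by rw [← card_vIso_out, Nat.card_eq_fintype_card]
    rw [h2, mul_inv_cancel₀ (Finset.prod_ne_zero_iff.2 fun i _ => autCard_ne_zero _), one_smul]

/-- A resolution of the identity: the coefficients of a class recover it once per translate, and the
weights `1 / |Aut|` compensate. It replaces a choice of bases in all later arguments on duals. -/
lemma sum_coef (y : Induced φ P.toPreOp v n) :
    ∑ x : φ.Over v, (F₁.autCard x.1 : k)⁻¹ • mk x.2 (coef hφ x y) = y := by
  classical
  have h : (∑ x : φ.Over v, (F₁.autCard x.1 : k)⁻¹ • (mk x.2).comp (coef hφ x)) =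
      (LinearMap.id : Induced φ P.toPreOp v n →ₗ[k] _) := by
    refine hom_ext fun x p => ?_
    rw [LinearMap.sum_apply]
    refine (Fintype.sum_of_injective (translate x) (translate_injective hφ x)
      (fun _ => (F₁.autCard x.1 : k)⁻¹ • mk x.2 p) _ ?_ ?_).symm.trans ?_
    · intro z hz
      rw [LinearMap.smul_apply, LinearMap.comp_apply, coef_eq_zero_of_notMem hφ x z hz, map_zero, smul_zero]
    · intro y
      rw [LinearMap.smul_apply, LinearMap.comp_apply, coef_translate]
      refine congrArg₂ (· • ·) ?_ (mk_translate x y p).symm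
      rw [show (translate x y).1 = x.1 from y.2.eq.symm]
    · rw [Finset.sum_const, Finset.card_univ, ← Nat.cast_smul_eq_nsmul k, smul_smul,
        ← Nat.card_eq_fintype_card, card_vIso_out, mul_inv_cancel₀ (autCard_ne_zero _), one_smul]
      rfl
  have h2 := LinearMap.congr_fun h y
  rw [LinearMap.sum_apply] at h2
  exact h2

include hφ in
lemma multilinear_ext {a b : MultilinearMap k (fun i => Induced φ P.toPreOp (B i) (m i)) M}
    (h : ∀ (x : ∀ i, φ.Over (B i)) (p : ∀ i, P.obj (x i).1 (m i)),
      a (fun i => mk (x i).2 (p i)) = b (fun i => mk (x i).2 (p i))) : a = b := by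
  classical
  refine MultilinearMap.ext fun y => ?_
  have hy : y = fun i => ∑ x : φ.Over (B i), mk x.2 ((F₁.autCard x.1 : k)⁻¹ • coef hφ x (y i)) := by
    funext i
    simp only [map_smul]
    exact (sum_coef hφ (y i)).symm
  rw [hy, MultilinearMap.map_sum, MultilinearMap.map_sum]
  exact Finset.sum_congr rfl fun x _ => h x _

end Coefficients

end Induced

end InducedModules

/-! ### The structure maps of the exceptional push-forward. -/

section PushForward

namespace FeynmanCategory

variable {F : FeynmanCategory.{u}} {ι : Type} [Finite ι] {A A' B : ι → F.V}

lemma pre_trans {v : F.V} (f : F.Hom B v) (l : ∀ i, F.VIso (A i) (A' i)) (σ : ∀ i, F.VIso (A' i) (B i)) :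
    F.pre f (fun i => ((l i).trans (σ i)).hom) =
      F.pre (F.pre f (fun i => (σ i).hom)) (fun i => (l i).hom) := by
  refine Mor.single_injective ?_
  rw [← FIso.diag_comp_single, ← FIso.diag_comp_single l, ← FIso.diag_comp_single σ, ← Mor.comp_assoc,
    ← FIso.mor_trans]
  rfl

lemma pre_post {v w : F.V} (τ : F.Hom (fun _ : Unit => v) w) (f : F.Hom B v) (σ : ∀ i, F.VIso (A i) (B i)) :
    F.pre (F.post τ f) (fun i => (σ i).hom) = F.post τ (F.pre f (fun i => (σ i).hom)) := by
  refine Mor.single_injective ?_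
  rw [← FIso.diag_comp_single, Mor.single_post, Mor.single_post, ← FIso.diag_comp_single, Mor.comp_assoc]

end FeynmanCategory

/-- Renaming the variables of a multilinear map. -/
def MultilinearMap.reindex {k : Type*} [Semiring k] {ι κ : Type*} (e : κ ≃ ι) {M : ι → Type*} {N : Type*}
    [∀ i, AddCommMonoid (M i)] [∀ i, Module k (M i)] [AddCommMonoid N] [Module k N]
    (G : MultilinearMap k (fun p => M (e p)) N) : MultilinearMap k M N where
  toFun x := G (fun p => x (e p))
  map_update_add' x i a b := by
    classical
    obtain ⟨p, rfl⟩ := e.surjective i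
    have h : ∀ a, (fun q => Function.update x (e p) a (e q)) = Function.update (fun q => x (e q)) p a :=
      fun a => Function.update_comp_eq_of_injective' x e.injective p a
    simp only [h, MultilinearMap.map_update_add]
  map_update_smul' x i c a := by
    classical
    obtain ⟨p, rfl⟩ := e.surjective i
    have h : ∀ a, (fun q => Function.update x (e p) a (e q)) = Function.update (fun q => x (e q)) p a :=
      fun a => Function.update_comp_eq_of_injective' x e.injective p a
    simp only [h, MultilinearMap.map_update_smul]

variable {k : Type u} [Field k]

section

variable {F : FeynmanCategory.{u}} {C : F.Cubical} {s : Bool} (P : PreOp k C s)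

/-- Composites of structure maps as multilinear maps. -/
noncomputable def PreOp.actCompL {ι κ : Type} [Fintype ι] [LinearOrder ι] [Fintype κ]
    [LinearOrder κ] {α : κ → Type} [∀ j, Fintype (α j)] [∀ j, LinearOrder (α j)]
    (e : (Σ j, α j) ≃ ι) {A : ι → F.V} {B : κ → F.V} {v : F.V}
    (f : F.Hom B v) (hf : C.deg f ≤ 1)
    (g : ∀ j, F.Hom (fun a : α j => A (e ⟨j, a⟩)) (B j)) (hg : ∀ j, C.deg (g j) ≤ 1)
    (n : ι → ℤ) (N : ℤ)
    (hN : N = ∑ i, n i + s.toNat * ((C.deg f + ∑ j, C.deg (g j) : ℕ) : ℤ)) :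
    MultilinearMap k (fun i => P.obj (A i) (n i)) (P.obj v N) :=
  (((koszulSign e n * passSign (fun j => s.toNat * (C.deg (g j) : ℤ))
    (fun j => ∑ a, n (e ⟨j, a⟩)) : ℤˣ) : ℤ) : k) •
    MultilinearMap.reindex e (M := fun i => P.obj (A i) (n i))
      ((P.act f hf (fun j => ∑ a, n (e ⟨j, a⟩) + s.toNat * (C.deg (g j) : ℤ)) N
        (hN.trans (sum_block e n _ _ _))).compMultilinearMap
          (fun j => P.act (g j) (hg j) (fun a => n (e ⟨j, a⟩)) _ rfl))

lemma PreOp.actCompL_apply {ι κ : Type} [Fintype ι] [LinearOrder ι] [Fintype κ]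
    [LinearOrder κ] {α : κ → Type} [∀ j, Fintype (α j)] [∀ j, LinearOrder (α j)]
    (e : (Σ j, α j) ≃ ι) {A : ι → F.V} {B : κ → F.V} {v : F.V}
    (f : F.Hom B v) (hf : C.deg f ≤ 1)
    (g : ∀ j, F.Hom (fun a : α j => A (e ⟨j, a⟩)) (B j)) (hg : ∀ j, C.deg (g j) ≤ 1)
    (n : ι → ℤ) (N : ℤ) (hN) (x : ∀ i, P.obj (A i) (n i)) :
    P.actCompL e f hf g hg n N hN x = P.actComp e f hf g hg n N hN x := by
  unfold actComp
  rw [Units.smul_def, ← Int.cast_smul_eq_zsmul k]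
  rfl

end

variable {F₁ F₂ : FeynmanCategory.{u}} {C₁ : F₁.Cubical} {C₂ : F₂.Cubical}
  {φ : CubicalMorphism C₁ C₂} {s : Bool}

lemma CubicalMorphism.map_pre {ι : Type} [Finite ι] {A B : ι → F₁.V} {v : F₁.V} (f : F₁.Hom B v)
    (l : ∀ i, F₁.VIso (A i) (B i)) :
    φ.map (F₁.pre f (fun i => (l i).hom)) = F₂.pre (φ.map f) (fun i => (φ.viso (l i)).hom) :=
  (φ.map_map _ _).trans (congrArg _ (φ.map_comp _ _))

lemma CubicalMorphism.deg_eq {ι : Type} [Fintype ι] {w : ι → F₁.V} {B : ι → F₂.V} {v : F₂.V} {f : F₂.Hom B v}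
    {σ : ∀ i, F₂.VIso (φ.obj (w i)) (B i)} {w₀ : F₁.V} {g : F₁.Hom w w₀} {τ : F₂.VIso (φ.obj w₀) v}
    (h : F₂.pre f (fun i => (σ i).hom) = F₂.post τ.hom (φ.map g)) : C₁.deg g = C₂.deg f :=
  (⟨g, τ, h⟩ : φ.Decomposition f σ w₀).deg_g

namespace GrOp

variable (P : GrOp k C₁ s) (hφ : φ.Admissible) {ι : Type} [Fintype ι] [LinearOrder ι]
  {B : ι → F₂.V} {v : F₂.V}

open scoped Classical in
/-- The structure maps of the exceptional push-forward, on representatives. -/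
noncomputable def pushAct (f : F₂.Hom B v) (hf : C₂.deg f ≤ 1) (n : ι → ℤ) (N : ℤ)
    (hN : N = ∑ i, n i + s.toNat * (C₂.deg f : ℤ)) (x : ∀ i, φ.Over (B i)) :
    MultilinearMap k (fun i => P.obj (x i).1 (n i)) (Induced φ P.toPreOp v N) :=
  if h : ∃ w₀, Nonempty (φ.Decomposition f (fun i => (x i).2) w₀) then
    (Induced.mk h.choose_spec.some.τ).compMultilinearMap
      (P.act h.choose_spec.some.g (by rw [h.choose_spec.some.deg_g]; exact hf) n N
        (by rw [h.choose_spec.some.deg_g]; exact hN))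
  else 0

variable {P}

include hφ in
-- Two decompositions differ by an isomorphism `m`, which the relation of the induced module moves
-- from one tensor factor to the other.
lemma mk_act_eq {w : ι → F₁.V} {w₀ w₁ : F₁.V} {n : ι → ℤ} {N : ℤ} (g : F₁.Hom w w₀) (g' : F₁.Hom w w₁)
    (τ : F₂.VIso (φ.obj w₀) v) (τ' : F₂.VIso (φ.obj w₁) v)
    (h : F₂.post τ.hom (φ.map g) = F₂.post τ'.hom (φ.map g')) (hg hg' hN hN')
    (p : ∀ i, P.obj (w i) (n i)) :
    (Induced.mk τ (P.act g hg n N hN p) : Induced φ P.toPreOp v N) =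
      Induced.mk τ' (P.act g' hg' n N hN' p) := by
  obtain ⟨m, rfl, rfl⟩ := hφ.exists_viso g g' τ τ' h
  rw [Induced.mk_viso, P.act_post m g hg hg' n N hN hN' p]

include hφ in
lemma pushAct_eq (f : F₂.Hom B v) (hf : C₂.deg f ≤ 1) (n : ι → ℤ) (N : ℤ) (hN) (x : ∀ i, φ.Over (B i))
    {w₀ : F₁.V} (g : F₁.Hom (fun i => (x i).1) w₀) (τ : F₂.VIso (φ.obj w₀) v)
    (h : F₂.pre f (fun i => (x i).2.hom) = F₂.post τ.hom (φ.map g)) (hg) (hN')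
    (p : ∀ i, P.obj (x i).1 (n i)) :
    P.pushAct f hf n N hN x p = Induced.mk τ (P.act g hg n N hN' p) := by
  have h' : ∃ w₀, Nonempty (φ.Decomposition f (fun i => (x i).2) w₀) := ⟨w₀, ⟨⟨g, τ, h⟩⟩⟩
  unfold pushAct
  rw [dif_pos h']
  exact mk_act_eq hφ _ g _ τ (h'.choose_spec.some.eq.symm.trans h) _ _ _ _ p

lemma pushAct_eq_zero (f : F₂.Hom B v) (hf : C₂.deg f ≤ 1) (n : ι → ℤ) (N : ℤ) (hN) (x : ∀ i, φ.Over (B i))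
    (h : ¬ ∃ w₀, Nonempty (φ.Decomposition f (fun i => (x i).2) w₀)) (p : ∀ i, P.obj (x i).1 (n i)) :
    P.pushAct f hf n N hN x p = 0 := by
  unfold pushAct
  rw [dif_neg h]
  rfl

/-- Change of the isomorphisms in a decomposition. -/
def _root_.CubicalMorphism.Decomposition.change {ι : Type} [Finite ι] {B : ι → F₂.V} {v : F₂.V} {f : F₂.Hom B v}
    {w w' : ι → F₁.V} {σ : ∀ i, F₂.VIso (φ.obj (w i)) (B i)} {σ' : ∀ i, F₂.VIso (φ.obj (w' i)) (B i)}
    (l : ∀ i, F₁.VIso (w i) (w' i)) (h : ∀ i, σ i = (φ.viso (l i)).trans (σ' i)) {w₀ : F₁.V}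
    (D : φ.Decomposition f σ' w₀) : φ.Decomposition f σ w₀ where
  g := F₁.pre D.g (fun i => (l i).hom)
  τ := D.τ
  eq := by
    obtain rfl : σ = fun i => (φ.viso (l i)).trans (σ' i) := funext h
    rw [pre_trans, D.eq, pre_post, φ.map_pre]

include hφ in
lemma pushAct_compatible (f : F₂.Hom B v) (hf : C₂.deg f ≤ 1) (n : ι → ℤ) (N : ℤ) (hN) :
    Induced.Compatible (P.pushAct (φ := φ) f hf n N hN) := by
  intro x x' l h p
  by_cases h' : ∃ w₀, Nonempty (φ.Decomposition f (fun i => (x' i).2) w₀)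
  · obtain ⟨w₀, ⟨D⟩⟩ := h'
    have hD : C₁.deg D.g ≤ 1 := by rw [D.deg_g]; exact hf
    have hE : C₁.deg (D.change l h).g ≤ 1 := by rw [(D.change l h).deg_g]; exact hf
    rw [pushAct_eq hφ f hf n N hN x (D.change l h).g (D.change l h).τ (D.change l h).eq hE
        (by rw [(D.change l h).deg_g]; exact hN),
      pushAct_eq hφ f hf n N hN x' D.g D.τ D.eq hD (by rw [D.deg_g]; exact hN)]
    exact congrArg (Induced.mk D.τ) (P.act_pre D.g l hD hE n N (by rw [D.deg_g]; exact hN) _ p)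
  · rw [pushAct_eq_zero f hf n N hN x' h', pushAct_eq_zero f hf n N hN x]
    rintro ⟨w₀, ⟨D⟩⟩
    refine h' ⟨w₀, ⟨D.change (fun i => (l i).symm) fun i => ?_⟩⟩
    rw [h i, φ.viso_symm, ← VIso.trans_assoc, VIso.symm_trans_self, VIso.refl_trans]

variable (P) in
/-- The exceptional push-forward of a graded operad, without its laws. -/
noncomputable def pushPre : PreOp k C₂ s where
  obj v n := Induced φ P.toPreOp v n
  act f hf n N hN := Induced.desc hφ (P.pushAct f hf n N hN)

variable (P) in
/-- The class of an element in the exceptional push-forward. -/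
noncomputable def pushMk {w : F₁.V} {v : F₂.V} {n : ℤ} (σ : F₂.VIso (φ.obj w) v) :
    P.obj w n →ₗ[k] (P.pushPre hφ).obj v n := Induced.mk σ

variable [CharZero k]

lemma push_act_mk (f : F₂.Hom B v) (hf : C₂.deg f ≤ 1) (n : ι → ℤ) (N : ℤ) (hN) {w : ι → F₁.V}
    (σ : ∀ i, F₂.VIso (φ.obj (w i)) (B i)) {w₀ : F₁.V} (g : F₁.Hom w w₀) (τ : F₂.VIso (φ.obj w₀) v)
    (h : F₂.pre f (fun i => (σ i).hom) = F₂.post τ.hom (φ.map g)) (hg) (hN') (p : ∀ i, P.obj (w i) (n i)) :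
    (P.pushPre hφ).act f hf n N hN (fun i => P.pushMk hφ (σ i) (p i)) = P.pushMk hφ τ (P.act g hg n N hN' p) :=
  (Induced.desc_mk hφ (pushAct_compatible hφ f hf n N hN) (fun i => ⟨w i, σ i⟩) p).trans
    (pushAct_eq hφ f hf n N hN (fun i => ⟨w i, σ i⟩) g τ h hg hN' p)

lemma push_act_mk_eq_zero (f : F₂.Hom B v) (hf : C₂.deg f ≤ 1) (n : ι → ℤ) (N : ℤ) (hN) {w : ι → F₁.V}
    (σ : ∀ i, F₂.VIso (φ.obj (w i)) (B i)) (h : ∀ w₀, IsEmpty (φ.Decomposition f σ w₀))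
    (p : ∀ i, P.obj (w i) (n i)) :
    (P.pushPre hφ).act f hf n N hN (fun i => P.pushMk hφ (σ i) (p i)) = 0 :=
  (Induced.desc_mk hφ (pushAct_compatible hφ f hf n N hN) (fun i => ⟨w i, σ i⟩) p).trans
    (pushAct_eq_zero f hf n N hN (fun i => ⟨w i, σ i⟩) (fun ⟨w₀, ⟨D⟩⟩ => (h w₀).false D) p)

lemma push_ext {n : ι → ℤ} {M : Type*} [AddCommGroup M] [Module k M]
    {a b : MultilinearMap k (fun i => (P.pushPre hφ).obj (B i) (n i)) M}
    (h : ∀ (w : ι → F₁.V) (σ : ∀ i, F₂.VIso (φ.obj (w i)) (B i)) (p : ∀ i, P.obj (w i) (n i)),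
      a (fun i => P.pushMk hφ (σ i) (p i)) = b (fun i => P.pushMk hφ (σ i) (p i))) : a = b :=
  Induced.multilinear_ext hφ (P := P) (B := B) (m := n) (fun x p => h (fun i => (x i).1) (fun i => (x i).2) p)

variable {κ : Type} [Fintype κ] [LinearOrder κ] {α : κ → Type} [∀ j, Fintype (α j)]
  [∀ j, LinearOrder (α j)] (e : (Σ j, α j) ≃ ι) {A : ι → F₂.V} {D : κ → F₂.V} (f : F₂.Hom D v)
  (hf : C₂.deg f ≤ 1) (g : ∀ j, F₂.Hom (fun a : α j => A (e ⟨j, a⟩)) (D j)) (hg : ∀ j, C₂.deg (g j) ≤ 1)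
  (n : ι → ℤ) (N : ℤ) (hN : N = ∑ i, n i + s.toNat * ((C₂.deg f + ∑ j, C₂.deg (g j) : ℕ) : ℤ))
  {w : ι → F₁.V} (σ : ∀ i, F₂.VIso (φ.obj (w i)) (A i)) (p : ∀ i, P.obj (w i) (n i))

/-- Decompositions preserve degrees, so the signs of the composite over `F₂` are those over `F₁`,
and the two structure maps can be evaluated in turn. -/
lemma push_actComp_mk {w' : κ → F₁.V} (ρ : ∀ j, F₂.VIso (φ.obj (w' j)) (D j))
    (d : ∀ j, F₁.Hom (fun a : α j => w (e ⟨j, a⟩)) (w' j))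
    (hd : ∀ j, F₂.pre (g j) (fun a => (σ (e ⟨j, a⟩)).hom) = F₂.post (ρ j).hom (φ.map (d j)))
    {w₀ : F₁.V} (h : F₁.Hom w' w₀) (τ : F₂.VIso (φ.obj w₀) v)
    (hfh : F₂.pre f (fun j => (ρ j).hom) = F₂.post τ.hom (φ.map h)) (h₁) (h₂) (hN') :
    (P.pushPre hφ).actComp e f hf g hg n N hN (fun i => P.pushMk hφ (σ i) (p i)) =
      P.pushMk hφ τ (P.actComp e h h₁ d h₂ n N hN' p) := by
  have hdeg : ∀ j, C₁.deg (d j) = C₂.deg (g j) := fun j =>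
    CubicalMorphism.deg_eq (σ := fun a => σ (e ⟨j, a⟩)) (hd j)
  have hdeg' : C₁.deg h = C₂.deg f := CubicalMorphism.deg_eq hfh
  unfold PreOp.actComp
  have h3 : ∀ j, (P.pushPre hφ).act (g j) (hg j) (fun a => n (e ⟨j, a⟩)) _ rfl
      (fun a => P.pushMk hφ (σ (e ⟨j, a⟩)) (p (e ⟨j, a⟩))) =
      P.pushMk hφ (ρ j) (P.act (d j) (h₂ j) (fun a => n (e ⟨j, a⟩)) _ (by rw [hdeg j])
        (fun a => p (e ⟨j, a⟩))) := fun j =>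
    push_act_mk hφ (g j) (hg j) _ _ _ (fun a => σ (e ⟨j, a⟩)) (d j) (ρ j) (hd j) _ _ _
  have h4 := P.actComp_eq e h h₁ d h₂ n N hN' (fun j => ∑ a, n (e ⟨j, a⟩) + s.toNat * (C₂.deg (g j) : ℤ))
    (fun j => by rw [hdeg j]) (by
      rw [hdeg']; exact hN.trans (sum_block e n _ _ _)) p
  refine Eq.trans ?_ (congrArg (P.pushMk hφ τ) h4).symm
  rw [Units.smul_def, Units.smul_def, map_zsmul]
  refine congrArg₂ (· • ·) (by simp only [hdeg]) ?_
  refine (congrArg _ (funext h3)).trans ?_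
  exact push_act_mk hφ f hf _ N _ ρ h τ hfh _ _ _

/-- Either an inner factor has no decomposition, and its value is zero, or all have one. In the
latter case the outer factor cannot decompose, as decompositions compose. -/
lemma push_actComp_mk_eq_zero
    (h : ∀ w₀, IsEmpty (φ.Decomposition (F₂.map e (A := A) (F₂.comp (A := fun p => A (e p)) f g)) σ w₀)) :
    (P.pushPre hφ).actComp e f hf g hg n N hN (fun i => P.pushMk hφ (σ i) (p i)) = 0 := by
  unfold PreOp.actComp
  refine (congrArg _ ?_).trans (smul_zero _)
  by_cases h' : ∀ j, ∃ w₀, Nonempty (φ.Decomposition (g j) (fun a => σ (e ⟨j, a⟩)) w₀)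
  · choose w' d using h'
    have h3 : ∀ j, (P.pushPre hφ).act (g j) (hg j) (fun a => n (e ⟨j, a⟩)) _ rfl
        (fun a => P.pushMk hφ (σ (e ⟨j, a⟩)) (p (e ⟨j, a⟩))) =
        P.pushMk hφ (d j).some.τ (P.act (d j).some.g (by rw [(d j).some.deg_g]; exact hg j)
          (fun a => n (e ⟨j, a⟩)) _ (by rw [(d j).some.deg_g]) (fun a => p (e ⟨j, a⟩))) := fun j =>
      push_act_mk hφ (g j) (hg j) _ _ _ (fun a => σ (e ⟨j, a⟩)) _ _ (d j).some.eq _ _ _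
    refine (congrArg _ (funext h3)).trans ?_
    refine push_act_mk_eq_zero hφ f hf _ N _ (fun j => (d j).some.τ) (fun w₀ => ⟨fun E => ?_⟩) _
    exact (h w₀).false ⟨_, E.τ, CubicalMorphism.decomposition_comp (fun j => (d j).some.eq) E.eq⟩
  · push Not at h'
    obtain ⟨j, hj⟩ := h'
    refine MultilinearMap.map_coord_zero _ j ?_
    exact push_act_mk_eq_zero hφ (g j) (hg j) _ _ _ (fun a => σ (e ⟨j, a⟩)) (fun w₀ => by simpa using hj w₀) _

end GrOp

end PushForward

/-! ### The laws of the exceptional push-forward as a graded operad. -/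

section ExceptionalPushForward

variable {k : Type u} [Field k] [CharZero k] {F₁ F₂ : FeynmanCategory.{u}} {C₁ : F₁.Cubical} {C₂ : F₂.Cubical}
  {φ : CubicalMorphism C₁ C₂} {s : Bool}

namespace GrOp

variable (P : GrOp k C₁ s) (hφ : φ.Admissible)

/-- If the composite decomposes, both factorizations lift to factorizations in `F₁` of one morphism
`q`, and `act_swap` for `P` applies to the lifts. If it does not, both sides vanish. -/
lemma push_swap {A X X' : F₂.Word} {v : F₂.V} (g : F₂.Mor A.2 X.2) (f : F₂.Hom X.2 v)
    (g' : F₂.Mor A.2 X'.2) (f' : F₂.Hom X'.2 v) (hg : C₂.mor g = 1) (hf : C₂.deg f = 1) (hg' : C₂.mor g' = 1)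
    (hf' : C₂.deg f' = 1) (h : g.into f = g'.into f') (hne : ¬ EquivFact g f g' f') (hf₁ hg₁ hf₁' hg₁')
    (n : Fin A.1 → ℤ) (N : ℤ) (hN hN') (x : ∀ i, (P.pushPre hφ).obj (A.2 i) (n i)) :
    (P.pushPre hφ).actComp (Equiv.sigmaFiberEquiv g'.π) f' hf₁' g'.hom hg₁' n N hN' x =
      (s.toNat : ℤ).negOnePow •
        (P.pushPre hφ).actComp (Equiv.sigmaFiberEquiv g.π) f hf₁ g.hom hg₁ n N hN x := by
  have hL := (P.pushPre hφ).actCompL_apply (Equiv.sigmaFiberEquiv g.π) f hf₁ g.hom hg₁ n N hN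
  have hL' := (P.pushPre hφ).actCompL_apply (Equiv.sigmaFiberEquiv g'.π) f' hf₁' g'.hom hg₁' n N hN'
  -- As a scalar of `k` the sign is part of an equation between `k`-multilinear maps, which may be
  -- checked on classes.
  obtain ⟨c, hc⟩ : ∃ c : k, c = (((s.toNat : ℤ).negOnePow : ℤ) : k) := ⟨_, rfl⟩
  suffices key : (P.pushPre hφ).actCompL (Equiv.sigmaFiberEquiv g'.π) f' hf₁' g'.hom hg₁' n N hN' =
      c • (P.pushPre hφ).actCompL (Equiv.sigmaFiberEquiv g.π) f hf₁ g.hom hg₁ n N hN by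
    refine (hL' x).symm.trans ((congrArg (fun t : MultilinearMap k (fun i => (P.pushPre hφ).obj (A.2 i) (n i)) _ =>
      t x) key).trans ?_)
    rw [Units.smul_def, ← Int.cast_smul_eq_zsmul k, ← hc]
    exact congrArg (c • ·) (hL x)
  refine push_ext hφ fun w σ p => ?_
  refine (hL' _).trans (Eq.trans ?_ (congrArg (c • ·) (hL _)).symm)
  by_cases h' : ∃ w₀, Nonempty (φ.Decomposition (g.into f) σ w₀)
  · obtain ⟨w₀, ⟨⟨q, τ, hq⟩⟩⟩ := h'
    have hq' : F₂.pre (g'.into f') (fun i => (σ i).hom) = F₂.post τ.hom (φ.map q) := by rw [← h]; exact hq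
    obtain ⟨w', ρ, d, hd⟩ := hφ.exists_factors hq
    obtain ⟨r, hr, hqr⟩ := hφ.exists_decomposition hd hq
    obtain ⟨w'', ρ', d', hd'⟩ := hφ.exists_factors hq'
    obtain ⟨r', hr', hqr'⟩ := hφ.exists_decomposition hd' hq'
    have e2 := CubicalMorphism.deg_eq hr
    have e3 : ∀ j, C₁.deg (d j) = C₂.deg (g.hom j) := fun j =>
      CubicalMorphism.deg_eq (σ := fun a => σ _) (hd j)
    have e2' := CubicalMorphism.deg_eq hr'
    have e3' : ∀ j, C₁.deg (d' j) = C₂.deg (g'.hom j) := fun j =>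
      CubicalMorphism.deg_eq (σ := fun a => σ _) (hd' j)
    have hNr : N = ∑ i, n i + s.toNat * ((C₁.deg r + ∑ j, C₁.deg (d j) : ℕ) : ℤ) :=
      hN.trans (congrArg (fun t : ℕ => ∑ i, n i + s.toNat * (t : ℤ))
        (congrArg₂ (· + ·) e2.symm (Finset.sum_congr rfl fun j _ => (e3 j).symm)))
    have hNr' : N = ∑ i, n i + s.toNat * ((C₁.deg r' + ∑ j, C₁.deg (d' j) : ℕ) : ℤ) :=
      hN'.trans (congrArg (fun t : ℕ => ∑ i, n i + s.toNat * (t : ℤ))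
        (congrArg₂ (· + ·) e2'.symm (Finset.sum_congr rfl fun j _ => (e3' j).symm)))
    have hA' := push_actComp_mk hφ (Equiv.sigmaFiberEquiv g'.π) f' hf₁' g'.hom hg₁' n N hN' σ p ρ' d' hd' r' τ hr'
      (by rw [e2']; exact hf₁') (fun j => by rw [e3']; exact hg₁' j) hNr'
    have hA := push_actComp_mk hφ (Equiv.sigmaFiberEquiv g.π) f hf₁ g.hom hg₁ n N hN σ p ρ d hd r τ hr
        (by rw [e2]; exact hf₁) (fun j => by rw [e3]; exact hg₁ j) hNr
    refine hA'.trans (Eq.trans ?_ (congrArg (c • ·) hA).symm)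
    let G : F₁.Mor w w' := ⟨g.π, d⟩
    let G' : F₁.Mor w w'' := ⟨g'.π, d'⟩
    have hG : (FIso.diag σ).mor.comp g = (φ.mor G).comp (FIso.diag ρ).mor := by
      have := CubicalMorphism.diag_comp_tens_eq (e := Equiv.sigmaFiberEquiv g.π) (g := g.hom) (σ := σ) (ρ := ρ) (d := d) hd
      rw [Mor.tens_fiber] at this
      exact this.trans (congrArg (fun t => (φ.mor t).comp _) (Mor.tens_fiber G))
    have hG' : (FIso.diag σ).mor.comp g' = (φ.mor G').comp (FIso.diag ρ').mor := by
      have := CubicalMorphism.diag_comp_tens_eq (e := Equiv.sigmaFiberEquiv g'.π) (g := g'.hom) (σ := σ) (ρ := ρ') (d := d') hd'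
      rw [Mor.tens_fiber] at this
      exact this.trans (congrArg (fun t => (φ.mor t).comp _) (Mor.tens_fiber G'))
    have hsw := P.act_swap (A := ⟨A.1, w⟩) (X := ⟨X.1, w'⟩) (X' := ⟨X'.1, w''⟩) G r G' r'
      ((Finset.sum_congr rfl fun j _ => e3 j).trans hg) (e2.trans hf)
      ((Finset.sum_congr rfl fun j _ => e3' j).trans hg') (e2'.trans hf') (hqr.symm.trans hqr') (by
        -- An equivalence of the lifts would be mapped by `φ`, and conjugated by the diagonal
        -- isomorphisms, to an equivalence of the original factorizations.
        rintro ⟨m, hm, h1, h2⟩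
        refine hne ⟨(((FIso.diag ρ).mor_isIso.inv).comp (φ.mor m)).comp (FIso.diag ρ').mor,
          ((FIso.diag ρ).mor_isIso.inv_isIso.comp (φ.mor_isIso hm)).comp (FIso.diag ρ').mor_isIso,
          (FIso.diag σ).mor_isIso.cancel_left ?_, ?_⟩
        · rw [← Mor.comp_assoc, hG, hG', Mor.comp_assoc, Mor.comp_assoc,
            (FIso.diag ρ).mor_isIso.comp_inv_assoc, ← Mor.comp_assoc, ← φ.mor_comp, h1]
        · refine Mor.single_injective ((FIso.diag ρ).mor_isIso.cancel_left ?_)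
          rw [Mor.single_into, Mor.comp_assoc, Mor.comp_assoc, (FIso.diag ρ).mor_isIso.comp_inv_assoc,
            FIso.diag_comp_single, hr', FIso.diag_comp_single, hr, Mor.single_post, Mor.single_post,
            ← Mor.comp_assoc, ← h2, φ.map_into, Mor.single_into])
      (by rw [e2]; exact hf₁) (fun j => (e3 j).le.trans (hg₁ j)) (by rw [e2']; exact hf₁')
      (fun j => (e3' j).le.trans (hg₁' j)) n N
      hNr hNr' p
    refine (congrArg (P.pushMk hφ τ) hsw).trans ?_
    rw [Units.smul_def, map_zsmul, ← Int.cast_smul_eq_zsmul k, ← hc]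
  · have h1 : ∀ w₀, IsEmpty (φ.Decomposition (g.into f) σ w₀) := fun w₀ => ⟨fun D => h' ⟨w₀, ⟨D⟩⟩⟩
    have h2 : ∀ w₀, IsEmpty (φ.Decomposition (g'.into f') σ w₀) := by rw [← h]; exact h1
    have hA := push_actComp_mk_eq_zero hφ (Equiv.sigmaFiberEquiv g.π) f hf₁ g.hom hg₁ n N hN σ p h1
    have hA' := push_actComp_mk_eq_zero hφ (Equiv.sigmaFiberEquiv g'.π) f' hf₁' g'.hom hg₁' n N hN' σ p h2
    exact hA'.trans ((congrArg (c • ·) hA).trans (smul_zero _)).symm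

/-- The exceptional push-forward of a graded operad. -/
noncomputable def push : GrOp k C₂ s where
  toPreOp := P.pushPre hφ
  act_one v n h hn x := by
    have key : ((MultilinearMap.ofSubsingleton k ((P.pushPre hφ).obj v n) ((P.pushPre hφ).obj v n) ()).symm
        ((P.pushPre hφ).act (F₂.one v) h (fun _ => n) n hn)) = LinearMap.id := by
      refine Induced.hom_ext fun x p => ?_
      have h1 := push_act_mk hφ (F₂.one v) h (fun _ => n) n hn (fun _ : Unit => x.2) (F₁.one x.1) x.2 (by
        refine Mor.single_injective ?_
        rw [φ.map_one, post_one, ← FIso.diag_comp_single, Mor.single_one, Mor.comp_id]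
        refine Mor.ext_hom (fun _ => rfl) ?_
        rintro ⟨⟩
        rw [← FIso.mor_hom]
        dsimp only [Mor.single]
        erw [F₂.map_map]
        exact map_congr (by exact Equiv.ext fun _ => rfl) HEq.rfl) (by rw [C₁.deg_one]; exact zero_le_one)
        (by rw [C₁.deg_one]; simp) (fun _ => p)
      rw [P.act_one] at h1
      exact h1
    exact LinearMap.congr_fun key x
  act_comp := by
    intro ι κ _ _ _ _ α _ _ e A B v f hf g hg h n N hN hN' x
    rw [← PreOp.actCompL_apply]
    refine congrArg (fun t : MultilinearMap k (fun i => (P.pushPre hφ).obj (A i) (n i)) _ => t x) ?_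
    refine push_ext hφ fun w σ p => ?_
    rw [PreOp.actCompL_apply]
    by_cases h' : ∃ w₀, Nonempty (φ.Decomposition (F₂.map e (A := A) (F₂.comp (A := fun p => A (e p)) f g)) σ w₀)
    · obtain ⟨w₀, ⟨⟨q, τ, hq⟩⟩⟩ := h'
      obtain ⟨w', ρ, d, hd⟩ := hφ.exists_factors hq
      obtain ⟨r, hr, rfl⟩ := hφ.exists_decomposition hd hq
      have e1 := CubicalMorphism.deg_eq hq
      have e2 := CubicalMorphism.deg_eq hr
      have e3 : ∀ j, C₁.deg (d j) = C₂.deg (g j) := fun j =>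
        CubicalMorphism.deg_eq (σ := fun a => σ (e ⟨j, a⟩)) (hd j)
      rw [push_act_mk hφ _ h n N hN σ _ τ hq (by rw [e1]; exact h) (by rw [e1]; exact hN),
        push_actComp_mk hφ e f hf g hg n N hN' σ p ρ d hd r τ hr (by rw [e2]; exact hf)
          (fun j => by rw [e3]; exact hg j) (by simp only [e2, e3]; exact hN')]
      exact congrArg (P.pushMk hφ τ) (P.act_comp e r _ d _ _ n N _ _ p)
    · have h'' : ∀ w₀, IsEmpty (φ.Decomposition (F₂.map e (A := A) (F₂.comp (A := fun p => A (e p)) f g)) σ w₀) :=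
        fun w₀ => ⟨fun D => h' ⟨w₀, ⟨D⟩⟩⟩
      rw [push_act_mk_eq_zero hφ _ h n N hN σ h'', push_actComp_mk_eq_zero hφ e f hf g hg n N hN' σ p h'']
  act_swap g f g' f' hg hf hg' hf' h hne hf₁ hg₁ hf₁' hg₁' n N hN hN' x :=
    P.push_swap hφ g f g' f' hg hf hg' hf' h hne hf₁ hg₁ hf₁' hg₁' n N hN hN' x

end GrOp

end ExceptionalPushForward

/-! ### The differential and the functoriality of the exceptional push-forward. -/

section ExceptionalPushForward

variable {k : Type u} [Field k] [CharZero k] {F₁ F₂ : FeynmanCategory.{u}} {C₁ : F₁.Cubical} {C₂ : F₂.Cubical}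
  {φ : CubicalMorphism C₁ C₂} {s : Bool}

/-- The linear maps which apply `d` in the place `i`. -/
def PreOp.applyAtL {F : FeynmanCategory.{u}} {C : F.Cubical} (P : PreOp k C s)
    (d : ∀ {v : F.V} {n m : ℤ}, m = n + 1 → P.obj v n →ₗ[k] P.obj v m)
    {ι : Type} [DecidableEq ι] (A : ι → F.V) (n : ι → ℤ) (i j : ι) :
    P.obj (A j) (n j) →ₗ[k] P.obj (A j) (if j = i then n j + 1 else n j) :=
  if h : j = i then d (by simp [h]) else P.castL (by simp [h])

lemma PreOp.applyAtL_apply {F : FeynmanCategory.{u}} {C : F.Cubical} (P : PreOp k C s)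
    (d : ∀ {v : F.V} {n m : ℤ}, m = n + 1 → P.obj v n →ₗ[k] P.obj v m)
    {ι : Type} [DecidableEq ι] {A : ι → F.V} {n : ι → ℤ} (x : ∀ i, P.obj (A i) (n i)) (i j : ι) :
    P.applyAtL d A n i j (x j) = P.applyAt (fun h => d h) x i j := by
  unfold applyAtL applyAt
  split_ifs <;> rfl

namespace DGOp

variable (P : DGOp k C₁ s) (hφ : φ.Admissible)

lemma push_hom_ext {P : GrOp k C₁ s} {v : F₂.V} {n : ℤ} {M : Type*} [AddCommGroup M] [Module k M]
    {a b : (P.pushPre hφ).obj v n →ₗ[k] M}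
    (h : ∀ (w : F₁.V) (σ : F₂.VIso (φ.obj w) v) (p : P.obj w n), a (P.pushMk hφ σ p) = b (P.pushMk hφ σ p)) :
    a = b :=
  Induced.hom_ext fun x p => h x.1 x.2 p

lemma pushMk_viso {P : GrOp k C₁ s} {v : F₂.V} {n : ℤ} {w w' : F₁.V} (σ : F₂.VIso (φ.obj w) v)
    (l : F₁.VIso w' w) (p : P.obj w' n) :
    P.pushMk hφ ((φ.viso l).trans σ) p = P.pushMk hφ σ (P.viso l n p) :=
  Induced.mk_viso σ l p

/-- The differential of the exceptional push-forward. -/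
noncomputable def pushD {v : F₂.V} {n m : ℤ} (h : m = n + 1) :
    (P.toGrOp.pushPre hφ).obj v n →ₗ[k] (P.toGrOp.pushPre hφ).obj v m :=
  Induced.lift (fun x => (P.toGrOp.pushMk hφ x.2).comp (P.d h)) (fun _ σ l p =>
    (pushMk_viso hφ σ l (P.d h p)).trans (congrArg (P.toGrOp.pushMk hφ σ) (P.d_viso l h p).symm))

lemma pushD_mk {v : F₂.V} {n m : ℤ} (h : m = n + 1) {w : F₁.V} (σ : F₂.VIso (φ.obj w) v) (p : P.obj w n) :
    P.pushD hφ h (P.toGrOp.pushMk hφ σ p) = P.toGrOp.pushMk hφ σ (P.d h p) :=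
  Induced.lift_mk _ _ _ _

lemma castDeg_pushMk {v : F₂.V} {n m : ℤ} (h : n = m) {w : F₁.V} (σ : F₂.VIso (φ.obj w) v) (p : P.obj w n) :
    (P.toGrOp.pushPre hφ).castDeg h (P.toGrOp.pushMk hφ σ p) = P.toGrOp.pushMk hφ σ (P.castDeg h p) := by
  subst h; rfl

lemma applyAt_pushMk {ι : Type} [DecidableEq ι] {w : ι → F₁.V} {B : ι → F₂.V} {n : ι → ℤ}
    (σ : ∀ i, F₂.VIso (φ.obj (w i)) (B i)) (p : ∀ i, P.obj (w i) (n i)) (i j : ι) :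
    (P.toGrOp.pushPre hφ).applyAt (fun h => P.pushD hφ h) (fun i => P.toGrOp.pushMk hφ (σ i) (p i)) i j =
      P.toGrOp.pushMk hφ (σ j) (P.applyAt (fun h => P.d h) p i j) := by
  unfold PreOp.applyAt
  split_ifs with h
  · exact P.pushD_mk hφ _ _ _
  · exact P.castDeg_pushMk hφ _ _ _

lemma pushD_pushD {v : F₂.V} {n m l : ℤ} (h : m = n + 1) (h' : l = m + 1) (x : (P.toGrOp.pushPre hφ).obj v n) :
    P.pushD hφ h' (P.pushD hφ h x) = 0 := by
  refine LinearMap.congr_fun (f := (P.pushD hφ h').comp (P.pushD hφ h)) (g := 0)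
    (push_hom_ext hφ fun w σ p => ?_) x
  rw [LinearMap.zero_apply, LinearMap.comp_apply, pushD_mk, pushD_mk, P.d_d, map_zero]

/-- Checked on classes, where the push-forward acts through a morphism `g` of the same degree; the
rule and its signs are those of `P.d_act`. -/
lemma pushD_act {ι : Type} [Fintype ι] [LinearOrder ι] {B : ι → F₂.V} {v : F₂.V}
    (f : F₂.Hom B v) (hf : C₂.deg f ≤ 1) (n : ι → ℤ) (N M : ℤ)
    (hN : N = ∑ i, n i + s.toNat * (C₂.deg f : ℤ)) (hM : M = N + 1)
    (hM' : ∀ i, M = ∑ j, (if j = i then n j + 1 else n j) + s.toNat * (C₂.deg f : ℤ))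
    (x : ∀ i, (P.toGrOp.pushPre hφ).obj (B i) (n i)) :
    P.pushD hφ hM ((P.toGrOp.pushPre hφ).act f hf n N hN x) =
      ∑ i, (s.toNat * (C₂.deg f : ℤ) + ∑ j with j < i, n j).negOnePow •
        (P.toGrOp.pushPre hφ).act f hf (fun j => if j = i then n j + 1 else n j) M (hM' i)
          ((P.toGrOp.pushPre hφ).applyAt (fun h => P.pushD hφ h) x i) := by
  let c : ι → k := fun i => (((s.toNat * (C₂.deg f : ℤ) + ∑ j with j < i, n j).negOnePow : ℤ) : k)
  let T : ι → MultilinearMap k (fun i => (P.toGrOp.pushPre hφ).obj (B i) (n i)) ((P.toGrOp.pushPre hφ).obj v M) :=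
    fun i => ((P.toGrOp.pushPre hφ).act f hf (fun j => if j = i then n j + 1 else n j) M (hM' i)).compLinearMap
      ((P.toGrOp.pushPre hφ).applyAtL (fun h => P.pushD hφ h) B n i)
  have hT : ∀ i x, T i x = (P.toGrOp.pushPre hφ).act f hf (fun j => if j = i then n j + 1 else n j) M (hM' i)
      ((P.toGrOp.pushPre hφ).applyAt (fun h => P.pushD hφ h) x i) := fun i x =>
    congrArg ((P.toGrOp.pushPre hφ).act f hf (fun j => if j = i then n j + 1 else n j) M (hM' i))
      (funext fun j => (P.toGrOp.pushPre hφ).applyAtL_apply (fun h => P.pushD hφ h) x i j)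
  have hS : ∀ x, (∑ i, c i • T i) x = ∑ i, c i • T i x := fun x => by
    rw [sum_apply]
    rfl
  have key : (P.pushD hφ hM).compMultilinearMap ((P.toGrOp.pushPre hφ).act f hf n N hN) = ∑ i, c i • T i := by
    refine GrOp.push_ext hφ fun w σ p => ?_
    rw [hS]
    have h1 : ∀ i, T i (fun i => P.toGrOp.pushMk hφ (σ i) (p i)) =
        (P.toGrOp.pushPre hφ).act f hf (fun j => if j = i then n j + 1 else n j) M (hM' i)
          (fun j => P.toGrOp.pushMk hφ (σ j) (P.applyAt (fun h => P.d h) p i j)) := fun i =>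
      (hT i _).trans (congrArg _ (funext fun j => P.applyAt_pushMk hφ σ p i j))
    simp only [h1]
    by_cases h' : ∃ w₀, Nonempty (φ.Decomposition f σ w₀)
    · obtain ⟨w₀, ⟨⟨g, τ, h⟩⟩⟩ := h'
      have hd := CubicalMorphism.deg_eq h
      have hg : C₁.deg g ≤ 1 := by rw [hd]; exact hf
      have hN₁ : N = ∑ i, n i + s.toNat * (C₁.deg g : ℤ) := by rw [hd]; exact hN
      have hM₁ : ∀ i, M = ∑ j, (if j = i then n j + 1 else n j) + s.toNat * (C₁.deg g : ℤ) := fun i => by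
        rw [hd]; exact hM' i
      refine (congrArg (P.pushD hφ hM) (GrOp.push_act_mk hφ f hf n N hN σ g τ h hg hN₁ p)).trans ?_
      rw [P.pushD_mk hφ hM τ, P.d_act g hg n N M hN₁ hM p, map_sum]
      refine Finset.sum_congr rfl fun i _ => ?_
      rw [Units.smul_def, map_zsmul, ← Int.cast_smul_eq_zsmul k]
      exact congrArg₂ (· • ·) (by rw [hd]) (GrOp.push_act_mk hφ f hf _ M (hM' i) σ g τ h hg (hM₁ i) _).symm
    · have h'' : ∀ w₀, IsEmpty (φ.Decomposition f σ w₀) := fun w₀ => ⟨fun D => h' ⟨w₀, ⟨D⟩⟩⟩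
      refine (congrArg (P.pushD hφ hM) (GrOp.push_act_mk_eq_zero hφ f hf n N hN σ h'' p)).trans ?_
      rw [map_zero]
      refine (Finset.sum_eq_zero fun i _ => ?_).symm
      rw [GrOp.push_act_mk_eq_zero hφ f hf _ M (hM' i) σ h'' _, smul_zero]
  refine (congrArg (fun t : MultilinearMap k (fun i => (P.toGrOp.pushPre hφ).obj (B i) (n i)) _ => t x) key).trans ?_
  refine (hS x).trans (Finset.sum_congr rfl fun i _ => ?_)
  rw [Units.smul_def, ← Int.cast_smul_eq_zsmul k]
  exact congrArg (c i • ·) (hT i x)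

/-- The exceptional push-forward of a differential graded operad. -/
noncomputable def push : DGOp k C₂ s where
  toGrOp := P.toGrOp.push hφ
  d h := P.pushD hφ h
  d_d h h' x := P.pushD_pushD hφ h h' x
  d_act f hf n N M hN hM x := P.pushD_act hφ f hf n N M hN hM _ x

variable {P} {Q : DGOp k C₁ s}

/-- The functoriality of the exceptional push-forward, on components. -/
noncomputable def pushMapApp (a : P ⟶ Q) (v : F₂.V) (n : ℤ) :
    (P.toGrOp.pushPre hφ).obj v n →ₗ[k] (Q.toGrOp.pushPre hφ).obj v n :=
  Induced.lift (fun x => (Q.toGrOp.pushMk hφ x.2).comp (a.app x.1 n)) (fun w σ l p =>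
    (pushMk_viso hφ σ l (a.app w n p)).trans (congrArg (Q.toGrOp.pushMk hφ σ) (a.app_viso l n p).symm))

lemma pushMapApp_mk (a : P ⟶ Q) {v : F₂.V} {n : ℤ} {w : F₁.V} (σ : F₂.VIso (φ.obj w) v) (p : P.obj w n) :
    pushMapApp hφ a v n (P.toGrOp.pushMk hφ σ p) = Q.toGrOp.pushMk hφ σ (a.app w n p) :=
  Induced.lift_mk _ _ _ _

lemma pushMapApp_act (a : P ⟶ Q) {ι : Type} [Fintype ι] [LinearOrder ι] {B : ι → F₂.V} {v : F₂.V}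
    (f : F₂.Hom B v) (hf : C₂.deg f ≤ 1) (n : ι → ℤ) (N : ℤ) (hN) (x : ∀ i, (P.toGrOp.pushPre hφ).obj (B i) (n i)) :
    pushMapApp hφ a v N ((P.toGrOp.pushPre hφ).act f hf n N hN x) =
      (Q.toGrOp.pushPre hφ).act f hf n N hN (fun i => pushMapApp hφ a (B i) (n i) (x i)) := by
  have key : (pushMapApp hφ a v N).compMultilinearMap ((P.toGrOp.pushPre hφ).act f hf n N hN) =
      ((Q.toGrOp.pushPre hφ).act f hf n N hN).compLinearMap (fun i => pushMapApp hφ a (B i) (n i)) := by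
    refine GrOp.push_ext hφ fun w σ p => ?_
    rw [LinearMap.compMultilinearMap_apply, MultilinearMap.compLinearMap_apply]
    simp only [pushMapApp_mk]
    by_cases h' : ∃ w₀, Nonempty (φ.Decomposition f σ w₀)
    · obtain ⟨w₀, ⟨⟨g, τ, h⟩⟩⟩ := h'
      have hd := CubicalMorphism.deg_eq h
      have hg : C₁.deg g ≤ 1 := by rw [hd]; exact hf
      have hN₁ : N = ∑ i, n i + s.toNat * (C₁.deg g : ℤ) := by rw [hd]; exact hN
      rw [GrOp.push_act_mk hφ f hf n N hN σ g τ h hg hN₁ p, GrOp.push_act_mk hφ f hf n N hN σ g τ h hg hN₁,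
        pushMapApp_mk, a.app_act]
    · have h'' : ∀ w₀, IsEmpty (φ.Decomposition f σ w₀) := fun w₀ => ⟨fun D => h' ⟨w₀, ⟨D⟩⟩⟩
      rw [GrOp.push_act_mk_eq_zero hφ f hf n N hN σ h'' p, GrOp.push_act_mk_eq_zero hφ f hf n N hN σ h'', map_zero]
  exact congrArg (fun t : MultilinearMap k (fun i => (P.toGrOp.pushPre hφ).obj (B i) (n i)) _ => t x) key

lemma pushMapApp_d (a : P ⟶ Q) {v : F₂.V} {n m : ℤ} (h : m = n + 1) (x : (P.toGrOp.pushPre hφ).obj v n) :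
    pushMapApp hφ a v m (P.pushD hφ h x) = Q.pushD hφ h (pushMapApp hφ a v n x) := by
  refine LinearMap.congr_fun (f := (pushMapApp hφ a v m).comp (P.pushD hφ h))
    (g := (Q.pushD hφ h).comp (pushMapApp hφ a v n)) (push_hom_ext hφ fun w σ p => ?_) x
  rw [LinearMap.comp_apply, LinearMap.comp_apply, pushD_mk, pushMapApp_mk, pushMapApp_mk, pushD_mk, a.app_d]

/-- The functoriality of the exceptional push-forward. -/
noncomputable def pushMap (a : P ⟶ Q) : P.push hφ ⟶ Q.push hφ where
  app := pushMapApp hφ a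
  app_act f hf n N hN x := pushMapApp_act hφ a f hf n N hN x
  app_d h x := pushMapApp_d hφ a h x

end DGOp

lemma DGOp.hom_ext_app {F : FeynmanCategory.{u}} {C : F.Cubical} {P Q : DGOp k C s} {a b : P ⟶ Q}
    (h : ∀ v n, a.app v n = b.app v n) : a = b :=
  DGOp.Hom.ext (funext fun v => funext fun n => h v n)

variable (k s) in
/-- The exceptional push-forward along an admissible morphism. -/
noncomputable def exceptionalPushforward (hφ : φ.Admissible) : ExceptionalPushforward k φ s where
  functor :=
    { obj := fun P => P.push hφ
      map := fun a => DGOp.pushMap hφ a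
      map_id := fun P => DGOp.hom_ext_app fun v n => Induced.hom_ext fun y p =>
        DGOp.pushMapApp_mk hφ (𝟙 P) y.2 p
      map_comp := fun {P Q R} a b => DGOp.hom_ext_app fun v n => Induced.hom_ext fun y p =>
        (DGOp.pushMapApp_mk hφ (a ≫ b) y.2 p).trans
          ((congrArg (DGOp.pushMapApp hφ b v n) (DGOp.pushMapApp_mk hφ a y.2 p)).trans
            (DGOp.pushMapApp_mk hφ b y.2 _)).symm }
  equiv P v n := LinearEquiv.refl k _
  map_mk a _ _ _ σ p := DGOp.pushMapApp_mk hφ a σ p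
  d_mk P _ _ _ h _ σ p := P.pushD_mk hφ h σ p
  act_mk := by
    classical
    intro P ι _ _ w B v f hf n N hN σ p
    by_cases h' : ∃ w₀, Nonempty (φ.Decomposition f σ w₀)
    · obtain ⟨w₀, hw⟩ := h'
      rw [finsum_eq_single _ w₀]
      · rw [dif_pos hw]
        exact GrOp.push_act_mk hφ f hf n N hN σ hw.some.g hw.some.τ hw.some.eq _ _ p
      · intro w₁ hne
        rw [dif_neg]
        rintro ⟨D⟩
        -- Targets of two decompositions are isomorphic, hence equal, so the sum over `w₀` has only
        -- one nonzero term.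
        obtain ⟨m, -⟩ := hφ.exists_viso D.g hw.some.g D.τ hw.some.τ (D.eq.symm.trans hw.some.eq)
        exact hne m.eq
    · have h'' : ∀ w₀, IsEmpty (φ.Decomposition f σ w₀) := fun w₀ => ⟨fun D => h' ⟨w₀, ⟨D⟩⟩⟩
      refine (GrOp.push_act_mk_eq_zero hφ f hf n N hN σ h'' p).trans ?_
      refine (finsum_eq_zero_of_forall_eq_zero fun w₀ => ?_).symm
      exact dif_neg fun h => h' ⟨w₀, h⟩

end ExceptionalPushForward

/-! ### Morphisms out of a Feynman transform, using only its defining properties. -/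

section Universal

variable {k : Type u} [Field k] {F : FeynmanCategory.{u}} {C : F.Cubical} {s : Bool}

/-- An element together with its differential, as a morphism to the jets. -/
noncomputable def DGOp.jetHom (P : DGOp k C s) : GrOp.Hom P.toGrOp P.toGrOp.jetGr where
  app v n := LinearMap.prod LinearMap.id (P.d rfl)
  app_act {ι _ _ A v} f hf n N hN x := by
    refine GrOp.jext rfl ?_
    refine Eq.trans ?_ (P.toGrOp.jsnd_act f hf n N hN _).symm
    refine (P.d_act f hf n N (N + 1) hN rfl x).trans (Finset.sum_congr rfl fun i _ => ?_)
    refine congrArg _ (congrArg _ (funext fun j => ?_))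
    have key : ∀ {v : F.V} {n m : ℤ} (h : m = n + 1) (x : P.obj v n), P.d h x = P.castL h.symm (P.d rfl x) := by
      rintro v n _ rfl x; rfl
    by_cases hj : j = i
    · subst hj
      refine Eq.trans ?_ (P.toGrOp.mix_self _ _).symm
      unfold PreOp.applyAt
      rw [dif_pos rfl]
      exact key _ _
    · refine Eq.trans ?_ (P.toGrOp.mix_of_ne _ hj).symm
      unfold PreOp.applyAt
      rw [dif_neg hj]
      rfl

/-- The functoriality of jets. -/
noncomputable def GrOp.Hom.jetMap {P Q : GrOp k C s} (a : GrOp.Hom P Q) : GrOp.Hom P.jetGr Q.jetGr where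
  app v n := (a.app v n).prodMap (a.app v (n + 1))
  app_act {ι _ _ A v} f hf n N hN x := by
    refine GrOp.jext (a.app_act f hf n N hN _) ?_
    refine Eq.trans ?_ (Q.jsnd_act f hf n N hN _).symm
    refine (congrArg (a.app v (N + 1)) (P.jsnd_act f hf n N hN x)).trans ?_
    rw [map_sum]
    refine Finset.sum_congr rfl fun i _ => ?_
    rw [Units.smul_def, map_zsmul, ← Units.smul_def, a.app_act]
    refine congrArg _ (congrArg _ (funext fun j => ?_))
    by_cases hj : j = i
    · subst hj
      exact (congrArg (a.app _ _) (P.mix_self x j)).trans ((a.app_castL _ _).trans (Q.mix_self (fun i => ((a.app (A i) (n i)).prodMap (a.app (A i) (n i + 1)) : _ →ₗ[k] Q.jetGr.obj (A i) (n i)) (x i)) j).symm)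
    · exact (congrArg (a.app _ _) (P.mix_of_ne x hj)).trans ((a.app_castL _ _).trans (Q.mix_of_ne (fun i => ((a.app (A i) (n i)).prodMap (a.app (A i) (n i + 1)) : _ →ₗ[k] Q.jetGr.obj (A i) (n i)) (x i)) hj).symm)

namespace FeynmanTransform

variable (D : FeynmanTransform k C s) (P : FinOp k C s)

/-- The generators. -/
abbrev gens : P.DualMap (D.functor.obj (.op P)).toGrOp := fun v n => D.gen P v n

lemma gens_equivariant : (D.gens P).Equivariant := fun σ n p => D.viso_gen P σ n p

variable {P}

lemma d_gen' [CharZero k] {v : F.V} {n m : ℤ} (h : m = n + 1) (p : Module.Dual k (P.obj.obj v (-n))) :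
    (D.functor.obj (.op P)).d h (D.gen P v n p) = (D.gens P).dif h p :=
  (D.d_gen P h p).trans (FinOp.DualMap.dif_eq_finsum (D.gens P) h p).symm

lemma hom_ext {Q : GrOp k C (!s)} {a b : GrOp.Hom (D.functor.obj (.op P)).toGrOp Q}
    (h : ∀ v n p, a.app v n (D.gen P v n p) = b.app v n (D.gen P v n p)) : a = b := by
  refine (D.exists_unique_hom P Q ((D.gens P).map b) ?_).unique h (fun _ _ _ => rfl)
  exact FinOp.DualMap.Equivariant.map (D.gens_equivariant P) b

lemma dgHom_ext {Q : DGOp k C (!s)} {a b : D.functor.obj (.op P) ⟶ Q}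
    (h : ∀ v n p, a.app v n (D.gen P v n p) = b.app v n (D.gen P v n p)) : a = b := by
  have h1 : a.toHom = b.toHom := D.hom_ext h
  exact DGOp.Hom.ext (congrArg GrOp.Hom.app h1)

/-- A morphism of graded operads which commutes with the differentials on generators is a morphism of
differential graded operads. -/
lemma app_d_of_gen {Q : DGOp k C (!s)} (a : GrOp.Hom (D.functor.obj (.op P)).toGrOp Q.toGrOp)
    (h : ∀ v n (p : Module.Dual k (P.obj.obj v (-n))),
      a.app v (n + 1) ((D.functor.obj (.op P)).d rfl (D.gen P v n p)) = Q.d rfl (a.app v n (D.gen P v n p)))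
    {v : F.V} {n m : ℤ} (hm : m = n + 1) (x : (D.functor.obj (.op P)).obj v n) :
    a.app v m ((D.functor.obj (.op P)).d hm x) = Q.d hm (a.app v n x) := by
  subst hm
  -- Both sides are morphisms of graded operads to the jets of `Q`, namely `x ↦ (a x, a (d x))` and
  -- `x ↦ (a x, d (a x))`. By freeness they agree as soon as they agree on generators.
  have h1 : (D.functor.obj (.op P)).jetHom.comp a.jetMap = a.comp Q.jetHom :=
    D.hom_ext fun v n p => GrOp.jext rfl (h v n p)
  exact congrArg (fun t : GrOp.Hom (D.functor.obj (.op P)).toGrOp Q.toGrOp.jetGr =>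
    Q.toGrOp.jsnd (t.app v n x)) h1

/-- The morphism of differential graded operads given by its values on generators. -/
lemma exists_dgHom {Q : DGOp k C (!s)} (j : P.DualMap Q.toGrOp) (hj : j.Equivariant)
    (h : ∀ a : GrOp.Hom (D.functor.obj (.op P)).toGrOp Q.toGrOp, (∀ v n p, a.app v n (D.gen P v n p) = j v n p) →
      ∀ v n (p : Module.Dual k (P.obj.obj v (-n))),
      a.app v (n + 1) ((D.functor.obj (.op P)).d rfl (D.gen P v n p)) = Q.d rfl (j v n p)) :
    ∃ a : D.functor.obj (.op P) ⟶ Q, ∀ v n p, a.app v n (D.gen P v n p) = j v n p := by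
  obtain ⟨a, ha, -⟩ := D.exists_unique_hom P Q.toGrOp j (fun σ n p => hj σ n p)
  refine ⟨{ toHom := a, app_d := fun hm x => D.app_d_of_gen a (fun v n p => ?_) hm x }, ha⟩
  rw [h a ha v n p, ha]

end FeynmanTransform

end Universal

/-! ### Classes and coefficients in an arbitrary exceptional push-forward. -/

section Pushforward

variable {k : Type u} [Field k] [CharZero k] {F₁ F₂ : FeynmanCategory.{u}} {C₁ : F₁.Cubical} {C₂ : F₂.Cubical}
  {φ : CubicalMorphism C₁ C₂} {s : Bool}

namespace Induced

variable {P : GrOp k C₁ s} {v v' : F₂.V} {n : ℤ} (hφ : φ.Admissible)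

lemma coef_mk_trans {w w' : F₁.V} (σ : F₂.VIso (φ.obj w) v) (σ' : F₂.VIso (φ.obj w') v) (τ : F₂.VIso v v')
    (p : P.obj w' n) :
    coef hφ ⟨w, σ.trans τ⟩ (mk (σ'.trans τ) p) = coef hφ ⟨w, σ⟩ (mk σ' p) := by
  by_cases h : ∃ l : F₁.VIso w' w, σ' = (φ.viso l).trans σ
  · obtain ⟨l, rfl⟩ := h
    rw [VIso.trans_assoc]
    exact (coef_mk hφ ⟨w, σ.trans τ⟩ l p).trans (coef_mk hφ ⟨w, σ⟩ l p).symm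
  · rw [coef_mk_eq_zero hφ ⟨w, σ⟩ σ' p h, coef_mk_eq_zero hφ ⟨w, σ.trans τ⟩]
    rintro ⟨l, hl⟩
    refine h ⟨l, ?_⟩
    have := congrArg (fun t => VIso.trans t τ.symm) hl
    simpa only [VIso.trans_assoc, VIso.self_trans_symm, VIso.trans_refl] using this

lemma viso_coef {w w' : F₁.V} (l : F₁.VIso w w') (σ : F₂.VIso (φ.obj w') v) (y : Induced φ P.toPreOp v n) :
    P.viso l n (coef hφ ⟨w, (φ.viso l).trans σ⟩ y) = coef hφ ⟨w', σ⟩ y := by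
  refine LinearMap.congr_fun (f := (P.viso l n).comp (coef hφ ⟨w, (φ.viso l).trans σ⟩))
    (g := coef hφ ⟨w', σ⟩) (hom_ext fun x p => ?_) y
  rw [LinearMap.comp_apply]
  by_cases h : ∃ m : F₁.VIso x.1 w, x.2 = (φ.viso m).trans ((φ.viso l).trans σ)
  · obtain ⟨m, hm⟩ := h
    rw [hm]
    refine (congrArg _ (coef_mk hφ ⟨w, (φ.viso l).trans σ⟩ m p)).trans ?_
    rw [← GrOp.viso_trans, ← VIso.trans_assoc, ← φ.viso_trans]
    exact (coef_mk hφ ⟨w', σ⟩ (m.trans l) p).symm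
  · refine (congrArg _ (coef_mk_eq_zero hφ ⟨w, (φ.viso l).trans σ⟩ x.2 p h)).trans ?_
    rw [map_zero]
    refine (coef_mk_eq_zero hφ ⟨w', σ⟩ x.2 p ?_).symm
    rintro ⟨m, hm⟩
    refine h ⟨m.trans l.symm, ?_⟩
    rw [hm, φ.viso_trans, φ.viso_symm, VIso.trans_assoc, ← VIso.trans_assoc (φ.viso l).symm,
      VIso.symm_trans_self, VIso.refl_trans]

lemma coef_map {Q : GrOp k C₁ s} {n m : ℤ} (T : ∀ w, P.obj w n →ₗ[k] Q.obj w m)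
    (hT : ∀ {w w' : F₁.V} (l : F₁.VIso w w') p, T w' (P.viso l n p) = Q.viso l m (T w p))
    (x : φ.Over v) {w : F₁.V} (σ : F₂.VIso (φ.obj w) v) (p : P.obj w n) :
    coef hφ x (mk σ (T w p)) = T x.1 (coef hφ x (mk σ p)) := by
  by_cases h : ∃ l : F₁.VIso w x.1, σ = (φ.viso l).trans x.2
  · obtain ⟨l, rfl⟩ := h
    rw [coef_mk, coef_mk, hT]
  · rw [coef_mk_eq_zero hφ x _ _ h, coef_mk_eq_zero hφ x _ _ h, map_zero]

end Induced

namespace ExceptionalPushforward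

variable (E : ExceptionalPushforward k φ s) (P : DGOp k C₁ s) (hφ : φ.Admissible)

/-- The class `[p ⊗ σ]` in the exceptional push-forward. -/
noncomputable def cls {w : F₁.V} {v : F₂.V} (n : ℤ) (σ : F₂.VIso (φ.obj w) v) :
    P.obj w n →ₗ[k] (E.functor.obj P).obj v n :=
  (E.equiv P v n).toLinearMap.comp (Induced.mk σ)

/-- The coefficients of an element of the exceptional push-forward. -/
noncomputable def cf {v : F₂.V} (n : ℤ) (x : φ.Over v) : (E.functor.obj P).obj v n →ₗ[k] P.obj x.1 n :=
  (Induced.coef (P := P.toGrOp) hφ x).comp (E.equiv P v n).symm.toLinearMap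

variable {P} {v v' : F₂.V} {n : ℤ}

lemma cf_cls (x : φ.Over v) {w : F₁.V} (σ : F₂.VIso (φ.obj w) v) (p : P.obj w n) :
    E.cf P hφ n x (E.cls P n σ p) = Induced.coef (P := P.toGrOp) hφ x (Induced.mk σ p) :=
  congrArg (Induced.coef (P := P.toGrOp) hφ x) ((E.equiv P v n).symm_apply_apply _)

lemma hom_ext {M : Type*} [AddCommGroup M] [Module k M] {a b : (E.functor.obj P).obj v n →ₗ[k] M}
    (h : ∀ (w : F₁.V) (σ : F₂.VIso (φ.obj w) v) (p : P.obj w n), a (E.cls P n σ p) = b (E.cls P n σ p)) :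
    a = b := by
  have h1 : a.comp (E.equiv P v n).toLinearMap = b.comp (E.equiv P v n).toLinearMap :=
    Induced.hom_ext fun x p => h x.1 x.2 p
  refine LinearMap.ext fun y => ?_
  have h2 := LinearMap.congr_fun h1 ((E.equiv P v n).symm y)
  simpa using h2

lemma sum_cls_cf (y : (E.functor.obj P).obj v n) :
    ∑ x : φ.Over v, (F₁.autCard x.1 : k)⁻¹ • E.cls P n x.2 (E.cf P hφ n x y) = y := by
  have h := congrArg (E.equiv P v n) (Induced.sum_coef (P := P.toGrOp) hφ ((E.equiv P v n).symm y))
  rw [LinearEquiv.apply_symm_apply, map_sum] at h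
  refine Eq.trans (Finset.sum_congr rfl fun x _ => ?_) h
  rw [map_smul]
  rfl

variable {ι : Type} [Fintype ι] [LinearOrder ι] {B : ι → F₂.V}

include hφ in
-- Turns the sum over targets and the chosen decomposition in `act_mk` into a formula for any
-- decomposition at hand; uniqueness up to isomorphism permits this.
lemma act_cls (f : F₂.Hom B v) (hf : C₂.deg f ≤ 1) (n : ι → ℤ) (N : ℤ) (hN) {w : ι → F₁.V}
    (σ : ∀ i, F₂.VIso (φ.obj (w i)) (B i)) {w₀ : F₁.V} (g : F₁.Hom w w₀) (τ : F₂.VIso (φ.obj w₀) v)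
    (h : F₂.pre f (fun i => (σ i).hom) = F₂.post τ.hom (φ.map g)) (hg) (hN') (p : ∀ i, P.obj (w i) (n i)) :
    (E.functor.obj P).act f hf n N hN (fun i => E.cls P _ (σ i) (p i)) = E.cls P N τ (P.act g hg n N hN' p) := by
  have hw : Nonempty (φ.Decomposition f σ w₀) := ⟨⟨g, τ, h⟩⟩
  refine (E.act_mk P f hf n N hN σ p).trans ?_
  rw [finsum_eq_single _ w₀]
  · rw [dif_pos hw]
    exact congrArg (E.equiv P v N) (GrOp.mk_act_eq (P := P.toGrOp) hφ _ g _ τ (hw.some.eq.symm.trans h) _ _ _ _ p)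
  · intro w₁ hne
    rw [dif_neg]
    rintro ⟨D⟩
    obtain ⟨m, -⟩ := hφ.exists_viso D.g g D.τ τ (D.eq.symm.trans h)
    exact hne m.eq

lemma act_cls_eq_zero (f : F₂.Hom B v) (hf : C₂.deg f ≤ 1) (n : ι → ℤ) (N : ℤ) (hN) {w : ι → F₁.V}
    (σ : ∀ i, F₂.VIso (φ.obj (w i)) (B i)) (h : ∀ w₀, IsEmpty (φ.Decomposition f σ w₀))
    (p : ∀ i, P.obj (w i) (n i)) :
    (E.functor.obj P).act f hf n N hN (fun i => E.cls P _ (σ i) (p i)) = 0 := by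
  refine (E.act_mk P f hf n N hN σ p).trans (finsum_eq_zero_of_forall_eq_zero fun w₀ => dif_neg ?_)
  rintro ⟨D⟩
  exact (h w₀).false D

include hφ in
lemma viso_cls (τ : F₂.VIso v v') {w : F₁.V} (σ : F₂.VIso (φ.obj w) v) (p : P.obj w n) :
    (E.functor.obj P).viso τ n (E.cls P n σ p) = E.cls P n (σ.trans τ) p := by
  rw [PreOp.viso_apply]
  have h1 : F₂.pre τ.hom (fun _ : Unit => σ.hom) = F₂.post (σ.trans τ).hom (φ.map (F₁.one w)) := by
    rw [φ.map_one, post_one]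
    refine congrArg (fun e => F₂.map e (A := fun _ => φ.obj w) (F₂.comp (α := fun _ => Unit) τ.hom fun _ => σ.hom)) ?_
    exact Equiv.ext fun _ => rfl
  refine (E.act_cls hφ τ.hom _ (fun _ => n) n _ (fun _ => σ) (F₁.one w) (σ.trans τ) h1
    (by rw [C₁.deg_one]; exact zero_le_one) (by rw [C₁.deg_one]; simp) (fun _ => p)).trans ?_
  rw [P.act_one]

lemma cf_viso (τ : F₂.VIso v v') {w : F₁.V} (σ : F₂.VIso (φ.obj w) v) (y : (E.functor.obj P).obj v n) :
    E.cf P hφ n ⟨w, σ.trans τ⟩ ((E.functor.obj P).viso τ n y) = E.cf P hφ n ⟨w, σ⟩ y := by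
  refine LinearMap.congr_fun (f := (E.cf P hφ n ⟨w, σ.trans τ⟩).comp ((E.functor.obj P).viso τ n))
    (g := E.cf P hφ n ⟨w, σ⟩) (E.hom_ext fun w' σ' p => ?_) y
  rw [LinearMap.comp_apply, E.viso_cls hφ, E.cf_cls, E.cf_cls]
  exact Induced.coef_mk_trans (P := P.toGrOp) hφ σ σ' τ p

lemma viso_cf {w w' : F₁.V} (l : F₁.VIso w w') (σ : F₂.VIso (φ.obj w') v) (y : (E.functor.obj P).obj v n) :
    P.viso l n (E.cf P hφ n ⟨w, (φ.viso l).trans σ⟩ y) = E.cf P hφ n ⟨w', σ⟩ y :=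
  Induced.viso_coef (P := P.toGrOp) hφ l σ _

lemma cf_d {m : ℤ} (h : m = n + 1) (x : φ.Over v) (y : (E.functor.obj P).obj v n) :
    E.cf P hφ m x ((E.functor.obj P).d h y) = P.d h (E.cf P hφ n x y) := by
  refine LinearMap.congr_fun (f := (E.cf P hφ m x).comp ((E.functor.obj P).d h))
    (g := (P.d h).comp (E.cf P hφ n x)) (E.hom_ext fun w' σ' p => ?_) y
  rw [LinearMap.comp_apply, LinearMap.comp_apply]
  refine (congrArg _ (E.d_mk P h σ' p)).trans ?_
  refine (E.cf_cls hφ x σ' _).trans ((Induced.coef_map (P := P.toGrOp) (Q := P.toGrOp) hφ (fun w => P.d h)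
    (fun l p => P.d_viso l h p) x σ' p).trans (congrArg _ (E.cf_cls hφ x σ' p).symm))

lemma cf_map {Q : DGOp k C₁ s} (a : P ⟶ Q) (x : φ.Over v) (y : (E.functor.obj P).obj v n) :
    E.cf Q hφ n x ((E.functor.map a).app v n y) = a.app x.1 n (E.cf P hφ n x y) := by
  refine LinearMap.congr_fun (f := (E.cf Q hφ n x).comp ((E.functor.map a).app v n))
    (g := (a.app x.1 n).comp (E.cf P hφ n x)) (E.hom_ext fun w' σ' p => ?_) y
  rw [LinearMap.comp_apply, LinearMap.comp_apply]
  refine (congrArg _ (E.map_mk a σ' p)).trans ?_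
  refine (E.cf_cls hφ x σ' _).trans ((Induced.coef_map (P := P.toGrOp) (Q := Q.toGrOp) hφ (fun w => a.app w n)
    (fun l p => a.app_viso l n p) x σ' p).trans (congrArg _ (E.cf_cls hφ x σ' p).symm))

include hφ in
-- Only finitely many isomorphisms lead from images of vertices to a given vertex, by the finiteness
-- of the fibres of `φ` and of automorphism groups. So each component is a finite sum of images of
-- components of `P`.
lemma finiteType (hP : DGOp.finiteType P) : DGOp.finiteType (E.functor.obj P) := by
  classical
  constructor
  · intro v n
    have : ∀ x : φ.Over v, Module.Finite k (P.obj x.1 n) := fun x => hP.1 x.1 n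
    refine Module.Finite.of_surjective
      (∑ x : φ.Over v, (E.cls P n x.2).comp (LinearMap.proj (φ := fun x : φ.Over v => P.obj x.1 n) x)) ?_
    intro y
    refine ⟨fun x => (F₁.autCard x.1 : k)⁻¹ • E.cf P hφ n x y, ?_⟩
    rw [LinearMap.sum_apply]
    refine Eq.trans (Finset.sum_congr rfl fun x _ => ?_) (E.sum_cls_cf hφ y)
    rw [LinearMap.comp_apply, LinearMap.proj_apply, map_smul]
  · intro A N
    -- A nonzero component of the push-forward requires a nonzero component of `P` over the same
    -- vertex; the degrees are covered by finitely many finite sets, one for each family of such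
    -- vertices.
    refine (Set.finite_iUnion fun x : ∀ i, φ.Over (A.2 i) => hP.2 ⟨A.1, fun i => (x i).1⟩ N).subset ?_
    rintro n ⟨hn, h⟩
    have : ∀ i, ∃ x : φ.Over (A.2 i), Nontrivial (P.obj x.1 (n i)) := by
      intro i
      by_contra hcon
      push Not at hcon
      obtain ⟨y, hy⟩ := (@exists_ne _ (h i) (0 : (E.functor.obj P).obj (A.2 i) (n i)))
      refine hy ?_
      rw [← E.sum_cls_cf hφ y]
      refine Finset.sum_eq_zero fun x _ => ?_
      have := hcon x
      rw [Subsingleton.elim (E.cf P hφ (n i) x y) 0, map_zero, smul_zero]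
    choose x hx using this
    exact Set.mem_iUnion.2 ⟨x, hn, hx⟩

end ExceptionalPushforward

end Pushforward

/-! ### Contractions in the presence of a resolution of the identity. -/

section Resolution

variable {k : Type u} [Field k] {ι : Type} [Fintype ι] {V : ι → Type u} [∀ i, AddCommGroup (V i)]
  [∀ i, Module k (V i)] [∀ i, Module.Finite k (V i)] {M : Type u} [AddCommGroup M] [Module k M]

/-- Contractions and resolutions of the identity. -/
lemma contr_resolution [DecidableEq ι] {κ : ι → Type u} [∀ i, Fintype (κ i)] {W : ∀ i, κ i → Type u}
    [∀ i x, AddCommGroup (W i x)] [∀ i x, Module k (W i x)] [∀ i x, Module.Finite k (W i x)]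
    {U : ι → Type u} [∀ i, AddCommGroup (U i)] [∀ i, Module k (U i)]
    (r : ∀ i, κ i → k) (c : ∀ i x, V i →ₗ[k] W i x) (m : ∀ i x, W i x →ₗ[k] V i)
    (h : ∀ i y, ∑ x, r i x • m i x (c i x y) = y) (β : MultilinearMap k V k) (T : MultilinearMap k U M)
    (S : ∀ i, Module.Dual k (V i) →ₗ[k] U i) :
    contr β (fun ξ => T (fun i => S i (ξ i))) = ∑ x : ∀ i, κ i, (∏ i, r i (x i)) •
      contr (fun y : ∀ i, W i (x i) => β (fun i => m i (x i) (y i)))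
        (fun η => T (fun i => S i ((η i).comp (c i (x i))))) := by
  have h1 : ∀ x : ∀ i, κ i, contr (fun y : ∀ i, W i (x i) => β (fun i => m i (x i) (y i)))
        (fun η => T (fun i => S i ((η i).comp (c i (x i))))) =
      contr β (fun ω => T (fun i => S i (((ω i).comp (m i (x i))).comp (c i (x i))))) := fun x =>
    contr_linear (Equiv.refl ι) (V := fun i => W i (x i)) (W := V) (U := U) β (fun i => m i (x i)) T
      (fun i => (S i).comp (c i (x i)).dualMap) (fun i ω => S i ((ω.comp (m i (x i))).comp (c i (x i))))
      (fun i ω => rfl)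
  simp only [h1, ← contr_smul_right]
  rw [← contr_sum_right]
  refine congrArg (contr β) (funext fun ω => ?_)
  simp only [← T.map_smul_univ]
  rw [← T.map_sum (fun i x => r i x • S i (((ω i).comp (m i x)).comp (c i x)))]
  refine congrArg T (funext fun i => ?_)
  simp only [← map_smul]
  rw [← map_sum]
  refine congrArg (S i) (LinearMap.ext fun y => ?_)
  rw [LinearMap.sum_apply]
  conv_lhs => rw [← h i y]
  rw [map_sum]
  refine Finset.sum_congr rfl fun x _ => ?_
  rw [map_smul]
  rfl

lemma contr_zero_left (c : (∀ i, Module.Dual k (V i)) → M) : contr (fun _ => 0) c = 0 := by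
  simp only [contr, zero_smul, Finset.sum_const_zero]

end Resolution

/-! ### Comparison of the differentials over `F₁` and `F₂`. -/

section Comparison

variable {k : Type u} [Field k] [CharZero k] {F₁ F₂ : FeynmanCategory.{u}} {C₁ : F₁.Cubical} {C₂ : F₂.Cubical}
  {φ : CubicalMorphism C₁ C₂} {s : Bool}

namespace ExceptionalPushforward

variable (E : ExceptionalPushforward k φ s) (hφ : φ.Admissible) (P : FinOp k C₁ s)

/-- The exceptional push-forward of an operad of finite type. -/
abbrev finOp : FinOp k C₂ s := ⟨E.functor.obj P.obj, E.finiteType hφ P.property⟩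

variable {P} {Q : DGOp k C₂ (!s)} (J : (E.finOp hφ P).DualMap Q.toGrOp)

/-- The restriction of a map of generators along `φ`. -/
noncomputable def restrictGen : P.DualMap ((restriction k hφ (!s)).obj Q).toGrOp := fun w n =>
  (J (φ.obj w) n).comp (E.cf P.obj hφ (-n) ⟨w, VIso.refl F₂ (φ.obj w)⟩).dualMap

variable {J} (hJ : J.Equivariant)
include hJ

/-- `restrictGen` keeps the part of `J` on the summand of the identity isomorphism. Equivariance
recovers `J` on all other summands. -/
lemma viso_restrictGen {v : F₂.V} (x : φ.Over v) (n : ℤ) (p : Module.Dual k (P.obj.obj x.1 (-n))) :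
    Q.viso x.2 n (E.restrictGen hφ J x.1 n p) = J v n (p.comp (E.cf P.obj hφ (-n) x)) := by
  refine Eq.trans (congrArg (fun z => Q.viso x.2 n (J (φ.obj x.1) n z)) (LinearMap.ext fun y => ?_))
    (hJ x.2 n (p.comp (E.cf P.obj hφ (-n) x)))
  have h := E.cf_viso (P := P.obj) hφ x.2 (VIso.refl F₂ (φ.obj x.1)) y
  rw [VIso.refl_trans] at h
  exact congrArg p h.symm

lemma restrictGen_equivariant : (E.restrictGen hφ J).Equivariant := by
  intro w w' l n p
  refine (E.viso_restrictGen hφ hJ ⟨w, φ.viso l⟩ n _).trans ?_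
  refine congrArg (J (φ.obj w') n) (LinearMap.ext fun y => congrArg p ?_)
  have h := E.viso_cf (P := P.obj) hφ l (VIso.refl F₂ (φ.obj w')) y
  rwa [VIso.trans_refl] at h

omit hJ
variable {r : ℕ} {B : Fin r → F₂.V} {w : F₁.V}

variable (J) in
/-- The part of a contraction belonging to a family of isomorphisms from images of vertices. -/
noncomputable def convOver (f : F₂.Hom B (φ.obj w)) (hf : C₂.deg f ≤ 1) (x : ∀ i, φ.Over (B i)) (l : Fin r → ℤ)
    (M N : ℤ) (hM : M = ∑ i, -l i + s.toNat * (C₂.deg f : ℤ)) (hN : N = ∑ i, l i + (!s).toNat * (C₂.deg f : ℤ))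
    (p : Module.Dual k (P.obj.obj w M)) : Q.obj (φ.obj w) N :=
  contr (V := fun i => P.obj.obj (x i).1 (-l i))
    (fun y => p (E.cf P.obj hφ M ⟨w, VIso.refl F₂ (φ.obj w)⟩
      ((E.functor.obj P.obj).act f hf (fun i => -l i) M hM (fun i => E.cls P.obj _ (x i).2 (y i)))))
    (fun η => Q.act f hf l N hN (fun i => J (B i) (l i) ((η i).comp (E.cf P.obj hφ (-l i) (x i)))))

/-- The resolution of the identity by classes and coefficients is inserted at every input of `f`. -/
lemma conv_eq_sum (f : F₂.Hom B (φ.obj w)) (hf : C₂.deg f ≤ 1) (l : Fin r → ℤ) (M N : ℤ) (hM) (hN)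
    (p : Module.Dual k (P.obj.obj w M)) :
    J.conv f hf l M N hM hN (p.comp (E.cf P.obj hφ M ⟨w, VIso.refl F₂ (φ.obj w)⟩)) =
      ∑ x : ∀ i, φ.Over (B i), (∏ i, (F₁.autCard (x i).1 : k)⁻¹) • E.convOver hφ J f hf x l M N hM hN p := by
  rw [FinOp.convAt_apply]
  have : ∀ i, Module.Finite k ((E.functor.obj P.obj).obj (B i) (-l i)) := fun i => (E.finOp hφ P).property.1 _ _
  exact contr_resolution (V := fun i => (E.functor.obj P.obj).obj (B i) (-l i)) (κ := fun i => φ.Over (B i))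
    (W := fun i x => P.obj.obj x.1 (-l i)) (U := fun i => Q.obj (B i) (l i))
    (fun i x => (F₁.autCard x.1 : k)⁻¹) (fun i x => E.cf P.obj hφ (-l i) x) (fun i x => E.cls P.obj (-l i) x.2)
    (fun i y => E.sum_cls_cf (P := P.obj) hφ y)
    ((p.comp (E.cf P.obj hφ M ⟨w, VIso.refl F₂ (φ.obj w)⟩)).compMultilinearMap
      ((E.functor.obj P.obj).act f hf (fun i => -l i) M hM))
    (Q.act f hf l N hN) (fun i => J (B i) (l i))

lemma convOver_eq_zero_of_trivial (f : F₂.Hom B (φ.obj w)) (hf : C₂.deg f ≤ 1) (x : ∀ i, φ.Over (B i))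
    (l : Fin r → ℤ) (M N : ℤ) (hM) (hN) (p : Module.Dual k (P.obj.obj w M)) (i : Fin r)
    (h : ¬ Nontrivial (P.obj.obj (x i).1 (-l i))) : E.convOver hφ J f hf x l M N hM hN p = 0 :=
  contr_eq_zero (V := fun i => P.obj.obj (x i).1 (-l i)) _ _ i h

include hJ in
-- In `L^! P` the operation `f` acts on these summands as `g`; in `Q` the isomorphisms `x i` are
-- moved from the generators into `f`, which turns it into `φ.map g`.
lemma convOver_eq (f : F₂.Hom B (φ.obj w)) (hf : C₂.deg f ≤ 1) (x : ∀ i, φ.Over (B i)) (l : Fin r → ℤ)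
    (M N : ℤ) (hM) (hN) (p : Module.Dual k (P.obj.obj w M)) (g : F₁.Hom (fun i => (x i).1) w)
    (h : F₂.pre f (fun i => (x i).2.hom) = φ.map g) (hg) (hM') (hN') :
    E.convOver hφ J f hf x l M N hM hN p = (E.restrictGen hφ J).conv g hg l M N hM' hN' p := by
  rw [FinOp.convAt_apply]
  refine congrArg₂ (contr (V := fun i => P.obj.obj (x i).1 (-l i))) (funext fun y => congrArg p ?_)
    (funext fun η => ?_)
  · have h1 := E.act_cls (P := P.obj) hφ f hf (fun i => -l i) M hM (fun i => (x i).2) g (VIso.refl F₂ (φ.obj w))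
      (h.trans (one_post _).symm) hg hM' y
    refine (congrArg _ h1).trans ?_
    refine (E.cf_cls hφ ⟨w, VIso.refl F₂ (φ.obj w)⟩ (VIso.refl F₂ (φ.obj w)) _).trans ?_
    exact Induced.coef_mk_self (P := P.obj.toGrOp) hφ ⟨w, VIso.refl F₂ (φ.obj w)⟩ _
  · have h2 : C₂.deg (F₂.pre f (fun i => (x i).2.hom)) = C₂.deg f := by
      rw [C₂.deg_pre]; simp only [C₂.deg_viso, Finset.sum_const_zero, add_zero]
    have hf' : C₂.deg (F₂.pre f (fun i => (x i).2.hom)) ≤ 1 := by rwa [h2]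
    have hN₂ : N = ∑ i, l i + (!s).toNat * (C₂.deg (F₂.pre f (fun i => (x i).2.hom)) : ℤ) := by rwa [h2]
    refine Eq.trans ?_ ((Q.act_pre f (fun i => (x i).2) hf hf' l N hN hN₂
      (fun i => E.restrictGen hφ J (x i).1 (l i) (η i))).symm.trans ?_)
    · exact congrArg _ (funext fun i => (E.viso_restrictGen hφ hJ (x i) (l i) (η i)).symm)
    · exact Q.act_congr h _ _ _ _ _ _ _

/-- A nonzero coefficient at the identity of `φ(w)` requires a decomposition whose `τ` is the image
of an isomorphism `m` to `w`; but then `f ∘ ⊗ x i` would be the image of `m ∘ g`. -/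
lemma convOver_eq_zero (f : F₂.Hom B (φ.obj w)) (hf : C₂.deg f ≤ 1) (x : ∀ i, φ.Over (B i)) (l : Fin r → ℤ)
    (M N : ℤ) (hM) (hN) (p : Module.Dual k (P.obj.obj w M))
    (h : ¬ ∃ g : F₁.Hom (fun i => (x i).1) w, F₂.pre f (fun i => (x i).2.hom) = φ.map g) :
    E.convOver hφ J f hf x l M N hM hN p = 0 := by
  refine Eq.trans ?_ (contr_zero_left (V := fun i => P.obj.obj (x i).1 (-l i))
    (fun η => Q.act f hf l N hN (fun i => J (B i) (l i) ((η i).comp (E.cf P.obj hφ (-l i) (x i))))))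
  refine congrArg₂ (contr (V := fun i => P.obj.obj (x i).1 (-l i))) (funext fun y => ?_) rfl
  refine (congrArg p ?_).trans (map_zero p)
  by_cases hD : ∃ w₀, Nonempty (φ.Decomposition f (fun i => (x i).2) w₀)
  · obtain ⟨w₀, ⟨D⟩⟩ := hD
    have h1 := E.act_cls (P := P.obj) hφ f hf (fun i => -l i) M hM (fun i => (x i).2) D.g D.τ D.eq
      (by rw [D.deg_g]; exact hf) (by rw [D.deg_g]; exact hM) y
    refine (congrArg _ h1).trans ((E.cf_cls hφ ⟨w, VIso.refl F₂ (φ.obj w)⟩ D.τ _).trans ?_)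
    refine Induced.coef_mk_eq_zero (P := P.obj.toGrOp) hφ ⟨w, VIso.refl F₂ (φ.obj w)⟩ D.τ _ ?_
    rintro ⟨m, hm⟩
    refine h ⟨F₁.post m.hom D.g, ?_⟩
    rw [D.eq, φ.map_post, hm, VIso.trans_refl]
    rfl
  · have h1 := E.act_cls_eq_zero (P := P.obj) f hf (fun i => -l i) M hM (fun i => (x i).2)
      (fun w₀ => ⟨fun D => hD ⟨w₀, ⟨D⟩⟩⟩) y
    exact (congrArg _ h1).trans (map_zero _)

variable (φ) in
/-- A morphism of degree one together with isomorphisms of the images of the vertices of its source gives a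
morphism of degree one with isomorphisms from images of vertices. -/
def transport (w : F₁.V) (a : Σ g : C₁.DegOne w, ∀ i, Σ Y, F₂.VIso (φ.obj (g.1.2 i)) Y) :
    Σ f : C₂.DegOne (φ.obj w), ∀ i, φ.Over (f.1.2 i) :=
  ⟨⟨⟨a.1.1.1, fun i => (a.2 i).1⟩, F₂.pre (φ.map a.1.2.1) (fun i => (a.2 i).2.symm.hom), by
    rw [C₂.deg_pre, φ.deg_map, a.1.2.2]
    simp only [C₂.deg_viso, Finset.sum_const_zero, add_zero]⟩, fun i => ⟨a.1.1.2 i, (a.2 i).2⟩⟩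

lemma pre_transport (w : F₁.V) (a : Σ g : C₁.DegOne w, ∀ i, Σ Y, F₂.VIso (φ.obj (g.1.2 i)) Y) :
    F₂.pre (transport φ w a).1.2.1 (fun i => ((transport φ w a).2 i).2.hom) = φ.map a.1.2.1 := by
  refine (pre_trans (φ.map a.1.2.1) (fun i => (a.2 i).2) (fun i => (a.2 i).2.symm)).symm.trans ?_
  simp only [VIso.self_trans_symm]
  exact pre_one _

include hφ in
-- `g` is recovered from `f` and the isomorphisms by `pre_transport`, as `φ` is faithful.
lemma transport_injective (w : F₁.V) : Function.Injective (transport φ w) := by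
  -- Sources, targets and isomorphisms are separated from the morphism. Once these data are equal
  -- the types of the two morphisms agree.
  let dec : (Σ f : C₂.DegOne (φ.obj w), ∀ i, φ.Over (f.1.2 i)) →
      Σ r : ℕ, (Fin r → Σ (X : F₁.V) (Y : F₂.V), F₂.VIso (φ.obj X) Y) :=
    fun b => ⟨b.1.1.1, fun i => ⟨(b.2 i).1, b.1.1.2 i, (b.2 i).2⟩⟩
  let mk : (Σ z : (Σ r : ℕ, (Fin r → Σ (X : F₁.V) (Y : F₂.V), F₂.VIso (φ.obj X) Y)),
      {g : F₁.Hom (fun i => (z.2 i).1) w // C₁.deg g = 1}) →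
      (Σ g : C₁.DegOne w, ∀ i, Σ Y, F₂.VIso (φ.obj (g.1.2 i)) Y) :=
    fun z => ⟨⟨⟨z.1.1, fun i => (z.1.2 i).1⟩, z.2⟩, fun i => (z.1.2 i).2⟩
  have key : ∀ z z', transport φ w (mk z) = transport φ w (mk z') → z = z' := by
    rintro ⟨z, g⟩ ⟨z', g'⟩ h
    obtain rfl : z = z' := congrArg dec h
    refine congrArg (Sigma.mk z) (Subtype.ext (hφ.hom_injective ?_))
    have h1 := eq_of_heq (Sigma.mk.inj (Sigma.mk.inj h).1).2
    refine (pre_transport w (mk ⟨z, g⟩)).symm.trans (Eq.trans ?_ (pre_transport w (mk ⟨z, g'⟩)))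
    exact congrArg (fun f => F₂.pre f (fun i => (z.2 i).2.2.hom)) (congrArg Subtype.val h1)
  intro a b h
  exact congrArg mk (key ⟨⟨a.1.1.1, fun i => ⟨a.1.1.2 i, a.2 i⟩⟩, a.1.2⟩
    ⟨⟨b.1.1.1, fun i => ⟨b.1.1.2 i, b.2 i⟩⟩, b.1.2⟩ h)

lemma mem_range_transport (w : F₁.V) (b : Σ f : C₂.DegOne (φ.obj w), ∀ i, φ.Over (f.1.2 i))
    (g : F₁.Hom (fun i => (b.2 i).1) w) (h : F₂.pre b.1.2.1 (fun i => (b.2 i).2.hom) = φ.map g) :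
    b ∈ Set.range (transport φ w) := by
  obtain ⟨⟨⟨r, Y⟩, f, hf⟩, x⟩ := b
  have hg : C₁.deg g = 1 := by
    rw [← φ.deg_map, ← h, C₂.deg_pre]
    simp only [C₂.deg_viso, Finset.sum_const_zero, hf, add_zero]
  refine ⟨⟨⟨⟨r, fun i => (x i).1⟩, g, hg⟩, fun i => ⟨Y i, (x i).2⟩⟩, ?_⟩
  have h1 : F₂.pre (φ.map g) (fun i => (x i).2.symm.hom) = f := by
    rw [← h]
    refine (pre_trans f (fun i => (x i).2.symm) (fun i => (x i).2)).symm.trans ?_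
    simp only [VIso.symm_trans_self]
    exact pre_one _
  exact congrArg (fun f : {f : F₂.Hom Y (φ.obj w) // C₂.deg f = 1} =>
    (⟨⟨⟨r, Y⟩, f⟩, x⟩ : Σ f : C₂.DegOne (φ.obj w), ∀ i, φ.Over (f.1.2 i))) (Subtype.ext h1)

/-- The part of the differential belonging to a morphism and a family of isomorphisms. -/
noncomputable def difOver (J : (E.finOp hφ P).DualMap Q.toGrOp) {n m : ℤ} (h : m = n + 1)
    (p : Module.Dual k (P.obj.obj w (-n))) (b : Σ f : C₂.DegOne (φ.obj w), ∀ i, φ.Over (f.1.2 i)) :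
    Q.obj (φ.obj w) m :=
  ∑ᶠ l : {l : Fin b.1.1.1 → ℤ // ∑ i, l i = n + s.toNat}, (s.toNat * n + eps l.1).negOnePow •
    E.convOver hφ J b.1.2.1 b.1.2.2.le b.2 l.1 (-n) m (FinOp.DualMap.deg_source b.1.2.2 l.2)
      (FinOp.DualMap.deg_target b.1.2.2 h l.2) p

lemma ext_eq_sum {n m : ℤ} (h : m = n + 1) (p : Module.Dual k (P.obj.obj w (-n))) :
    J.ext h (p.comp (E.cf P.obj hφ (-n) ⟨w, VIso.refl F₂ (φ.obj w)⟩)) =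
      ∑ b : Σ f : C₂.DegOne (φ.obj w), ∀ i, φ.Over (f.1.2 i),
        (wt k b.1.1.2 * ∏ i, (F₁.autCard (b.2 i).1 : k)⁻¹) • E.difOver hφ J h p b := by
  rw [FinOp.DualMap.ext_eq_finsum, Fintype.sum_sigma]
  refine Finset.sum_congr rfl fun f _ => ?_
  -- The interchange of the two sums needs finite support, which finite type of `P` at the vertices
  -- `(x i).1` provides.
  have hfin : ∀ x : ∀ i, φ.Over (f.1.2 i), (Function.support
      fun l : {l : Fin f.1.1 → ℤ // ∑ i, l i = n + s.toNat} => (s.toNat * n + eps l.1).negOnePow •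
        E.convOver hφ J f.2.1 f.2.2.le x l.1 (-n) m (FinOp.DualMap.deg_source f.2.2 l.2)
          (FinOp.DualMap.deg_target f.2.2 h l.2) p).Finite := by
    intro x
    refine (Finset.finite_toSet _).subset (P.support_subset_degs (A := ⟨f.1.1, fun i => (x i).1⟩) _ ?_)
    intro l i hi
    rw [E.convOver_eq_zero_of_trivial hφ _ _ _ _ _ _ _ _ _ i hi, smul_zero]
  simp only [mul_smul]
  refine Eq.trans (congrArg (wt k f.1.2 • ·) ?_) Finset.smul_sum
  have h1 : ∀ x : ∀ i, φ.Over (f.1.2 i), (∏ i, (F₁.autCard (x i).1 : k)⁻¹) • E.difOver hφ J h p ⟨f, x⟩ =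
      ∑ᶠ l : {l : Fin f.1.1 → ℤ // ∑ i, l i = n + s.toNat}, (∏ i, (F₁.autCard (x i).1 : k)⁻¹) •
        (s.toNat * n + eps l.1).negOnePow •
        E.convOver hφ J f.2.1 f.2.2.le x l.1 (-n) m (FinOp.DualMap.deg_source f.2.2 l.2)
          (FinOp.DualMap.deg_target f.2.2 h l.2) p := fun x => smul_finsum' _ (hfin x)
  simp only [h1]
  rw [← finsum_sum_comm]
  · refine finsum_congr fun l => ?_
    rw [E.conv_eq_sum hφ, Finset.smul_sum]
    exact Finset.sum_congr rfl fun x _ => smul_comm _ _ _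
  · intro x _
    exact (hfin x).subset (Function.support_const_smul_subset _ _)

include hJ in
lemma difOver_transport {n m : ℤ} (h : m = n + 1) (p : Module.Dual k (P.obj.obj w (-n)))
    (a : Σ g : C₁.DegOne w, ∀ i, Σ Y, F₂.VIso (φ.obj (g.1.2 i)) Y) :
    E.difOver hφ J h p (transport φ w a) =
      ∑ᶠ l : {l : Fin a.1.1.1 → ℤ // ∑ i, l i = n + s.toNat}, (s.toNat * n + eps l.1).negOnePow •
        (E.restrictGen hφ J).conv a.1.2.1 a.1.2.2.le l.1 (-n) m (FinOp.DualMap.deg_source a.1.2.2 l.2)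
          (FinOp.DualMap.deg_target a.1.2.2 h l.2) p := by
  unfold difOver
  refine finsum_congr fun l => congrArg ((s.toNat * n + eps l.1).negOnePow • ·) ?_
  exact E.convOver_eq hφ hJ (transport φ w a).1.2.1 (transport φ w a).1.2.2.le (transport φ w a).2 l.1 (-n) m
    (FinOp.DualMap.deg_source (transport φ w a).1.2.2 l.2) (FinOp.DualMap.deg_target (transport φ w a).1.2.2 h l.2)
    p a.1.2.1 (pre_transport w a) a.1.2.2.le (FinOp.DualMap.deg_source a.1.2.2 l.2)
    (FinOp.DualMap.deg_target a.1.2.2 h l.2)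

/-- There are `∏ |Aut φ(w i)|` families of isomorphisms out of the `φ(w i)`. This number cancels the
automorphisms in the weight of `f`, and the factors `1 / |Aut w i|` of the resolution complete the
weight of `g`. -/
lemma weight_transport (g : C₁.DegOne w) :
    ∑ t : ∀ i, Σ Y, F₂.VIso (φ.obj (g.1.2 i)) Y, wt k (transport φ w ⟨g, t⟩).1.1.2 *
      ∏ i, (F₁.autCard (((transport φ w ⟨g, t⟩).2 i).1) : k)⁻¹ = wt k g.1.2 := by
  have h1 : ∀ t : ∀ i, Σ Y, F₂.VIso (φ.obj (g.1.2 i)) Y, wt k (transport φ w ⟨g, t⟩).1.1.2 *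
      ∏ i, (F₁.autCard (((transport φ w ⟨g, t⟩).2 i).1) : k)⁻¹ =
      (∏ i, (F₂.autCard (φ.obj (g.1.2 i)) : k))⁻¹ * wt k g.1.2 := by
    intro t
    have h2 : isoCard (transport φ w ⟨g, t⟩).1.1.2 = (g.1.1).factorial * ∏ i, F₂.autCard (φ.obj (g.1.2 i)) := by
      unfold isoCard
      rw [Fintype.card_fin]
      refine congrArg _ (Finset.prod_congr rfl fun i _ => ?_)
      exact congrArg F₂.autCard (t i).2.eq.symm
    have h3 : isoCard g.1.2 = (g.1.1).factorial * ∏ i, F₁.autCard (g.1.2 i) := by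
      unfold isoCard
      rw [Fintype.card_fin]
    unfold wt
    rw [h2, h3]
    push_cast
    rw [mul_inv, mul_inv, Finset.prod_inv_distrib]
    ring_nf
    rfl
  simp only [h1]
  rw [Finset.sum_const, Finset.card_univ, Fintype.card_pi, nsmul_eq_mul, ← mul_assoc]
  have h4 : ((∏ i, Fintype.card (Σ Y, F₂.VIso (φ.obj (g.1.2 i)) Y) : ℕ) : k) =
      ∏ i, (F₂.autCard (φ.obj (g.1.2 i)) : k) := by
    push_cast
    exact Finset.prod_congr rfl fun i _ => by rw [← card_vIso_out, Nat.card_eq_fintype_card]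
  rw [h4, mul_inv_cancel₀ (Finset.prod_ne_zero_iff.2 fun i _ => Induced.autCard_ne_zero _), one_mul]

include hJ in
-- The expanded sum over `F₂` is supported on the image of `transport`. There the summand depends
-- only on `g`, and the weights over `g` add up to the weight of `g`.
lemma ext_restrictGen {n m : ℤ} (h : m = n + 1) (p : Module.Dual k (P.obj.obj w (-n))) :
    (E.restrictGen hφ J).ext h p = J.ext h (p.comp (E.cf P.obj hφ (-n) ⟨w, VIso.refl F₂ (φ.obj w)⟩)) := by
  classical
  rw [E.ext_eq_sum hφ h p, FinOp.DualMap.ext_eq_finsum]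
  refine Eq.trans ?_ (Fintype.sum_of_injective (transport φ w) (transport_injective hφ w) (fun a =>
    (wt k (transport φ w a).1.1.2 * ∏ i, (F₁.autCard (((transport φ w a).2 i).1) : k)⁻¹) •
      E.difOver hφ J h p (transport φ w a)) _ ?_ fun a => rfl)
  · rw [Fintype.sum_sigma]
    refine Finset.sum_congr rfl fun g _ => ?_
    have key : ∀ T : Q.obj (φ.obj w) m, (∀ t, E.difOver hφ J h p (transport φ w ⟨g, t⟩) = T) →
        wt k g.1.2 • T = ∑ t, (wt k (transport φ w ⟨g, t⟩).1.1.2 *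
          ∏ i, (F₁.autCard (((transport φ w ⟨g, t⟩).2 i).1) : k)⁻¹) • E.difOver hφ J h p (transport φ w ⟨g, t⟩) := by
      intro T hT
      simp only [hT]
      rw [← Finset.sum_smul, weight_transport]
    exact key _ fun t => E.difOver_transport hφ hJ h p ⟨g, t⟩
  · intro b hb
    have : E.difOver hφ J h p b = 0 := by
      refine finsum_eq_zero_of_forall_eq_zero fun l => ?_
      rw [E.convOver_eq_zero hφ, smul_zero]
      rintro ⟨g, hg⟩
      exact hb (mem_range_transport w b g hg)
    rw [this, smul_zero]

include hJ in
-- The parts given by morphisms of degree one agree by `ext_restrictGen`, and the dual differentials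
-- agree because coefficients commute with `d`.
lemma dif_restrictGen {n m : ℤ} (h : m = n + 1) (p : Module.Dual k (P.obj.obj w (-n))) :
    (E.restrictGen hφ J).dif h p = J.dif h (p.comp (E.cf P.obj hφ (-n) ⟨w, VIso.refl F₂ (φ.obj w)⟩)) := by
  rw [FinOp.DualMap.dif_apply, FinOp.DualMap.dif_apply, E.ext_restrictGen hφ hJ]
  refine congrArg₂ (· + ·) (congrArg _ (congrArg (J (φ.obj w) m) (LinearMap.ext fun y => congrArg p ?_))) rfl
  exact (E.cf_d (P := P.obj) hφ (show -n = -m + 1 by omega) ⟨w, VIso.refl F₂ (φ.obj w)⟩ y).symm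

end ExceptionalPushforward

end Comparison

/-! ### Frobenius reciprocity for generators, and the isomorphism of functors. -/

section Main

variable {k : Type u} [Field k] [CharZero k] {F₁ F₂ : FeynmanCategory.{u}} {C₁ : F₁.Cubical} {C₂ : F₂.Cubical}
  {φ : CubicalMorphism C₁ C₂} {s : Bool}

namespace ExceptionalPushforward

variable (E : ExceptionalPushforward k φ s) (hφ : φ.Admissible) {P : FinOp k C₁ s} {Q : DGOp k C₂ (!s)}

lemma sum_comp_cls_cf {M : Type*} [AddCommGroup M] [Module k M] {v : F₂.V} {n : ℤ}
    (T : Module.Dual k ((E.functor.obj P.obj).obj v n) →ₗ[k] M) (q) :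
    ∑ x : φ.Over v, (F₁.autCard x.1 : k)⁻¹ • T ((q.comp (E.cls P.obj n x.2)).comp (E.cf P.obj hφ n x)) = T q := by
  simp only [← map_smul]
  rw [← map_sum]
  refine congrArg T (LinearMap.ext fun y => ?_)
  rw [LinearMap.sum_apply]
  conv_rhs => rw [← E.sum_cls_cf (P := P.obj) hφ y]
  rw [map_sum]
  refine Finset.sum_congr rfl fun x _ => ?_
  rw [map_smul]
  rfl

/-- One half of Frobenius reciprocity: an equivariant family on the dual of the push-forward is
determined by its restriction. -/
lemma sum_viso_restrictGen {J : (E.finOp hφ P).DualMap Q.toGrOp} (hJ : J.Equivariant) {v : F₂.V} {n : ℤ}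
    (q : Module.Dual k ((E.functor.obj P.obj).obj v (-n))) :
    ∑ x : φ.Over v, (F₁.autCard x.1 : k)⁻¹ •
      Q.viso x.2 n (E.restrictGen hφ J x.1 n (q.comp (E.cls P.obj (-n) x.2))) = J v n q := by
  refine Eq.trans (Finset.sum_congr rfl fun x _ => ?_) (E.sum_comp_cls_cf (P := P) hφ (J v n) q)
  rw [E.viso_restrictGen hφ hJ]

/-- The map on the generators of the Feynman transform of the push-forward which is induced by a map
on the generators of the Feynman transform. -/
noncomputable def inducedGen (K : P.DualMap ((restriction k hφ (!s)).obj Q).toGrOp) :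
    (E.finOp hφ P).DualMap Q.toGrOp := fun v n =>
  ∑ x : φ.Over v, (F₁.autCard x.1 : k)⁻¹ • ((Q.viso x.2 n).comp (show _ →ₗ[k] Q.obj (φ.obj x.1) n from K x.1 n)).comp
    (E.cls P.obj (-n) x.2).dualMap

variable {K : P.DualMap ((restriction k hφ (!s)).obj Q).toGrOp}

lemma inducedGen_apply (v : F₂.V) (n : ℤ) (q) : E.inducedGen hφ K v n q = ∑ x : φ.Over v,
    (F₁.autCard x.1 : k)⁻¹ • Q.viso x.2 n (K x.1 n (q.comp (E.cls P.obj (-n) x.2))) := by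
  unfold inducedGen
  rw [LinearMap.sum_apply]
  rfl

/-- The effect of an isomorphism on isomorphisms from images of vertices. -/
def overEquiv {v v' : F₂.V} (σ : F₂.VIso v v') : φ.Over v ≃ φ.Over v' where
  toFun x := ⟨x.1, x.2.trans σ⟩
  invFun x := ⟨x.1, x.2.trans σ.symm⟩
  left_inv x := by simp only [VIso.trans_assoc, VIso.self_trans_symm, VIso.trans_refl]
  right_inv x := by simp only [VIso.trans_assoc, VIso.symm_trans_self, VIso.trans_refl]

lemma inducedGen_equivariant : (E.inducedGen hφ K).Equivariant := by
  intro v v' σ n q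
  rw [inducedGen_apply, inducedGen_apply, map_sum]
  refine Fintype.sum_equiv (overEquiv σ) _ _ fun x => ?_
  rw [map_smul]
  refine congrArg (fun z => (F₁.autCard x.1 : k)⁻¹ • z) ((GrOp.viso_trans _ x.2 σ n _).symm.trans ?_)
  refine congrArg (fun z => Q.viso (x.2.trans σ) n (K x.1 n z)) (LinearMap.ext fun y => ?_)
  exact congrArg q (E.viso_cls hφ σ x.2 y)

/-- The other half of Frobenius reciprocity. Only isomorphisms in the image of `φ` contribute; there
are `|Aut w|` of them, and equivariance of `K` makes their terms equal. -/
lemma restrictGen_inducedGen (hK : K.Equivariant) : E.restrictGen hφ (E.inducedGen hφ K) = K := by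
  refine funext fun w => funext fun n => LinearMap.ext fun p => ?_
  refine (E.inducedGen_apply hφ (φ.obj w) n _).trans ?_
  have key : ∀ (w' : F₁.V) (l : F₁.VIso w' w) (σ : F₂.VIso (φ.obj w') (φ.obj w)), σ = φ.viso l →
      (F₁.autCard w' : k)⁻¹ • Q.viso σ n (K w' n ((p.comp (E.cf P.obj hφ (-n) ⟨w, VIso.refl F₂ (φ.obj w)⟩)).comp
        (E.cls P.obj (-n) σ))) = (F₁.autCard w : k)⁻¹ • (K w n p : Q.obj (φ.obj w) n) := by
    rintro w' l _ rfl
    refine congrArg₂ (fun (c : k) (z : Q.obj (φ.obj w) n) => c • z) (by rw [l.eq]) ?_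
    refine Eq.trans ?_ (hK l n p)
    refine congrArg (fun z => Q.viso (φ.viso l) n (K w' n z)) (LinearMap.ext fun y => congrArg p ?_)
    refine (E.cf_cls (P := P.obj) hφ ⟨w, VIso.refl F₂ (φ.obj w)⟩ (φ.viso l) y).trans ?_
    have h1 := Induced.coef_mk (P := P.obj.toGrOp) hφ ⟨w, VIso.refl F₂ (φ.obj w)⟩ l y
    rwa [VIso.trans_refl] at h1
  refine (Fintype.sum_of_injective (Induced.translate (φ := φ) ⟨w, VIso.refl F₂ (φ.obj w)⟩)
    (Induced.translate_injective hφ _) (fun _ => (F₁.autCard w : k)⁻¹ • (K w n p : Q.obj (φ.obj w) n)) _ ?_ ?_).symm.trans ?_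
  · intro x hx
    have h0 : ¬ ∃ l : F₁.VIso x.1 w, x.2 = (φ.viso l).trans (VIso.refl F₂ (φ.obj w)) := by
      rintro ⟨l, hl⟩
      exact hx ⟨⟨x.1, l.symm⟩, Sigma.ext rfl (heq_of_eq hl.symm)⟩
    have h1 : (p.comp (E.cf P.obj hφ (-n) ⟨w, VIso.refl F₂ (φ.obj w)⟩)).comp (E.cls P.obj (-n) x.2) = 0 := by
      refine LinearMap.ext fun y => (congrArg p ?_).trans (map_zero p)
      exact (E.cf_cls (P := P.obj) hφ ⟨w, VIso.refl F₂ (φ.obj w)⟩ x.2 y).trans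
        (Induced.coef_mk_eq_zero (P := P.obj.toGrOp) hφ _ _ _ h0)
    refine (congrArg (fun z => (F₁.autCard x.1 : k)⁻¹ • Q.viso x.2 n (K x.1 n z)) h1).trans ?_
    refine (congrArg (fun z => (F₁.autCard x.1 : k)⁻¹ • Q.viso x.2 n z) (map_zero (K x.1 n))).trans ?_
    exact (congrArg _ (map_zero (Q.viso x.2 n))).trans (smul_zero _)
  · intro y
    exact (key y.1 y.2.symm _ (VIso.trans_refl _)).symm
  · rw [Finset.sum_const, Finset.card_univ, ← Nat.card_eq_fintype_card, card_vIso_out, ← Nat.cast_smul_eq_nsmul k,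
      smul_smul, mul_inv_cancel₀ (Induced.autCard_ne_zero w), one_smul]

/-- The map induced by a map compatible with the differentials is compatible with the differentials. -/
lemma d_inducedGen (hK : K.Equivariant)
    (hd : ∀ {w : F₁.V} {n m : ℤ} (h : m = n + 1) (p), ((restriction k hφ (!s)).obj Q).d h (K w n p) = K.dif h p)
    {v : F₂.V} {n m : ℤ} (h : m = n + 1) (q) :
    Q.d h (E.inducedGen hφ K v n q) = (E.inducedGen hφ K).dif h q := by
  rw [inducedGen_apply, map_sum]
  refine Eq.trans (Finset.sum_congr rfl fun x _ => ?_)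
    (E.sum_comp_cls_cf (P := P) hφ ((E.inducedGen hφ K).dif h) q)
  rw [map_smul]
  refine congrArg (fun z => (F₁.autCard x.1 : k)⁻¹ • z) ((Q.d_viso x.2 h _).trans ?_)
  refine (congrArg (Q.viso x.2 m) (hd h (q.comp (E.cls P.obj (-n) x.2)))).trans ?_
  -- `K` is the restriction of the induced family, so its `dif` is expressed by that of the induced
  -- family; equivariance then transports the equation along `x.2`.
  have h2 := E.dif_restrictGen hφ (E.inducedGen_equivariant hφ (K := K)) h (q.comp (E.cls P.obj (-n) x.2))
  rw [E.restrictGen_inducedGen hφ hK] at h2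
  refine (congrArg (Q.viso x.2 m) h2).trans ?_
  refine Eq.trans (congrArg (fun z => Q.viso x.2 m ((E.inducedGen hφ K).dif h z)) (LinearMap.ext fun y => ?_))
    (FinOp.DualMap.Equivariant.dif (E.inducedGen_equivariant hφ (K := K)) x.2 h ((q.comp (E.cls P.obj (-n) x.2)).comp (E.cf P.obj hφ (-n) x)))
  have h := E.cf_viso (P := P.obj) hφ x.2 (VIso.refl F₂ (φ.obj x.1)) y
  rw [VIso.refl_trans] at h
  exact congrArg (q.comp (E.cls P.obj (-n) x.2)) h.symm

end ExceptionalPushforward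

namespace FeynmanTransform

variable (D₁ : FeynmanTransform k C₁ s) (D₂ : FeynmanTransform k C₂ s) (E : ExceptionalPushforward k φ s)
  (hφ : φ.Admissible) (P : FinOp k C₁ s)

/-- The restriction of the generators of `D₂ L^! P` satisfies the differential equation that defines
morphisms out of `D₁ P`, by `dif_restrictGen`. -/
lemma exists_unit : ∃ a : D₁.functor.obj (.op P) ⟶
      (restriction k hφ (!s)).obj (D₂.functor.obj (.op (E.finOp hφ P))),
    ∀ v n p, a.app v n (D₁.gen P v n p) = E.restrictGen hφ (D₂.gens (E.finOp hφ P)) v n p := by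
  refine D₁.exists_dgHom _ (E.restrictGen_equivariant hφ (D₂.gens_equivariant _)) fun a ha v n p => ?_
  rw [D₁.d_gen', FinOp.DualMap.map_dif]
  have h1 : (D₁.gens P).map a = E.restrictGen hφ (D₂.gens (E.finOp hφ P)) :=
    funext fun v => funext fun n => LinearMap.ext fun p => ha v n p
  rw [h1]
  exact (E.dif_restrictGen hφ (D₂.gens_equivariant _) rfl p).trans (D₂.d_gen' rfl _).symm

/-- The universal morphism from the Feynman transform to the restriction of the Feynman transform of the
push-forward. -/
noncomputable def unit : D₁.functor.obj (.op P) ⟶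
    (restriction k hφ (!s)).obj (D₂.functor.obj (.op (E.finOp hφ P))) :=
  (exists_unit D₁ D₂ E hφ P).choose

lemma unit_gen (w : F₁.V) (n : ℤ) (p) : (unit D₁ D₂ E hφ P).app w n (D₁.gen P w n p) =
    D₂.gen (E.finOp hφ P) (φ.obj w) n (p.comp (E.cf P.obj hφ (-n) ⟨w, VIso.refl F₂ (φ.obj w)⟩)) :=
  (exists_unit D₁ D₂ E hφ P).choose_spec w n p

variable {P}

/-- By `sum_viso_restrictGen` the value of a morphism on any generator is a combination of
translates of its values on the image of `unit`. -/
lemma unit_comp_injective (Q : DGOp k C₂ (!s)) :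
    Function.Injective fun a : D₂.functor.obj (.op (E.finOp hφ P)) ⟶ Q =>
      unit D₁ D₂ E hφ P ≫ (restriction k hφ (!s)).map a := by
  intro a b h
  refine D₂.dgHom_ext fun v n q => ?_
  have h1 : ∀ c : D₂.functor.obj (.op (E.finOp hφ P)) ⟶ Q, c.app v n (D₂.gen (E.finOp hφ P) v n q) =
      ∑ x : φ.Over v, (F₁.autCard x.1 : k)⁻¹ • Q.viso x.2 n
        ((unit D₁ D₂ E hφ P ≫ (restriction k hφ (!s)).map c).app x.1 n
          (D₁.gen P x.1 n (q.comp (E.cls P.obj (-n) x.2)))) := by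
    intro c
    refine (congrArg (c.app v n) (E.sum_viso_restrictGen hφ (D₂.gens_equivariant _) q)).symm.trans ?_
    rw [map_sum]
    refine Finset.sum_congr rfl fun x _ => ?_
    rw [map_smul]
    refine congrArg (fun z => (F₁.autCard x.1 : k)⁻¹ • z) ?_
    refine (c.app_viso x.2 n _).trans (congrArg (Q.viso x.2 n) ?_)
    exact congrArg (c.app (φ.obj x.1) n) (unit_gen D₁ D₂ E hφ P x.1 n (q.comp (E.cls P.obj (-n) x.2))).symm
  rw [h1 a, h1 b]
  exact congrArg (fun t : D₁.functor.obj (.op P) ⟶ (restriction k hφ (!s)).obj Q => ∑ x : φ.Over v,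
    (F₁.autCard x.1 : k)⁻¹ • Q.viso x.2 n (t.app x.1 n (D₁.gen P x.1 n (q.comp (E.cls P.obj (-n) x.2))))) h

/-- The family of generators given by `b` is induced to `F₂`. The result satisfies the differential
equation by `d_inducedGen`, so it extends to a morphism, which restricts to `b` by
`restrictGen_inducedGen`. -/
lemma unit_comp_surjective (Q : DGOp k C₂ (!s)) :
    Function.Surjective fun a : D₂.functor.obj (.op (E.finOp hφ P)) ⟶ Q =>
      unit D₁ D₂ E hφ P ≫ (restriction k hφ (!s)).map a := by
  intro b
  have hK : ((D₁.gens P).map b.toHom).Equivariant := FinOp.DualMap.Equivariant.map (D₁.gens_equivariant P) b.toHom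
  have hd : ∀ {w : F₁.V} {n m : ℤ} (h : m = n + 1) (p), ((restriction k hφ (!s)).obj Q).d h
      ((D₁.gens P).map b.toHom w n p) = ((D₁.gens P).map b.toHom).dif h p := by
    intro w n m h p
    refine (b.app_d h _).symm.trans ?_
    rw [D₁.d_gen']
    exact FinOp.DualMap.map_dif b.toHom h p
  obtain ⟨a, ha⟩ := D₂.exists_dgHom (E.inducedGen hφ ((D₁.gens P).map b.toHom)) (E.inducedGen_equivariant hφ)
    fun a ha v n q => by
      rw [D₂.d_gen', FinOp.DualMap.map_dif, E.d_inducedGen hφ hK hd]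
      have h1 : (D₂.gens (E.finOp hφ P)).map a = E.inducedGen hφ ((D₁.gens P).map b.toHom) :=
        funext fun v => funext fun n => LinearMap.ext fun p => ha v n p
      rw [h1]
  refine ⟨a, D₁.dgHom_ext fun w n p => ?_⟩
  refine (congrArg (a.app (φ.obj w) n) (unit_gen D₁ D₂ E hφ P w n p)).trans ((ha _ _ _).trans ?_)
  exact LinearMap.congr_fun (congrFun (congrFun (E.restrictGen_inducedGen hφ hK) w) n) p

lemma unit_naturality {P P' : FinOp k C₁ s} (f : P ⟶ P') :
    D₁.functor.map f.op ≫ unit D₁ D₂ E hφ P = unit D₁ D₂ E hφ P' ≫ (restriction k hφ (!s)).map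
      (D₂.functor.map (ObjectProperty.homMk (E.functor.map f.hom) : E.finOp hφ P ⟶ E.finOp hφ P').op) := by
  refine D₁.dgHom_ext fun w n p => ?_
  refine (congrArg ((unit D₁ D₂ E hφ P).app w n) (D₁.map_gen f p)).trans ((unit_gen D₁ D₂ E hφ P w n _).trans ?_)
  refine Eq.trans ?_ (congrArg ((D₂.functor.map
    (ObjectProperty.homMk (E.functor.map f.hom) : E.finOp hφ P ⟶ E.finOp hφ P').op).app (φ.obj w) n)
    (unit_gen D₁ D₂ E hφ P' w n p)).symm
  refine Eq.trans ?_ (D₂.map_gen _ _).symm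
  refine congrArg (D₂.gen (E.finOp hφ P) (φ.obj w) n) (LinearMap.ext fun y => congrArg p ?_)
  exact (E.cf_map hφ f.hom ⟨w, VIso.refl F₂ (φ.obj w)⟩ y).symm

variable {L : DGOp k C₁ (!s) ⥤ DGOp k C₂ (!s)} (adj : L ⊣ restriction k hφ (!s))

/-- Under the adjunction, composition with the adjoint morphism is composition with `unit`, which is
bijective for every `Q`; Yoneda concludes. -/
lemma isIso_homEquiv_symm_unit (P : FinOp k C₁ s) : IsIso ((adj.homEquiv _ _).symm (unit D₁ D₂ E hφ P)) := by
  rw [isIso_iff_coyoneda_map_bijective]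
  intro Q
  have h : (fun a => (adj.homEquiv _ _).symm (unit D₁ D₂ E hφ P) ≫ a) = (adj.homEquiv _ Q).symm ∘
      fun a => unit D₁ D₂ E hφ P ≫ (restriction k hφ (!s)).map a :=
    funext fun a => (adj.homEquiv_naturality_right_symm _ a).symm
  rw [h]
  exact (adj.homEquiv _ Q).symm.bijective.comp
    ⟨unit_comp_injective D₁ D₂ E hφ Q, unit_comp_surjective D₁ D₂ E hφ Q⟩

/-- The Feynman transform exchanges the exceptional push-forward and the push-forward. -/
noncomputable def pushforwardIso :
    (DGOp.finiteType.lift (DGOp.finiteType.ι ⋙ E.functor) (fun P => E.finiteType hφ P.property)).op ⋙ D₂.functor ≅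
      D₁.functor ⋙ L :=
  (NatIso.ofComponents (F := D₁.functor ⋙ L)
    (G := (DGOp.finiteType.lift (DGOp.finiteType.ι ⋙ E.functor) (fun P => E.finiteType hφ P.property)).op ⋙
      D₂.functor)
    (fun P => @asIso _ _ _ _ ((adj.homEquiv _ _).symm (unit D₁ D₂ E hφ P.unop))
      (isIso_homEquiv_symm_unit D₁ D₂ E hφ adj P.unop)) (by
      intro P P' f
      refine (adj.homEquiv_naturality_left_symm _ _).symm.trans (Eq.trans ?_ (adj.homEquiv_naturality_right_symm _ _))
      exact congrArg _ (unit_naturality D₁ D₂ E hφ f.unop))).symm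

end FeynmanTransform

end Main

theorem theorem4p9 (k : Type u) [Field k] [CharZero k] {F₁ F₂ : FeynmanCategory.{u}}
    {C₁ : F₁.Cubical} {C₂ : F₂.Cubical} (φ : CubicalMorphism C₁ C₂) (hφ : φ.Admissible)
    (s : Bool) :
    Nonempty (FeynmanTransform k C₁ s) ∧ Nonempty (FeynmanTransform k C₂ s) ∧
    Nonempty (ExceptionalPushforward k φ s) ∧ (restriction k hφ (!s)).IsRightAdjoint ∧
    ∀ (D₁ : FeynmanTransform k C₁ s) (D₂ : FeynmanTransform k C₂ s)
      (E : ExceptionalPushforward k φ s) (L : DGOp k C₁ (!s) ⥤ DGOp k C₂ (!s))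
      (_ : L ⊣ restriction k hφ (!s)),
      ∃ h : ∀ P : FinOp k C₁ s, DGOp.finiteType (E.functor.obj P.obj),
        Nonempty ((DGOp.finiteType.lift (DGOp.finiteType.ι ⋙ E.functor) h).op ⋙ D₂.functor ≅
          D₁.functor ⋙ L) :=
  ⟨⟨feynmanTransform k C₁ s⟩, ⟨feynmanTransform k C₂ s⟩, ⟨exceptionalPushforward k s hφ⟩,
    restriction_isRightAdjoint hφ, fun D₁ D₂ E _ adj =>
      ⟨fun P => E.finiteType hφ P.property, ⟨FeynmanTransform.pushforwardIso D₁ D₂ E hφ adj⟩⟩⟩
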